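/- Functions on the torus $\mathbb T=[-\pi,\pi]$ are $2\pi$-periodic and real valued; $\langle f,g\rangle=\int_{-\pi}^{\pi}fg\,d\theta$, $\|f\|_{L^2}^2=\langle f,f\rangle$ and $\|f\|_{H^m}^2=\sum_{k=0}^m\|f^{(k)}\|_{L^2}^2$ (weak derivatives). Let $H$ be the Hilbert transform $Hf(\theta)=\frac1{2\pi}\,\mathrm{p.v.}\!\int_{-\pi}^{\pi}\cot\big(\tfrac{\theta-\vartheta}{2}\big)f(\vartheta)\,d\vartheta$, let $v(f)$ be defined by $\partial_\theta v(f)=Hf$, $v(f)(0)=0$, and let $\{f,g\}=f\,\partial_\theta g-g\,\partial_\theta f$. With $v^\pm=v(\eta^\pm)$ consider the system $$\partial_t\eta^+=L^+\eta^++N_1,\qquad \partial_t\eta^-=L^-\eta^-+N_2,\qquad(\ast)$$ $$L^\pm\eta=\{\tfrac12\eta\pm v(\eta),\sin 2\theta\},\quad N_1=\{\eta^+,v^+\}-\{\eta^-,v^-\},\quad N_2=\{\eta^-,v^+\}-\{\eta^+,v^-\}.$$ For $\rho_2=\frac1{4\pi\sin^2\theta}$ let $\rho_2^{1/2}=\frac{1}{2\sqrt\pi\,\sin\theta}$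 denote the signed square root. For an integer $m>3$, admissible initial values are odd $C^1$ functions $\eta_0^\pm$ on $\mathbb T$ with $\rho_2^{1/2}\partial_\theta\eta_0^\pm\in H^m(\mathbb T)$; put $$I_m(0)=\sqrt{\|\rho_2^{1/2}\partial_\theta\eta_0^+\|_{H^m}^2+\|\rho_2^{1/2}\partial_\theta\eta_0^-\|_{H^m}^2}.$$ **Theorem.** There are absolute constants $C_1,C_2>0$ such that the following holds, where $$T_0=\frac1{C_1}\ln\Big(1+\frac{C_1}{2C_2I_m(0)}\Big).$$ (0) For every integer $m>3$ and all admissible initial values with $I_m(0)>0$ there is exactly one classical odd solution $\eta^\pm$ of $(\ast)$ on $[0,T_0]$ with $\eta^\pm(0)=\eta_0^\pm$ and $\rho_2^{1/2}\partial_\theta\eta^\pm\in C([0,T_0];H^m(\mathbb T))\cap C^2([0,T_0];H^{m-2}(\mathbb T))$. Below, "the solution" means this one. (1) Let $m>3$ be an integer, $\delta>0$, $K>0$, $\lambda_1>0$, and let $F:[0,\infty)\to\mathbb R$ satisfy $F(y)\le Ky$ for all $y\ge0$. Then there are admissible initial values $\eta_0^\pm$ with $0<I_m(0)<\delta$ such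 that, with $u_0^+=\rho_2^{1/2}\partial_\theta\eta_0^+$ and $L_1^+u_0^+=\rho_2^{1/2}\partial_\theta L^+\eta_0^+$, $$0\le\langle L_1^+u_0^+,u_0^+\rangle\le\sqrt{\lambda_1}\,\|u_0^+\|_{L^2}\quad\text{and}\quad\langle L_1^+u_0^+,u_0^+\rangle\le\sqrt{\lambda_1}\,\|u_0^+\|_{L^2}^2,$$ and the solution satisfies $$\|\rho_2^{1/2}\partial_\theta\eta^+(t_K)\|_{L^2}>F(I_m(0))\qquad\text{for some }t_K\in(0,T_0).$$ (2) Consequently no Lipschitz-type stability bound holds: for every integer $m>3$ and every $\delta>0$ there is no constant $C>0$ such that for all admissible initial values with $0<I_m(0)<\delta$ the solution satisfies $\|\rho_2^{1/2}\partial_\theta\eta^+(t)\|_{L^2}\le C\,\|\rho_2^{1/2}\partial_\theta\eta_0^+\|_{H^m}$ for all $t\in[0,T_0]$. -/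

import Mathlib

open Set Filter MeasureTheory
open scoped Topology ContDiff

noncomputable section

namespace MHD1D

/-! ### Sobolev spaces on the torus

Functions on the torus `[-π, π]` are `2π`-periodic functions on `ℝ`. -/

/-- The `L²` norm over one period. -/
def l2Norm (f : ℝ → ℝ) : ℝ :=
  Real.sqrt (∫ θ in (-Real.pi)..Real.pi, f θ ^ 2)

/-- The `L²` inner product over one period. -/
def l2Inner (f g : ℝ → ℝ) : ℝ :=
  ∫ θ in (-Real.pi)..Real.pi, f θ * g θ

/-- Square integrability over one period. -/
def MemL2 (f : ℝ → ℝ) : Prop :=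
  MemLp f 2 (volume.restrict (Ioc (-Real.pi) Real.pi))

/-- `g` is the weak derivative of order `k` of `f` on the torus, and lies in `L²`. -/
structure IsWeakDeriv (k : ℕ) (f g : ℝ → ℝ) : Prop where
  periodic : Function.Periodic g (2 * Real.pi)
  memL2 : MemL2 g
  integral_eq : ∀ φ : ℝ → ℝ, ContDiff ℝ ∞ φ → Function.Periodic φ (2 * Real.pi) →
    l2Inner f (iteratedDeriv k φ) = (-1) ^ k * l2Inner g φ

open Classical in
/-- The weak derivative of order `k` (unique up to null sets; `0` if there is none in `L²`). -/
def weakDeriv (k : ℕ) (f : ℝ → ℝ) : ℝ → ℝ :=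
  if h : ∃ g, IsWeakDeriv k f g then h.choose else 0

/-- `f ∈ H^m(𝕋)`. -/
structure MemH (m : ℕ) (f : ℝ → ℝ) : Prop where
  periodic : Function.Periodic f (2 * Real.pi)
  memL2 : MemL2 f
  exists_weakDeriv : ∀ k ≤ m, ∃ g, IsWeakDeriv k f g

/-- `‖f‖_{H^m}`, with square `∑_{k ≤ m} ‖f^{(k)}‖²_{L²}`; meaningful for `f ∈ H^m(𝕋)`. -/
def hNorm (m : ℕ) (f : ℝ → ℝ) : ℝ :=
  Real.sqrt (∑ k ∈ Finset.range (m + 1), l2Norm (weakDeriv k f) ^ 2)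

/-- `f ∈ C([0,T]; H^s(𝕋))`. -/
structure ContInH (s : ℕ) (T : ℝ) (f : ℝ → ℝ → ℝ) : Prop where
  memH : ∀ t ∈ Icc 0 T, MemH s (f t)
  tendsto : ∀ t ∈ Icc 0 T,
    Tendsto (fun r => hNorm s (fun θ => f r θ - f t θ)) (𝓝[Icc 0 T] t) (𝓝 0)

/-- `g` is the derivative in time of `f` on `[0,T]`, as a map into `H^s(𝕋)`
(one-sided at the end points). -/
def HasTimeDerivInH (s : ℕ) (T : ℝ) (f g : ℝ → ℝ → ℝ) : Prop :=
  ∀ t ∈ Icc 0 T,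
    Tendsto (fun r => hNorm s (fun θ => (r - t)⁻¹ * (f r θ - f t θ) - g t θ))
      (𝓝[Icc 0 T \ {t}] t) (𝓝 0)

/-- `f ∈ C²([0,T]; H^s(𝕋))`. -/
def C2InH (s : ℕ) (T : ℝ) (f : ℝ → ℝ → ℝ) : Prop :=
  ∃ f₁ f₂ : ℝ → ℝ → ℝ,
    ContInH s T f ∧ ContInH s T f₁ ∧ ContInH s T f₂ ∧
    HasTimeDerivInH s T f f₁ ∧ HasTimeDerivInH s T f₁ f₂

/-! ### The equations -/

/-- The Hilbert transform on the torus,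
`H f (θ) = (1 / 2π) p.v. ∫ cot ((θ - ϑ) / 2) f(ϑ) dϑ` over one period, centred at `θ`. -/
def hilbertTransform (f : ℝ → ℝ) (θ : ℝ) : ℝ :=
  (2 * Real.pi)⁻¹ * limUnder (𝓝[>] (0 : ℝ)) (fun ε : ℝ =>
    (∫ x in (θ - Real.pi)..(θ - ε), Real.cot ((θ - x) / 2) * f x) +
      ∫ x in (θ + ε)..(θ + Real.pi), Real.cot ((θ - x) / 2) * f x)

/-- The velocity `v` of `f`: `∂_θ v = H f` and `v(0) = 0`. -/
def velocity (f : ℝ → ℝ) (θ : ℝ) : ℝ :=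
  ∫ x in (0 : ℝ)..θ, hilbertTransform f x

/-- The Lie bracket `{f, g} = f ∂_θ g - g ∂_θ f`. -/
def bracket (f g : ℝ → ℝ) (θ : ℝ) : ℝ :=
  f θ * deriv g θ - g θ * deriv f θ

/-- `L⁺ η = {η / 2 + v, sin 2θ}`. -/
def opLplus (η : ℝ → ℝ) : ℝ → ℝ :=
  bracket (fun θ => η θ / 2 + velocity η θ) (fun θ => Real.sin (2 * θ))

/-- `L⁻ η = {η / 2 - v, sin 2θ}`. -/
def opLminus (η : ℝ → ℝ) : ℝ → ℝ :=
  bracket (fun θ => η θ / 2 - velocity η θ) (fun θ => Real.sin (2 * θ))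

/-- `N₁ = {η⁺, v⁺} - {η⁻, v⁻}`. -/
def nonlin₁ (ηp ηm : ℝ → ℝ) (θ : ℝ) : ℝ :=
  bracket ηp (velocity ηp) θ - bracket ηm (velocity ηm) θ

/-- `N₂ = {η⁻, v⁺} - {η⁺, v⁻}`. -/
def nonlin₂ (ηp ηm : ℝ → ℝ) (θ : ℝ) : ℝ :=
  bracket ηm (velocity ηp) θ - bracket ηp (velocity ηm) θ

/-- `ρ₂^{1/2} ∂_θ η`, where `ρ₂ = 1 / (4π sin² θ)` and `ρ₂^{1/2}` is the smooth (signed) root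
`1 / (2 √π sin θ)`. -/
def weighted (η : ℝ → ℝ) (θ : ℝ) : ℝ :=
  deriv η θ / (2 * Real.sqrt Real.pi * Real.sin θ)

/-- Odd `C¹` functions `η` on the torus with `ρ₂^{1/2} ∂_θ η ∈ H^m(𝕋)`. -/
structure IsState (m : ℕ) (η : ℝ → ℝ) : Prop where
  periodic : Function.Periodic η (2 * Real.pi)
  odd : ∀ θ, η (-θ) = -η θ
  contDiff : ContDiff ℝ 1 η
  memH : MemH m (weighted η)

/-- `(ηp, ηm)` is a classical odd solution on `[0,T]` of
`∂_t η⁺ = L⁺ η⁺ + N₁`, `∂_t η⁻ = L⁻ η⁻ + N₂` with initial values `(ηp₀, ηm₀)`, such that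
`ρ₂^{1/2} ∂_θ η^± ∈ C([0,T]; H^m) ∩ C²([0,T]; H^{m-2})`. -/
structure IsSolution (m : ℕ) (T : ℝ) (ηp₀ ηm₀ : ℝ → ℝ) (ηp ηm : ℝ → ℝ → ℝ) : Prop where
  init_plus : ηp 0 = ηp₀
  init_minus : ηm 0 = ηm₀
  state_plus : ∀ t ∈ Icc 0 T, IsState m (ηp t)
  state_minus : ∀ t ∈ Icc 0 T, IsState m (ηm t)
  eq_plus : ∀ t ∈ Icc 0 T, ∀ θ,
    HasDerivWithinAt (fun s => ηp s θ)
      (opLplus (ηp t) θ + nonlin₁ (ηp t) (ηm t) θ) (Icc 0 T) t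
  eq_minus : ∀ t ∈ Icc 0 T, ∀ θ,
    HasDerivWithinAt (fun s => ηm s θ)
      (opLminus (ηm t) θ + nonlin₂ (ηp t) (ηm t) θ) (Icc 0 T) t
  cont_plus : ContInH m T (fun t => weighted (ηp t))
  cont_minus : ContInH m T (fun t => weighted (ηm t))
  c2_plus : C2InH (m - 2) T (fun t => weighted (ηp t))
  c2_minus : C2InH (m - 2) T (fun t => weighted (ηm t))

/-- `I_m(0)`. -/
def dataSize (m : ℕ) (ηp₀ ηm₀ : ℝ → ℝ) : ℝ :=
  Real.sqrt (hNorm m (weighted ηp₀) ^ 2 + hNorm m (weighted ηm₀) ^ 2)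

/-- The existence time `T₀ = (1 / C₁) ln (1 + C₁ / (2 C₂ I))`. -/
def existenceTime (C₁ C₂ I : ℝ) : ℝ :=
  1 / C₁ * Real.log (1 + C₁ / (2 * C₂ * I))

/-- Local well-posedness at regularity `m` with the existence time given by `C₁` and `C₂`:
all nonzero odd initial values with finite `I_m(0)` have one and only one solution
on `[0, T₀]`. -/
def LocallyWellPosed (C₁ C₂ : ℝ) (m : ℕ) : Prop :=
  ∀ ηp₀ ηm₀ : ℝ → ℝ, IsState m ηp₀ → IsState m ηm₀ → 0 < dataSize m ηp₀ ηm₀ →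
    (∃ ηp ηm : ℝ → ℝ → ℝ,
      IsSolution m (existenceTime C₁ C₂ (dataSize m ηp₀ ηm₀)) ηp₀ ηm₀ ηp ηm) ∧
    ∀ ηp ηm ξp ξm : ℝ → ℝ → ℝ,
      IsSolution m (existenceTime C₁ C₂ (dataSize m ηp₀ ηm₀)) ηp₀ ηm₀ ηp ηm →
      IsSolution m (existenceTime C₁ C₂ (dataSize m ηp₀ ηm₀)) ηp₀ ηm₀ ξp ξm →
      ∀ t ∈ Icc 0 (existenceTime C₁ C₂ (dataSize m ηp₀ ηm₀)), ηp t = ξp t ∧ ηm t = ξm t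

end MHD1D

end

/-!
# Well-posedness and instability for a one-dimensional model of magnetohydrodynamics

In the variables `ξ = η⁺ + η⁻` and `ζ = η⁺ - η⁻` both equations of the system take the same form:
`∂ₜ ξ = {ξ / 2 + v(ζ), sin 2θ} + {ξ, v(ζ)}`, and the same with `ξ` and `ζ` exchanged. An odd function
`ξ` with finite weighted norm is determined by the sine coefficients `x` of `∂_θ ξ / sin θ`; these form
an odd sequence on `ℤ` with `x 1 = 0`, the latter because `∂_θ ξ` has mean zero. In terms of the
coefficients `x` of `ξ` and `y` of `ζ` the system reads `x' = rhs x y`, `y' = rhs y x`, where `rhs` is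
the sum of two three-term operators and a bilinear term built from convolutions
(`evol_eq_profile`, `system_profile`).

*Existence.* Only two parts of `rhs x y` lose a derivative, and both do so in `x` alone: the operator
with symbol `symS`, and the transport `v(ζ) ∂_θ`. Both are antisymmetric up to order zero, hence bounded
in the energy (`exists_pairing_band_symS_le`, `exists_pairing_transport_le`). The energy estimate
`E' ≤ C √(1 + E) E` for the sum `E` of the squared base norms closes, up to a time bounded below
through a Riccati comparison; the time in question is the one of the theorem. Every other weighted norm
grows at most exponentially on that interval, and the weights include ones that single out high
frequencies, which yields continuity in time with values in `H^m` (`tailWeight`). Galerkin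
approximations converge by the estimate for differences `exists_diffEnergy_le`, which gives uniqueness
as well.

*Fourier dictionary.* Weak derivatives act on Fourier coefficients by multiplication
(`IsWeakDeriv.fourierC_eq`), so the norms of `H^m` are weighted `ℓ²` norms of the coefficients
(`MemH.hasSum_hNorm_sq`), and states correspond to sequences (`IsState.eq_profile`). Solutions in the two
pictures correspond to each other (`IsSeqSolution.isSolution`, `IsSolution.isSeqSolution`).

*Instability.* For `η⁻ = 0` the equation is `x' = band symT x + bilin x x`. The linear part is bounded in
the energy but not dissipative: the functional `x₂² - ½ ∑_{k ≥ 3} xₖ²` grows at least like `e^t` under the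
linear flow (`exists_growthForm_deriv_ge`). For initial values of size `ε` the solution exists on an
interval whose length tends to infinity as `ε → 0`, while on any fixed interval it stays of size `O(ε)`
and the nonlinearity contributes `O(ε³)` to the functional. Hence for a time `τ` fixed beforehand the
second mode grows by a factor of order `e^{τ / 2}` once `ε` is small, which exceeds any prescribed
multiple of the initial size (`SeqSolvable.norm_inflation`). The initial value excites the frequencies
`2` and `4` in such a proportion that the quadratic form of `L⁺` vanishes at it; this form therefore gives
no sign of the growth. The failure of a Lipschitz bound is the same statement.
-/

set_option autoImplicit false

noncomputable section

namespace MHD1D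

open scoped NNReal ENNReal

/-! ### Weighted `ℓ²` norms of sequences and convolutions -/

lemma ENNReal_two_mul_le_sq_add_sq (a b : ℝ≥0∞) : 2 * (a * b) ≤ a ^ 2 + b ^ 2 := by
  wlog h : a ≤ b generalizing a b
  · rw [mul_comm a, add_comm]; exact this b a (le_of_not_ge h)
  obtain ⟨c, rfl⟩ := exists_add_of_le h
  calc 2 * (a * (a + c)) = a ^ 2 + (a ^ 2 + 2 * a * c) := by ring
    _ ≤ a ^ 2 + (a ^ 2 + 2 * a * c + c ^ 2) := by exact add_le_add le_rfl le_self_add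
    _ = _ := by ring

lemma ENNReal_add_sq_le (a b : ℝ≥0∞) : (a + b) ^ 2 ≤ 2 * (a ^ 2 + b ^ 2) := by
  have := ENNReal_two_mul_le_sq_add_sq a b
  calc (a + b) ^ 2 = a ^ 2 + b ^ 2 + 2 * (a * b) := by ring
    _ ≤ a ^ 2 + b ^ 2 + (a ^ 2 + b ^ 2) := by gcongr
    _ = _ := by ring

lemma ENNReal_le_of_two_mul_le {a b : ℝ≥0∞} (h : 2 * a ≤ 2 * b) : a ≤ b :=
  (ENNReal.mul_le_mul_iff_right (by simp) (by simp)).1 h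

/-- Cauchy–Schwarz for unrestricted sums in `[0, ∞]`. -/
lemma ENNReal_tsum_mul_sq_le {ι : Type*} (a b : ι → ℝ≥0∞) :
    (∑' i, a i * b i) ^ 2 ≤ (∑' i, a i ^ 2) * ∑' i, b i ^ 2 := by
  apply ENNReal_le_of_two_mul_le
  have h1 : 2 * (∑' i, a i * b i) ^ 2 = ∑' i, ∑' j, 2 * ((a i * b j) * (a j * b i)) := by
    rw [sq, ← ENNReal.tsum_mul_right, ← ENNReal.tsum_mul_left]
    refine tsum_congr fun i => ?_
    rw [← ENNReal.tsum_mul_left, ← ENNReal.tsum_mul_left]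
    exact tsum_congr fun j => by ring
  have h2 : (∑' i, a i ^ 2) * ∑' i, b i ^ 2 = ∑' i, ∑' j, (a i * b j) ^ 2 := by
    rw [← ENNReal.tsum_mul_right]
    refine tsum_congr fun i => ?_
    rw [← ENNReal.tsum_mul_left]
    exact tsum_congr fun j => by ring
  have h3 : ∑' i, ∑' j, (a j * b i) ^ 2 = ∑' i, ∑' j, (a i * b j) ^ 2 := ENNReal.tsum_comm
  calc 2 * (∑' i, a i * b i) ^ 2 ≤ ∑' i, ∑' j, ((a i * b j) ^ 2 + (a j * b i) ^ 2) := by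
        rw [h1]; gcongr with i j; exact ENNReal_two_mul_le_sq_add_sq _ _
    _ = 2 * ((∑' i, a i ^ 2) * ∑' i, b i ^ 2) := by
        simp_rw [ENNReal.tsum_add]; rw [h3, h2, two_mul]

lemma ENNReal_tsum_shift (f : ℤ → ℝ≥0∞) (i : ℤ) : ∑' m, f (m - i) = ∑' m, f m :=
  (Equiv.subRight i).tsum_eq f

lemma ENNReal_tsum_reflect (f : ℤ → ℝ≥0∞) (i : ℤ) : ∑' m, f (i - m) = ∑' m, f m :=
  (Equiv.subLeft i).tsum_eq f

/-- Young's inequality `ℓ¹ * ℓ² → ℓ²`. -/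
lemma ENNReal_young (a b : ℤ → ℝ≥0∞) :
    ∑' m, (∑' i, a i * b (m - i)) ^ 2 ≤ (∑' i, a i) ^ 2 * ∑' i, b i ^ 2 := by
  have key : ∀ m, (∑' i, a i * b (m - i)) ^ 2 ≤ (∑' i, a i) * ∑' i, a i * b (m - i) ^ 2 := by
    intro m
    apply ENNReal_le_of_two_mul_le
    have h1 : 2 * (∑' i, a i * b (m - i)) ^ 2
        = ∑' i, ∑' j, a i * a j * (2 * (b (m - i) * b (m - j))) := by
      rw [sq, ← ENNReal.tsum_mul_right, ← ENNReal.tsum_mul_left]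
      refine tsum_congr fun i => ?_
      rw [← ENNReal.tsum_mul_left, ← ENNReal.tsum_mul_left]
      exact tsum_congr fun j => by ring
    have h2 : (∑' i, a i) * ∑' i, a i * b (m - i) ^ 2
        = ∑' i, ∑' j, a i * a j * b (m - j) ^ 2 := by
      rw [← ENNReal.tsum_mul_right]
      refine tsum_congr fun i => ?_
      rw [← ENNReal.tsum_mul_left]
      exact tsum_congr fun j => by ring
    have h3 : ∑' i, ∑' j, a i * a j * b (m - i) ^ 2 = ∑' i, ∑' j, a i * a j * b (m - j) ^ 2 := by
      rw [ENNReal.tsum_comm]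
      exact tsum_congr fun i => tsum_congr fun j => by ring
    calc _ ≤ ∑' i, ∑' j, (a i * a j * b (m - i) ^ 2 + a i * a j * b (m - j) ^ 2) := by
          rw [h1]; gcongr with i j; rw [← mul_add]; gcongr
          exact ENNReal_two_mul_le_sq_add_sq _ _
      _ = _ := by simp_rw [ENNReal.tsum_add]; rw [h3, h2, two_mul]
  calc _ ≤ ∑' m, (∑' i, a i) * ∑' i, a i * b (m - i) ^ 2 := by gcongr with m; exact key m
    _ = (∑' i, a i) * ∑' i, ∑' m, a i * b (m - i) ^ 2 := by
        rw [ENNReal.tsum_mul_left, ENNReal.tsum_comm]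
    _ = (∑' i, a i) * ∑' i, a i * ∑' m, b m ^ 2 := by
        congr 1; refine tsum_congr fun i => ?_
        rw [ENNReal.tsum_mul_left, ENNReal_tsum_shift (fun k => b k ^ 2)]
    _ = _ := by rw [ENNReal.tsum_mul_right]; ring

/-- The square of the `ℓ²(ℤ)` norm with weight `w |k|`, with values in `[0, ∞]`. -/
def sqNorm (w : ℕ → ℝ≥0) (x : ℤ → ℝ) : ℝ≥0∞ :=
  ∑' k : ℤ, ((w k.natAbs : ℝ≥0∞) * ‖x k‖ₑ) ^ 2

/-- The `ℓ¹(ℤ)` norm with values in `[0, ∞]`. -/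
def absSum (x : ℤ → ℝ) : ℝ≥0∞ := ∑' k : ℤ, ‖x k‖ₑ

/-- Convolution on `ℤ`. -/
def conv (a b : ℤ → ℝ) (m : ℤ) : ℝ := ∑' i, a i * b (m - i)

/-- Nondecreasing weights of growth at most `(k + 1) ^ R`, in the scale-invariant sense that
`w k / (k + 1) ^ R` is nonincreasing. -/
structure IsWeight (R : ℕ) (w : ℕ → ℝ≥0) : Prop where
  mono : Monotone w
  growth : ∀ l m : ℕ, l ≤ m → w m * ((l : ℝ≥0) + 1) ^ R ≤ w l * ((m : ℝ≥0) + 1) ^ R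

/-- The Sobolev weight `(k + 1) ^ s`. -/
def powWeight (s : ℕ) (k : ℕ) : ℝ≥0 := ((k : ℝ≥0) + 1) ^ s

/-- The weight `(k + 1) w k`, one derivative stronger than `w`. -/
def raise (w : ℕ → ℝ≥0) (k : ℕ) : ℝ≥0 := ((k : ℝ≥0) + 1) * w k

lemma raise_powWeight (s : ℕ) : raise (powWeight s) = powWeight (s + 1) := by
  ext k; simp [raise, powWeight, pow_succ, mul_comm]

lemma IsWeight.le_of_le_two_mul {R : ℕ} {w : ℕ → ℝ≥0} (h : IsWeight R w) {l m : ℕ}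
    (hlm : m + 1 ≤ 2 * (l + 1)) : w m ≤ 2 ^ R * w l := by
  rcases le_total m l with hml | hml
  · calc w m ≤ w l := h.mono hml
      _ ≤ 2 ^ R * w l := le_mul_of_one_le_left (by positivity) (one_le_pow₀ (by norm_num))
  · have h1 := h.growth l m hml
    have h2 : ((m : ℝ≥0) + 1) ^ R ≤ 2 ^ R * ((l : ℝ≥0) + 1) ^ R := by
      rw [← mul_pow]; gcongr; exact_mod_cast hlm
    have h3 : (0 : ℝ≥0) < ((l : ℝ≥0) + 1) ^ R := by positivity
    have : w m * ((l : ℝ≥0) + 1) ^ R ≤ (2 ^ R * w l) * ((l : ℝ≥0) + 1) ^ R :=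
      h1.trans (by calc _ ≤ w l * (2 ^ R * ((l : ℝ≥0) + 1) ^ R) := by gcongr
                      _ = _ := by ring)
    exact le_of_mul_le_mul_right this h3

lemma IsWeight.add_le {R : ℕ} {w : ℕ → ℝ≥0} (h : IsWeight R w) (i j : ℤ) :
    w (i + j).natAbs ≤ 2 ^ R * (w i.natAbs + w j.natAbs) := by
  rcases le_total i.natAbs j.natAbs with hij | hij
  · calc _ ≤ 2 ^ R * w j.natAbs := h.le_of_le_two_mul (by omega)
      _ ≤ _ := by gcongr; exact le_add_self
  · calc _ ≤ 2 ^ R * w i.natAbs := h.le_of_le_two_mul (by omega)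
      _ ≤ _ := by gcongr; exact le_self_add

lemma isWeight_powWeight (s : ℕ) : IsWeight s (powWeight s) where
  mono := fun a b h => by unfold powWeight; gcongr
  growth := fun l m _ => by unfold powWeight; rw [mul_comm]

lemma IsWeight.raise {R : ℕ} {w : ℕ → ℝ≥0} (h : IsWeight R w) : IsWeight (R + 1) (raise w) where
  mono := fun a b hab => by
    unfold MHD1D.raise
    have := h.mono hab
    gcongr
  growth := fun l m hlm => by
    unfold MHD1D.raise
    calc _ = ((m : ℝ≥0) + 1) * (l + 1) * (w m * ((l : ℝ≥0) + 1) ^ R) := by ring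
      _ ≤ ((m : ℝ≥0) + 1) * (l + 1) * (w l * ((m : ℝ≥0) + 1) ^ R) := by
        exact mul_le_mul' le_rfl (h.growth l m hlm)
      _ = _ := by ring

/-- The sum of `(|k| + 1)⁻²` over the integers, the constant in the embedding of weighted `ℓ²` in `ℓ¹`. -/
def invSqSum : ℝ≥0∞ := ∑' k : ℤ, ((k.natAbs : ℝ≥0∞) + 1)⁻¹ ^ 2

lemma invSqSum_ne_top : invSqSum ≠ ⊤ := by
  have h : Summable fun k : ℤ => (((k.natAbs : ℝ≥0) + 1)⁻¹ ^ 2 : ℝ≥0) := by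
    rw [← NNReal.summable_coe]
    have hnat : Summable fun n : ℕ => (((n : ℝ) + 1)⁻¹ ^ 2) := by
      have := (Real.summable_nat_pow_inv (p := 2)).2 (by norm_num)
      have h2 := (summable_nat_add_iff 1).2 this
      simpa [inv_pow] using h2
    refine Summable.of_nat_of_neg ?_ ?_ <;> simpa using hnat
  have := ENNReal.tsum_coe_ne_top_iff_summable.2 h
  unfold invSqSum
  convert this using 4 with k
  push_cast
  rw [ENNReal.coe_inv (by positivity)]
  push_cast; rfl

/-- The constant `invSqSum` as a real number. -/
def invSq : ℝ≥0 := invSqSum.toNNReal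

lemma coe_invSq : (invSq : ℝ≥0∞) = invSqSum := ENNReal.coe_toNNReal invSqSum_ne_top

lemma sqNorm_mono {w w' : ℕ → ℝ≥0} (h : ∀ k, w k ≤ w' k) (x : ℤ → ℝ) :
    sqNorm w x ≤ sqNorm w' x := by
  unfold sqNorm; gcongr with k; exact h _

lemma sqNorm_le_of_enorm_le {w : ℕ → ℝ≥0} {x y : ℤ → ℝ} (h : ∀ k, ‖x k‖ₑ ≤ ‖y k‖ₑ) :
    sqNorm w x ≤ sqNorm w y := by
  unfold sqNorm; gcongr with k; exact h _

lemma sqNorm_add_le (w : ℕ → ℝ≥0) (x y : ℤ → ℝ) :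
    sqNorm w (x + y) ≤ 2 * (sqNorm w x + sqNorm w y) := by
  unfold sqNorm
  rw [← ENNReal.tsum_add, ← ENNReal.tsum_mul_left]
  gcongr with k
  calc _ ≤ ((w k.natAbs : ℝ≥0∞) * ‖x k‖ₑ + w k.natAbs * ‖y k‖ₑ) ^ 2 := by
        rw [← mul_add]; gcongr; exact enorm_add_le _ _
    _ ≤ _ := ENNReal_add_sq_le _ _

lemma sqNorm_smul (w : ℕ → ℝ≥0) (c : ℝ) (x : ℤ → ℝ) :
    sqNorm w (fun k => c * x k) = ‖c‖ₑ ^ 2 * sqNorm w x := by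
  unfold sqNorm
  rw [← ENNReal.tsum_mul_left]
  exact tsum_congr fun k => by rw [enorm_mul]; ring

lemma sqNorm_neg (w : ℕ → ℝ≥0) (x : ℤ → ℝ) : sqNorm w (-x) = sqNorm w x := by
  simp [sqNorm]

lemma sqNorm_zero (w : ℕ → ℝ≥0) : sqNorm w (0 : ℤ → ℝ) = 0 := by
  simp [sqNorm]

lemma sqNorm_sub_le (w : ℕ → ℝ≥0) (x y : ℤ → ℝ) :
    sqNorm w (x - y) ≤ 2 * (sqNorm w x + sqNorm w y) := by
  rw [sub_eq_add_neg]; simpa [sqNorm_neg] using sqNorm_add_le w x (-y)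

lemma le_sqNorm (w : ℕ → ℝ≥0) (x : ℤ → ℝ) (k : ℤ) :
    ((w k.natAbs : ℝ≥0∞) * ‖x k‖ₑ) ^ 2 ≤ sqNorm w x :=
  ENNReal.le_tsum (f := fun k : ℤ => ((w k.natAbs : ℝ≥0∞) * ‖x k‖ₑ) ^ 2) k

lemma absSum_mul_sq_le (s : ℕ) (x : ℤ → ℝ) :
    absSum (fun k => ((k.natAbs : ℝ) + 1) ^ s * x k) ^ 2 ≤ invSq * sqNorm (powWeight (s + 1)) x := by
  unfold absSum sqNorm
  rw [coe_invSq, invSqSum]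
  refine le_trans (le_of_eq ?_) (ENNReal_tsum_mul_sq_le _ _)
  congr 1
  refine tsum_congr fun k => ?_
  have h0 : ((k.natAbs : ℝ≥0∞) + 1) ≠ 0 := by positivity
  have h1 : ((k.natAbs : ℝ≥0∞) + 1) ≠ ⊤ := by finiteness
  have h2 : ‖((k.natAbs : ℝ) + 1) ^ s‖ₑ = ((k.natAbs : ℝ≥0∞) + 1) ^ s := by
    rw [enorm_pow]; congr 1
    have : ((k.natAbs : ℝ) + 1) = (((k.natAbs : ℝ≥0) + 1 : ℝ≥0) : ℝ) := by push_cast; rfl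
    rw [this, Real.enorm_eq_ofReal (by positivity), ENNReal.ofReal_coe_nnreal]; push_cast; rfl
  have h3 : ((powWeight (s + 1) k.natAbs : ℝ≥0) : ℝ≥0∞) = ((k.natAbs : ℝ≥0∞) + 1) ^ (s + 1) := by
    simp [powWeight]
  rw [enorm_mul, h2, h3, pow_succ, mul_comm _ ((k.natAbs : ℝ≥0∞) + 1), mul_assoc, ← mul_assoc,
    ENNReal.inv_mul_cancel h0 h1, one_mul]

lemma absSum_le_absSum {x y : ℤ → ℝ} (h : ∀ k, ‖x k‖ₑ ≤ ‖y k‖ₑ) : absSum x ≤ absSum y := by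
  unfold absSum; gcongr with k; exact h k

lemma absSum_sq_le_sqNorm_one (x : ℤ → ℝ) : absSum x ^ 2 ≤ invSq * sqNorm (powWeight 1) x := by
  simpa using absSum_mul_sq_le 0 x

lemma powWeight_mono {s t : ℕ} (h : s ≤ t) (k : ℕ) : powWeight s k ≤ powWeight t k := by
  unfold powWeight; exact pow_le_pow_right₀ (by simp) h

lemma absSum_sq_le (x : ℤ → ℝ) : absSum x ^ 2 ≤ invSq * sqNorm (powWeight 2) x :=
  (absSum_sq_le_sqNorm_one x).trans (by gcongr; exact sqNorm_mono (powWeight_mono (by norm_num)) x)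

lemma absSum_freq_sq_le (x : ℤ → ℝ) :
    absSum (fun k => (k : ℝ) * x k) ^ 2 ≤ invSq * sqNorm (powWeight 2) x := by
  refine le_trans ?_ (absSum_mul_sq_le 1 x)
  gcongr
  refine absSum_le_absSum fun k => ?_
  rw [enorm_mul, enorm_mul]
  gcongr
  rw [Real.enorm_eq_ofReal_abs, Real.enorm_eq_ofReal_abs]
  apply ENNReal.ofReal_le_ofReal
  rw [pow_one, abs_of_nonneg (by positivity : (0 : ℝ) ≤ (k.natAbs : ℝ) + 1), Nat.cast_natAbs]
  push_cast; linarith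

/-- Tame product estimate for convolutions in weighted `ℓ²`. -/
lemma sqNorm_conv_le {R : ℕ} {w : ℕ → ℝ≥0} (h : IsWeight R w) (a b : ℤ → ℝ) :
    sqNorm w (conv a b) ≤
      2 * 4 ^ R * (sqNorm w a * absSum b ^ 2 + absSum a ^ 2 * sqNorm w b) := by
  have hpt : ∀ m : ℤ, (w m.natAbs : ℝ≥0∞) * ‖conv a b m‖ₑ ≤
      2 ^ R * (∑' i, ‖b i‖ₑ * ((w (m - i).natAbs : ℝ≥0∞) * ‖a (m - i)‖ₑ) +
        ∑' i, ‖a i‖ₑ * ((w (m - i).natAbs : ℝ≥0∞) * ‖b (m - i)‖ₑ)) := by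
    intro m
    have e1 : ∑' i, ‖b i‖ₑ * ((w (m - i).natAbs : ℝ≥0∞) * ‖a (m - i)‖ₑ)
        = ∑' i, ‖b (m - i)‖ₑ * ((w i.natAbs : ℝ≥0∞) * ‖a i‖ₑ) := by
      rw [← ENNReal_tsum_reflect _ m]; simp
    rw [e1, ← ENNReal.tsum_add, ← ENNReal.tsum_mul_left]
    calc _ ≤ (w m.natAbs : ℝ≥0∞) * ∑' i, ‖a i * b (m - i)‖ₑ := by
          gcongr; exact enorm_tsum_le_tsum_enorm
      _ = ∑' i, (w m.natAbs : ℝ≥0∞) * ‖a i * b (m - i)‖ₑ := ENNReal.tsum_mul_left.symm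
      _ ≤ _ := by
          refine ENNReal.tsum_le_tsum fun i => ?_
          have := h.add_le i (m - i)
          rw [add_sub_cancel] at this
          have h' : (w m.natAbs : ℝ≥0∞) ≤ 2 ^ R * (w i.natAbs + w (m - i).natAbs) := by
            exact_mod_cast this
          rw [enorm_mul]
          calc _ ≤ (2 ^ R * (w i.natAbs + w (m - i).natAbs) : ℝ≥0∞) * (‖a i‖ₑ * ‖b (m - i)‖ₑ) := by
                gcongr
            _ = _ := by ring
            _ ≤ _ := le_rfl
  unfold sqNorm
  calc _ ≤ ∑' m : ℤ, (2 ^ R * (∑' i, ‖b i‖ₑ * ((w (m - i).natAbs : ℝ≥0∞) * ‖a (m - i)‖ₑ) +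
        ∑' i, ‖a i‖ₑ * ((w (m - i).natAbs : ℝ≥0∞) * ‖b (m - i)‖ₑ))) ^ 2 := by
        exact ENNReal.tsum_le_tsum fun m => pow_le_pow_left₀ (by simp) (hpt m) 2
    _ ≤ ∑' m : ℤ, 2 * 4 ^ R * ((∑' i, ‖b i‖ₑ * ((w (m - i).natAbs : ℝ≥0∞) * ‖a (m - i)‖ₑ)) ^ 2 +
        (∑' i, ‖a i‖ₑ * ((w (m - i).natAbs : ℝ≥0∞) * ‖b (m - i)‖ₑ)) ^ 2) := by
        gcongr with m
        rw [mul_pow, ← pow_mul, mul_comm R 2, pow_mul]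
        norm_num
        calc _ ≤ (4 : ℝ≥0∞) ^ R * (2 * (_ + _)) := by gcongr; exact ENNReal_add_sq_le _ _
          _ = _ := by ring
    _ ≤ _ := by
        rw [ENNReal.tsum_mul_left, ENNReal.tsum_add]
        gcongr
        · rw [mul_comm]
          exact ENNReal_young _ (fun i => (w i.natAbs : ℝ≥0∞) * ‖a i‖ₑ)
        · exact ENNReal_young _ (fun i => (w i.natAbs : ℝ≥0∞) * ‖b i‖ₑ)

lemma sqNorm_le_of_neighbours {R : ℕ} {w : ℕ → ℝ≥0} (h : IsWeight R w) {f y : ℤ → ℝ}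
    (hf : ∀ n, ‖f n‖ₑ ≤ ‖y (n + 1)‖ₑ + ‖y (n - 1)‖ₑ) :
    sqNorm w f ≤ 4 * 4 ^ R * sqNorm w y := by
  have hwt : ∀ n : ℤ, (w n.natAbs : ℝ≥0∞) * ‖f n‖ₑ ≤
      2 ^ R * ((w (n + 1).natAbs : ℝ≥0∞) * ‖y (n + 1)‖ₑ)
        + 2 ^ R * ((w (n - 1).natAbs : ℝ≥0∞) * ‖y (n - 1)‖ₑ) := by
    intro n
    have h1 : (w n.natAbs : ℝ≥0∞) ≤ 2 ^ R * w (n + 1).natAbs := by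
      exact_mod_cast h.le_of_le_two_mul (l := (n + 1).natAbs) (m := n.natAbs) (by omega)
    have h2 : (w n.natAbs : ℝ≥0∞) ≤ 2 ^ R * w (n - 1).natAbs := by
      exact_mod_cast h.le_of_le_two_mul (l := (n - 1).natAbs) (m := n.natAbs) (by omega)
    calc _ ≤ (w n.natAbs : ℝ≥0∞) * (‖y (n + 1)‖ₑ + ‖y (n - 1)‖ₑ) := by gcongr; exact hf n
      _ = (w n.natAbs : ℝ≥0∞) * ‖y (n + 1)‖ₑ + (w n.natAbs : ℝ≥0∞) * ‖y (n - 1)‖ₑ := by ring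
      _ ≤ _ := by rw [← mul_assoc, ← mul_assoc]; gcongr
  unfold sqNorm
  calc _ ≤ ∑' n : ℤ, 2 * ((2 ^ R * ((w (n + 1).natAbs : ℝ≥0∞) * ‖y (n + 1)‖ₑ)) ^ 2
        + (2 ^ R * ((w (n - 1).natAbs : ℝ≥0∞) * ‖y (n - 1)‖ₑ)) ^ 2) := by
        gcongr with n
        exact (pow_le_pow_left₀ (by simp) (hwt n) 2).trans (ENNReal_add_sq_le _ _)
    _ = 2 * 4 ^ R * (∑' n : ℤ, ((w (n + 1).natAbs : ℝ≥0∞) * ‖y (n + 1)‖ₑ) ^ 2 +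
        ∑' n : ℤ, ((w (n - 1).natAbs : ℝ≥0∞) * ‖y (n - 1)‖ₑ) ^ 2) := by
        rw [← ENNReal.tsum_add, ← ENNReal.tsum_mul_left]
        refine tsum_congr fun n => ?_
        have : ((2 : ℝ≥0∞) ^ R) ^ 2 = 4 ^ R := by
          rw [← pow_mul, mul_comm R 2, pow_mul]; norm_num
        rw [mul_pow (2 ^ R : ℝ≥0∞), mul_pow (2 ^ R : ℝ≥0∞), this]; ring
    _ = _ := by
        rw [ENNReal_tsum_shift (fun n : ℤ => ((w n.natAbs : ℝ≥0∞) * ‖y n‖ₑ) ^ 2) 1]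
        have := ENNReal_tsum_shift (fun n : ℤ => ((w n.natAbs : ℝ≥0∞) * ‖y n‖ₑ) ^ 2) (-1)
        simp only [sub_neg_eq_add] at this
        rw [this]; ring

lemma absSum_le_of_neighbours {f y : ℤ → ℝ}
    (hf : ∀ n, ‖f n‖ₑ ≤ ‖y (n + 1)‖ₑ + ‖y (n - 1)‖ₑ) : absSum f ≤ 2 * absSum y := by
  unfold absSum
  calc _ ≤ ∑' n : ℤ, (‖y (n + 1)‖ₑ + ‖y (n - 1)‖ₑ) := by gcongr with n; exact hf n
    _ = _ := by
      rw [ENNReal.tsum_add, ENNReal_tsum_shift (fun n : ℤ => ‖y n‖ₑ) 1]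
      have := ENNReal_tsum_shift (fun n : ℤ => ‖y n‖ₑ) (-1)
      simp only [sub_neg_eq_add] at this
      rw [this, two_mul]

/-- The tail sum `∑_{|k| > |i|} |x k| / (|k| + 1)²`, which dominates the coefficients of `ξ / sin θ` and
`v(ξ) / sin θ` up to the diagonal term. -/
def tailSum (x : ℤ → ℝ) (i : ℤ) : ℝ≥0∞ :=
  ∑' k : ℤ, if i.natAbs < k.natAbs then ((k.natAbs : ℝ≥0∞) + 1)⁻¹ ^ 2 * ‖x k‖ₑ else 0

lemma tsum_tailSum_le (x : ℤ → ℝ) : ∑' i, tailSum x i ≤ invSq * absSum x := by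
  unfold tailSum absSum
  rw [ENNReal.tsum_comm, ← ENNReal.tsum_mul_left, coe_invSq, invSqSum]
  gcongr with k
  rw [← ENNReal.tsum_mul_right]
  gcongr with i
  split_ifs with h
  · gcongr
  · simp

/-- A Hardy-type inequality: the sum over higher frequencies is bounded in every weighted norm, the weight
being nondecreasing. -/
lemma tsum_weight_tailSum_le {R : ℕ} {w : ℕ → ℝ≥0} (h : IsWeight R w) (x : ℤ → ℝ) :
    ∑' i : ℤ, ((w i.natAbs : ℝ≥0∞) * tailSum x i) ^ 2 ≤ invSq * invSq * sqNorm w x := by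
  have key : ∀ i : ℤ, ((w i.natAbs : ℝ≥0∞) * tailSum x i) ^ 2 ≤
      ((i.natAbs : ℝ≥0∞) + 1)⁻¹ ^ 2 * (invSqSum * sqNorm w x) := by
    intro i
    have h1 : (w i.natAbs : ℝ≥0∞) * tailSum x i ≤ ((i.natAbs : ℝ≥0∞) + 1)⁻¹ *
        ∑' k : ℤ, ((k.natAbs : ℝ≥0∞) + 1)⁻¹ * ((w k.natAbs : ℝ≥0∞) * ‖x k‖ₑ) := by
      unfold tailSum
      rw [← ENNReal.tsum_mul_left, ← ENNReal.tsum_mul_left]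
      refine ENNReal.tsum_le_tsum fun k => ?_
      split_ifs with hk
      · have hm : (w i.natAbs : ℝ≥0∞) ≤ w k.natAbs := by exact_mod_cast h.mono hk.le
        have hk' : ((k.natAbs : ℝ≥0∞) + 1)⁻¹ ≤ ((i.natAbs : ℝ≥0∞) + 1)⁻¹ := by gcongr
        calc _ = ((k.natAbs : ℝ≥0∞) + 1)⁻¹ * (((k.natAbs : ℝ≥0∞) + 1)⁻¹ *
              ((w i.natAbs : ℝ≥0∞) * ‖x k‖ₑ)) := by ring
          _ ≤ _ := by gcongr
      · simp
    calc _ ≤ (((i.natAbs : ℝ≥0∞) + 1)⁻¹ *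
        ∑' k : ℤ, ((k.natAbs : ℝ≥0∞) + 1)⁻¹ * ((w k.natAbs : ℝ≥0∞) * ‖x k‖ₑ)) ^ 2 := by gcongr
      _ ≤ _ := by
        rw [mul_pow]; gcongr
        exact ENNReal_tsum_mul_sq_le _ _
  calc _ ≤ ∑' i : ℤ, ((i.natAbs : ℝ≥0∞) + 1)⁻¹ ^ 2 * (invSqSum * sqNorm w x) := by
        gcongr with i; exact key i
    _ = _ := by rw [ENNReal.tsum_mul_right, coe_invSq, invSqSum]; ring

lemma sqNorm_le_of_tail {R : ℕ} {w : ℕ → ℝ≥0} (h : IsWeight R w) {p x : ℤ → ℝ}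
    (hp : ∀ i, ‖p i‖ₑ ≤ ‖x i‖ₑ + 9 * tailSum x i) :
    sqNorm w p ≤ 2 * (1 + 81 * (invSq * invSq)) * sqNorm w x := by
  unfold sqNorm
  calc _ ≤ ∑' i : ℤ, 2 * (((w i.natAbs : ℝ≥0∞) * ‖x i‖ₑ) ^ 2 +
        81 * ((w i.natAbs : ℝ≥0∞) * tailSum x i) ^ 2) := by
        gcongr with i
        calc _ ≤ ((w i.natAbs : ℝ≥0∞) * ‖x i‖ₑ + w i.natAbs * (9 * tailSum x i)) ^ 2 := by
              rw [← mul_add]; gcongr; exact hp i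
          _ ≤ _ := ENNReal_add_sq_le _ _
          _ = _ := by ring
    _ = 2 * (sqNorm w x + 81 * ∑' i : ℤ, ((w i.natAbs : ℝ≥0∞) * tailSum x i) ^ 2) := by
        rw [ENNReal.tsum_mul_left, ENNReal.tsum_add, ENNReal.tsum_mul_left, sqNorm]
    _ ≤ 2 * (sqNorm w x + 81 * (invSq * invSq * sqNorm w x)) := by
        gcongr; exact tsum_weight_tailSum_le h x
    _ = _ := by unfold sqNorm; ring

lemma absSum_le_of_tail {p x : ℤ → ℝ} (hp : ∀ i, ‖p i‖ₑ ≤ ‖x i‖ₑ + 9 * tailSum x i) :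
    absSum p ≤ (1 + 9 * invSq) * absSum x := by
  calc _ ≤ ∑' i : ℤ, (‖x i‖ₑ + 9 * tailSum x i) := by unfold absSum; gcongr with i; exact hp i
    _ = absSum x + 9 * ∑' i, tailSum x i := by
        rw [ENNReal.tsum_add, ENNReal.tsum_mul_left, absSum]
    _ ≤ absSum x + 9 * (invSq * absSum x) := by gcongr; exact tsum_tailSum_le x
    _ = _ := by ring

/-! ### The equations on the level of Fourier coefficients -/

/-- Odd sequences without modes of frequency `0` and `±1`: the sine coefficients of
`∂_θ ξ / sin θ` for an odd periodic `ξ`. -/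
structure OddModes (x : ℤ → ℝ) : Prop where
  odd : ∀ k, x (-k) = -x k
  one : x 1 = 0

/-- The coefficients of `sin (n θ) / sin θ` for `n ≥ 0`, as a cosine series over `ℤ`: it equals
`1` at `n - 1, n - 3, …, -(n - 1)`. -/
def ladder (n i : ℤ) : ℝ := if |i| < n ∧ Even (n - 1 - i) then 1 else 0

/-- The coefficients of `ξ / sin θ` if `∂_θ ξ = sin θ sin (k θ)`. -/
def primKer (i k : ℤ) : ℝ :=
  if 2 ≤ k then (ladder (k - 1) i / (k - 1) - ladder (k + 1) i / (k + 1)) / 2 else 0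

/-- The coefficients of `v / sin θ` if `v = v(ξ)` and `∂_θ ξ = sin θ sin (k θ)`. -/
def velKer (i k : ℤ) : ℝ :=
  if 2 ≤ k then -(ladder (k - 1) i / (k - 1) ^ 2 - ladder (k + 1) i / (k + 1) ^ 2) / 2 else 0

/-- The coefficients of `ξ / sin θ`. -/
def primQuot (x : ℤ → ℝ) (i : ℤ) : ℝ := ∑' k, primKer i k * x k

/-- The coefficients of `v(ξ) / sin θ`. -/
def velQuot (x : ℤ → ℝ) (i : ℤ) : ℝ := ∑' k, velKer i k * x k

/-- The coefficients of `∂_θ² v(ξ)`. -/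
def velSecond (x : ℤ → ℝ) (n : ℤ) : ℝ := n.sign * (x (n + 1) - x (n - 1)) / 2

/-- The coefficients of `cos θ ∂_θ ξ / sin θ`. -/
def cosMul (x : ℤ → ℝ) (n : ℤ) : ℝ := (x (n + 1) + x (n - 1)) / 2

/-- The coefficients of `v(ξ)`. -/
def velCoeff (x : ℤ → ℝ) (n : ℤ) : ℝ := -velSecond x n / (n : ℝ) ^ 2

/-- The part of order zero of the bilinear term. -/
def bilinZero (x y : ℤ → ℝ) (k : ℤ) : ℝ :=
  conv (primQuot x) (velSecond y) k - conv (velQuot y) (cosMul x) k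

/-- The transport part `v(ζ) ∂_θ u` of the bilinear term. -/
def bilinTransport (x y : ℤ → ℝ) (k : ℤ) : ℝ := conv (fun l => (l : ℝ) * x l) (velCoeff y) k / 2

/-- The bilinear term: the coefficients of `∂_θ {ξ, v(ζ)} / sin θ`. -/
def bilin (x y : ℤ → ℝ) (k : ℤ) : ℝ := bilinZero x y k - bilinTransport x y k

/-- A three-term operator in divergence form: a difference across one frequency, multiplication by the
symbol `τ`, and a sum across one frequency. -/
def band (τ : ℤ → ℝ) (x : ℤ → ℝ) (k : ℤ) : ℝ :=
  τ (k + 1) * (x (k + 2) - x k) + τ (k - 1) * (x k - x (k - 2))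

/-- Symbol of `ξ ↦ {ξ / 2, sin 2θ}`. Its value at `n = 0`, zero by convention, multiplies
`x 1 - x (-1)`, which vanishes for the sequences in question. -/
def symS (n : ℤ) : ℝ := ((n : ℝ) ^ 2 - 4) / (4 * n)

/-- Symbol of `ζ ↦ {v(ζ), sin 2θ}`; the value at `n = 0` is as immaterial as for `symS`. -/
def symR (n : ℤ) : ℝ := -(n.sign * (1 - 4 / (n : ℝ) ^ 2)) / 2

/-- The right-hand side of the equation for `ξ = η⁺ + η⁻`, where `ζ = η⁺ - η⁻`. -/
def rhs (x y : ℤ → ℝ) (k : ℤ) : ℝ := band symS x k + band symR y k + bilin x y k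

lemma OddModes.zero {x : ℤ → ℝ} (h : OddModes x) : x 0 = 0 := by
  have := h.odd 0; simp at this; linarith

lemma OddModes.neg_one {x : ℤ → ℝ} (h : OddModes x) : x (-1) = 0 := by rw [h.odd, h.one, neg_zero]

lemma OddModes.eq_zero {x : ℤ → ℝ} (h : OddModes x) {k : ℤ} (hk : |k| < 2) : x k = 0 := by
  have : k = 0 ∨ k = 1 ∨ k = -1 := by rw [abs_lt] at hk; omega
  rcases this with rfl | rfl | rfl
  exacts [h.zero, h.one, h.neg_one]

lemma OddModes.enorm_abs {x : ℤ → ℝ} (h : OddModes x) (i : ℤ) : ‖x |i|‖ₑ = ‖x i‖ₑ := by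
  rcases abs_choice i with hi | hi <;> rw [hi]
  rw [h.odd, enorm_neg]

lemma ladder_nonneg (n i : ℤ) : 0 ≤ ladder n i := by unfold ladder; split_ifs <;> norm_num

lemma ladder_le_one (n i : ℤ) : ladder n i ≤ 1 := by unfold ladder; split_ifs <;> norm_num

lemma ladder_step {k i : ℤ} (h : |i| ≠ k) : ladder (k + 1) i = ladder (k - 1) i := by
  unfold ladder
  congr 1
  have e1 : (k + 1 - 1 - i) = k - i := by ring
  rw [e1]
  have e2 : Even (k - 1 - 1 - i) ↔ Even (k - i) := by
    rw [show k - 1 - 1 - i = k - i - 2 by ring]; simp [Int.even_sub]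
  rw [e2]
  apply propext
  constructor
  · rintro ⟨h1, h2⟩
    refine ⟨?_, h2⟩
    have h3 : |i| ≠ k - 1 := by
      intro h4
      rcases abs_choice i with hi | hi <;> rw [hi] at h4
      · rw [show k - i = 1 by omega] at h2; exact absurd h2 (by decide)
      · rw [show k - i = 2 * k - 1 by omega, Int.even_sub] at h2; simp at h2
    omega
  · rintro ⟨h1, h2⟩
    exact ⟨by omega, h2⟩

lemma ladder_eq_zero {n i : ℤ} (h : n ≤ |i|) : ladder n i = 0 := by
  unfold ladder; rw [if_neg]; rintro ⟨h1, -⟩; omega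

lemma primKer_eq_zero {i k : ℤ} (h : k < |i|) : primKer i k = 0 := by
  unfold primKer
  split_ifs
  · rw [ladder_eq_zero (by omega), ladder_eq_zero (by omega)]; simp
  · rfl

lemma velKer_eq_zero {i k : ℤ} (h : k < |i|) : velKer i k = 0 := by
  unfold velKer
  split_ifs
  · rw [ladder_eq_zero (by omega), ladder_eq_zero (by omega)]; simp
  · rfl

lemma abs_primKer_self_le (i : ℤ) : |primKer i (|i|)| ≤ 1 := by
  unfold primKer
  split_ifs with h
  · rw [ladder_eq_zero (by omega)]
    have h1 : (2 : ℝ) ≤ (|i| : ℤ) := by exact_mod_cast h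
    have h2 := ladder_nonneg (|i| + 1) i
    have h3 := ladder_le_one (|i| + 1) i
    rw [zero_div, zero_sub, abs_div, abs_neg, abs_of_nonneg (by positivity)]
    rw [div_le_one (by norm_num), div_le_iff₀ (by linarith)]
    norm_num; linarith [abs_nonneg (i : ℝ)]
  · simp

lemma abs_velKer_self_le (i : ℤ) : |velKer i (|i|)| ≤ 1 := by
  unfold velKer
  split_ifs with h
  · rw [ladder_eq_zero (by omega)]
    have h1 : (2 : ℝ) ≤ (|i| : ℤ) := by exact_mod_cast h
    have h2 := ladder_nonneg (|i| + 1) i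
    have h3 := ladder_le_one (|i| + 1) i
    rw [zero_div, zero_sub, neg_neg, abs_of_nonneg (by positivity)]
    rw [div_le_one (by norm_num), div_le_iff₀ (by positivity)]
    nlinarith
  · simp

lemma abs_primKer_le {i k : ℤ} (h : |i| < k) : |primKer i k| ≤ 9 * ((k : ℝ) + 1)⁻¹ ^ 2 := by
  unfold primKer
  split_ifs with hk
  · rw [ladder_step (by omega)]
    have h1 : (2 : ℝ) ≤ k := by exact_mod_cast hk
    have h2 := ladder_nonneg (k - 1) i
    have h3 := ladder_le_one (k - 1) i
    have e : (ladder (k - 1) i / ((k : ℝ) - 1) - ladder (k - 1) i / (k + 1)) / 2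
        = ladder (k - 1) i * (((k : ℝ) - 1) * (k + 1))⁻¹ := by
      have : (k : ℝ) - 1 ≠ 0 := by linarith
      field_simp; ring
    rw [e, abs_of_nonneg (mul_nonneg h2 (inv_nonneg.2 (by nlinarith))), inv_pow]
    calc _ ≤ 1 * (((k : ℝ) - 1) * (k + 1))⁻¹ := by
          gcongr; exact inv_nonneg.2 (by nlinarith)
      _ ≤ _ := by
          rw [one_mul, ← div_eq_mul_inv, inv_eq_one_div,
            div_le_div_iff₀ (by nlinarith) (by positivity)]
          nlinarith
  · rw [abs_zero]; positivity

lemma abs_velKer_le {i k : ℤ} (h : |i| < k) : |velKer i k| ≤ 9 * ((k : ℝ) + 1)⁻¹ ^ 2 := by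
  unfold velKer
  split_ifs with hk
  · rw [ladder_step (by omega)]
    have h1 : (2 : ℝ) ≤ k := by exact_mod_cast hk
    have h2 := ladder_nonneg (k - 1) i
    have h3 := ladder_le_one (k - 1) i
    have h4 : (0 : ℝ) < ((k : ℝ) - 1) ^ 2 := by nlinarith
    have h5 : (0 : ℝ) ≤ 1 / (k + 1) ^ 2 := by positivity
    have h6 : 1 / ((k : ℝ) + 1) ^ 2 ≤ 1 / (k - 1) ^ 2 :=
      one_div_le_one_div_of_le h4 (by nlinarith)
    have h7 : 1 / ((k : ℝ) - 1) ^ 2 ≤ 9 * (1 / (k + 1) ^ 2) := by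
      rw [mul_one_div, div_le_div_iff₀ h4 (by positivity)]; nlinarith
    have e : -(ladder (k - 1) i / ((k : ℝ) - 1) ^ 2 - ladder (k - 1) i / (k + 1) ^ 2) / 2
        = -(ladder (k - 1) i * ((1 / ((k : ℝ) - 1) ^ 2 - 1 / (k + 1) ^ 2) / 2)) := by ring
    rw [e, abs_neg, abs_of_nonneg (mul_nonneg h2 (by linarith)), inv_pow, inv_eq_one_div]
    calc _ ≤ 1 * ((1 / ((k : ℝ) - 1) ^ 2 - 1 / (k + 1) ^ 2) / 2) := by
          gcongr
      _ ≤ _ := by linarith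
  · rw [abs_zero]; positivity

/-- The bound shared by `primKer` and `velKer`: triangular kernels, bounded on the diagonal and of second
order decay above it. -/
lemma enorm_kernel_sum_le {ker : ℤ → ℤ → ℝ} (h0 : ∀ i k, k < |i| → ker i k = 0)
    (h1 : ∀ i, |ker i (|i|)| ≤ 1) (h2 : ∀ i k, |i| < k → |ker i k| ≤ 9 * ((k : ℝ) + 1)⁻¹ ^ 2)
    {x : ℤ → ℝ} (hx : OddModes x) (i : ℤ) :
    ∑' k, ‖ker i k * x k‖ₑ ≤ ‖x i‖ₑ + 9 * tailSum x i := by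
  have hpt : ∀ k, ‖ker i k * x k‖ₑ ≤ (if k = |i| then ‖x i‖ₑ else 0) +
      9 * (if i.natAbs < k.natAbs then ((k.natAbs : ℝ≥0∞) + 1)⁻¹ ^ 2 * ‖x k‖ₑ else 0) := by
    intro k
    rcases lt_trichotomy k |i| with hk | hk | hk
    · rw [h0 i k hk]; simp
    · rw [if_pos hk, hk, enorm_mul, hx.enorm_abs]
      refine le_add_right ?_
      calc _ ≤ 1 * ‖x i‖ₑ := by
            gcongr; rw [Real.enorm_eq_ofReal_abs]; exact ENNReal.ofReal_le_one.2 (h1 i)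
        _ = _ := one_mul _
    · have hk0 : 0 ≤ k := (abs_nonneg i).trans hk.le
      have hlt : i.natAbs < k.natAbs := by rw [Int.abs_eq_natAbs] at hk; omega
      rw [if_pos hlt, enorm_mul, ← mul_assoc]
      refine le_add_left ?_
      gcongr
      rw [Real.enorm_eq_ofReal_abs]
      have hkk : (k : ℝ) = (k.natAbs : ℝ) := by
        rw [Nat.cast_natAbs, abs_of_nonneg hk0]
      calc _ ≤ ENNReal.ofReal (9 * ((k : ℝ) + 1)⁻¹ ^ 2) := ENNReal.ofReal_le_ofReal (h2 i k hk)
        _ = _ := by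
          rw [hkk, ENNReal.ofReal_mul (by norm_num), ENNReal.ofReal_pow (by positivity),
            ENNReal.ofReal_inv_of_pos (by positivity), ENNReal.ofReal_add (by positivity)
            (by norm_num), ENNReal.ofReal_natCast, ENNReal.ofReal_one, ENNReal.ofReal_ofNat]
  calc _ ≤ ∑' k, ((if k = |i| then ‖x i‖ₑ else 0) +
      9 * (if i.natAbs < k.natAbs then ((k.natAbs : ℝ≥0∞) + 1)⁻¹ ^ 2 * ‖x k‖ₑ else 0)) :=
        ENNReal.tsum_le_tsum hpt
    _ = _ := by
      rw [ENNReal.tsum_add, ENNReal.tsum_mul_left, tsum_ite_eq, tailSum]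

lemma enorm_primQuot_le {x : ℤ → ℝ} (hx : OddModes x) (i : ℤ) :
    ‖primQuot x i‖ₑ ≤ ‖x i‖ₑ + 9 * tailSum x i :=
  enorm_tsum_le_tsum_enorm.trans (enorm_kernel_sum_le (fun _ _ => primKer_eq_zero)
    abs_primKer_self_le (fun _ _ => abs_primKer_le) hx i)

lemma enorm_velQuot_le {x : ℤ → ℝ} (hx : OddModes x) (i : ℤ) :
    ‖velQuot x i‖ₑ ≤ ‖x i‖ₑ + 9 * tailSum x i :=
  enorm_tsum_le_tsum_enorm.trans (enorm_kernel_sum_le (fun _ _ => velKer_eq_zero)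
    abs_velKer_self_le (fun _ _ => abs_velKer_le) hx i)

lemma enorm_half_le (a b : ℝ) : ‖(a + b) / 2‖ₑ ≤ ‖a‖ₑ + ‖b‖ₑ := by
  rw [Real.enorm_eq_ofReal_abs, Real.enorm_eq_ofReal_abs, Real.enorm_eq_ofReal_abs,
    ← ENNReal.ofReal_add (abs_nonneg _) (abs_nonneg _)]
  apply ENNReal.ofReal_le_ofReal
  rw [abs_div, abs_of_pos (by norm_num : (0 : ℝ) < 2)]
  have := abs_add_le a b
  have := abs_nonneg (a + b)
  linarith

lemma enorm_cosMul_le (x : ℤ → ℝ) (n : ℤ) : ‖cosMul x n‖ₑ ≤ ‖x (n + 1)‖ₑ + ‖x (n - 1)‖ₑ :=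
  enorm_half_le _ _

lemma abs_sign_le (n : ℤ) : |((n.sign : ℤ) : ℝ)| ≤ 1 := by
  rcases lt_trichotomy n 0 with h | h | h
  · simp [Int.sign_eq_neg_one_of_neg h]
  · simp [h]
  · simp [Int.sign_eq_one_of_pos h]

lemma enorm_velSecond_le (x : ℤ → ℝ) (n : ℤ) :
    ‖velSecond x n‖ₑ ≤ ‖x (n + 1)‖ₑ + ‖x (n - 1)‖ₑ := by
  unfold velSecond
  rw [mul_div_assoc, enorm_mul]
  calc _ ≤ 1 * ‖(x (n + 1) - x (n - 1)) / 2‖ₑ := by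
        gcongr; rw [Real.enorm_eq_ofReal_abs]; exact ENNReal.ofReal_le_one.2 (abs_sign_le n)
    _ ≤ _ := by
        rw [one_mul, sub_eq_add_neg, ← enorm_neg (x (n - 1))]; exact enorm_half_le _ _

lemma abs_freq_mul_velCoeff_le (x : ℤ → ℝ) (n : ℤ) : |(n : ℝ) * velCoeff x n| ≤ |velSecond x n| := by
  unfold velCoeff
  rcases eq_or_ne n 0 with rfl | hn
  · simp
  · have h1 : (1 : ℝ) ≤ |(n : ℝ)| := by exact_mod_cast Int.one_le_abs hn
    have h0 : (n : ℝ) ≠ 0 := by exact_mod_cast hn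
    rw [show (n : ℝ) * (-velSecond x n / (n : ℝ) ^ 2) = -(velSecond x n / n) by field_simp,
      abs_neg, abs_div]
    exact div_le_self (abs_nonneg _) h1

lemma abs_velCoeff_le (x : ℤ → ℝ) (n : ℤ) : |velCoeff x n| ≤ |velSecond x n| := by
  rcases eq_or_ne n 0 with rfl | hn
  · simp [velCoeff]
  · have h1 : (1 : ℝ) ≤ |(n : ℝ)| := by exact_mod_cast Int.one_le_abs hn
    refine le_trans ?_ (abs_freq_mul_velCoeff_le x n)
    rw [abs_mul]
    exact le_mul_of_one_le_left (abs_nonneg _) h1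

lemma enorm_le_of_abs_le {a b : ℝ} (h : |a| ≤ |b|) : ‖a‖ₑ ≤ ‖b‖ₑ := by
  rw [Real.enorm_eq_ofReal_abs, Real.enorm_eq_ofReal_abs]; exact ENNReal.ofReal_le_ofReal h

lemma enorm_velCoeff_le (x : ℤ → ℝ) (n : ℤ) :
    ‖velCoeff x n‖ₑ ≤ ‖x (n + 1)‖ₑ + ‖x (n - 1)‖ₑ :=
  (enorm_le_of_abs_le (abs_velCoeff_le x n)).trans (enorm_velSecond_le x n)

lemma enorm_freq_velCoeff_le (x : ℤ → ℝ) (n : ℤ) :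
    ‖(n : ℝ) * velCoeff x n‖ₑ ≤ ‖x (n + 1)‖ₑ + ‖x (n - 1)‖ₑ :=
  (enorm_le_of_abs_le (abs_freq_mul_velCoeff_le x n)).trans (enorm_velSecond_le x n)

lemma natAbs_add_one_enorm (k : ℤ) : ‖((k.natAbs : ℝ) + 1)‖ₑ = (k.natAbs : ℝ≥0∞) + 1 := by
  have : ((k.natAbs : ℝ) + 1) = (((k.natAbs : ℝ≥0) + 1 : ℝ≥0) : ℝ) := by push_cast; rfl
  rw [this, Real.enorm_eq_ofReal (by positivity), ENNReal.ofReal_coe_nnreal]; push_cast; rfl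

lemma sqNorm_raise (w : ℕ → ℝ≥0) (x : ℤ → ℝ) :
    sqNorm w (fun k => ((k.natAbs : ℝ) + 1) * x k) = sqNorm (raise w) x := by
  unfold sqNorm
  refine tsum_congr fun k => ?_
  rw [enorm_mul, natAbs_add_one_enorm]
  simp only [raise]; push_cast; ring

lemma sqNorm_freq_le (w : ℕ → ℝ≥0) (x : ℤ → ℝ) :
    sqNorm w (fun k => (k : ℝ) * x k) ≤ sqNorm (raise w) x := by
  rw [← sqNorm_raise]
  refine sqNorm_le_of_enorm_le fun k => enorm_le_of_abs_le ?_
  rw [abs_mul, abs_mul]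
  refine mul_le_mul_of_nonneg_right ?_ (abs_nonneg _)
  rw [abs_of_nonneg (by positivity : (0 : ℝ) ≤ (k.natAbs : ℝ) + 1), Nat.cast_natAbs]
  push_cast; linarith

/-- The tame estimate for the part of order zero. -/
lemma exists_sqNorm_bilinZero_le (R : ℕ) : ∃ C : ℝ≥0, ∀ w, IsWeight R w → ∀ x y : ℤ → ℝ,
    OddModes x → OddModes y → sqNorm w (bilinZero x y) ≤
      C * (sqNorm w x * sqNorm (powWeight 2) y + sqNorm (powWeight 2) x * sqNorm w y) := by
  set K1 : ℝ≥0 := 2 * (1 + 81 * (invSq * invSq)) with hK1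
  set K2 : ℝ≥0 := (1 + 9 * invSq) ^ 2 * invSq with hK2
  set K3 : ℝ≥0 := 4 * 4 ^ R with hK3
  set K4 : ℝ≥0 := 4 * invSq with hK4
  refine ⟨2 * ((2 * 4 ^ R) * (K1 * K4) + (2 * 4 ^ R) * (K2 * K3) +
    ((2 * 4 ^ R) * (K1 * K4) + (2 * 4 ^ R) * (K2 * K3))), fun w hw x y hx hy => ?_⟩
  have habs : ∀ {f z : ℤ → ℝ}, (∀ n, ‖f n‖ₑ ≤ ‖z (n + 1)‖ₑ + ‖z (n - 1)‖ₑ) →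
      absSum f ^ 2 ≤ K4 * sqNorm (powWeight 2) z := by
    intro f z hf
    calc _ ≤ (2 * absSum z) ^ 2 := by gcongr; exact absSum_le_of_neighbours hf
      _ = 4 * absSum z ^ 2 := by ring
      _ ≤ 4 * (invSq * sqNorm (powWeight 2) z) := by gcongr; exact absSum_sq_le z
      _ = _ := by rw [hK4]; push_cast; ring
  have hsq : ∀ {f z : ℤ → ℝ}, (∀ n, ‖f n‖ₑ ≤ ‖z (n + 1)‖ₑ + ‖z (n - 1)‖ₑ) →
      sqNorm w f ≤ K3 * sqNorm w z := by
    intro f z hf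
    rw [hK3]; push_cast; exact sqNorm_le_of_neighbours hw hf
  have tsq : ∀ {f z : ℤ → ℝ}, (∀ n, ‖f n‖ₑ ≤ ‖z n‖ₑ + 9 * tailSum z n) →
      sqNorm w f ≤ K1 * sqNorm w z := by
    intro f z hf
    rw [hK1]; push_cast; exact sqNorm_le_of_tail hw hf
  have tabs : ∀ {f z : ℤ → ℝ}, (∀ n, ‖f n‖ₑ ≤ ‖z n‖ₑ + 9 * tailSum z n) →
      absSum f ^ 2 ≤ K2 * sqNorm (powWeight 2) z := by
    intro f z hf
    calc _ ≤ ((1 + 9 * invSq) * absSum z) ^ 2 := by gcongr; exact absSum_le_of_tail hf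
      _ = (1 + 9 * invSq) ^ 2 * absSum z ^ 2 := by ring
      _ ≤ (1 + 9 * invSq) ^ 2 * (invSq * sqNorm (powWeight 2) z) := by
        gcongr; exact absSum_sq_le z
      _ = _ := by rw [hK2]; push_cast; ring
  have h1 : sqNorm w (conv (primQuot x) (velSecond y)) ≤ 2 * 4 ^ R *
      ((K1 * sqNorm w x) * (K4 * sqNorm (powWeight 2) y) +
        (K2 * sqNorm (powWeight 2) x) * (K3 * sqNorm w y)) := by
    refine (sqNorm_conv_le hw _ _).trans ?_
    gcongr
    exacts [tsq (enorm_primQuot_le hx), habs (enorm_velSecond_le y), tabs (enorm_primQuot_le hx),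
      hsq (enorm_velSecond_le y)]
  have h2 : sqNorm w (conv (velQuot y) (cosMul x)) ≤ 2 * 4 ^ R *
      ((K1 * sqNorm w y) * (K4 * sqNorm (powWeight 2) x) +
        (K2 * sqNorm (powWeight 2) y) * (K3 * sqNorm w x)) := by
    refine (sqNorm_conv_le hw _ _).trans ?_
    gcongr
    exacts [tsq (enorm_velQuot_le hy), habs (enorm_cosMul_le x), tabs (enorm_velQuot_le hy),
      hsq (enorm_cosMul_le x)]
  have h3 : sqNorm w (bilinZero x y) ≤ 2 * (sqNorm w (conv (primQuot x) (velSecond y)) +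
      sqNorm w (conv (velQuot y) (cosMul x))) := sqNorm_sub_le w _ _
  set a := sqNorm w x * sqNorm (powWeight 2) y
  set b := sqNorm (powWeight 2) x * sqNorm w y
  have ea : 2 * 4 ^ R * ((K1 * sqNorm w x) * (K4 * sqNorm (powWeight 2) y) +
        (K2 * sqNorm (powWeight 2) x) * (K3 * sqNorm w y)) ≤
        ((2 * 4 ^ R) * (K1 * K4) + (2 * 4 ^ R) * (K2 * K3)) * (a + b) := by
    calc _ = (2 * 4 ^ R) * (K1 * K4) * a + (2 * 4 ^ R) * (K2 * K3) * b := by simp only [a, b]; ring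
      _ ≤ ((2 * 4 ^ R) * (K1 * K4) + (2 * 4 ^ R) * (K2 * K3)) * a +
        ((2 * 4 ^ R) * (K1 * K4) + (2 * 4 ^ R) * (K2 * K3)) * b := by
        gcongr
        exacts [le_self_add, le_add_self]
      _ = _ := by ring
  have eb : 2 * 4 ^ R * ((K1 * sqNorm w y) * (K4 * sqNorm (powWeight 2) x) +
        (K2 * sqNorm (powWeight 2) y) * (K3 * sqNorm w x)) ≤
        ((2 * 4 ^ R) * (K1 * K4) + (2 * 4 ^ R) * (K2 * K3)) * (a + b) := by
    calc _ = (2 * 4 ^ R) * (K2 * K3) * a + (2 * 4 ^ R) * (K1 * K4) * b := by simp only [a, b]; ring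
      _ ≤ ((2 * 4 ^ R) * (K1 * K4) + (2 * 4 ^ R) * (K2 * K3)) * a +
        ((2 * 4 ^ R) * (K1 * K4) + (2 * 4 ^ R) * (K2 * K3)) * b := by
        gcongr
        exacts [le_add_self, le_self_add]
      _ = _ := by ring
  calc _ ≤ _ := h3
    _ ≤ 2 * (((2 * 4 ^ R) * (K1 * K4) + (2 * 4 ^ R) * (K2 * K3)) * (a + b) +
        ((2 * 4 ^ R) * (K1 * K4) + (2 * 4 ^ R) * (K2 * K3)) * (a + b)) := by
        gcongr
        exacts [h1.trans ea, h2.trans eb]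
    _ = _ := by push_cast; ring

lemma sqNorm_le_raise (w : ℕ → ℝ≥0) (x : ℤ → ℝ) : sqNorm w x ≤ sqNorm (raise w) x :=
  sqNorm_mono (fun k => by unfold raise; exact le_mul_of_one_le_left (by simp) (by simp)) x

/-- The tame estimate for the bilinear term, with the loss of one derivative in the first
argument only. -/
lemma exists_sqNorm_bilin_le (R : ℕ) : ∃ C : ℝ≥0, ∀ w, IsWeight R w → ∀ x y : ℤ → ℝ,
    OddModes x → OddModes y → sqNorm w (bilin x y) ≤
      C * (sqNorm (raise w) x * sqNorm (powWeight 2) y + sqNorm (powWeight 2) x * sqNorm w y) := by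
  obtain ⟨C, hC⟩ := exists_sqNorm_bilinZero_le R
  refine ⟨2 * (C + 2 * 4 ^ R * ((4 * invSq) + invSq * (4 * 4 ^ R))), fun w hw x y hx hy => ?_⟩
  have h1 := hC w hw x y hx hy
  have h2 : sqNorm w (bilinTransport x y) ≤ 2 * 4 ^ R *
      (sqNorm (raise w) x * ((4 * invSq) * sqNorm (powWeight 2) y) +
        (invSq * sqNorm (powWeight 2) x) * ((4 * 4 ^ R) * sqNorm w y)) := by
    have h3 : sqNorm w (bilinTransport x y)
        ≤ sqNorm w (conv (fun l => (l : ℝ) * x l) (velCoeff y)) := by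
      refine sqNorm_le_of_enorm_le fun k => enorm_le_of_abs_le ?_
      unfold bilinTransport
      rw [abs_div, abs_of_pos (by norm_num : (0 : ℝ) < 2)]
      linarith [abs_nonneg (conv (fun l => (l : ℝ) * x l) (velCoeff y) k)]
    refine h3.trans ((sqNorm_conv_le hw _ _).trans ?_)
    gcongr
    · exact sqNorm_freq_le w x
    · calc _ ≤ (2 * absSum y) ^ 2 := by
            gcongr; exact absSum_le_of_neighbours (enorm_velCoeff_le y)
        _ = 4 * absSum y ^ 2 := by ring
        _ ≤ 4 * (invSq * sqNorm (powWeight 2) y) := by gcongr; exact absSum_sq_le y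
        _ = _ := by ring
    · exact absSum_freq_sq_le x
    · exact sqNorm_le_of_neighbours hw (enorm_velCoeff_le y)
  set a := sqNorm (raise w) x * sqNorm (powWeight 2) y with ha
  set b := sqNorm (powWeight 2) x * sqNorm w y with hb
  calc sqNorm w (bilin x y) ≤ 2 * (sqNorm w (bilinZero x y) + sqNorm w (bilinTransport x y)) :=
        sqNorm_sub_le w _ _
    _ ≤ 2 * (C * (a + b) + 2 * 4 ^ R * (sqNorm (raise w) x * ((4 * invSq) * sqNorm (powWeight 2) y)
        + (invSq * sqNorm (powWeight 2) x) * ((4 * 4 ^ R) * sqNorm w y))) := by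
        gcongr
        refine h1.trans ?_
        rw [ha]; gcongr
        exact sqNorm_le_raise w x
    _ = 2 * (C * (a + b) + (2 * 4 ^ R * (4 * invSq) * a + 2 * 4 ^ R * (invSq * (4 * 4 ^ R)) * b)) := by
        rw [ha, hb]; ring
    _ ≤ 2 * (C * (a + b) + (2 * 4 ^ R * (4 * invSq + invSq * (4 * 4 ^ R)) * a +
        2 * 4 ^ R * (4 * invSq + invSq * (4 * 4 ^ R)) * b)) := by
        gcongr
        exacts [le_self_add, le_add_self]
    _ = _ := by push_cast; ring

lemma abs_symS_le (n : ℤ) : |symS n| ≤ |(n : ℝ)| := by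
  unfold symS
  rcases eq_or_ne n 0 with rfl | hn
  · simp
  · have h1 : (1 : ℝ) ≤ |(n : ℝ)| := by exact_mod_cast Int.one_le_abs hn
    rw [abs_div, abs_mul, abs_of_pos (by norm_num : (0 : ℝ) < 4), div_le_iff₀ (by positivity)]
    have h2 : |(n : ℝ)| ^ 2 = (n : ℝ) ^ 2 := sq_abs _
    rw [abs_le]
    constructor <;> nlinarith

lemma abs_symR_le (n : ℤ) : |symR n| ≤ 2 := by
  unfold symR
  rcases eq_or_ne n 0 with rfl | hn
  · simp
  · have h1 : (1 : ℝ) ≤ |(n : ℝ)| := by exact_mod_cast Int.one_le_abs hn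
    have h2 : (1 : ℝ) ≤ (n : ℝ) ^ 2 := by rw [← sq_abs]; nlinarith
    have h3 : 4 / (n : ℝ) ^ 2 ≤ 4 := div_le_self (by norm_num) h2
    have h4 : 0 ≤ 4 / (n : ℝ) ^ 2 := by positivity
    rw [abs_div, abs_neg, abs_mul, abs_of_pos (by norm_num : (0 : ℝ) < 2)]
    have h5 : |1 - 4 / (n : ℝ) ^ 2| ≤ 3 := by rw [abs_le]; constructor <;> linarith
    have := mul_le_mul (abs_sign_le n) h5 (abs_nonneg _) zero_le_one
    linarith

lemma sqNorm_le_of_three {R : ℕ} {w : ℕ → ℝ≥0} (h : IsWeight R w) {f x : ℤ → ℝ}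
    (hf : ∀ k, |f k| ≤ |x (k + 2)| + 2 * |x k| + |x (k - 2)|) :
    sqNorm w f ≤ 16 * 16 ^ R * sqNorm w x := by
  set z : ℤ → ℝ := fun n => |x (n + 1)| + |x (n - 1)| with hz
  have h1 : sqNorm w z ≤ 4 * 4 ^ R * sqNorm w x := by
    refine sqNorm_le_of_neighbours h fun n => (enorm_add_le _ _).trans ?_
    simp
  have h2 : sqNorm w f ≤ 4 * 4 ^ R * sqNorm w z := by
    refine sqNorm_le_of_neighbours h fun n => ?_
    have e1 : z (n + 1) = |x (n + 2)| + |x n| := by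
      simp only [hz]; congr 3 <;> ring
    have e2 : z (n - 1) = |x n| + |x (n - 2)| := by
      simp only [hz]; congr 3 <;> ring
    rw [e1, e2, Real.enorm_eq_ofReal_abs, Real.enorm_eq_ofReal (by positivity),
      Real.enorm_eq_ofReal (by positivity), ← ENNReal.ofReal_add (by positivity) (by positivity)]
    apply ENNReal.ofReal_le_ofReal
    linarith [hf n]
  calc _ ≤ 4 * 4 ^ R * (4 * 4 ^ R * sqNorm w x) := h2.trans (by gcongr)
    _ = _ := by
      have : (16 : ℝ≥0∞) ^ R = 4 ^ R * 4 ^ R := by rw [← mul_pow]; norm_num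
      rw [this]; ring

lemma abs_band_le {τ : ℤ → ℝ} {c : ℝ} {k : ℤ} (h1 : |τ (k + 1)| ≤ c) (h2 : |τ (k - 1)| ≤ c)
    (x : ℤ → ℝ) : |band τ x k| ≤ c * (|x (k + 2)| + 2 * |x k| + |x (k - 2)|) := by
  unfold band
  have hc : 0 ≤ c := (abs_nonneg _).trans h1
  calc _ ≤ |τ (k + 1)| * |x (k + 2) - x k| + |τ (k - 1)| * |x k - x (k - 2)| := by
        rw [← abs_mul, ← abs_mul]; exact abs_add_le _ _
    _ ≤ c * (|x (k + 2)| + |x k|) + c * (|x k| + |x (k - 2)|) := by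
        gcongr
        exacts [abs_sub _ _, abs_sub _ _]
    _ = _ := by ring

lemma exists_sqNorm_band_symS_le (R : ℕ) : ∃ C : ℝ≥0, ∀ w, IsWeight R w → ∀ x : ℤ → ℝ,
    sqNorm w (band symS x) ≤ C * sqNorm (raise w) x := by
  refine ⟨16 * 16 ^ (R + 1), fun w hw x => ?_⟩
  have e : band symS x = fun k => ((k.natAbs : ℝ) + 1) * (((k.natAbs : ℝ) + 1)⁻¹ * band symS x k) := by
    ext k; rw [mul_inv_cancel_left₀ (by positivity)]
  rw [e, sqNorm_raise]
  push_cast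
  refine sqNorm_le_of_three hw.raise fun k => ?_
  have hk : (k.natAbs : ℝ) = |(k : ℝ)| := by rw [Nat.cast_natAbs]; push_cast; rfl
  have h1 : |symS (k + 1)| ≤ (k.natAbs : ℝ) + 1 := by
    refine (abs_symS_le _).trans ?_
    rw [hk]; push_cast; simpa using abs_add_le (k : ℝ) 1
  have h2 : |symS (k - 1)| ≤ (k.natAbs : ℝ) + 1 := by
    refine (abs_symS_le _).trans ?_
    rw [hk]; push_cast; simpa using abs_sub (k : ℝ) 1
  rw [abs_mul, abs_of_pos (by positivity), inv_mul_le_iff₀ (by positivity)]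
  exact abs_band_le h1 h2 x

lemma exists_sqNorm_band_symR_le (R : ℕ) : ∃ C : ℝ≥0, ∀ w, IsWeight R w → ∀ x : ℤ → ℝ,
    sqNorm w (band symR x) ≤ C * sqNorm w x := by
  refine ⟨4 * (16 * 16 ^ R), fun w hw x => ?_⟩
  have h := sqNorm_le_of_three hw (f := fun k => 2⁻¹ * band symR x k) (x := x) (fun k => by
    have := abs_band_le (abs_symR_le (k + 1)) (abs_symR_le (k - 1)) x
    rw [abs_mul, abs_of_pos (by norm_num : (0 : ℝ) < 2⁻¹)]; linarith)
  have e : band symR x = fun k => 2 * (2⁻¹ * band symR x k) := by ext k; ring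
  rw [e, sqNorm_smul]
  have : ‖(2 : ℝ)‖ₑ ^ 2 = 4 := by
    rw [Real.enorm_eq_ofReal (by norm_num)]; norm_num
  rw [this]; push_cast
  calc _ ≤ 4 * (16 * 16 ^ R * sqNorm w x) := by gcongr
    _ = _ := by ring

/-! ### Energy estimates -/

/-- The sequence vanishes at frequencies larger than `L`. -/
def SupportedIn (L : ℕ) (x : ℤ → ℝ) : Prop := ∀ k : ℤ, L < k.natAbs → x k = 0

/-- The weighted `ℓ²` pairing, a finite sum whenever one factor has bounded support. -/
def pairing (w : ℕ → ℝ≥0) (x z : ℤ → ℝ) : ℝ := ∑' k : ℤ, (w k.natAbs : ℝ) ^ 2 * x k * z k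

lemma summable_of_supported {L : ℕ} {f : ℤ → ℝ} (hf : SupportedIn L f) : Summable f :=
  summable_of_ne_finset_zero (s := Finset.Icc (-(L : ℤ)) L) fun k hk => hf k (by
    rw [Finset.mem_Icc] at hk; omega)

lemma tsum_eq_sum_of_supported {L : ℕ} {f : ℤ → ℝ} (hf : SupportedIn L f) :
    ∑' k, f k = ∑ k ∈ Finset.Icc (-(L : ℤ)) L, f k :=
  tsum_eq_sum fun k hk => hf k (by rw [Finset.mem_Icc] at hk; omega)

lemma pairing_sq_le (w : ℕ → ℝ≥0) (x z : ℤ → ℝ) :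
    ‖pairing w x z‖ₑ ^ 2 ≤ sqNorm w x * sqNorm w z := by
  unfold pairing sqNorm
  refine le_trans ?_ (ENNReal_tsum_mul_sq_le _ _)
  gcongr
  refine enorm_tsum_le_tsum_enorm.trans (le_of_eq (tsum_congr fun k => ?_))
  have : ‖((w k.natAbs : ℝ≥0) : ℝ)‖ₑ = w k.natAbs := by
    rw [Real.enorm_eq_ofReal (by positivity), ENNReal.ofReal_coe_nnreal]
  rw [enorm_mul, enorm_mul, enorm_pow, this]; ring

lemma pairing_add {L : ℕ} (w : ℕ → ℝ≥0) {x : ℤ → ℝ} (hx : SupportedIn L x) (z z' : ℤ → ℝ) :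
    pairing w x (z + z') = pairing w x z + pairing w x z' := by
  unfold pairing
  have h : ∀ z : ℤ → ℝ, Summable fun k : ℤ => (w k.natAbs : ℝ) ^ 2 * x k * z k := fun z =>
    summable_of_supported (L := L) fun k hk => by rw [hx k hk]; ring
  rw [← (h z).tsum_add (h z')]
  exact tsum_congr fun k => by simp only [Pi.add_apply]; ring

lemma pairing_neg (w : ℕ → ℝ≥0) (x z : ℤ → ℝ) : pairing w x (-z) = -pairing w x z := by
  unfold pairing
  rw [← tsum_neg]
  exact tsum_congr fun k => by simp only [Pi.neg_apply]; ring

lemma one_add_pow_le {h : ℝ} (h0 : 0 ≤ h) (h2 : h ≤ 2) (R : ℕ) : (1 + h) ^ R ≤ 1 + 4 ^ R * h := by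
  induction R with
  | zero => simp; exact h0
  | succ R ih =>
    have h4 : (1 : ℝ) ≤ 4 ^ R := one_le_pow₀ (by norm_num)
    calc (1 + h) ^ (R + 1) = (1 + h) ^ R * (1 + h) := pow_succ _ _
      _ ≤ (1 + 4 ^ R * h) * (1 + h) := by gcongr
      _ = 1 + h * (1 + 4 ^ R + 4 ^ R * h) := by ring
      _ ≤ 1 + h * (4 ^ R + 4 ^ R + 4 ^ R * 2) := by gcongr
      _ = _ := by ring

/-- The discrete derivative of a weight is bounded by the weight divided by the frequency. -/
lemma IsWeight.sub_le {R : ℕ} {w : ℕ → ℝ≥0} (h : IsWeight R w) {a b : ℕ} (hab : a ≤ b)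
    (hb : b ≤ 3 * a + 2) : ((w b : ℝ) - w a) * (a + 1) ≤ 4 ^ R * ((b : ℝ) - a) * w a := by
  have h1 : (w b : ℝ) * ((a : ℝ) + 1) ^ R ≤ w a * ((b : ℝ) + 1) ^ R := by
    exact_mod_cast h.growth a b hab
  have ha : (0 : ℝ) < (a : ℝ) + 1 := by positivity
  set t : ℝ := ((b : ℝ) - a) / (a + 1) with ht
  have hab' : (a : ℝ) ≤ b := by exact_mod_cast hab
  have t0 : 0 ≤ t := div_nonneg (by linarith) ha.le
  have t2 : t ≤ 2 := by
    rw [ht, div_le_iff₀ ha]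
    have : (b : ℝ) ≤ 3 * a + 2 := by exact_mod_cast hb
    linarith
  have e : (b : ℝ) + 1 = (1 + t) * (a + 1) := by rw [ht]; field_simp; ring
  have h2 : (w b : ℝ) ≤ w a * (1 + t) ^ R := by
    rw [e, mul_pow, ← mul_assoc] at h1
    exact le_of_mul_le_mul_right h1 (by positivity)
  have h3 : (w b : ℝ) ≤ w a * (1 + 4 ^ R * t) :=
    h2.trans (by gcongr; exact one_add_pow_le t0 t2 R)
  have e2 : 4 ^ R * ((b : ℝ) - a) * w a = (w a * (4 ^ R * t)) * (a + 1) := by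
    rw [ht]; field_simp
  rw [e2]
  gcongr
  linarith

/-- The symbol inequality behind the commutator estimate for the transport term: of the
frequency factor and a weight, at least one falls on the difference `m - l`. -/
lemma IsWeight.commutator {R : ℕ} {w : ℕ → ℝ≥0} (h : IsWeight R w) (l m : ℤ) :
    |(l : ℝ) * (w m.natAbs : ℝ) ^ 2 - m * (w l.natAbs : ℝ) ^ 2| ≤
      (2 * 4 ^ R + 1) * (|((m - l : ℤ) : ℝ)| * (w l.natAbs * w m.natAbs) +
        w (m - l).natAbs * (|(l : ℝ)| * w m.natAbs + |(m : ℝ)| * w l.natAbs)) := by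
  wlog hlm : l.natAbs ≤ m.natAbs generalizing l m
  · have := this m l (by omega)
    rw [abs_sub_comm, show (m - l).natAbs = (l - m).natAbs by omega,
      show |((m - l : ℤ) : ℝ)| = |((l - m : ℤ) : ℝ)| by push_cast; exact abs_sub_comm _ _]
    convert this using 2
    ring
  have hmono : (w l.natAbs : ℝ) ≤ w m.natAbs := by exact_mod_cast h.mono hlm
  have cl : |(l : ℝ)| = (l.natAbs : ℝ) := by rw [Nat.cast_natAbs]; push_cast; rfl
  have cm : |(m : ℝ)| = (m.natAbs : ℝ) := by rw [Nat.cast_natAbs]; push_cast; rfl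
  have cj : |((m - l : ℤ) : ℝ)| = ((m - l).natAbs : ℝ) := by rw [Nat.cast_natAbs]; push_cast; rfl
  have w0 : (0 : ℝ) ≤ w l.natAbs := by positivity
  have w1 : (0 : ℝ) ≤ w m.natAbs := by positivity
  have w2 : (0 : ℝ) ≤ w (m - l).natAbs := by positivity
  have a0 := abs_nonneg (l : ℝ)
  have b0 := abs_nonneg (m : ℝ)
  have j0 := abs_nonneg ((m - l : ℤ) : ℝ)
  have hR : (1 : ℝ) ≤ 4 ^ R := one_le_pow₀ (by norm_num)
  rcases lt_or_ge l.natAbs (m - l).natAbs with hj | hj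
  · have h1 : (w m.natAbs : ℝ) ≤ 2 ^ R * w (m - l).natAbs := by
      exact_mod_cast h.le_of_le_two_mul (l := (m - l).natAbs) (m := m.natAbs) (by omega)
    have h2 : (w l.natAbs : ℝ) ≤ w (m - l).natAbs := by exact_mod_cast h.mono hj.le
    have h24 : (2 : ℝ) ^ R ≤ 4 ^ R := pow_le_pow_left₀ (by norm_num) (by norm_num) R
    calc _ ≤ |(l : ℝ)| * (w m.natAbs : ℝ) ^ 2 + |(m : ℝ)| * (w l.natAbs : ℝ) ^ 2 := by
          refine (abs_sub _ _).trans (le_of_eq ?_)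
          rw [abs_mul, abs_mul, abs_of_nonneg (sq_nonneg (w m.natAbs : ℝ)),
            abs_of_nonneg (sq_nonneg (w l.natAbs : ℝ))]
      _ = |(l : ℝ)| * w m.natAbs * w m.natAbs + |(m : ℝ)| * w l.natAbs * w l.natAbs := by ring
      _ ≤ |(l : ℝ)| * w m.natAbs * (4 ^ R * w (m - l).natAbs) +
          |(m : ℝ)| * w l.natAbs * (4 ^ R * w (m - l).natAbs) := by
          gcongr
          · exact h1.trans (by gcongr)
          · exact h2.trans (le_mul_of_one_le_left w2 hR)
      _ = 4 ^ R * (w (m - l).natAbs * (|(l : ℝ)| * w m.natAbs + |(m : ℝ)| * w l.natAbs)) := by ring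
      _ ≤ _ := by
          gcongr
          · linarith
          · exact le_add_of_nonneg_left (by positivity)
  · have h3 := h.sub_le hlm (by omega)
    have e : (l : ℝ) * (w m.natAbs : ℝ) ^ 2 - m * (w l.natAbs : ℝ) ^ 2 =
        l * (((w m.natAbs : ℝ) - w l.natAbs) * (w m.natAbs + w l.natAbs))
          - ((m - l : ℤ) : ℝ) * (w l.natAbs : ℝ) ^ 2 := by push_cast; ring
    have hd : (m.natAbs : ℝ) - l.natAbs ≤ (m - l).natAbs := by
      rw [sub_le_iff_le_add]; exact_mod_cast (by omega : m.natAbs ≤ (m - l).natAbs + l.natAbs)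
    have h4 : |(l : ℝ)| * ((w m.natAbs : ℝ) - w l.natAbs) ≤ 4 ^ R * |((m - l : ℤ) : ℝ)| * w l.natAbs := by
      have hs : 0 ≤ (w m.natAbs : ℝ) - w l.natAbs := by linarith
      calc _ ≤ ((w m.natAbs : ℝ) - w l.natAbs) * (l.natAbs + 1) := by rw [cl]; nlinarith
        _ ≤ _ := h3
        _ ≤ _ := by rw [cj]; gcongr
    calc _ ≤ |(l : ℝ)| * ((w m.natAbs : ℝ) - w l.natAbs) * (w m.natAbs + w l.natAbs)
          + |((m - l : ℤ) : ℝ)| * (w l.natAbs : ℝ) ^ 2 := by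
          rw [e]
          refine (abs_sub _ _).trans (le_of_eq ?_)
          rw [abs_mul, abs_mul, abs_mul, abs_of_nonneg (sq_nonneg (w l.natAbs : ℝ)),
            abs_of_nonneg (by linarith : 0 ≤ (w m.natAbs : ℝ) - w l.natAbs),
            abs_of_nonneg (by linarith : 0 ≤ (w m.natAbs : ℝ) + w l.natAbs)]
          ring
      _ ≤ 4 ^ R * |((m - l : ℤ) : ℝ)| * w l.natAbs * (w m.natAbs + w m.natAbs)
          + |((m - l : ℤ) : ℝ)| * (w l.natAbs * w m.natAbs) := by
          gcongr
          rw [sq]; gcongr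
      _ = (2 * 4 ^ R + 1) * (|((m - l : ℤ) : ℝ)| * (w l.natAbs * w m.natAbs)) := by ring
      _ ≤ _ := by
          gcongr
          exact le_add_of_nonneg_right (by positivity)

lemma enorm_weight' (c : ℝ≥0) : ‖(c : ℝ)‖ₑ = c := by
  rw [Real.enorm_eq_ofReal (by positivity), ENNReal.ofReal_coe_nnreal]

lemma enorm_abs_real (a : ℝ) : ‖|a|‖ₑ = ‖a‖ₑ := by
  rw [Real.enorm_eq_ofReal_abs, Real.enorm_eq_ofReal_abs, abs_abs]

lemma velSecond_neg {y : ℤ → ℝ} (hy : OddModes y) (n : ℤ) : velSecond y (-n) = -velSecond y n := by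
  unfold velSecond
  rw [Int.sign_neg, show -n + 1 = -(n - 1) by ring, show -n - 1 = -(n + 1) by ring, hy.odd, hy.odd]
  push_cast; ring

lemma velCoeff_neg {y : ℤ → ℝ} (hy : OddModes y) (n : ℤ) : velCoeff y (-n) = -velCoeff y n := by
  unfold velCoeff
  rw [velSecond_neg hy]; push_cast; ring

/-- The transport term loses no derivative in the energy: by oddness of the velocity it can be
antisymmetrised, which leaves a commutator with the weight. -/
lemma exists_pairing_transport_le (R : ℕ) : ∃ C : ℝ≥0, ∀ w, IsWeight R w → ∀ (L : ℕ) (x y : ℤ → ℝ),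
    SupportedIn L x → OddModes y → ‖pairing w x (bilinTransport x y)‖ₑ ^ 2 ≤
      C * sqNorm w x * (sqNorm (powWeight 2) y * sqNorm w x + sqNorm (powWeight 2) x * sqNorm w y) := by
  set K : ℝ≥0 := 2 * 4 ^ R + 1 with hK
  refine ⟨K ^ 2 * (2 * (4 * invSq + 4 * (invSq * (4 * 4 ^ R)))), fun w hw L x y hx hy => ?_⟩
  set S := Finset.Icc (-(L : ℤ)) L with hS
  set V := velCoeff y with hV
  set G : ℤ → ℤ → ℝ := fun m l => (w m.natAbs : ℝ) ^ 2 * x m * (l * x l) * V (m - l) / 2 with hG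
  have hP : pairing w x (bilinTransport x y) = ∑ m ∈ S, ∑ l ∈ S, G m l := by
    unfold pairing
    rw [tsum_eq_sum_of_supported (L := L) (fun k hk => by rw [hx k hk]; ring)]
    refine Finset.sum_congr rfl fun m _ => ?_
    unfold bilinTransport conv
    rw [tsum_eq_sum_of_supported (L := L) (fun k hk => by simp [hx k hk]), Finset.sum_div,
      Finset.mul_sum]
    exact Finset.sum_congr rfl fun l _ => by simp only [hG, hV]; ring
  -- The velocity coefficients being odd, exchanging `m` and `l` turns the pairing into a commutator.
  set H : ℤ → ℤ → ℝ := fun m l =>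
    x m * x l * V (m - l) * (l * (w m.natAbs : ℝ) ^ 2 - m * (w l.natAbs : ℝ) ^ 2) / 4 with hH
  have hP2 : pairing w x (bilinTransport x y) = ∑ m ∈ S, ∑ l ∈ S, H m l := by
    have h1 : ∑ m ∈ S, ∑ l ∈ S, G m l = ∑ m ∈ S, ∑ l ∈ S, G l m := Finset.sum_comm
    have h2 : ∑ m ∈ S, ∑ l ∈ S, H m l
        = (∑ m ∈ S, ∑ l ∈ S, G m l + ∑ m ∈ S, ∑ l ∈ S, G l m) / 2 := by
      rw [← Finset.sum_add_distrib, Finset.sum_div]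
      refine Finset.sum_congr rfl fun m _ => ?_
      rw [← Finset.sum_add_distrib, Finset.sum_div]
      refine Finset.sum_congr rfl fun l _ => ?_
      simp only [hG, hH]
      rw [show l - m = -(m - l) by ring, hV, velCoeff_neg hy]
      ring
    rw [hP, h2, ← h1]; ring
  set X : ℤ → ℝ≥0∞ := fun k => (w k.natAbs : ℝ≥0∞) * ‖x k‖ₑ with hX
  set D1 : ℤ → ℝ≥0∞ := fun m => ∑' i : ℤ, ‖(i : ℝ) * V i‖ₑ * X (m - i) with hD1
  set D2 : ℤ → ℝ≥0∞ := fun m => ∑' l : ℤ, ‖(l : ℝ) * x l‖ₑ *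
    ((w (m - l).natAbs : ℝ≥0∞) * ‖V (m - l)‖ₑ) with hD2
  have hD1' : ∀ m, D1 m = ∑' l : ℤ, ‖((m - l : ℤ) : ℝ) * V (m - l)‖ₑ * X l := by
    intro m
    simp only [hD1]
    rw [← ENNReal_tsum_reflect _ m]; simp
  have hHb : ∀ m l, ‖H m l‖ₑ ≤ K * (X m * (‖((m - l : ℤ) : ℝ) * V (m - l)‖ₑ * X l) +
      (X m * (‖(l : ℝ) * x l‖ₑ * ((w (m - l).natAbs : ℝ≥0∞) * ‖V (m - l)‖ₑ)) +
       X l * (‖(m : ℝ) * x m‖ₑ * ((w (l - m).natAbs : ℝ≥0∞) * ‖V (l - m)‖ₑ)))) := by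
    intro m l
    have hc := hw.commutator l m
    have hv : ‖V (l - m)‖ₑ = ‖V (m - l)‖ₑ := by
      rw [show l - m = -(m - l) by ring, hV, velCoeff_neg hy, enorm_neg]
    rw [hv, show (l - m).natAbs = (m - l).natAbs by omega]
    set J : ℝ := ((m - l : ℤ) : ℝ) with hJ
    have habs : |H m l| ≤ |(K : ℝ) * (|x m| * |x l| * |V (m - l)| *
        (|J| * ((w l.natAbs : ℝ) * w m.natAbs) +
        w (m - l).natAbs * (|(l : ℝ)| * w m.natAbs + |(m : ℝ)| * w l.natAbs)))| := by
      refine le_trans ?_ (le_abs_self _)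
      simp only [hH]
      rw [abs_div, abs_mul, abs_mul, abs_mul, abs_of_pos (by norm_num : (0 : ℝ) < 4),
        div_le_iff₀ (by norm_num)]
      have hKc : (K : ℝ) = 2 * 4 ^ R + 1 := by rw [hK]; push_cast; ring
      have hnn : 0 ≤ |x m| * |x l| * |V (m - l)| := by positivity
      calc _ ≤ |x m| * |x l| * |V (m - l)| * ((2 * 4 ^ R + 1) * (|J| * (w l.natAbs * w m.natAbs) +
            w (m - l).natAbs * (|(l : ℝ)| * w m.natAbs + |(m : ℝ)| * w l.natAbs))) := by
            gcongr
        _ = (K : ℝ) * (|x m| * |x l| * |V (m - l)| *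
          (|J| * ((w l.natAbs : ℝ) * w m.natAbs) +
          w (m - l).natAbs * (|(l : ℝ)| * w m.natAbs + |(m : ℝ)| * w l.natAbs))) := by
            rw [hKc]; ring
        _ ≤ _ := le_mul_of_one_le_right (by positivity) (by norm_num)
    refine (enorm_le_of_abs_le habs).trans ?_
    rw [enorm_mul, enorm_weight' K]
    gcongr
    rw [enorm_mul, enorm_mul, enorm_mul]
    calc _ ≤ ‖|x m|‖ₑ * ‖|x l|‖ₑ * ‖|V (m - l)|‖ₑ * (‖|J| * ((w l.natAbs : ℝ) * w m.natAbs)‖ₑ +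
        ‖(w (m - l).natAbs : ℝ) * (|(l : ℝ)| * w m.natAbs + |(m : ℝ)| * w l.natAbs)‖ₑ) := by
          gcongr; exact enorm_add_le _ _
      _ ≤ ‖|x m|‖ₑ * ‖|x l|‖ₑ * ‖|V (m - l)|‖ₑ * (‖|J| * ((w l.natAbs : ℝ) * w m.natAbs)‖ₑ +
        ‖(w (m - l).natAbs : ℝ)‖ₑ * (‖|(l : ℝ)| * w m.natAbs‖ₑ + ‖|(m : ℝ)| * w l.natAbs‖ₑ)) := by
          gcongr; rw [enorm_mul]; gcongr; exact enorm_add_le _ _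
      _ = _ := by
          simp only [enorm_mul, enorm_weight', enorm_abs_real, hX]; ring
  have hsum : ‖pairing w x (bilinTransport x y)‖ₑ ≤ K * ∑' m, X m * (D1 m + 2 * D2 m) := by
    rw [hP2]
    calc _ ≤ ∑ m ∈ S, ∑ l ∈ S, ‖H m l‖ₑ :=
          (enorm_sum_le _ _).trans (Finset.sum_le_sum fun m _ => enorm_sum_le _ _)
      _ ≤ ∑' m, ∑' l, ‖H m l‖ₑ :=
          (Finset.sum_le_sum fun m _ => ENNReal.sum_le_tsum _).trans (ENNReal.sum_le_tsum _)
      _ ≤ _ := ENNReal.tsum_le_tsum fun m => ENNReal.tsum_le_tsum fun l => hHb m l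
      _ = K * (∑' m, X m * D1 m + (∑' m, X m * D2 m + ∑' m, X m * D2 m)) := by
          have h3 : ∑' m : ℤ, ∑' l : ℤ,
              X l * (‖(m : ℝ) * x m‖ₑ * ((w (l - m).natAbs : ℝ≥0∞) * ‖V (l - m)‖ₑ))
              = ∑' m, X m * D2 m := by
            rw [ENNReal.tsum_comm]
            exact tsum_congr fun l => by rw [ENNReal.tsum_mul_left]
          simp_rw [ENNReal.tsum_mul_left, ENNReal.tsum_add, h3, ENNReal.tsum_mul_left, ← hD1']
          rfl
      _ = _ := by
          rw [← ENNReal.tsum_add, ← ENNReal.tsum_add]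
          congr 1
          exact tsum_congr fun m => by ring
  have hD1s : ∑' m, D1 m ^ 2 ≤ (4 * invSq) * sqNorm (powWeight 2) y * sqNorm w x := by
    refine (ENNReal_young _ X).trans ?_
    gcongr
    · calc _ ≤ (2 * absSum y) ^ 2 := by
            gcongr; exact absSum_le_of_neighbours (enorm_freq_velCoeff_le y)
        _ = 4 * absSum y ^ 2 := by ring
        _ ≤ 4 * (invSq * sqNorm (powWeight 2) y) := by gcongr; exact absSum_sq_le y
        _ = _ := by ring
    · exact le_rfl
  have hD2s : ∑' m, D2 m ^ 2 ≤ (invSq * sqNorm (powWeight 2) x) * ((4 * 4 ^ R) * sqNorm w y) := by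
    refine (ENNReal_young _ (fun k => (w k.natAbs : ℝ≥0∞) * ‖V k‖ₑ)).trans ?_
    gcongr
    · exact absSum_freq_sq_le x
    · exact sqNorm_le_of_neighbours hw (enorm_velCoeff_le y)
  calc _ ≤ (K * ∑' m, X m * (D1 m + 2 * D2 m)) ^ 2 := by gcongr
    _ = K ^ 2 * (∑' m, X m * (D1 m + 2 * D2 m)) ^ 2 := by ring
    _ ≤ K ^ 2 * ((∑' m, X m ^ 2) * ∑' m, (D1 m + 2 * D2 m) ^ 2) := by
        gcongr; exact ENNReal_tsum_mul_sq_le _ _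
    _ ≤ K ^ 2 * (sqNorm w x * ∑' m, 2 * (D1 m ^ 2 + 4 * D2 m ^ 2)) := by
        gcongr with m
        · exact le_rfl
        · refine (ENNReal_add_sq_le _ _).trans (le_of_eq ?_); ring
    _ = K ^ 2 * (sqNorm w x * (2 * (∑' m, D1 m ^ 2 + 4 * ∑' m, D2 m ^ 2))) := by
        rw [ENNReal.tsum_mul_left, ENNReal.tsum_add, ENNReal.tsum_mul_left]
    _ ≤ K ^ 2 * (sqNorm w x * (2 * ((4 * invSq) * sqNorm (powWeight 2) y * sqNorm w x + 4 *
        ((invSq * sqNorm (powWeight 2) x) * ((4 * 4 ^ R) * sqNorm w y))))) := by gcongr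
    _ = K ^ 2 * sqNorm w x * 2 * ((4 * invSq) * (sqNorm (powWeight 2) y * sqNorm w x) +
        (4 * (invSq * (4 * 4 ^ R))) * (sqNorm (powWeight 2) x * sqNorm w y)) := by ring
    _ ≤ K ^ 2 * sqNorm w x * 2 * ((4 * invSq + 4 * (invSq * (4 * 4 ^ R))) *
          (sqNorm (powWeight 2) y * sqNorm w x) +
        (4 * invSq + 4 * (invSq * (4 * 4 ^ R))) * (sqNorm (powWeight 2) x * sqNorm w y)) := by
        have k1 : (4 * invSq : ℝ≥0∞) ≤ 4 * invSq + 4 * (invSq * (4 * 4 ^ R)) := le_self_add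
        have k2 : (4 * (invSq * (4 * 4 ^ R)) : ℝ≥0∞) ≤ 4 * invSq + 4 * (invSq * (4 * 4 ^ R)) :=
          le_add_self
        gcongr
    _ = _ := by push_cast; ring

lemma abs_symS_sub_le (n : ℤ) : |symS n - n / 4| ≤ 1 := by
  unfold symS
  rcases eq_or_ne n 0 with rfl | hn
  · simp
  · have h1 : (1 : ℝ) ≤ |(n : ℝ)| := by exact_mod_cast Int.one_le_abs hn
    have h0 : (n : ℝ) ≠ 0 := by exact_mod_cast hn
    rw [show ((n : ℝ) ^ 2 - 4) / (4 * n) - n / 4 = -(1 / n) by field_simp; ring, abs_neg, abs_div,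
      abs_one]
    exact div_le_one_of_le₀ h1 (abs_nonneg _)

lemma IsWeight.abs_mul_sq_sub_le {R : ℕ} {w : ℕ → ℝ≥0} (h : IsWeight R w) (k : ℤ) :
    |(k : ℝ) + 1| * |(w k.natAbs : ℝ) ^ 2 - (w (k + 2).natAbs : ℝ) ^ 2| ≤
      4 * 4 ^ R * (w k.natAbs * w (k + 2).natAbs) := by
  have main : ∀ a b : ℕ, a ≤ b → b ≤ a + 2 → |(k : ℝ) + 1| ≤ a + 1 →
      |(k : ℝ) + 1| * |(w b : ℝ) ^ 2 - (w a : ℝ) ^ 2| ≤ 4 * 4 ^ R * (w a * w b) := by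
    intro a b hab hb hk
    have h1 := h.sub_le hab (by omega)
    have h2 : (w a : ℝ) ≤ w b := by exact_mod_cast h.mono hab
    have h0 : (0 : ℝ) ≤ w a := by positivity
    have h3 : (b : ℝ) - a ≤ 2 := by
      have : (b : ℝ) ≤ a + 2 := by exact_mod_cast hb
      linarith
    rw [abs_of_nonneg (by nlinarith : 0 ≤ (w b : ℝ) ^ 2 - (w a : ℝ) ^ 2)]
    calc _ ≤ ((a : ℝ) + 1) * ((w b : ℝ) ^ 2 - (w a : ℝ) ^ 2) := by
          gcongr; nlinarith
      _ = ((w b : ℝ) - w a) * (a + 1) * (w b + w a) := by ring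
      _ ≤ 4 ^ R * 2 * w a * (w b + w b) := by
          have h4 : 4 ^ R * ((b : ℝ) - a) * w a ≤ 4 ^ R * 2 * w a := by gcongr
          exact mul_le_mul (h1.trans h4) (by linarith) (by linarith) (by positivity)
      _ = _ := by ring
  rcases le_total k.natAbs (k + 2).natAbs with hk | hk
  · rw [abs_sub_comm]
    refine main _ _ hk (by omega) ?_
    rw [Nat.cast_natAbs]; push_cast
    simpa using abs_add_le (k : ℝ) 1
  · rw [mul_comm (w k.natAbs : ℝ)]
    refine main _ _ hk (by omega) ?_
    rw [Nat.cast_natAbs]; push_cast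
    have := abs_sub ((k : ℝ) + 2) 1
    rwa [abs_one, show (k : ℝ) + 2 - 1 = k + 1 by ring] at this

/-- The operator with symbol `symS` loses no derivative in the energy: its off-diagonal part is
antisymmetric up to the difference of two neighbouring weights. -/
lemma exists_pairing_band_symS_le (R : ℕ) : ∃ C : ℝ≥0, ∀ w, IsWeight R w → ∀ (L : ℕ) (x : ℤ → ℝ),
    SupportedIn L x → ‖pairing w x (band symS x)‖ₑ ≤ C * sqNorm w x := by
  refine ⟨3 + 4 * 4 ^ R, fun w hw L x hx => ?_⟩
  -- `A` is the diagonal part; the off-diagonal parts `B` and `G` nearly cancel after a shift by `2`.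
  set A : ℤ → ℝ := fun k => (w k.natAbs : ℝ) ^ 2 * x k ^ 2 * (symS (k - 1) - symS (k + 1)) with hA
  set B : ℤ → ℝ := fun k => (w k.natAbs : ℝ) ^ 2 * symS (k + 1) * x k * x (k + 2) with hB
  set G : ℤ → ℝ := fun k => (w k.natAbs : ℝ) ^ 2 * symS (k - 1) * x k * x (k - 2) with hG
  have sA : Summable A := summable_of_supported (L := L) fun k hk => by simp [hA, hx k hk]
  have sB : Summable B := summable_of_supported (L := L) fun k hk => by simp [hB, hx k hk]
  have sG : Summable G := summable_of_supported (L := L) fun k hk => by simp [hG, hx k hk]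
  have sG2 : Summable fun k => G (k + 2) := (Equiv.addRight (2 : ℤ)).summable_iff.2 sG
  have eG : ∑' k, G k = ∑' k, G (k + 2) := ((Equiv.addRight (2 : ℤ)).tsum_eq G).symm
  have hP : pairing w x (band symS x) = ∑' k, (A k + (B k - G (k + 2))) := by
    rw [sA.tsum_add (sB.sub sG2), sB.tsum_sub sG2, ← eG, ← sB.tsum_sub sG, ← sA.tsum_add (sB.sub sG)]
    unfold pairing
    exact tsum_congr fun k => by simp only [hA, hB, hG, band]; ring
  set X : ℤ → ℝ≥0∞ := fun k => (w k.natAbs : ℝ≥0∞) * ‖x k‖ₑ with hX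
  have bA : ∀ k, ‖A k‖ₑ ≤ 3 * X k ^ 2 := by
    intro k
    have h1 : |symS (k - 1) - symS (k + 1)| ≤ 3 := by
      have e1 := abs_symS_sub_le (k - 1)
      have e2 := abs_symS_sub_le (k + 1)
      push_cast at e1 e2
      rw [abs_le] at e1 e2 ⊢
      constructor <;> linarith [e1.1, e1.2, e2.1, e2.2]
    have h2 : ‖symS (k - 1) - symS (k + 1)‖ₑ ≤ 3 := by
      rw [Real.enorm_eq_ofReal_abs]
      exact (ENNReal.ofReal_le_ofReal h1).trans (by simp)
    simp only [hA, hX, enorm_mul, enorm_pow, enorm_weight']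
    calc _ ≤ (w k.natAbs : ℝ≥0∞) ^ 2 * ‖x k‖ₑ ^ 2 * 3 := by gcongr
      _ = _ := by ring
  have bB : ∀ k, ‖B k - G (k + 2)‖ₑ ≤ 4 * 4 ^ R * (X k * X (k + 2)) := by
    intro k
    have hk := hw.abs_mul_sq_sub_le k
    have e : B k - G (k + 2) = (symS (k + 1) *
        ((w k.natAbs : ℝ) ^ 2 - (w (k + 2).natAbs : ℝ) ^ 2)) * x k * x (k + 2) := by
      simp only [hB, hG]
      rw [show k + 2 - 1 = k + 1 by ring, show k + 2 - 2 = k by ring]; ring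
    have h2 : ‖symS (k + 1) * ((w k.natAbs : ℝ) ^ 2 - (w (k + 2).natAbs : ℝ) ^ 2)‖ₑ ≤
        4 * 4 ^ R * (w k.natAbs * w (k + 2).natAbs) := by
      have h3 : |symS (k + 1) * ((w k.natAbs : ℝ) ^ 2 - (w (k + 2).natAbs : ℝ) ^ 2)| ≤
          |(((4 * 4 ^ R * (w k.natAbs * w (k + 2).natAbs) : ℝ≥0)) : ℝ)| := by
        refine le_trans ?_ (le_abs_self _)
        rw [abs_mul]
        push_cast
        refine le_trans ?_ hk
        exact mul_le_mul_of_nonneg_right (by simpa using abs_symS_le (k + 1)) (abs_nonneg _)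
      refine (enorm_le_of_abs_le h3).trans (le_of_eq ?_)
      rw [enorm_weight']; push_cast; rfl
    rw [e, enorm_mul, enorm_mul]
    calc _ ≤ (4 * 4 ^ R * (w k.natAbs * w (k + 2).natAbs) : ℝ≥0∞) * ‖x k‖ₑ * ‖x (k + 2)‖ₑ := by
          gcongr
      _ = _ := by simp only [hX]; ring
  have hXX : ∑' k, X k * X (k + 2) ≤ sqNorm w x := by
    apply ENNReal_le_of_two_mul_le
    rw [← ENNReal.tsum_mul_left]
    calc _ ≤ ∑' k, (X k ^ 2 + X (k + 2) ^ 2) :=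
          ENNReal.tsum_le_tsum fun k => ENNReal_two_mul_le_sq_add_sq _ _
      _ = _ := by
        have := ENNReal_tsum_shift (fun k => X k ^ 2) (-2)
        simp only [sub_neg_eq_add] at this
        rw [ENNReal.tsum_add, this, two_mul]; rfl
  rw [hP]
  calc _ ≤ ∑' k, ‖A k + (B k - G (k + 2))‖ₑ := enorm_tsum_le_tsum_enorm
    _ ≤ ∑' k, (3 * X k ^ 2 + 4 * 4 ^ R * (X k * X (k + 2))) :=
        ENNReal.tsum_le_tsum fun k => (enorm_add_le _ _).trans (add_le_add (bA k) (bB k))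
    _ = 3 * sqNorm w x + 4 * 4 ^ R * ∑' k, X k * X (k + 2) := by
        rw [ENNReal.tsum_add, ENNReal.tsum_mul_left, ENNReal.tsum_mul_left]; rfl
    _ ≤ 3 * sqNorm w x + 4 * 4 ^ R * sqNorm w x := by gcongr
    _ = _ := by push_cast; ring

/-- The energy estimate for the terms of `rhs x y` that lose a derivative of `x`. -/
lemma exists_pairing_main_le (R : ℕ) : ∃ C : ℝ≥0, ∀ w, IsWeight R w → ∀ (L : ℕ) (x y : ℤ → ℝ),
    SupportedIn L x → OddModes x → OddModes y →
    ‖pairing w x (band symS x + bilin x y)‖ₑ ^ 2 ≤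
      C * sqNorm w x * ((1 + sqNorm (powWeight 2) y) * sqNorm w x
        + sqNorm (powWeight 2) x * sqNorm w y) := by
  obtain ⟨C1, h1⟩ := exists_pairing_band_symS_le R
  obtain ⟨C2, h2⟩ := exists_pairing_transport_le R
  obtain ⟨C3, h3⟩ := exists_sqNorm_bilinZero_le R
  refine ⟨4 * (C1 ^ 2 + C2 + C3), fun w hw L x y hx hxo hy => ?_⟩
  have e : band symS x + bilin x y = band symS x + (bilinZero x y + -bilinTransport x y) := by
    ext k; simp [bilin]; ring
  rw [e, pairing_add w hx, pairing_add w hx, pairing_neg]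
  set a := sqNorm w x
  set b := sqNorm (powWeight 2) y * sqNorm w x with hb
  set c := sqNorm (powWeight 2) x * sqNorm w y with hc
  have k1 : ‖pairing w x (band symS x)‖ₑ ^ 2 ≤ C1 ^ 2 * a * a := by
    calc _ ≤ (C1 * a) ^ 2 := by gcongr; exact h1 w hw L x hx
      _ = _ := by ring
  have k2 : ‖-pairing w x (bilinTransport x y)‖ₑ ^ 2 ≤ C2 * a * (b + c) := by
    rw [enorm_neg]; exact h2 w hw L x y hx hy
  have k3 : ‖pairing w x (bilinZero x y)‖ₑ ^ 2 ≤ C3 * a * (b + c) := by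
    refine (pairing_sq_le w x _).trans ?_
    calc _ ≤ a * (C3 * (b + c)) := by
          gcongr; rw [hb, hc, mul_comm (sqNorm _ y)]; exact h3 w hw x y hxo hy
      _ = _ := by ring
  calc _ ≤ (‖pairing w x (band symS x)‖ₑ + (‖pairing w x (bilinZero x y)‖ₑ
        + ‖-pairing w x (bilinTransport x y)‖ₑ)) ^ 2 := by
        gcongr; exact (enorm_add_le _ _).trans (by gcongr; exact enorm_add_le _ _)
    _ ≤ 2 * (‖pairing w x (band symS x)‖ₑ ^ 2 + 2 * (‖pairing w x (bilinZero x y)‖ₑ ^ 2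
        + ‖-pairing w x (bilinTransport x y)‖ₑ ^ 2)) := by
        refine (ENNReal_add_sq_le _ _).trans ?_
        gcongr; exact ENNReal_add_sq_le _ _
    _ ≤ 2 * (C1 ^ 2 * a * a + 2 * (C3 * a * (b + c) + C2 * a * (b + c))) := by gcongr
    _ ≤ 2 * (C1 ^ 2 * a * (a + (b + c)) + 2 * (C3 * a * (a + (b + c))
        + C2 * a * (a + (b + c)))) := by
        have ka : a ≤ a + (b + c) := le_self_add
        have kb : b + c ≤ a + (b + c) := le_add_self
        gcongr
    _ ≤ 2 * (2 * (C1 ^ 2 * a * (a + (b + c))) + 2 * (C3 * a * (a + (b + c))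
        + C2 * a * (a + (b + c)))) := by
        have kc : C1 ^ 2 * a * (a + (b + c)) ≤ 2 * (C1 ^ 2 * a * (a + (b + c))) := by
          rw [two_mul]; exact le_self_add
        gcongr
    _ = 4 * (C1 ^ 2 + C2 + C3) * a * (a + (b + c)) := by ring
    _ = _ := by rw [hb]; push_cast; ring

/-! ### Bilinearity and Lipschitz bounds -/

lemma summable_of_tsum_enorm_ne_top {ι : Type*} {f : ι → ℝ} (h : ∑' i, ‖f i‖ₑ ≠ ⊤) :
    Summable f := by
  have : Summable fun i => ‖f i‖₊ := ENNReal.tsum_coe_ne_top_iff_summable.1 h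
  exact Summable.of_nnnorm this

lemma absSum_ne_top {x : ℤ → ℝ} (hx : sqNorm (powWeight 2) x ≠ ⊤) : absSum x ≠ ⊤ := by
  have h := absSum_sq_le x
  have h2 : (invSq : ℝ≥0∞) * sqNorm (powWeight 2) x ≠ ⊤ := ENNReal.mul_ne_top (by simp) hx
  intro h3
  rw [h3] at h
  exact h2 (top_le_iff.1 (by simpa using h))

lemma absSum_freq_ne_top {x : ℤ → ℝ} (hx : sqNorm (powWeight 2) x ≠ ⊤) :
    absSum (fun k => (k : ℝ) * x k) ≠ ⊤ := by
  have h := absSum_freq_sq_le x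
  have h2 : (invSq : ℝ≥0∞) * sqNorm (powWeight 2) x ≠ ⊤ := ENNReal.mul_ne_top (by simp) hx
  intro h3
  rw [h3] at h
  exact h2 (top_le_iff.1 (by simpa using h))

lemma absSum_ne_top_of_neighbours {f y : ℤ → ℝ} (hy : sqNorm (powWeight 2) y ≠ ⊤)
    (hf : ∀ n, ‖f n‖ₑ ≤ ‖y (n + 1)‖ₑ + ‖y (n - 1)‖ₑ) : absSum f ≠ ⊤ :=
  ne_top_of_le_ne_top (ENNReal.mul_ne_top (by simp) (absSum_ne_top hy)) (absSum_le_of_neighbours hf)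

lemma absSum_ne_top_of_tail {f x : ℤ → ℝ} (hx : sqNorm (powWeight 2) x ≠ ⊤)
    (hf : ∀ i, ‖f i‖ₑ ≤ ‖x i‖ₑ + 9 * tailSum x i) : absSum f ≠ ⊤ :=
  ne_top_of_le_ne_top (ENNReal.mul_ne_top (by finiteness) (absSum_ne_top hx)) (absSum_le_of_tail hf)

lemma summable_conv {a b : ℤ → ℝ} (ha : absSum a ≠ ⊤) (hb : absSum b ≠ ⊤) (m : ℤ) :
    Summable fun i => a i * b (m - i) := by
  apply summable_of_tsum_enorm_ne_top
  refine ne_top_of_le_ne_top (ENNReal.mul_ne_top ha hb) ?_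
  unfold absSum
  rw [← ENNReal.tsum_mul_right]
  refine ENNReal.tsum_le_tsum fun i => ?_
  rw [enorm_mul]
  gcongr
  exact ENNReal.le_tsum (f := fun j => ‖b j‖ₑ) (m - i)

lemma conv_add_left {a a' b : ℤ → ℝ} (ha : absSum a ≠ ⊤) (ha' : absSum a' ≠ ⊤)
    (hb : absSum b ≠ ⊤) : conv (a + a') b = conv a b + conv a' b := by
  ext m
  simp only [conv, Pi.add_apply, add_mul]
  exact (summable_conv ha hb m).tsum_add (summable_conv ha' hb m)

lemma conv_add_right {a b b' : ℤ → ℝ} (ha : absSum a ≠ ⊤) (hb : absSum b ≠ ⊤)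
    (hb' : absSum b' ≠ ⊤) : conv a (b + b') = conv a b + conv a b' := by
  ext m
  simp only [conv, Pi.add_apply, mul_add]
  exact (summable_conv ha hb m).tsum_add (summable_conv ha hb' m)

lemma conv_smul_left (c : ℝ) (a b : ℤ → ℝ) : conv (c • a) b = c • conv a b := by
  ext m
  simp only [conv, Pi.smul_apply, smul_eq_mul, mul_assoc, tsum_mul_left]

lemma conv_smul_right (c : ℝ) (a b : ℤ → ℝ) : conv a (c • b) = c • conv a b := by
  ext m
  simp only [conv, Pi.smul_apply, smul_eq_mul, mul_left_comm, tsum_mul_left]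

/-- Admissible sequences: odd, without low modes and with finite norm at the base regularity. -/
structure Adm (x : ℤ → ℝ) : Prop extends OddModes x where
  finite : sqNorm (powWeight 2) x ≠ ⊤

lemma OddModes.add {x y : ℤ → ℝ} (hx : OddModes x) (hy : OddModes y) : OddModes (x + y) where
  odd := fun k => by simp [hx.odd, hy.odd]; ring
  one := by simp [hx.one, hy.one]

lemma OddModes.smul {x : ℤ → ℝ} (c : ℝ) (hx : OddModes x) : OddModes (c • x) where
  odd := fun k => by simp [hx.odd]
  one := by simp [hx.one]

lemma OddModes.sub {x y : ℤ → ℝ} (hx : OddModes x) (hy : OddModes y) : OddModes (x - y) where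
  odd := fun k => by simp [hx.odd, hy.odd]; ring
  one := by simp [hx.one, hy.one]

lemma oddModes_zero : OddModes (0 : ℤ → ℝ) := ⟨by simp, by simp⟩

lemma sqNorm_smul' (w : ℕ → ℝ≥0) (c : ℝ) (x : ℤ → ℝ) : sqNorm w (c • x) = ‖c‖ₑ ^ 2 * sqNorm w x :=
  sqNorm_smul w c x

lemma Adm.add {x y : ℤ → ℝ} (hx : Adm x) (hy : Adm y) : Adm (x + y) where
  toOddModes := hx.toOddModes.add hy.toOddModes
  finite := ne_top_of_le_ne_top (ENNReal.mul_ne_top (by simp) (ENNReal.add_ne_top.2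
    ⟨hx.finite, hy.finite⟩)) (sqNorm_add_le _ x y)

lemma Adm.smul {x : ℤ → ℝ} (c : ℝ) (hx : Adm x) : Adm (c • x) where
  toOddModes := hx.toOddModes.smul c
  finite := by rw [sqNorm_smul']; exact ENNReal.mul_ne_top (by simp) hx.finite

lemma Adm.sub {x y : ℤ → ℝ} (hx : Adm x) (hy : Adm y) : Adm (x - y) where
  toOddModes := hx.toOddModes.sub hy.toOddModes
  finite := ne_top_of_le_ne_top (ENNReal.mul_ne_top (by simp) (ENNReal.add_ne_top.2
    ⟨hx.finite, hy.finite⟩)) (sqNorm_sub_le _ x y)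

lemma adm_zero : Adm (0 : ℤ → ℝ) := ⟨oddModes_zero, by rw [sqNorm_zero]; simp⟩

lemma summable_kernel {ker : ℤ → ℤ → ℝ} (h0 : ∀ i k, k < |i| → ker i k = 0)
    (h1 : ∀ i, |ker i (|i|)| ≤ 1) (h2 : ∀ i k, |i| < k → |ker i k| ≤ 9 * ((k : ℝ) + 1)⁻¹ ^ 2)
    {x : ℤ → ℝ} (hx : Adm x) (i : ℤ) : Summable fun k => ker i k * x k := by
  apply summable_of_tsum_enorm_ne_top
  refine ne_top_of_le_ne_top ?_ (enorm_kernel_sum_le h0 h1 h2 hx.toOddModes i)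
  have : tailSum x i ≠ ⊤ := ne_top_of_le_ne_top
    (ENNReal.mul_ne_top (by simp) (absSum_ne_top hx.finite))
    ((ENNReal.le_tsum i).trans (tsum_tailSum_le x))
  finiteness

lemma summable_primKer {x : ℤ → ℝ} (hx : Adm x) (i : ℤ) : Summable fun k => primKer i k * x k :=
  summable_kernel (fun _ _ => primKer_eq_zero) abs_primKer_self_le (fun _ _ => abs_primKer_le) hx i

lemma summable_velKer {x : ℤ → ℝ} (hx : Adm x) (i : ℤ) : Summable fun k => velKer i k * x k :=
  summable_kernel (fun _ _ => velKer_eq_zero) abs_velKer_self_le (fun _ _ => abs_velKer_le) hx i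

lemma primQuot_add {x y : ℤ → ℝ} (hx : Adm x) (hy : Adm y) :
    primQuot (x + y) = primQuot x + primQuot y := by
  ext i
  simp only [primQuot, Pi.add_apply, mul_add]
  exact (summable_primKer hx i).tsum_add (summable_primKer hy i)

lemma velQuot_add {x y : ℤ → ℝ} (hx : Adm x) (hy : Adm y) :
    velQuot (x + y) = velQuot x + velQuot y := by
  ext i
  simp only [velQuot, Pi.add_apply, mul_add]
  exact (summable_velKer hx i).tsum_add (summable_velKer hy i)

lemma primQuot_smul (c : ℝ) (x : ℤ → ℝ) : primQuot (c • x) = c • primQuot x := by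
  ext i; simp only [primQuot, Pi.smul_apply, smul_eq_mul, mul_left_comm, tsum_mul_left]

lemma velQuot_smul (c : ℝ) (x : ℤ → ℝ) : velQuot (c • x) = c • velQuot x := by
  ext i; simp only [velQuot, Pi.smul_apply, smul_eq_mul, mul_left_comm, tsum_mul_left]

lemma velSecond_add (x y : ℤ → ℝ) : velSecond (x + y) = velSecond x + velSecond y := by
  ext i; simp only [velSecond, Pi.add_apply]; ring

lemma velSecond_smul (c : ℝ) (x : ℤ → ℝ) : velSecond (c • x) = c • velSecond x := by
  ext i; simp only [velSecond, Pi.smul_apply, smul_eq_mul]; ring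

lemma velCoeff_add (x y : ℤ → ℝ) : velCoeff (x + y) = velCoeff x + velCoeff y := by
  ext i; simp only [velCoeff, velSecond_add, Pi.add_apply]; ring

lemma velCoeff_smul (c : ℝ) (x : ℤ → ℝ) : velCoeff (c • x) = c • velCoeff x := by
  ext i; simp only [velCoeff, velSecond_smul, Pi.smul_apply, smul_eq_mul]; ring

lemma cosMul_add (x y : ℤ → ℝ) : cosMul (x + y) = cosMul x + cosMul y := by
  ext i; simp only [cosMul, Pi.add_apply]; ring

lemma cosMul_smul (c : ℝ) (x : ℤ → ℝ) : cosMul (c • x) = c • cosMul x := by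
  ext i; simp only [cosMul, Pi.smul_apply, smul_eq_mul]; ring

lemma Adm.absSum_primQuot {x : ℤ → ℝ} (hx : Adm x) : absSum (primQuot x) ≠ ⊤ :=
  absSum_ne_top_of_tail hx.finite (enorm_primQuot_le hx.toOddModes)

lemma Adm.absSum_velQuot {x : ℤ → ℝ} (hx : Adm x) : absSum (velQuot x) ≠ ⊤ :=
  absSum_ne_top_of_tail hx.finite (enorm_velQuot_le hx.toOddModes)

lemma Adm.absSum_velSecond {x : ℤ → ℝ} (hx : Adm x) : absSum (velSecond x) ≠ ⊤ :=
  absSum_ne_top_of_neighbours hx.finite (enorm_velSecond_le x)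

lemma Adm.absSum_cosMul {x : ℤ → ℝ} (hx : Adm x) : absSum (cosMul x) ≠ ⊤ :=
  absSum_ne_top_of_neighbours hx.finite (enorm_cosMul_le x)

lemma Adm.absSum_velCoeff {x : ℤ → ℝ} (hx : Adm x) : absSum (velCoeff x) ≠ ⊤ :=
  absSum_ne_top_of_neighbours hx.finite (enorm_velCoeff_le x)

lemma bilin_add_left {x x' y : ℤ → ℝ} (hx : Adm x) (hx' : Adm x') (hy : Adm y) :
    bilin (x + x') y = bilin x y + bilin x' y := by
  have e : (fun l : ℤ => (l : ℝ) * (x + x') l) = (fun l : ℤ => (l : ℝ) * x l)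
      + fun l : ℤ => (l : ℝ) * x' l := by ext l; simp only [Pi.add_apply]; ring
  ext k
  rw [Pi.add_apply]
  simp only [bilin, bilinZero, bilinTransport]
  rw [e, primQuot_add hx hx', cosMul_add,
    conv_add_left hx.absSum_primQuot hx'.absSum_primQuot hy.absSum_velSecond,
    conv_add_right hy.absSum_velQuot hx.absSum_cosMul hx'.absSum_cosMul,
    conv_add_left (absSum_freq_ne_top hx.finite) (absSum_freq_ne_top hx'.finite) hy.absSum_velCoeff]
  simp only [Pi.add_apply]; ring

lemma bilin_add_right {x y y' : ℤ → ℝ} (hx : Adm x) (hy : Adm y) (hy' : Adm y') :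
    bilin x (y + y') = bilin x y + bilin x y' := by
  ext k
  simp only [bilin, bilinZero, bilinTransport, Pi.add_apply]
  rw [velSecond_add, velQuot_add hy hy', velCoeff_add,
    conv_add_right hx.absSum_primQuot hy.absSum_velSecond hy'.absSum_velSecond,
    conv_add_left hy.absSum_velQuot hy'.absSum_velQuot hx.absSum_cosMul,
    conv_add_right (absSum_freq_ne_top hx.finite) hy.absSum_velCoeff hy'.absSum_velCoeff]
  simp only [Pi.add_apply]; ring

lemma bilin_smul_left (c : ℝ) (x y : ℤ → ℝ) : bilin (c • x) y = c • bilin x y := by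
  have e : (fun l : ℤ => (l : ℝ) * (c • x) l) = c • fun l : ℤ => (l : ℝ) * x l := by
    ext l; simp only [Pi.smul_apply, smul_eq_mul]; ring
  ext k
  simp only [bilin, bilinZero, bilinTransport]
  rw [e, primQuot_smul, cosMul_smul, conv_smul_left, conv_smul_left, conv_smul_right]
  simp only [Pi.smul_apply, smul_eq_mul, bilin, bilinZero, bilinTransport]; ring

lemma bilin_smul_right (c : ℝ) (x y : ℤ → ℝ) : bilin x (c • y) = c • bilin x y := by
  ext k
  simp only [bilin, bilinZero, bilinTransport]
  rw [velQuot_smul, velSecond_smul, velCoeff_smul, conv_smul_left, conv_smul_right, conv_smul_right]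
  simp only [Pi.smul_apply, smul_eq_mul, bilin, bilinZero, bilinTransport]; ring

lemma bilin_sub_left {x x' y : ℤ → ℝ} (hx : Adm x) (hx' : Adm x') (hy : Adm y) :
    bilin (x - x') y = bilin x y - bilin x' y := by
  have := bilin_add_left (hx.sub hx') hx' hy
  rw [sub_add_cancel] at this
  rw [this]; simp

lemma bilin_sub_right {x y y' : ℤ → ℝ} (hx : Adm x) (hy : Adm y) (hy' : Adm y') :
    bilin x (y - y') = bilin x y - bilin x y' := by
  have := bilin_add_right hx (hy.sub hy') hy'
  rw [sub_add_cancel] at this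
  rw [this]; simp

lemma band_add (τ x y : ℤ → ℝ) : band τ (x + y) = band τ x + band τ y := by
  ext k; simp only [band, Pi.add_apply]; ring

lemma band_sub (τ x y : ℤ → ℝ) : band τ (x - y) = band τ x - band τ y := by
  ext k; simp only [band, Pi.sub_apply]; ring

lemma band_smul (τ : ℤ → ℝ) (c : ℝ) (x : ℤ → ℝ) : band τ (c • x) = c • band τ x := by
  ext k; simp only [band, Pi.smul_apply, smul_eq_mul]; ring

lemma rhs_sub {x y x' y' : ℤ → ℝ} (hx : Adm x) (hy : Adm y) (hx' : Adm x') (hy' : Adm y') :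
    rhs x y - rhs x' y' = band symS (x - x') + band symR (y - y') + bilin (x - x') y
      + bilin x' (y - y') := by
  rw [band_sub, band_sub, bilin_sub_left hx hx' hy, bilin_sub_right hx' hy hy']
  ext k; simp only [rhs, Pi.sub_apply, Pi.add_apply]; ring

lemma sqNorm_add_four_le (w : ℕ → ℝ≥0) (a b c d : ℤ → ℝ) :
    sqNorm w (a + b + c + d) ≤ 4 * (sqNorm w a + sqNorm w b + sqNorm w c + sqNorm w d) := by
  rw [show a + b + c + d = (a + b) + (c + d) by abel]
  calc _ ≤ 2 * (sqNorm w (a + b) + sqNorm w (c + d)) := sqNorm_add_le _ _ _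
    _ ≤ 2 * (2 * (sqNorm w a + sqNorm w b) + 2 * (sqNorm w c + sqNorm w d)) := by
      gcongr <;> exact sqNorm_add_le _ _ _
    _ = _ := by ring

/-- The linearisation of the right-hand side, `rhs` being affine in each argument. -/
def rhsLin (x y u v : ℤ → ℝ) : ℤ → ℝ := band symS u + band symR v + bilin u y + bilin x v

lemma rhs_sub' {x y x' y' : ℤ → ℝ} (hx : Adm x) (hy : Adm y) (hx' : Adm x') (hy' : Adm y') :
    rhs x y - rhs x' y' = rhsLin x' y (x - x') (y - y') := rhs_sub hx hy hx' hy'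

lemma le_sqNorm_powWeight {s t : ℕ} (h : s ≤ t) (x : ℤ → ℝ) :
    sqNorm (powWeight s) x ≤ sqNorm (powWeight t) x := sqNorm_mono (powWeight_mono h) x

/-- `rhsLin` loses one derivative. -/
lemma exists_sqNorm_rhsLin_le (s : ℕ) (hs : 1 ≤ s) : ∃ C : ℝ≥0, ∀ x y u v : ℤ → ℝ,
    OddModes x → OddModes y → OddModes u → OddModes v →
    sqNorm (powWeight s) (rhsLin x y u v) ≤
      C * (1 + sqNorm (powWeight (s + 1)) x + sqNorm (powWeight (s + 1)) y) *
        (sqNorm (powWeight (s + 1)) u + sqNorm (powWeight (s + 1)) v) := by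
  obtain ⟨C1, h1⟩ := exists_sqNorm_band_symS_le s
  obtain ⟨C2, h2⟩ := exists_sqNorm_band_symR_le s
  obtain ⟨C3, h3⟩ := exists_sqNorm_bilin_le s
  refine ⟨4 * (C1 + C2 + 4 * C3), fun x y u v hx hy hu hv => ?_⟩
  have hw := isWeight_powWeight s
  set X := sqNorm (powWeight (s + 1)) x
  set Y := sqNorm (powWeight (s + 1)) y
  set U := sqNorm (powWeight (s + 1)) u
  set V := sqNorm (powWeight (s + 1)) v
  have k1 : sqNorm (powWeight s) (band symS u) ≤ C1 * U := by
    have := h1 _ hw u; rwa [raise_powWeight] at this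
  have k2 : sqNorm (powWeight s) (band symR v) ≤ C2 * V :=
    (h2 _ hw v).trans (by gcongr; exact le_sqNorm_powWeight (by omega) v)
  have k3 : sqNorm (powWeight s) (bilin u y) ≤ C3 * (2 * (U * Y)) := by
    refine (h3 _ hw u y hu hy).trans ?_
    rw [raise_powWeight, two_mul]
    gcongr <;> exact le_sqNorm_powWeight (by omega) _
  have k4 : sqNorm (powWeight s) (bilin x v) ≤ C3 * (2 * (X * V)) := by
    refine (h3 _ hw x v hx hv).trans ?_
    rw [raise_powWeight, two_mul]
    gcongr <;> exact le_sqNorm_powWeight (by omega) _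
  have one_le : (1 : ℝ≥0∞) ≤ 1 + X + Y := by rw [add_assoc]; exact le_self_add
  have X_le : X ≤ 1 + X + Y := by rw [add_comm 1 X, add_assoc]; exact le_self_add
  have Y_le : Y ≤ 1 + X + Y := le_add_self
  have U_le : U ≤ U + V := le_self_add
  have V_le : V ≤ U + V := le_add_self
  calc _ ≤ 4 * (C1 * U + C2 * V + C3 * (2 * (U * Y)) + C3 * (2 * (X * V))) :=
        (sqNorm_add_four_le _ _ _ _ _).trans (by gcongr)
    _ ≤ 4 * (C1 * ((1 + X + Y) * (U + V)) + C2 * ((1 + X + Y) * (U + V))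
        + C3 * (2 * ((U + V) * (1 + X + Y))) + C3 * (2 * ((1 + X + Y) * (U + V)))) := by
        gcongr
        · calc U = 1 * U := (one_mul _).symm
            _ ≤ _ := by gcongr
        · calc V = 1 * V := (one_mul _).symm
            _ ≤ _ := by gcongr
    _ = 4 * (C1 + C2 + 4 * C3) * (1 + X + Y) * (U + V) := by ring
    _ = _ := by push_cast; ring

lemma ladder_neg (n i : ℤ) : ladder n (-i) = ladder n i := by
  unfold ladder
  have h : Even (n - 1 - -i) ↔ Even (n - 1 - i) := by
    rw [Int.even_sub (m := n - 1) (n := -i), Int.even_sub (m := n - 1) (n := i), even_neg]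
  simp only [abs_neg, h]

lemma primQuot_neg {x : ℤ → ℝ} (i : ℤ) : primQuot x (-i) = primQuot x i := by
  unfold primQuot
  refine tsum_congr fun k => ?_
  unfold primKer; rw [ladder_neg, ladder_neg]

lemma velQuot_neg {x : ℤ → ℝ} (i : ℤ) : velQuot x (-i) = velQuot x i := by
  unfold velQuot
  refine tsum_congr fun k => ?_
  unfold velKer; rw [ladder_neg, ladder_neg]

lemma cosMul_neg {x : ℤ → ℝ} (hx : OddModes x) (n : ℤ) : cosMul x (-n) = -cosMul x n := by
  unfold cosMul
  rw [show -n + 1 = -(n - 1) by ring, show -n - 1 = -(n + 1) by ring, hx.odd, hx.odd]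
  ring

lemma conv_neg_of_even_odd {a b : ℤ → ℝ} (ha : ∀ i, a (-i) = a i) (hb : ∀ i, b (-i) = -b i)
    (m : ℤ) : conv a b (-m) = -conv a b m := by
  unfold conv
  rw [← (Equiv.neg ℤ).tsum_eq, ← tsum_neg]
  refine tsum_congr fun i => ?_
  simp only [Equiv.neg_apply]
  rw [ha, show -m - -i = -(m - i) by ring, hb]; ring

lemma rhs_neg {x y : ℤ → ℝ} (hx : OddModes x) (hy : OddModes y) (k : ℤ) :
    rhs x y (-k) = -rhs x y k := by
  have h1 := conv_neg_of_even_odd (a := primQuot x) primQuot_neg (velSecond_neg hy) k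
  have h2 := conv_neg_of_even_odd (a := velQuot y) velQuot_neg (cosMul_neg hx) k
  have h3 := conv_neg_of_even_odd (a := fun l : ℤ => (l : ℝ) * x l)
    (fun i => by rw [hx.odd]; push_cast; ring) (velCoeff_neg hy) k
  have hS : ∀ n, symS (-n) = -symS n := fun n => by
    unfold symS; push_cast; rw [neg_sq, mul_neg, div_neg]
  have hR : ∀ n, symR (-n) = -symR n := fun n => by
    unfold symR; rw [Int.sign_neg]; push_cast; rw [neg_sq]; ring
  have hb : ∀ (τ z : ℤ → ℝ), (∀ n, τ (-n) = -τ n) → OddModes z → band τ z (-k) = -band τ z k := by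
    intro τ z hτ hz
    unfold band
    rw [show -k + 1 = -(k - 1) by ring, show -k - 1 = -(k + 1) by ring,
      show -k + 2 = -(k - 2) by ring, show -k - 2 = -(k + 2) by ring, hτ, hτ, hz.odd, hz.odd, hz.odd]
    ring
  unfold rhs bilin bilinZero bilinTransport
  rw [hb _ _ hS hx, hb _ _ hR hy, h1, h2, h3]; ring

/-! ### Energy inequalities -/

lemma hasDerivWithinAt_Ici_of_Icc {f : ℝ → ℝ} {f' T t : ℝ} (ht : t ∈ Ico 0 T)
    (h : HasDerivWithinAt f f' (Icc 0 T) t) : HasDerivWithinAt f f' (Ici t) t :=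
  h.mono_of_mem_nhdsWithin (Icc_mem_nhdsGE_of_mem ht)

/-- Grönwall's inequality with a constant inhomogeneity. -/
lemma gronwall_le {f f' : ℝ → ℝ} {K e T : ℝ} (hK : 0 ≤ K) (he : 0 ≤ e)
    (hf : ∀ t ∈ Icc 0 T, HasDerivWithinAt f (f' t) (Icc 0 T) t)
    (hb : ∀ t ∈ Icc 0 T, f' t ≤ K * f t + e) :
    ∀ t ∈ Icc 0 T, f t ≤ (f 0 + e * t) * Real.exp (K * t) := by
  intro t ht
  have hE : ∀ s, HasDerivAt (fun s => Real.exp (-(K * s))) (Real.exp (-(K * s)) * (-K)) s := by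
    intro s
    have := ((hasDerivAt_id s).const_mul K).neg.exp
    simpa using this
  have h1 : ∀ s ∈ Icc 0 T, HasDerivWithinAt (fun s => f s * Real.exp (-(K * s)))
      (f' s * Real.exp (-(K * s)) + f s * (Real.exp (-(K * s)) * (-K))) (Icc 0 T) s :=
    fun s hs => (hf s hs).mul (hE s).hasDerivWithinAt
  have h2 := image_le_of_deriv_right_le_deriv_boundary (a := 0) (b := T)
    (f := fun s => f s * Real.exp (-(K * s)))
    (B := fun s => f 0 + e * s) (B' := fun _ => e)
    (fun s hs => (h1 s hs).continuousWithinAt)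
    (fun s hs => hasDerivWithinAt_Ici_of_Icc hs (h1 s (Ico_subset_Icc_self hs)))
    (by simp) (by fun_prop)
    (fun s _ => by simpa using (((hasDerivAt_id s).const_mul e).const_add (f 0)).hasDerivWithinAt)
    (fun s hs => by
      have h3 := hb s (Ico_subset_Icc_self hs)
      have h4 : Real.exp (-(K * s)) ≤ 1 := Real.exp_le_one_iff.2 (by
        have := mul_nonneg hK hs.1; linarith)
      have h5 := Real.exp_pos (-(K * s))
      nlinarith) ht
  have h6 := Real.exp_pos (K * t)
  have h7 : Real.exp (-(K * t)) * Real.exp (K * t) = 1 := by rw [← Real.exp_add]; simp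
  calc f t = f t * Real.exp (-(K * t)) * Real.exp (K * t) := by rw [mul_assoc, h7, mul_one]
    _ ≤ _ := by gcongr

/-- Comparison of `f` with `z²`, where `z' = c z (1 + z)` and `z 0 = a`, that is, `z = u / (1 + a - u)`
with `u = a e^{ct}`. The assumption on `T` keeps the denominator above `1 / 2`. -/
lemma riccati_le {f f' : ℝ → ℝ} {c a T : ℝ} (hc : 0 < c) (ha : 0 < a)
    (hT : Real.exp (c * T) * a ≤ a + 1 / 2) (hf0 : f 0 ≤ a ^ 2)
    (hf : ∀ t ∈ Icc 0 T, HasDerivWithinAt f (f' t) (Icc 0 T) t)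
    (hb : ∀ t ∈ Icc 0 T, f' t ≤ c * Real.sqrt (1 + f t) * f t) :
    ∀ t ∈ Icc 0 T, f t ≤ (2 * a + 1) ^ 2 := by
  set u : ℝ → ℝ := fun t => Real.exp (c * t) * a with hu
  have hu' : ∀ t, HasDerivAt u (c * u t) t := fun t =>
    ((((hasDerivAt_id t).const_mul c).exp).mul_const a).congr_deriv (by simp [hu]; ring)
  have hupos : ∀ t, 0 < u t := fun t => by positivity
  have hule : ∀ t ∈ Icc 0 T, 1 / 2 ≤ 1 + a - u t := fun t ht => by
    have : u t ≤ u T := by simp only [hu]; gcongr; exact ht.2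
    have : u T ≤ a + 1 / 2 := hT
    linarith
  set z : ℝ → ℝ := fun t => u t / (1 + a - u t) with hz
  have hz' : ∀ t ∈ Icc 0 T, HasDerivAt z (c * z t * (1 + z t)) t := fun t ht => by
    have h1 := hule t ht
    have h2 : (1 + a - u t) ≠ 0 := by linarith
    refine ((hu' t).div ((hu' t).const_sub (1 + a)) h2).congr_deriv ?_
    simp only [hz]; field_simp; ring
  have hzpos : ∀ t ∈ Icc 0 T, 0 < z t := fun t ht => by
    have h1 := hule t ht
    exact div_pos (hupos t) (by linarith)
  have hz2 : ∀ t ∈ Icc 0 T, HasDerivAt (fun t => z t ^ 2) (2 * z t * (c * z t * (1 + z t))) t :=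
    fun t ht => by simpa using (hz' t ht).fun_pow 2
  have key := image_le_of_deriv_right_lt_deriv_boundary' (a := 0) (b := T) (f := f)
    (B := fun t => z t ^ 2) (B' := fun t => 2 * z t * (c * z t * (1 + z t)))
    (fun s hs => (hf s hs).continuousWithinAt)
    (fun s hs => hasDerivWithinAt_Ici_of_Icc hs (hf s (Ico_subset_Icc_self hs)))
    (by simpa [hz, hu] using hf0)
    (fun s hs => (hz2 s hs).continuousAt.continuousWithinAt)
    (fun s hs => (hz2 s (Ico_subset_Icc_self hs)).hasDerivWithinAt)
    (fun s hs hfs => by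
      have hs' := Ico_subset_Icc_self hs
      have h1 := hb s hs'
      have h2 := hzpos s hs'
      rw [hfs] at h1
      have h3 : Real.sqrt (1 + z s ^ 2) ≤ 1 + z s := Real.sqrt_le_iff.2 ⟨by linarith, by nlinarith⟩
      have h4 : c * Real.sqrt (1 + z s ^ 2) * z s ^ 2 ≤ c * (1 + z s) * z s ^ 2 := by gcongr
      have h5 : 0 < c * (1 + z s) * z s ^ 2 := by positivity
      nlinarith)
  intro t ht
  refine (key ht).trans ?_
  have h1 := hule t ht
  have h2 : z t ≤ 2 * a + 1 := by
    rw [hz]; simp only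
    rw [div_le_iff₀ (by linarith)]
    nlinarith
  have := hzpos t ht
  gcongr

/-- The restriction of a sequence to the frequencies `|k| ≤ L`. -/
def trunc (L : ℕ) (x : ℤ → ℝ) (k : ℤ) : ℝ := if k.natAbs ≤ L then x k else 0

lemma supportedIn_trunc (L : ℕ) (x : ℤ → ℝ) : SupportedIn L (trunc L x) := fun k hk => by
  unfold trunc; rw [if_neg (by omega)]

lemma OddModes.trunc {x : ℤ → ℝ} (hx : OddModes x) (L : ℕ) : OddModes (trunc L x) where
  odd := fun k => by
    unfold MHD1D.trunc; rw [Int.natAbs_neg, hx.odd]; split_ifs <;> simp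
  one := by unfold MHD1D.trunc; rw [hx.one]; simp

lemma sqNorm_trunc_le (w : ℕ → ℝ≥0) (L : ℕ) (x : ℤ → ℝ) : sqNorm w (trunc L x) ≤ sqNorm w x :=
  sqNorm_le_of_enorm_le fun k => by unfold trunc; split_ifs <;> simp

/-- High frequencies are small in weaker norms. -/
lemma sqNorm_sub_trunc_le (s : ℕ) (L : ℕ) (x : ℤ → ℝ) :
    ((L : ℝ≥0∞) + 1) ^ 2 * sqNorm (powWeight s) (x - trunc L x) ≤ sqNorm (powWeight (s + 1)) x := by
  unfold sqNorm
  rw [← ENNReal.tsum_mul_left]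
  refine ENNReal.tsum_le_tsum fun k => ?_
  simp only [Pi.sub_apply, trunc]
  split_ifs with h
  · simp
  · rw [sub_zero, ← mul_pow, ← mul_assoc]
    gcongr
    unfold powWeight
    rw [pow_succ, mul_comm]
    push_cast
    gcongr
    omega

lemma sqNorm_sub_trunc_le' {s L : ℕ} {K : ℝ≥0} {z z' : ℤ → ℝ} (hz : sqNorm (powWeight (s + 1)) z ≤ K)
    (hz' : sqNorm (powWeight (s + 1)) z' ≤ K) :
    sqNorm (powWeight s) ((z - z') - trunc L (z - z')) ≤
      ENNReal.ofReal (1 / ((L : ℝ) + 1) ^ 2 * (4 * K)) := by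
  have k1 := sqNorm_sub_trunc_le s L (z - z')
  have k2 : sqNorm (powWeight (s + 1)) (z - z') ≤ ENNReal.ofReal (4 * K) := by
    refine (sqNorm_sub_le _ z z').trans ?_
    calc _ ≤ 2 * ((K : ℝ≥0∞) + K) := by gcongr
      _ = ENNReal.ofReal (4 * K) := by
        rw [ENNReal.ofReal_mul (by norm_num), ENNReal.ofReal_coe_nnreal]
        rw [show ENNReal.ofReal 4 = 4 by norm_num]; ring
  have k3 : ((L : ℝ≥0∞) + 1) ^ 2 ≠ 0 := by positivity
  have k4 : ((L : ℝ≥0∞) + 1) ^ 2 ≠ ⊤ := by finiteness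
  have k5 : ENNReal.ofReal (1 / ((L : ℝ) + 1) ^ 2) = (((L : ℝ≥0∞) + 1) ^ 2)⁻¹ := by
    rw [one_div, ENNReal.ofReal_inv_of_pos (by positivity), ENNReal.ofReal_pow (by positivity),
      ENNReal.ofReal_add (by positivity) (by positivity)]
    simp
  rw [ENNReal.ofReal_mul (by positivity), k5, ← ENNReal.div_eq_inv_mul,
    ENNReal.le_div_iff_mul_le (Or.inl k3) (Or.inl k4), mul_comm]
  exact k1.trans k2

lemma pairing_self {L : ℕ} {x : ℤ → ℝ} (w : ℕ → ℝ≥0) (hx : SupportedIn L x) :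
    sqNorm w x = ENNReal.ofReal (pairing w x x) := by
  unfold pairing sqNorm
  rw [ENNReal.ofReal_tsum_of_nonneg (fun k => by rw [mul_assoc]; exact mul_nonneg (sq_nonneg _) (mul_self_nonneg _))
    (summable_of_supported (L := L) fun k hk => by rw [hx k hk]; ring)]
  refine tsum_congr fun k => ?_
  rw [← enorm_weight', ← enorm_mul, Real.enorm_eq_ofReal_abs, ← ENNReal.ofReal_pow (abs_nonneg _),
    sq_abs]
  congr 1
  ring_nf

lemma pairing_self_nonneg (w : ℕ → ℝ≥0) (x : ℤ → ℝ) : 0 ≤ pairing w x x :=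
  tsum_nonneg fun k => by rw [mul_assoc]; exact mul_nonneg (sq_nonneg _) (mul_self_nonneg _)

lemma hasDerivWithinAt_pairing {L : ℕ} (w : ℕ → ℝ≥0) {z : ℝ → ℤ → ℝ} {d : ℤ → ℝ} {s : Set ℝ} {t : ℝ}
    (hz : ∀ r, SupportedIn L (z r))
    (hd : ∀ k : ℤ, k.natAbs ≤ L → HasDerivWithinAt (fun r => z r k) (d k) s t ∨ ∀ r, z r k = 0) :
    HasDerivWithinAt (fun r => pairing w (z r) (z r)) (2 * pairing w (z t) d) s t := by
  unfold pairing
  have e1 : ∀ r, ∑' k : ℤ, (w k.natAbs : ℝ) ^ 2 * z r k * z r k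
      = ∑ k ∈ Finset.Icc (-(L : ℤ)) L, (w k.natAbs : ℝ) ^ 2 * z r k * z r k := fun r =>
    tsum_eq_sum_of_supported fun k hk => by rw [hz r k hk]; ring
  have e2 : ∑' k : ℤ, (w k.natAbs : ℝ) ^ 2 * z t k * d k
      = ∑ k ∈ Finset.Icc (-(L : ℤ)) L, (w k.natAbs : ℝ) ^ 2 * z t k * d k :=
    tsum_eq_sum_of_supported fun k hk => by rw [hz t k hk]; ring
  simp_rw [e1]
  rw [e2, Finset.mul_sum]
  refine HasDerivWithinAt.fun_sum fun k hk => ?_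
  rw [Finset.mem_Icc] at hk
  rcases hd k (by omega) with h | h
  · exact ((h.const_mul ((w k.natAbs : ℝ) ^ 2)).fun_mul h).congr_deriv (by ring)
  · simp only [h]; simpa using hasDerivWithinAt_const t s (0 : ℝ)

lemma abs_le_of_enorm_sq_le {p b : ℝ} (hb : 0 ≤ b) (h : ‖p‖ₑ ^ 2 ≤ ENNReal.ofReal (b ^ 2)) :
    |p| ≤ b := by
  rw [Real.enorm_eq_ofReal_abs, ENNReal.ofReal_pow hb] at h
  have := (ENNReal.pow_le_pow_left_iff (by norm_num)).1 h
  exact (ENNReal.ofReal_le_ofReal_iff hb).1 this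

/-- The energy estimate for truncations of the equation. -/
lemma exists_abs_pairing_rhs_le (R : ℕ) : ∃ C : ℝ, 0 < C ∧ ∀ w, IsWeight R w → ∀ (L : ℕ) (x y : ℤ → ℝ),
    SupportedIn L x → SupportedIn L y → OddModes x → OddModes y →
    |pairing w x (rhs x y) + pairing w y (rhs y x)| ≤
      C * Real.sqrt (1 + (pairing (powWeight 2) x x + pairing (powWeight 2) y y)) *
        (pairing w x x + pairing w y y) := by
  obtain ⟨C1, h1⟩ := exists_pairing_main_le R
  obtain ⟨C2, h2⟩ := exists_sqNorm_band_symR_le R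
  have main : ∀ w, IsWeight R w → ∀ (L : ℕ) (x y : ℤ → ℝ),
      SupportedIn L x → SupportedIn L y → OddModes x → OddModes y → |pairing w x (rhs x y)| ≤
      (C1 + C2 + 2) * Real.sqrt (1 + (pairing (powWeight 2) x x + pairing (powWeight 2) y y)) *
        (pairing w x x + pairing w y y) := by
    intro w hw L x y hsx hsy hx hy
    have e : rhs x y = (band symS x + bilin x y) + band symR y := by
      ext k; simp only [rhs, Pi.add_apply]; ring
    rw [e, pairing_add w hsx]
    set X := pairing w x x
    set Y := pairing w y y
    set X2 := pairing (powWeight 2) x x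
    set Y2 := pairing (powWeight 2) y y
    have hX : 0 ≤ X := pairing_self_nonneg _ _
    have hY : 0 ≤ Y := pairing_self_nonneg _ _
    have hX2 : 0 ≤ X2 := pairing_self_nonneg _ _
    have hY2 : 0 ≤ Y2 := pairing_self_nonneg _ _
    set S := Real.sqrt (1 + (X2 + Y2)) with hS
    have hS2 : S ^ 2 = 1 + (X2 + Y2) := Real.sq_sqrt (by positivity)
    have hS1 : 1 ≤ S := Real.one_le_sqrt.2 (by linarith)
    have hC1 : (0 : ℝ) ≤ C1 := C1.2
    have hC2 : (0 : ℝ) ≤ C2 := C2.2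
    have k1 : |pairing w x (band symS x + bilin x y)| ≤ (C1 + 1) * S * (X + Y) := by
      refine abs_le_of_enorm_sq_le (by positivity) ((h1 w hw L x y hsx hx hy).trans ?_)
      rw [pairing_self w hsx, pairing_self w hsy, pairing_self _ hsx, pairing_self _ hsy,
        ← ENNReal.ofReal_coe_nnreal, ← ENNReal.ofReal_one, ← ENNReal.ofReal_add (by positivity) hY2,
        ← ENNReal.ofReal_mul hC1, ← ENNReal.ofReal_mul (by positivity), ← ENNReal.ofReal_mul hX2,
        ← ENNReal.ofReal_add (by positivity) (by positivity), ← ENNReal.ofReal_mul (by positivity)]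
      apply ENNReal.ofReal_le_ofReal
      rw [mul_pow, mul_pow, hS2]
      have a1 : (1 + Y2) * X + X2 * Y ≤ (1 + (X2 + Y2)) * (X + Y) := by nlinarith [mul_nonneg hX2 hX, mul_nonneg hY2 hY]
      calc C1 * X * ((1 + Y2) * X + X2 * Y) ≤ C1 * (X + Y) * ((1 + (X2 + Y2)) * (X + Y)) := by
            gcongr; linarith
        _ ≤ (C1 + 1) ^ 2 * (X + Y) * ((1 + (X2 + Y2)) * (X + Y)) := by gcongr; nlinarith
        _ = _ := by ring
    have k3 : |pairing w x (band symR y)| ≤ (C2 + 1) * (X + Y) := by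
      refine abs_le_of_enorm_sq_le (by positivity) ((pairing_sq_le w _ _).trans ?_)
      refine (mul_le_mul_right (h2 w hw y) _).trans ?_
      rw [pairing_self w hsx, pairing_self w hsy, ← ENNReal.ofReal_coe_nnreal,
        ← ENNReal.ofReal_mul hC2, ← ENNReal.ofReal_mul hX]
      apply ENNReal.ofReal_le_ofReal
      have : X * Y ≤ (X + Y) ^ 2 := by nlinarith
      calc X * (C2 * Y) = C2 * (X * Y) := by ring
        _ ≤ (C2 + 1) ^ 2 * (X + Y) ^ 2 := by gcongr; nlinarith
        _ = _ := by ring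
    calc _ ≤ (C1 + 1) * S * (X + Y) + (C2 + 1) * (X + Y) := (abs_add_le _ _).trans (add_le_add k1 k3)
      _ ≤ (C1 + 1) * S * (X + Y) + (C2 + 1) * S * (X + Y) := by gcongr; nlinarith
      _ = (C1 + C2 + 2) * S * (X + Y) := by ring
  refine ⟨2 * (C1 + C2 + 2), by positivity, fun w hw L x y hsx hsy hx hy => ?_⟩
  have k1 := main w hw L x y hsx hsy hx hy
  have k2 := main w hw L y x hsy hsx hy hx
  rw [add_comm (pairing _ y y) (pairing _ x x), add_comm (pairing _ y y) (pairing _ x x)] at k2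
  refine (abs_add_le _ _).trans ((add_le_add k1 k2).trans (le_of_eq ?_))
  ring

/-- The difference of two solutions of truncated equations satisfies an energy inequality in the
base norm; the frequencies above the truncation enter as an error. -/
lemma exists_abs_pairing_rhs_sub_le (K : ℝ≥0) : ∃ C : ℝ, 0 < C ∧ ∀ (L : ℕ) (x y x' y' : ℤ → ℝ),
    OddModes x → OddModes y → OddModes x' → OddModes y' →
    sqNorm (powWeight 4) x ≤ K → sqNorm (powWeight 4) y ≤ K →
    sqNorm (powWeight 4) x' ≤ K → sqNorm (powWeight 4) y' ≤ K →
    |pairing (powWeight 2) (trunc L (x - x')) (rhs x y - rhs x' y')| ≤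
      C * (pairing (powWeight 2) (trunc L (x - x')) (trunc L (x - x')) +
        pairing (powWeight 2) (trunc L (y - y')) (trunc L (y - y')) + 1 / ((L : ℝ) + 1) ^ 2) := by
  obtain ⟨C1, h1⟩ := exists_pairing_main_le 2
  obtain ⟨C2, h2⟩ := exists_sqNorm_band_symS_le 2
  obtain ⟨C3, h3⟩ := exists_sqNorm_band_symR_le 2
  obtain ⟨C4, h4⟩ := exists_sqNorm_bilin_le 2
  set B : ℝ≥0 := 4 * (C2 + 2 * C3 + 2 * C4 * K + 4 * C4 * K) * (4 * K + 1) with hB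
  have hC1 : (0 : ℝ) ≤ C1 := C1.2
  have hK : (0 : ℝ) ≤ K := K.2
  have hBp : (0 : ℝ) ≤ B := B.2
  refine ⟨(C1 + 1) * (1 + 2 * K) + (B + 1), by positivity,
    fun L x y x' y' hx hy hx' hy' kx ky kx' ky' => ?_⟩
  have low : ∀ z : ℤ → ℝ, sqNorm (powWeight 4) z ≤ K → sqNorm (powWeight 3) z ≤ K ∧
      sqNorm (powWeight 2) z ≤ K := fun z hz =>
    ⟨(le_sqNorm_powWeight (by omega) z).trans hz, (le_sqNorm_powWeight (by omega) z).trans hz⟩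
  have adm : ∀ z : ℤ → ℝ, OddModes z → sqNorm (powWeight 4) z ≤ K → Adm z := fun z h hz =>
    ⟨h, ne_top_of_le_ne_top (by simp) (low z hz).2⟩
  set d := trunc L (x - x') with hd
  set e := trunc L (y - y') with he
  set r := (x - x') - d with hr
  set q := (y - y') - e with hq
  have hw := isWeight_powWeight 2
  have sd : SupportedIn L d := supportedIn_trunc _ _
  have se : SupportedIn L e := supportedIn_trunc _ _
  have od : OddModes d := (hx.sub hx').trunc L
  have oe : OddModes e := (hy.sub hy').trunc L
  have or' : OddModes r := (hx.sub hx').sub od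
  have hxx := (adm x hx kx).sub (adm x' hx' kx')
  have hyy := (adm y hy ky).sub (adm y' hy' ky')
  have ad : Adm d := ⟨od, ne_top_of_le_ne_top hxx.finite (sqNorm_trunc_le _ _ _)⟩
  have ar : Adm r := hxx.sub ad
  -- The parts `r` and `q` above the truncation are small in weaker norms.
  set ε : ℝ := 1 / ((L : ℝ) + 1) ^ 2 with hε
  have hεp : 0 ≤ ε := by positivity
  have Nr : sqNorm (powWeight 3) r ≤ ENNReal.ofReal (ε * (4 * K)) :=
    sqNorm_sub_trunc_le' kx kx'
  have Nq : sqNorm (powWeight 2) q ≤ ENNReal.ofReal (ε * (4 * K)) :=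
    (le_sqNorm_powWeight (by omega) q).trans (sqNorm_sub_trunc_le' ky ky')
  set D := pairing (powWeight 2) d d with hD
  set E := pairing (powWeight 2) e e with hE
  have hDp : 0 ≤ D := pairing_self_nonneg _ _
  have hEp : 0 ≤ E := pairing_self_nonneg _ _
  have ND : sqNorm (powWeight 2) d = ENNReal.ofReal D := pairing_self _ sd
  have NE : sqNorm (powWeight 2) e = ENNReal.ofReal E := pairing_self _ se
  -- `M` bounds the difference in the second argument and the high frequencies of the first.
  set M : ℝ := E + ε * (4 * K) with hM
  have hMp : 0 ≤ M := by positivity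
  have Nr' : sqNorm (powWeight 3) r ≤ ENNReal.ofReal M :=
    Nr.trans (ENNReal.ofReal_le_ofReal (by linarith))
  have Nyy : sqNorm (powWeight 2) (y - y') ≤ 2 * ENNReal.ofReal M := by
    have : y - y' = e + q := by rw [hq]; abel
    rw [this, hM, ENNReal.ofReal_add hEp (by positivity)]
    refine (sqNorm_add_le _ _ _).trans ?_
    rw [NE]; gcongr
  set Z := band symS r + band symR (y - y') + bilin r y + bilin x' (y - y') with hZ
  have split : rhs x y - rhs x' y' = (band symS d + bilin d y) + Z := by
    rw [rhs_sub (adm x hx kx) (adm y hy ky) (adm x' hx' kx') (adm y' hy' ky'), hZ,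
      show x - x' = d + r by rw [hr]; abel, band_add, bilin_add_left ad ar (adm y hy ky)]
    abel
  have NZ : sqNorm (powWeight 2) Z ≤ ENNReal.ofReal (B * (E + ε)) := by
    have z1 : sqNorm (powWeight 2) (band symS r) ≤ C2 * ENNReal.ofReal M := by
      have := h2 _ hw r
      rw [raise_powWeight] at this
      exact this.trans (by gcongr)
    have z2 : sqNorm (powWeight 2) (band symR (y - y')) ≤ C3 * (2 * ENNReal.ofReal M) :=
      (h3 _ hw _).trans (by gcongr)
    have z3 : sqNorm (powWeight 2) (bilin r y) ≤ C4 * (ENNReal.ofReal M * K + ENNReal.ofReal M * K) := by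
      have := h4 _ hw r y or' hy
      rw [raise_powWeight] at this
      refine this.trans ?_
      gcongr
      · exact (low y ky).2
      · exact (le_sqNorm_powWeight (by omega) r).trans Nr'
      · exact (low y ky).2
    have z4 : sqNorm (powWeight 2) (bilin x' (y - y')) ≤
        C4 * (K * (2 * ENNReal.ofReal M) + K * (2 * ENNReal.ofReal M)) := by
      have := h4 _ hw x' (y - y') hx' (hy.sub hy')
      rw [raise_powWeight] at this
      refine this.trans ?_
      gcongr
      · exact (low x' kx').1
      · exact (low x' kx').2
    have z5 : M ≤ (4 * K + 1) * (E + ε) := by rw [hM]; nlinarith [mul_nonneg hK hEp]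
    calc _ ≤ 4 * (C2 * ENNReal.ofReal M + C3 * (2 * ENNReal.ofReal M)
          + C4 * (ENNReal.ofReal M * K + ENNReal.ofReal M * K)
          + C4 * (K * (2 * ENNReal.ofReal M) + K * (2 * ENNReal.ofReal M))) :=
          (sqNorm_add_four_le _ _ _ _ _).trans (by gcongr)
      _ = (4 * (C2 + 2 * C3 + 2 * C4 * K + 4 * C4 * K) : ℝ≥0) * ENNReal.ofReal M := by
          push_cast; ring
      _ ≤ (4 * (C2 + 2 * C3 + 2 * C4 * K + 4 * C4 * K) : ℝ≥0) *
          ENNReal.ofReal ((4 * K + 1) * (E + ε)) := by gcongr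
      _ = ENNReal.ofReal (B * (E + ε)) := by
          rw [← ENNReal.ofReal_coe_nnreal, ← ENNReal.ofReal_mul (NNReal.coe_nonneg _)]
          congr 1; rw [hB]; push_cast; ring
  rw [split, pairing_add _ sd]
  have p1 : |pairing (powWeight 2) d (band symS d + bilin d y)| ≤ (C1 + 1) * (1 + 2 * K) * D := by
    refine abs_le_of_enorm_sq_le (by positivity) ((h1 _ hw L d y sd od hy).trans ?_)
    rw [ND]
    calc _ ≤ (C1 : ℝ≥0∞) * ENNReal.ofReal D * ((1 + K) * ENNReal.ofReal D + ENNReal.ofReal D * K) := by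
          gcongr <;> exact (low y ky).2
      _ = ENNReal.ofReal (C1 * D * ((1 + K) * D + D * K)) := by
          rw [← ENNReal.ofReal_coe_nnreal, ← ENNReal.ofReal_coe_nnreal, ← ENNReal.ofReal_one,
            ← ENNReal.ofReal_add zero_le_one hK, ← ENNReal.ofReal_mul hC1,
            ← ENNReal.ofReal_mul (by positivity), ← ENNReal.ofReal_mul hDp,
            ← ENNReal.ofReal_add (by positivity) (by positivity), ← ENNReal.ofReal_mul (by positivity)]
      _ ≤ _ := by
          apply ENNReal.ofReal_le_ofReal
          calc C1 * D * ((1 + K) * D + D * K) = C1 * (1 + 2 * K) * D ^ 2 := by ring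
            _ ≤ ((C1 + 1) ^ 2 * (1 + 2 * K) ^ 2) * D ^ 2 := by
              gcongr <;> nlinarith
            _ = _ := by ring
  have p2 : |pairing (powWeight 2) d Z| ≤ (B + 1) * (D + E + ε) := by
    refine abs_le_of_enorm_sq_le (by positivity) ((pairing_sq_le _ d Z).trans ?_)
    rw [ND]
    refine (mul_le_mul_right NZ _).trans ?_
    rw [← ENNReal.ofReal_mul hDp]
    apply ENNReal.ofReal_le_ofReal
    calc D * (B * (E + ε)) = B * (D * (E + ε)) := by ring
      _ ≤ (B + 1) ^ 2 * (D + E + ε) ^ 2 := by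
        gcongr <;> nlinarith
      _ = _ := by ring
  calc _ ≤ (C1 + 1) * (1 + 2 * K) * D + (B + 1) * (D + E + ε) := (abs_add_le _ _).trans (add_le_add p1 p2)
    _ ≤ (C1 + 1) * (1 + 2 * K) * (D + E + ε) + (B + 1) * (D + E + ε) := by gcongr; linarith
    _ = _ := by ring

/-! ### Galerkin approximations -/

lemma OddModes.eq_zero' {x : ℤ → ℝ} (h : OddModes x) {k : ℤ} (hk : k.natAbs < 2) : x k = 0 :=
  h.eq_zero (by rw [abs_lt]; omega)

/-- A bounded `C¹` vector field on a finite-dimensional space has solutions on any interval. -/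
lemma exists_solution_of_bounded {E : Type*} [NormedAddCommGroup E] [NormedSpace ℝ E]
    [FiniteDimensional ℝ E] {f : E → E} (hf : ContDiff ℝ 1 f) {M : ℝ≥0} (hM : ∀ x, ‖f x‖ ≤ M)
    {T : ℝ} (hT : 0 ≤ T) (x₀ : E) :
    ∃ α : ℝ → E, α 0 = x₀ ∧ ∀ t ∈ Icc 0 T, HasDerivWithinAt α (f (α t)) (Icc 0 T) t := by
  have : CompleteSpace E := FiniteDimensional.complete ℝ E
  have : ProperSpace E := FiniteDimensional.proper ℝ E
  set T' : ℝ≥0 := ⟨T, hT⟩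
  obtain ⟨K, hK⟩ := (hf.locallyLipschitz.locallyLipschitzOn).exists_lipschitzOnWith_of_compact
    (isCompact_closedBall x₀ ((M * T' : ℝ≥0) : ℝ))
  have hP : IsPicardLindelof (fun _ => f) (tmin := 0) (tmax := T) ⟨0, left_mem_Icc.2 hT⟩ x₀
      (M * T') 0 M K := by
    refine IsPicardLindelof.of_time_independent (fun x _ => hM x) hK ?_
    simp [hT]; rfl
  exact hP.exists_eq_forall_mem_Icc_hasDerivWithinAt₀

/-- The odd sequence with prescribed entries at the frequencies `2, …, N`. -/
def oddExt (N : ℕ) : (Finset.Icc 2 N → ℝ) →ₗ[ℝ] (ℤ → ℝ) where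
  toFun v k := if h : k.natAbs ∈ Finset.Icc 2 N then k.sign * v ⟨k.natAbs, h⟩ else 0
  map_add' v w := by
    ext k; simp only [Pi.add_apply]; split_ifs <;> ring
  map_smul' c v := by
    ext k; simp only [Pi.smul_apply, smul_eq_mul, RingHom.id_apply]; split_ifs <;> ring

lemma oddExt_apply {N : ℕ} (v : Finset.Icc 2 N → ℝ) (k : ℤ) :
    oddExt N v k = if h : k.natAbs ∈ Finset.Icc 2 N then k.sign * v ⟨k.natAbs, h⟩ else 0 := rfl

lemma supportedIn_oddExt {N : ℕ} (v : Finset.Icc 2 N → ℝ) : SupportedIn N (oddExt N v) := by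
  intro k hk
  rw [oddExt_apply, dif_neg]
  rw [Finset.mem_Icc]; omega

lemma oddModes_oddExt {N : ℕ} (v : Finset.Icc 2 N → ℝ) : OddModes (oddExt N v) where
  odd k := by
    simp only [oddExt_apply, Int.natAbs_neg, Int.sign_neg]
    split_ifs <;> push_cast <;> ring
  one := by rw [oddExt_apply, dif_neg]; simp

lemma adm_of_supported {N : ℕ} {x : ℤ → ℝ} (hx : OddModes x) (hs : SupportedIn N x) : Adm x :=
  ⟨hx, by rw [pairing_self _ hs]; simp⟩

lemma contDiff_oddExt {N : ℕ} (k : ℤ) : ContDiff ℝ 1 (fun v : Finset.Icc 2 N → ℝ => oddExt N v k) := by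
  simp only [oddExt_apply]
  split_ifs <;> fun_prop

lemma contDiff_rhs_oddExt {N : ℕ} (k : ℤ) :
    ContDiff ℝ 1 (fun p : (Finset.Icc 2 N → ℝ) × (Finset.Icc 2 N → ℝ) =>
      rhs (oddExt N p.1) (oddExt N p.2) k) := by
  have had : ∀ v, Adm (oddExt N v) := fun v =>
    adm_of_supported (oddModes_oddExt v) (supportedIn_oddExt v)
  set B : (Finset.Icc 2 N → ℝ) →ₗ[ℝ] (Finset.Icc 2 N → ℝ) →ₗ[ℝ] ℝ :=
    LinearMap.mk₂ ℝ (fun v w => bilin (oddExt N v) (oddExt N w) k)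
      (fun v v' w => by rw [map_add, bilin_add_left (had v) (had v') (had w)]; rfl)
      (fun c v w => by rw [map_smul, bilin_smul_left]; rfl)
      (fun v w w' => by rw [map_add, bilin_add_right (had v) (had w) (had w')]; rfl)
      (fun c v w => by rw [map_smul, bilin_smul_right]; rfl)
  have hB : ContDiff ℝ 1 (fun p : (Finset.Icc 2 N → ℝ) × (Finset.Icc 2 N → ℝ) =>
      bilin (oddExt N p.1) (oddExt N p.2) k) :=
    (B.toContinuousBilinearMap).isBoundedBilinearMap.contDiff
  have h1 : ∀ j, ContDiff ℝ 1 (fun p : (Finset.Icc 2 N → ℝ) × (Finset.Icc 2 N → ℝ) =>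
      oddExt N p.1 j) := fun j => (contDiff_oddExt j).comp contDiff_fst
  have h2 : ∀ j, ContDiff ℝ 1 (fun p : (Finset.Icc 2 N → ℝ) × (Finset.Icc 2 N → ℝ) =>
      oddExt N p.2 j) := fun j => (contDiff_oddExt j).comp contDiff_snd
  unfold rhs band
  exact ((((contDiff_const.mul ((h1 _).sub (h1 _))).add (contDiff_const.mul ((h1 _).sub (h1 _)))).add
    ((contDiff_const.mul ((h2 _).sub (h2 _))).add (contDiff_const.mul ((h2 _).sub (h2 _))))).add hB)

lemma one_le_powWeight (s k : ℕ) : 1 ≤ powWeight s k := by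
  unfold powWeight; exact one_le_pow₀ (by simp)

lemma sq_le_pairing_self {N : ℕ} {x : ℤ → ℝ} (hs : SupportedIn N x) (k : ℤ) (s : ℕ) :
    x k ^ 2 ≤ pairing (powWeight s) x x := by
  have h1 : (1 : ℝ) ≤ powWeight s k.natAbs := by exact_mod_cast one_le_powWeight s k.natAbs
  calc x k ^ 2 ≤ (powWeight s k.natAbs : ℝ) ^ 2 * x k * x k := by
        rw [mul_assoc, ← sq]; exact le_mul_of_one_le_left (sq_nonneg _) (one_le_pow₀ h1)
    _ ≤ _ := Summable.le_tsum (f := fun k : ℤ => (powWeight s k.natAbs : ℝ) ^ 2 * x k * x k)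
        (summable_of_supported (L := N) fun k hk => by rw [hs k hk]; ring) k
        (fun j _ => by rw [mul_assoc]; exact mul_nonneg (sq_nonneg _) (mul_self_nonneg _))

/-- The base energy of a pair, as a function of the free modes. -/
def modeEnergy (N : ℕ) (p : (Finset.Icc 2 N → ℝ) × (Finset.Icc 2 N → ℝ)) : ℝ :=
  pairing (powWeight 2) (oddExt N p.1) (oddExt N p.1) +
    pairing (powWeight 2) (oddExt N p.2) (oddExt N p.2)

lemma contDiff_modeEnergy (N : ℕ) : ContDiff ℝ 1 (modeEnergy N) := by
  have e : ∀ v, pairing (powWeight 2) (oddExt N v) (oddExt N v) = ∑ k ∈ Finset.Icc (-(N : ℤ)) N,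
      (powWeight 2 k.natAbs : ℝ) ^ 2 * oddExt N v k * oddExt N v k := fun v =>
    tsum_eq_sum_of_supported fun k hk => by rw [supportedIn_oddExt v k hk]; ring
  have h : ContDiff ℝ 1 fun v => pairing (powWeight 2) (oddExt N v) (oddExt N v) := by
    simp_rw [e]
    exact ContDiff.sum fun k _ => (contDiff_const.mul (contDiff_oddExt k)).mul (contDiff_oddExt k)
  exact (h.comp contDiff_fst).add (h.comp contDiff_snd)

lemma norm_le_sqrt_modeEnergy {N : ℕ} (p : (Finset.Icc 2 N → ℝ) × (Finset.Icc 2 N → ℝ)) :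
    ‖p‖ ≤ Real.sqrt (modeEnergy N p) := by
  have h : ∀ v : Finset.Icc 2 N → ℝ, ∀ b, pairing (powWeight 2) (oddExt N v) (oddExt N v) ≤ b →
      ‖v‖ ≤ Real.sqrt b := by
    intro v b hb
    rw [pi_norm_le_iff_of_nonneg (Real.sqrt_nonneg _)]
    intro i
    apply Real.le_sqrt_of_sq_le
    rw [Real.norm_eq_abs, sq_abs]
    refine le_trans ?_ hb
    have := sq_le_pairing_self (supportedIn_oddExt v) (i : ℕ) 2
    rw [oddExt_apply, dif_pos (by simp)] at this
    have h2 : (((i : ℕ) : ℤ).sign : ℝ) = 1 := by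
      rw [Int.sign_eq_one_of_pos]; · simp
      have := (Finset.mem_Icc.1 i.2).1; omega
    rw [h2, one_mul] at this
    exact this
  rw [Prod.norm_def]
  exact max_le (h _ _ (le_add_of_nonneg_right (pairing_self_nonneg _ _)))
    (h _ _ (le_add_of_nonneg_left (pairing_self_nonneg _ _)))

/-- The Galerkin equations have solutions on a time interval that does not depend on the number
of modes: the vector field is cut off at high energy, and the a priori estimate shows that the
cut-off is never reached. -/
lemma exists_galerkin : ∃ c : ℝ, 0 < c ∧ ∀ (a T : ℝ), 0 < a → 0 ≤ T →
    Real.exp (c * T) * a ≤ a + 1 / 2 → ∀ (N : ℕ) (u v : ℤ → ℝ), OddModes u → OddModes v →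
    sqNorm (powWeight 2) u + sqNorm (powWeight 2) v ≤ ENNReal.ofReal (a ^ 2) →
    ∃ x y : ℝ → ℤ → ℝ, x 0 = trunc N u ∧ y 0 = trunc N v ∧
      (∀ t, SupportedIn N (x t) ∧ OddModes (x t)) ∧ (∀ t, SupportedIn N (y t) ∧ OddModes (y t)) ∧
      (∀ t ∈ Icc 0 T, ∀ k : ℤ, 2 ≤ k.natAbs → k.natAbs ≤ N →
        HasDerivWithinAt (fun s => x s k) (rhs (x t) (y t) k) (Icc 0 T) t ∧
        HasDerivWithinAt (fun s => y s k) (rhs (y t) (x t) k) (Icc 0 T) t) ∧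
      ∀ t ∈ Icc 0 T, pairing (powWeight 2) (x t) (x t) + pairing (powWeight 2) (y t) (y t)
        ≤ (2 * a + 1) ^ 2 := by
  obtain ⟨C, hC, hE⟩ := exists_abs_pairing_rhs_le 2
  refine ⟨2 * C, by positivity, fun a T ha hT haT N u v hu hv huv => ?_⟩
  set V := Finset.Icc 2 N → ℝ
  set ρ : ℝ := (2 * a + 1) ^ 2 with hρ
  -- The cut-off is `1` where the energy is at most `ρ` and `0` where it exceeds `ρ + 1`.
  set φ : V × V → ℝ := fun p => Real.smoothTransition (ρ + 1 - modeEnergy N p) with hφ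
  have hφc : ContDiff ℝ 1 φ :=
    Real.smoothTransition.contDiff.comp (contDiff_const.sub (contDiff_modeEnergy N))
  set G : V × V → V × V := fun p => (fun i => rhs (oddExt N p.1) (oddExt N p.2) (i : ℕ),
    fun i => rhs (oddExt N p.2) (oddExt N p.1) (i : ℕ)) with hG
  have hGc : ContDiff ℝ 1 G := (contDiff_pi.2 fun i => contDiff_rhs_oddExt _).prodMk
    (contDiff_pi.2 fun i => (contDiff_rhs_oddExt (i : ℕ)).comp (contDiff_snd.prodMk contDiff_fst))
  set f : V × V → V × V := fun p => φ p • G p with hf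
  have hfc : ContDiff ℝ 1 f := hφc.smul hGc
  obtain ⟨M, hM⟩ : ∃ M : ℝ≥0, ∀ p, ‖f p‖ ≤ M := by
    obtain ⟨M, hM⟩ := (isCompact_closedBall (0 : V × V) (Real.sqrt (ρ + 1))).exists_bound_of_continuousOn
      hfc.continuous.continuousOn
    refine ⟨⟨max M 0, le_max_right _ _⟩, fun p => ?_⟩
    by_cases hp : p ∈ Metric.closedBall (0 : V × V) (Real.sqrt (ρ + 1))
    · exact (hM p hp).trans (le_max_left _ _)
    · have h1 : ρ + 1 - modeEnergy N p ≤ 0 := by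
        by_contra h2
        apply hp
        rw [mem_closedBall_zero_iff]
        exact (norm_le_sqrt_modeEnergy p).trans (Real.sqrt_le_sqrt (by linarith))
      have h3 : f p = 0 := by
        simp only [hf, hφ]; rw [Real.smoothTransition.zero_of_nonpos h1, zero_smul]
      rw [h3, norm_zero]; exact le_max_right _ _
  obtain ⟨α, hα0, hα⟩ := exists_solution_of_bounded hfc hM hT
    ((fun i => u (i : ℕ), fun i => v (i : ℕ)) : V × V)
  set x : ℝ → ℤ → ℝ := fun t => oddExt N (α t).1 with hx
  set y : ℝ → ℤ → ℝ := fun t => oddExt N (α t).2 with hy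
  have sx : ∀ t, SupportedIn N (x t) := fun t => supportedIn_oddExt _
  have sy : ∀ t, SupportedIn N (y t) := fun t => supportedIn_oddExt _
  have ox : ∀ t, OddModes (x t) := fun t => oddModes_oddExt _
  have oy : ∀ t, OddModes (y t) := fun t => oddModes_oddExt _
  have ini : ∀ z : ℤ → ℝ, OddModes z → oddExt N (fun i => z (i : ℕ)) = trunc N z := by
    intro z hz
    ext k
    rw [oddExt_apply, trunc]
    by_cases h1 : k.natAbs ≤ N
    · rw [if_pos h1]
      by_cases h2 : 2 ≤ k.natAbs
      · rw [dif_pos (Finset.mem_Icc.2 ⟨h2, h1⟩)]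
        rcases lt_or_gt_of_ne (show k ≠ 0 by rintro rfl; simp at h2) with hk | hk
        · rw [Int.sign_eq_neg_one_of_neg hk]
          simp only [Int.natCast_natAbs, abs_of_neg hk, hz.odd]; push_cast; ring
        · rw [Int.sign_eq_one_of_pos hk]
          simp only [Int.natCast_natAbs, abs_of_pos hk]; push_cast; ring
      · rw [dif_neg (by rw [Finset.mem_Icc]; omega), hz.eq_zero' (by omega)]
    · rw [if_neg h1, dif_neg (by rw [Finset.mem_Icc]; omega)]
  have hd : ∀ t ∈ Icc 0 T, ∀ k : ℤ, 2 ≤ k.natAbs → k.natAbs ≤ N →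
      HasDerivWithinAt (fun s => x s k) (φ (α t) * rhs (x t) (y t) k) (Icc 0 T) t ∧
      HasDerivWithinAt (fun s => y s k) (φ (α t) * rhs (y t) (x t) k) (Icc 0 T) t := by
    intro t ht k hk2 hkN
    have hmem : k.natAbs ∈ Finset.Icc 2 N := Finset.mem_Icc.2 ⟨hk2, hkN⟩
    have h1 := (hα t ht).fst
    have h2 := (hα t ht).snd
    have h3 := (hasDerivWithinAt_pi.1 h1) ⟨k.natAbs, hmem⟩
    have h4 := (hasDerivWithinAt_pi.1 h2) ⟨k.natAbs, hmem⟩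
    have sgn : ∀ z z' : ℤ → ℝ, OddModes z → OddModes z' →
        (k.sign : ℝ) * rhs z z' (k.natAbs : ℤ) = rhs z z' k := by
      intro z z' hz hz'
      rcases lt_or_gt_of_ne (show k ≠ 0 by rintro rfl; simp at hk2) with hk | hk
      · rw [Int.sign_eq_neg_one_of_neg hk, Int.natCast_natAbs, abs_of_neg hk, rhs_neg hz hz']
        push_cast; ring
      · rw [Int.sign_eq_one_of_pos hk, Int.natCast_natAbs, abs_of_pos hk]; push_cast; ring
    simp only [hx, hy, oddExt_apply, dif_pos hmem]
    constructor
    · refine (h3.const_mul (k.sign : ℝ)).congr_deriv ?_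
      rw [← sgn _ _ (ox t) (oy t)]
      exact mul_left_comm _ _ _
    · refine (h4.const_mul (k.sign : ℝ)).congr_deriv ?_
      rw [← sgn _ _ (oy t) (ox t)]
      exact mul_left_comm _ _ _
  -- The energy inequality holds whether or not the cut-off is active, as `0 ≤ φ ≤ 1`.
  have hEd : ∀ t ∈ Icc 0 T, HasDerivWithinAt (fun s => modeEnergy N (α s))
      (φ (α t) * (2 * (pairing (powWeight 2) (x t) (rhs (x t) (y t))
        + pairing (powWeight 2) (y t) (rhs (y t) (x t))))) (Icc 0 T) t := by
    intro t ht
    have hsm : ∀ z d : ℤ → ℝ, pairing (powWeight 2) z (fun k => φ (α t) * d k)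
        = φ (α t) * pairing (powWeight 2) z d := fun z d => by
      unfold pairing; rw [← tsum_mul_left]; exact tsum_congr fun k => by ring
    have k1 := hasDerivWithinAt_pairing (powWeight 2) (z := x) (s := Icc 0 T) (t := t)
      (d := fun k => φ (α t) * rhs (x t) (y t) k) sx (fun k hk => by
        rcases le_or_gt 2 k.natAbs with h | h
        · exact Or.inl (hd t ht k h hk).1
        · exact Or.inr fun r => (ox r).eq_zero' (by omega))
    have k2 := hasDerivWithinAt_pairing (powWeight 2) (z := y) (s := Icc 0 T) (t := t)
      (d := fun k => φ (α t) * rhs (y t) (x t) k) sy (fun k hk => by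
        rcases le_or_gt 2 k.natAbs with h | h
        · exact Or.inl (hd t ht k h hk).2
        · exact Or.inr fun r => (oy r).eq_zero' (by omega))
    refine (k1.add k2).congr_deriv ?_
    rw [hsm, hsm]; ring
  have hα0' : modeEnergy N (α 0) ≤ a ^ 2 := by
    rw [hα0]
    simp only [modeEnergy]
    rw [ini u hu, ini v hv]
    have h1 := pairing_self (powWeight 2) (supportedIn_trunc N u)
    have h2 := pairing_self (powWeight 2) (supportedIn_trunc N v)
    rw [← ENNReal.ofReal_le_ofReal_iff (by positivity), ENNReal.ofReal_add (pairing_self_nonneg _ _)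
      (pairing_self_nonneg _ _), ← h1, ← h2]
    exact (add_le_add (sqNorm_trunc_le _ _ _) (sqNorm_trunc_le _ _ _)).trans huv
  have hbound := riccati_le (c := 2 * C) (by positivity) ha haT hα0' hEd (fun t ht => by
    have h1 := hE _ (isWeight_powWeight 2) N (x t) (y t) (sx t) (sy t) (ox t) (oy t)
    have h2 : φ (α t) ≤ 1 := Real.smoothTransition.le_one _
    have h3 : 0 ≤ φ (α t) := Real.smoothTransition.nonneg _
    have h4 : 0 ≤ C * √(1 + modeEnergy N (α t)) * modeEnergy N (α t) := (abs_nonneg _).trans h1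
    calc _ ≤ φ (α t) * (2 * (C * √(1 + modeEnergy N (α t)) * modeEnergy N (α t))) := by
          gcongr; exact (le_abs_self _).trans h1
      _ ≤ 1 * (2 * (C * √(1 + modeEnergy N (α t)) * modeEnergy N (α t))) := by gcongr
      _ = _ := by ring)
  refine ⟨x, y, ?_, ?_, fun t => ⟨sx t, ox t⟩, fun t => ⟨sy t, oy t⟩, fun t ht k hk2 hkN => ?_, hbound⟩
  · simp only [hx, hα0]; exact ini u hu
  · simp only [hy, hα0]; exact ini v hv
  · have h1 : φ (α t) = 1 := Real.smoothTransition.one_of_one_le (by linarith [hbound t ht])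
    have := hd t ht k hk2 hkN
    rwa [h1, one_mul, one_mul] at this

/-! ### Existence for the coefficients -/

/-- Pairs of odd sequences solving the equations at the frequencies `2 ≤ |k| ≤ L`. The other entries are
unrestricted, so that both Galerkin approximations with at least `L` modes and full solutions qualify. -/
structure Solves (L : ℕ) (T : ℝ) (x y : ℝ → ℤ → ℝ) : Prop where
  modes_left : ∀ t, OddModes (x t)
  modes_right : ∀ t, OddModes (y t)
  deriv_left : ∀ t ∈ Icc 0 T, ∀ k : ℤ, 2 ≤ k.natAbs → k.natAbs ≤ L →
    HasDerivWithinAt (fun s => x s k) (rhs (x t) (y t) k) (Icc 0 T) t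
  deriv_right : ∀ t ∈ Icc 0 T, ∀ k : ℤ, 2 ≤ k.natAbs → k.natAbs ≤ L →
    HasDerivWithinAt (fun s => y s k) (rhs (y t) (x t) k) (Icc 0 T) t

lemma Solves.mono {L M : ℕ} {T : ℝ} {x y : ℝ → ℤ → ℝ} (h : Solves M T x y) (hLM : L ≤ M) :
    Solves L T x y where
  modes_left := h.modes_left
  modes_right := h.modes_right
  deriv_left t ht k h2 hL := h.deriv_left t ht k h2 (hL.trans hLM)
  deriv_right t ht k h2 hL := h.deriv_right t ht k h2 (hL.trans hLM)

lemma Solves.symm {L : ℕ} {T : ℝ} {x y : ℝ → ℤ → ℝ} (h : Solves L T x y) : Solves L T y x where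
  modes_left := h.modes_right
  modes_right := h.modes_left
  deriv_left := h.deriv_right
  deriv_right := h.deriv_left

/-- Persistence of regularity: every weighted norm grows at most exponentially, with a rate that
depends on the base norm only. -/
lemma exists_sqNorm_solves_le (R : ℕ) : ∃ C : ℝ, 0 < C ∧ ∀ w, IsWeight R w → ∀ (N : ℕ) (T b : ℝ)
    (x y : ℝ → ℤ → ℝ), Solves N T x y → (∀ t, SupportedIn N (x t)) → (∀ t, SupportedIn N (y t)) →
    (∀ t ∈ Icc 0 T, pairing (powWeight 2) (x t) (x t) + pairing (powWeight 2) (y t) (y t) ≤ b) →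
    ∀ t ∈ Icc 0 T, sqNorm w (x t) + sqNorm w (y t) ≤
      ENNReal.ofReal (Real.exp (C * Real.sqrt (1 + b) * t)) * (sqNorm w (x 0) + sqNorm w (y 0)) := by
  obtain ⟨C, hC, hE⟩ := exists_abs_pairing_rhs_le R
  refine ⟨2 * C, by positivity, fun w hw N T b x y h sx sy hb t ht => ?_⟩
  have hd : ∀ s ∈ Icc 0 T, HasDerivWithinAt (fun s => pairing w (x s) (x s) + pairing w (y s) (y s))
      (2 * pairing w (x s) (rhs (x s) (y s)) + 2 * pairing w (y s) (rhs (y s) (x s))) (Icc 0 T) s := by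
    intro s hs
    refine (hasDerivWithinAt_pairing w sx fun k hk => ?_).add
      (hasDerivWithinAt_pairing w sy fun k hk => ?_)
    · rcases le_or_gt 2 k.natAbs with h2 | h2
      · exact Or.inl (h.deriv_left s hs k h2 hk)
      · exact Or.inr fun r => (h.modes_left r).eq_zero' h2
    · rcases le_or_gt 2 k.natAbs with h2 | h2
      · exact Or.inl (h.deriv_right s hs k h2 hk)
      · exact Or.inr fun r => (h.modes_right r).eq_zero' h2
  have hp : ∀ z, 0 ≤ pairing w z z := fun z => pairing_self_nonneg w z
  have hg := gronwall_le (K := 2 * C * Real.sqrt (1 + b)) (e := 0) (by positivity) le_rfl hd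
    (fun s hs => by
      have h1 := (le_abs_self _).trans (hE w hw N _ _ (sx s) (sy s) (h.modes_left s) (h.modes_right s))
      have h2 : Real.sqrt (1 + (pairing (powWeight 2) (x s) (x s) + pairing (powWeight 2) (y s) (y s)))
          ≤ Real.sqrt (1 + b) := Real.sqrt_le_sqrt (by linarith [hb s hs])
      have h3 : C * Real.sqrt (1 + (pairing (powWeight 2) (x s) (x s) + pairing (powWeight 2) (y s) (y s)))
          * (pairing w (x s) (x s) + pairing w (y s) (y s)) ≤
          C * Real.sqrt (1 + b) * (pairing w (x s) (x s) + pairing w (y s) (y s)) := by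
        have := hp (x s); have := hp (y s)
        gcongr
      linarith) t ht
  rw [pairing_self w (sx t), pairing_self w (sy t), pairing_self w (sx 0), pairing_self w (sy 0),
    ← ENNReal.ofReal_add (hp _) (hp _), ← ENNReal.ofReal_add (hp _) (hp _),
    ← ENNReal.ofReal_mul (Real.exp_pos _).le]
  apply ENNReal.ofReal_le_ofReal
  rw [zero_mul, add_zero, mul_comm] at hg
  exact hg

/-- The base energy of the difference of two pairs, up to frequency `L`. -/
def diffEnergy (L : ℕ) (x y x' y' : ℤ → ℝ) : ℝ :=
  pairing (powWeight 2) (trunc L (x - x')) (trunc L (x - x')) +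
    pairing (powWeight 2) (trunc L (y - y')) (trunc L (y - y'))

lemma ofReal_diffEnergy (L : ℕ) (x y x' y' : ℤ → ℝ) :
    ENNReal.ofReal (diffEnergy L x y x' y') =
      sqNorm (powWeight 2) (trunc L (x - x')) + sqNorm (powWeight 2) (trunc L (y - y')) := by
  rw [diffEnergy, ENNReal.ofReal_add (pairing_self_nonneg _ _) (pairing_self_nonneg _ _),
    ← pairing_self _ (supportedIn_trunc _ _), ← pairing_self _ (supportedIn_trunc _ _)]

/-- Stability in the base norm. It gives the convergence of the Galerkin approximations as well as
the uniqueness of solutions. -/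
lemma exists_diffEnergy_le (K : ℝ≥0) : ∃ C : ℝ, 0 < C ∧ ∀ (L : ℕ) (T : ℝ) (x y x' y' : ℝ → ℤ → ℝ),
    Solves L T x y → Solves L T x' y' →
    (∀ t ∈ Icc 0 T, sqNorm (powWeight 4) (x t) ≤ K ∧ sqNorm (powWeight 4) (y t) ≤ K ∧
      sqNorm (powWeight 4) (x' t) ≤ K ∧ sqNorm (powWeight 4) (y' t) ≤ K) →
    ∀ t ∈ Icc 0 T, diffEnergy L (x t) (y t) (x' t) (y' t) ≤
      (diffEnergy L (x 0) (y 0) (x' 0) (y' 0) + C * (1 / ((L : ℝ) + 1) ^ 2) * t) *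
        Real.exp (C * t) := by
  obtain ⟨C, hC, hE⟩ := exists_abs_pairing_rhs_sub_le K
  refine ⟨4 * C, by positivity, fun L T x y x' y' h h' hK => ?_⟩
  refine gronwall_le (f := fun t => diffEnergy L (x t) (y t) (x' t) (y' t))
    (f' := fun t => 2 * pairing (powWeight 2) (trunc L (x t - x' t)) (rhs (x t) (y t) - rhs (x' t) (y' t))
      + 2 * pairing (powWeight 2) (trunc L (y t - y' t)) (rhs (y t) (x t) - rhs (y' t) (x' t)))
    (by positivity) (by positivity) (fun t ht => ?_) fun t ht => ?_
  · have aux : ∀ {x y x' y' : ℝ → ℤ → ℝ}, Solves L T x y → Solves L T x' y' → HasDerivWithinAt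
        (fun t => pairing (powWeight 2) (trunc L (x t - x' t)) (trunc L (x t - x' t)))
        (2 * pairing (powWeight 2) (trunc L (x t - x' t)) (rhs (x t) (y t) - rhs (x' t) (y' t)))
        (Icc 0 T) t := by
      intro x y x' y' h h'
      refine hasDerivWithinAt_pairing (z := fun t => trunc L (x t - x' t)) _
        (fun r => supportedIn_trunc _ _) fun k hk => ?_
      rcases le_or_gt 2 k.natAbs with h2 | h2
      · left
        simp only [trunc, if_pos hk, Pi.sub_apply]
        exact (h.deriv_left t ht k h2 hk).sub (h'.deriv_left t ht k h2 hk)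
      · exact Or.inr fun r => (((h.modes_left r).sub (h'.modes_left r)).trunc L).eq_zero' h2
    exact (aux h h').add (aux h.symm h'.symm)
  · obtain ⟨k1, k2, k3, k4⟩ := hK t ht
    have e1 := (le_abs_self _).trans (hE L (x t) (y t) (x' t) (y' t) (h.modes_left t) (h.modes_right t)
      (h'.modes_left t) (h'.modes_right t) k1 k2 k3 k4)
    have e2 := (le_abs_self _).trans (hE L (y t) (x t) (y' t) (x' t) (h.modes_right t) (h.modes_left t)
      (h'.modes_right t) (h'.modes_left t) k2 k1 k4 k3)
    simp only [diffEnergy]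
    linarith

/-- `ℓ²` norms are lower semicontinuous under convergence of the entries. -/
lemma sqNorm_le_of_tendsto {w : ℕ → ℝ≥0} {z : ℕ → ℤ → ℝ} {z' : ℤ → ℝ} {b : ℝ≥0∞}
    (hz : ∀ k, Tendsto (fun n => z n k) atTop (𝓝 (z' k))) (hb : ∀ᶠ n in atTop, sqNorm w (z n) ≤ b) :
    sqNorm w z' ≤ b := by
  unfold sqNorm
  rw [ENNReal.tsum_eq_iSup_sum]
  refine iSup_le fun s => ?_
  refine le_of_tendsto (f := fun n => ∑ k ∈ s, ((w k.natAbs : ℝ≥0∞) * ‖z n k‖ₑ) ^ 2) (x := atTop) ?_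
    (hb.mono fun n hn => (ENNReal.sum_le_tsum s).trans hn)
  refine tendsto_finsetSum _ fun k _ => ?_
  refine ((ENNReal.continuous_pow 2).tendsto _).comp ?_
  exact ENNReal.Tendsto.const_mul ((hz k).enorm) (Or.inr (by simp))

/-- Uniformly small tails and continuity of the entries give continuity in norm. -/
lemma tendsto_sqNorm_sub {w : ℕ → ℝ≥0} {x : ℝ → ℤ → ℝ} {s : Set ℝ} {t : ℝ} (hts : t ∈ s)
    (hc : ∀ k, ContinuousWithinAt (fun r => x r k) s t)
    (tail : ∀ ε : ℝ≥0, 0 < ε → ∃ L : ℕ, ∀ r ∈ s, sqNorm w (x r - trunc L (x r)) ≤ ε) :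
    Tendsto (fun r => sqNorm w (x r - x t)) (𝓝[s] t) (𝓝 0) := by
  rw [ENNReal.tendsto_nhds_zero]
  intro ε hε
  obtain ⟨δ, hδ0, hδ⟩ := ENNReal.lt_iff_exists_nnreal_btwn.1 hε
  have hδ0' : 0 < δ := by exact_mod_cast hδ0
  obtain ⟨L, hL⟩ := tail (δ / 10) (by positivity)
  have h1 : Tendsto (fun r => sqNorm w (trunc L (x r - x t))) (𝓝[s] t) (𝓝 0) := by
    have e : ∀ r, sqNorm w (trunc L (x r - x t)) = ENNReal.ofReal (∑ k ∈ Finset.Icc (-(L : ℤ)) L,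
        (w k.natAbs : ℝ) ^ 2 * trunc L (x r - x t) k * trunc L (x r - x t) k) := fun r => by
      rw [pairing_self w (supportedIn_trunc _ _), pairing]
      rw [tsum_eq_sum_of_supported (L := L) fun k hk => by rw [supportedIn_trunc L _ k hk]; ring]
    simp_rw [e]
    rw [← ENNReal.ofReal_zero]
    refine ENNReal.tendsto_ofReal ?_
    rw [← Finset.sum_const_zero (s := Finset.Icc (-(L : ℤ)) L)]
    refine tendsto_finsetSum _ fun k hk => ?_
    have h2 : Tendsto (fun r => trunc L (x r - x t) k) (𝓝[s] t) (𝓝 0) := by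
      rw [Finset.mem_Icc] at hk
      simp only [trunc, if_pos (show k.natAbs ≤ L by omega), Pi.sub_apply]
      simpa using (hc k).sub_const (x t k)
    simpa using (h2.const_mul ((w k.natAbs : ℝ) ^ 2)).mul h2
  filter_upwards [ENNReal.tendsto_nhds_zero.1 h1 ((δ / 10 : ℝ≥0) : ℝ≥0∞) (by
    have : 0 < δ / 10 := by positivity
    exact_mod_cast this), self_mem_nhdsWithin] with r hr hrs
  have e : x r - x t = trunc L (x r - x t) + ((x r - trunc L (x r)) - (x t - trunc L (x t))) := by
    ext k; simp only [Pi.add_apply, Pi.sub_apply, trunc]; split_ifs <;> ring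
  rw [e]
  calc _ ≤ 2 * (sqNorm w (trunc L (x r - x t)) + 2 * (sqNorm w (x r - trunc L (x r))
        + sqNorm w (x t - trunc L (x t)))) :=
        (sqNorm_add_le _ _ _).trans (by gcongr; exact sqNorm_sub_le _ _ _)
    _ ≤ 2 * (((δ / 10 : ℝ≥0) : ℝ≥0∞) + 2 * (((δ / 10 : ℝ≥0) : ℝ≥0∞) + ((δ / 10 : ℝ≥0) : ℝ≥0∞))) := by
        gcongr
        · exact hL r hrs
        · exact hL t hts
    _ = ((2 * (δ / 10 + 2 * (δ / 10 + δ / 10)) : ℝ≥0) : ℝ≥0∞) := by push_cast; ring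
    _ = (δ : ℝ≥0∞) := by congr 1; ring
    _ ≤ ε := hδ.le

/-- A weight which is small at low frequencies and equals the Sobolev weight from `L` on. As it satisfies
`IsWeight` uniformly in `L`, the propagation of weighted norms controls the tails of solutions. -/
def tailWeight (m L : ℕ) (k : ℕ) : ℝ≥0 := powWeight m k * min 1 (((k : ℝ≥0) + 1) / (L + 1))

lemma isWeight_tailWeight (m L : ℕ) : IsWeight (m + 1) (tailWeight m L) where
  mono := fun a b h => by
    unfold tailWeight
    exact mul_le_mul' ((isWeight_powWeight m).mono h) (by gcongr)
  growth := fun l k h => by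
    unfold tailWeight powWeight
    have key : min 1 (((k : ℝ≥0) + 1) / (L + 1)) * ((l : ℝ≥0) + 1) ≤
        min 1 (((l : ℝ≥0) + 1) / (L + 1)) * ((k : ℝ≥0) + 1) := by
      have hlk : (l : ℝ≥0) + 1 ≤ k + 1 := by gcongr
      rcases le_total 1 (((l : ℝ≥0) + 1) / (L + 1)) with h1 | h1
      · rw [min_eq_left h1]
        exact mul_le_mul' (min_le_left _ _) hlk
      · rw [min_eq_right h1]
        calc _ ≤ ((k : ℝ≥0) + 1) / (L + 1) * (l + 1) := by gcongr; exact min_le_right _ _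
          _ = _ := by rw [div_mul_eq_mul_div, div_mul_eq_mul_div, mul_comm]
    calc _ = ((k : ℝ≥0) + 1) ^ m * ((l : ℝ≥0) + 1) ^ m *
          (min 1 (((k : ℝ≥0) + 1) / (L + 1)) * ((l : ℝ≥0) + 1)) := by ring
      _ ≤ ((k : ℝ≥0) + 1) ^ m * ((l : ℝ≥0) + 1) ^ m *
          (min 1 (((l : ℝ≥0) + 1) / (L + 1)) * ((k : ℝ≥0) + 1)) := by gcongr
      _ = _ := by ring

lemma tendsto_sqNorm_tailWeight {m : ℕ} {u : ℤ → ℝ} (hu : sqNorm (powWeight m) u ≠ ⊤) :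
    Tendsto (fun L => sqNorm (tailWeight m L) u) atTop (𝓝 0) := by
  have h := tendsto_lintegral_of_dominated_convergence (μ := Measure.count) (f := fun _ => 0)
    (F := fun (L : ℕ) (k : ℤ) => ((tailWeight m L k.natAbs : ℝ≥0∞) * ‖u k‖ₑ) ^ 2)
    (fun k => ((powWeight m k.natAbs : ℝ≥0∞) * ‖u k‖ₑ) ^ 2)
    (fun _ => Measurable.of_discrete) (fun L => Eventually.of_forall fun k => by
      simp only
      gcongr
      unfold tailWeight
      exact mul_le_of_le_one_right' (min_le_left _ _))
    (by rw [lintegral_count]; exact hu)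
    (Eventually.of_forall fun k => by
      have h1 : Tendsto (fun L : ℕ => tailWeight m L k.natAbs) atTop (𝓝 0) := by
        have h2 : Tendsto (fun L : ℕ => (powWeight m k.natAbs : ℝ≥0) *
            (((k.natAbs : ℝ≥0) + 1) / (L + 1))) atTop (𝓝 0) := by
          have h3 : Tendsto (fun L : ℕ => ((k.natAbs : ℝ≥0) + 1) * (1 / ((L : ℝ≥0) + 1))) atTop (𝓝 0) := by
            simpa using tendsto_one_div_add_atTop_nhds_zero_nat.const_mul ((k.natAbs : ℝ≥0) + 1)
          simpa [div_eq_mul_inv] using h3.const_mul (powWeight m k.natAbs)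
        exact tendsto_of_tendsto_of_tendsto_of_le_of_le tendsto_const_nhds h2 (fun _ => zero_le)
          (fun L => by unfold tailWeight; gcongr; exact min_le_right _ _)
      have h4 : Tendsto (fun L : ℕ => (tailWeight m L k.natAbs : ℝ≥0∞) * ‖u k‖ₑ) atTop (𝓝 0) := by
        have h5 : Tendsto (fun L : ℕ => (tailWeight m L k.natAbs : ℝ≥0∞)) atTop (𝓝 ((0 : ℝ≥0) : ℝ≥0∞)) :=
          ENNReal.tendsto_coe.2 h1
        simpa using ENNReal.Tendsto.mul_const h5 (Or.inr (enorm_ne_top (x := u k)))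
      simpa [Function.comp_def] using ((ENNReal.continuous_pow 2).tendsto _).comp h4)
  simpa only [lintegral_count, tsum_zero, sqNorm] using h

lemma sqNorm_sub_trunc_le_tailWeight (m L : ℕ) (x : ℤ → ℝ) :
    sqNorm (powWeight m) (x - trunc L x) ≤ sqNorm (tailWeight m L) x := by
  unfold sqNorm
  refine ENNReal.tsum_le_tsum fun k => ?_
  simp only [Pi.sub_apply, trunc]
  split_ifs with h
  · simp
  · rw [sub_zero]
    have : tailWeight m L k.natAbs = powWeight m k.natAbs := by
      unfold tailWeight
      rw [min_eq_left, mul_one]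
      rw [le_div_iff₀ (by positivity), one_mul]
      have : (L : ℝ≥0) ≤ k.natAbs := by exact_mod_cast (by omega)
      gcongr
    rw [this]

/-- A limit of differentiable functions whose derivatives converge uniformly, on an interval. -/
lemma hasDerivWithinAt_of_uniform_limit {f g : ℕ → ℝ → ℝ} {F G : ℝ → ℝ} {s : Set ℝ} (hs : Convex ℝ s)
    (hf : ∀ᶠ n in atTop, ∀ t ∈ s, HasDerivWithinAt (f n) (g n t) s t)
    (hF : ∀ t ∈ s, Tendsto (fun n => f n t) atTop (𝓝 (F t))) (hG : TendstoUniformlyOn g G atTop s)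
    {t : ℝ} (ht : t ∈ s) (hGc : ContinuousWithinAt G s t) : HasDerivWithinAt F (G t) s t := by
  rw [hasDerivWithinAt_iff_isLittleO, Asymptotics.isLittleO_iff]
  intro c hc
  obtain ⟨δ, hδ, hball⟩ := Metric.continuousWithinAt_iff.1 hGc (c / 2) (by positivity)
  have hmem : s ∩ Metric.ball t δ ∈ 𝓝[s] t :=
    inter_mem self_mem_nhdsWithin (mem_nhdsWithin_of_mem_nhds (Metric.ball_mem_nhds t hδ))
  filter_upwards [hmem] with r hr
  have key : ∀ᶠ n in atTop, ‖f n r - f n t - (r - t) * G t‖ ≤ c * ‖r - t‖ := by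
    filter_upwards [hf, Metric.tendstoUniformlyOn_iff.1 hG (c / 2) (by positivity)] with n hn hu
    have h1 : ∀ q ∈ s ∩ Metric.ball t δ, HasDerivWithinAt (fun q => f n q - q * G t) (g n q - G t)
        (s ∩ Metric.ball t δ) q := fun q hq => by
      refine (((hn q hq.1).sub ((hasDerivWithinAt_id q s).mul_const (G t))).mono inter_subset_left).congr_deriv ?_
      ring
    have h2 := (hs.inter (convex_ball t δ)).norm_image_sub_le_of_norm_hasDerivWithin_le h1
      (C := c) (fun q hq => by
        have a1 := hu q hq.1
        have a2 := hball hq.1 hq.2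
        rw [Real.dist_eq] at a1 a2
        rw [Real.norm_eq_abs]
        have : g n q - G t = -(G q - g n q) + (G q - G t) := by ring
        rw [this]
        refine (abs_add_le _ _).trans ?_
        rw [abs_neg]; linarith) ⟨ht, Metric.mem_ball_self hδ⟩ hr
    have h3 : f n r - r * G t - (f n t - t * G t) = f n r - f n t - (r - t) * G t := by ring
    rwa [h3] at h2
  have hlim : Tendsto (fun n => ‖f n r - f n t - (r - t) * G t‖) atTop
      (𝓝 ‖F r - F t - (r - t) * G t‖) := (((hF r hr.1).sub (hF t ht)).sub_const _).norm
  simpa [smul_eq_mul] using le_of_tendsto hlim key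

/-- `x ∈ C([0, T]; h^m)`, with values in odd sequences. -/
structure ContIn (m : ℕ) (T : ℝ) (x : ℝ → ℤ → ℝ) : Prop where
  modes : ∀ t ∈ Icc 0 T, OddModes (x t)
  finite : ∀ t ∈ Icc 0 T, sqNorm (powWeight m) (x t) ≠ ⊤
  tendsto : ∀ t ∈ Icc 0 T,
    Tendsto (fun r => sqNorm (powWeight m) (x r - x t)) (𝓝[Icc 0 T] t) (𝓝 0)

lemma ContIn.adm {m : ℕ} {T : ℝ} {x : ℝ → ℤ → ℝ} (h : ContIn m T x) (hm : 2 ≤ m) {t : ℝ}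
    (ht : t ∈ Icc 0 T) : Adm (x t) :=
  ⟨h.modes t ht, ne_top_of_le_ne_top (h.finite t ht) (le_sqNorm_powWeight hm _)⟩

lemma ContIn.of_le {m l : ℕ} {T : ℝ} {x : ℝ → ℤ → ℝ} (h : ContIn m T x) (hlm : l ≤ m) : ContIn l T x where
  modes := h.modes
  finite t ht := ne_top_of_le_ne_top (h.finite t ht) (le_sqNorm_powWeight hlm _)
  tendsto t ht := tendsto_of_tendsto_of_tendsto_of_le_of_le tendsto_const_nhds (h.tendsto t ht)
    (fun _ => zero_le) fun _ => le_sqNorm_powWeight hlm _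

lemma tendsto_zero_of_le_const_mul {α : Type*} {l : Filter α} {f g : α → ℝ≥0∞} {A : ℝ≥0∞} (hA : A ≠ ⊤)
    (hg : Tendsto g l (𝓝 0)) (h : ∀ᶠ a in l, f a ≤ A * g a) : Tendsto f l (𝓝 0) := by
  have : Tendsto (fun a => A * g a) l (𝓝 0) := by
    simpa using ENNReal.Tendsto.const_mul hg (Or.inr hA)
  exact tendsto_of_tendsto_of_tendsto_of_le_of_le' tendsto_const_nhds this
    (Eventually.of_forall fun _ => zero_le) h

lemma sqNorm_le_of_sub {w : ℕ → ℝ≥0} (x y : ℤ → ℝ) :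
    sqNorm w x ≤ 2 * (sqNorm w (x - y) + sqNorm w y) := by
  simpa using sqNorm_add_le w (x - y) y

lemma ContIn.eventually_le {m : ℕ} {T : ℝ} {x : ℝ → ℤ → ℝ} (h : ContIn m T x) {t : ℝ}
    (ht : t ∈ Icc 0 T) :
    ∀ᶠ r in 𝓝[Icc 0 T] t, sqNorm (powWeight m) (x r) ≤ 2 * (1 + sqNorm (powWeight m) (x t)) := by
  filter_upwards [ENNReal.tendsto_nhds_zero.1 (h.tendsto t ht) 1 one_pos] with r hr
  exact (sqNorm_le_of_sub (x r) (x t)).trans (by gcongr)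

lemma ContIn.tendsto_rhs {s : ℕ} (hs : 1 ≤ s) {T : ℝ} {x y : ℝ → ℤ → ℝ} (hx : ContIn (s + 1) T x)
    (hy : ContIn (s + 1) T y) {t : ℝ} (ht : t ∈ Icc 0 T) :
    Tendsto (fun r => sqNorm (powWeight s) (rhs (x r) (y r) - rhs (x t) (y t))) (𝓝[Icc 0 T] t) (𝓝 0) := by
  obtain ⟨C, hC⟩ := exists_sqNorm_rhsLin_le s hs
  have hX := hx.finite t ht
  have hY := hy.finite t ht
  have h0 : Tendsto (fun r => sqNorm (powWeight (s + 1)) (x r - x t)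
      + sqNorm (powWeight (s + 1)) (y r - y t)) (𝓝[Icc 0 T] t) (𝓝 0) := by
    simpa using (hx.tendsto t ht).add (hy.tendsto t ht)
  refine tendsto_zero_of_le_const_mul (A := C * (1 + sqNorm (powWeight (s + 1)) (x t)
      + 2 * (1 + sqNorm (powWeight (s + 1)) (y t)))) (by finiteness) h0 ?_
  filter_upwards [hy.eventually_le ht, self_mem_nhdsWithin] with r hr hrs
  rw [rhs_sub' (hx.adm (by omega) hrs) (hy.adm (by omega) hrs) (hx.adm (by omega) ht)
    (hy.adm (by omega) ht)]
  refine (hC _ _ _ _ (hx.modes _ ht) (hy.modes _ hrs) ((hx.modes _ hrs).sub (hx.modes _ ht))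
    ((hy.modes _ hrs).sub (hy.modes _ ht))).trans ?_
  gcongr

lemma enorm_sq_le_sqNorm (s : ℕ) (x : ℤ → ℝ) (k : ℤ) : ‖x k‖ₑ ^ 2 ≤ sqNorm (powWeight s) x := by
  refine le_trans ?_ (le_sqNorm (powWeight s) x k)
  gcongr
  exact le_mul_of_one_le_left zero_le (by exact_mod_cast one_le_powWeight s k.natAbs)

lemma continuousWithinAt_of_tendsto_sqNorm {s : ℕ} {f : ℝ → ℤ → ℝ} {S : Set ℝ} {t : ℝ}
    (h : Tendsto (fun r => sqNorm (powWeight s) (f r - f t)) (𝓝[S] t) (𝓝 0)) (k : ℤ) :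
    ContinuousWithinAt (fun r => f r k) S t := by
  rw [ContinuousWithinAt, tendsto_iff_edist_tendsto_0]
  have h1 : Tendsto (fun r => (edist (f r k) (f t k)) ^ 2) (𝓝[S] t) (𝓝 0) := by
    refine tendsto_of_tendsto_of_tendsto_of_le_of_le tendsto_const_nhds h (fun _ => zero_le) fun r => ?_
    simp only
    rw [edist_eq_enorm_sub]
    exact enorm_sq_le_sqNorm s (f r - f t) k
  have h2 := ((ENNReal.continuous_rpow_const (y := (1 / 2 : ℝ))).tendsto 0).comp h1
  simpa [Function.comp_def, ← ENNReal.rpow_natCast_mul] using h2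

/-- Solutions of the full equations for the coefficients, in `C([0, T]; h^m)`. -/
structure IsSeqSolution (m : ℕ) (T : ℝ) (u v : ℤ → ℝ) (x y : ℝ → ℤ → ℝ) : Prop where
  init_left : x 0 = u
  init_right : y 0 = v
  cont_left : ContIn m T x
  cont_right : ContIn m T y
  solves : ∀ L, Solves L T x y

lemma abs_le_of_sqNorm_le {s : ℕ} {x : ℤ → ℝ} {b : ℝ} (hb : 0 ≤ b)
    (h : sqNorm (powWeight s) x ≤ ENNReal.ofReal b) (k : ℤ) : |x k| ≤ Real.sqrt b :=
  abs_le_of_enorm_sq_le (Real.sqrt_nonneg _) (by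
    rw [Real.sq_sqrt hb]; exact (enorm_sq_le_sqNorm s x k).trans h)

/-- Existence for the coefficients, on a time interval determined by the size of the initial
values in the base norm, at any regularity of the initial values, and with exponential growth at
most in the base norm. -/
def SeqSolvable (c C : ℝ) : Prop := ∀ (a T : ℝ), 0 < a → 0 ≤ T →
    Real.exp (c * T) * a ≤ a + 1 / 2 → ∀ (m : ℕ) (u v : ℤ → ℝ), 4 ≤ m → OddModes u → OddModes v →
    sqNorm (powWeight 2) u + sqNorm (powWeight 2) v ≤ ENNReal.ofReal (a ^ 2) →
    sqNorm (powWeight m) u ≠ ⊤ → sqNorm (powWeight m) v ≠ ⊤ →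
    ∃ x y : ℝ → ℤ → ℝ, IsSeqSolution m T u v x y ∧ ∀ t ∈ Icc 0 T, sqNorm (powWeight 2) (x t) ≤
      ENNReal.ofReal (Real.exp (C * Real.sqrt (1 + (2 * a + 1) ^ 2) * t)) *
        (sqNorm (powWeight 2) u + sqNorm (powWeight 2) v)

/-- The limit of Galerkin approximations. -/
theorem exists_seqSolvable : ∃ c C : ℝ, 0 < c ∧ 0 < C ∧ SeqSolvable c C := by
  obtain ⟨c, hc, hgal⟩ := exists_galerkin
  obtain ⟨C₂, hC₂, hbase⟩ := exists_sqNorm_solves_le 2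
  refine ⟨c, C₂, hc, hC₂, fun a T ha hT haT m u v hm hu hv huv hum hvm => ?_⟩
  choose x y x0 y0 hx hy hd hb using fun N => hgal a T ha hT haT N u v hu hv huv
  have sol : ∀ N, Solves N T (x N) (y N) := fun N =>
    ⟨fun t => (hx N t).2, fun t => (hy N t).2, fun t ht k h2 hk => (hd N t ht k h2 hk).1,
      fun t ht k h2 hk => (hd N t ht k h2 hk).2⟩
  have h00 : (0 : ℝ) ∈ Icc 0 T := left_mem_Icc.2 hT
  -- The bound depends on the growth exponent of the weight only, not on the weight.
  have bound : ∀ R, ∃ B : ℝ≥0, ∀ w, IsWeight R w → ∀ N, ∀ t ∈ Icc 0 T,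
      sqNorm w (x N t) + sqNorm w (y N t) ≤ B * (sqNorm w u + sqNorm w v) := by
    intro R
    obtain ⟨C, hC0, hC⟩ := exists_sqNorm_solves_le R
    refine ⟨(Real.exp (C * Real.sqrt (1 + (2 * a + 1) ^ 2) * T)).toNNReal, fun w hw N t ht => ?_⟩
    refine (hC w hw N T _ (x N) (y N) (sol N) (fun t => (hx N t).1) (fun t => (hy N t).1)
      (hb N) t ht).trans ?_
    rw [x0, y0]
    refine mul_le_mul' (ENNReal.ofReal_le_ofReal ?_)
      (add_le_add (sqNorm_trunc_le _ _ _) (sqNorm_trunc_le _ _ _))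
    gcongr
    exact ht.2
  obtain ⟨K, hK⟩ : ∃ K : ℝ≥0, ∀ N, ∀ t ∈ Icc 0 T,
      sqNorm (powWeight 4) (x N t) ≤ K ∧ sqNorm (powWeight 4) (y N t) ≤ K := by
    obtain ⟨B, hB⟩ := bound 4
    have fin : (B : ℝ≥0∞) * (sqNorm (powWeight 4) u + sqNorm (powWeight 4) v) ≠ ⊤ :=
      ENNReal.mul_ne_top (by simp) (ENNReal.add_ne_top.2
        ⟨ne_top_of_le_ne_top hum (le_sqNorm_powWeight hm u),
          ne_top_of_le_ne_top hvm (le_sqNorm_powWeight hm v)⟩)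
    refine ⟨((B : ℝ≥0∞) * (sqNorm (powWeight 4) u + sqNorm (powWeight 4) v)).toNNReal,
      fun N t ht => ?_⟩
    have := hB _ (isWeight_powWeight 4) N t ht
    rw [ENNReal.coe_toNNReal fin]
    exact ⟨le_self_add.trans this, le_add_self.trans this⟩
  obtain ⟨C, hC, hdiff⟩ := exists_diffEnergy_le K
  -- The approximations form a Cauchy sequence in the base norm, uniformly in time.
  set B : ℝ := 2 * (C * T * Real.exp (C * T) + 4 * K) with hBdef
  have hB0 : 0 ≤ B := by have := K.2; positivity
  have cauchy : ∀ N M : ℕ, N ≤ M → ∀ t ∈ Icc 0 T,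
      sqNorm (powWeight 2) (x N t - x M t) ≤ ENNReal.ofReal (B * (1 / ((N : ℝ) + 1) ^ 2)) ∧
      sqNorm (powWeight 2) (y N t - y M t) ≤ ENNReal.ofReal (B * (1 / ((N : ℝ) + 1) ^ 2)) := by
    intro N M hNM t ht
    set ε : ℝ := 1 / ((N : ℝ) + 1) ^ 2 with hε
    have hεp : 0 ≤ ε := by positivity
    have k1 := hdiff N T (x N) (y N) (x M) (y M) (sol N) ((sol M).mono hNM)
      (fun s hs => ⟨(hK N s hs).1, (hK N s hs).2, (hK M s hs).1, (hK M s hs).2⟩) t ht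
    have k0 : diffEnergy N (x N 0) (y N 0) (x M 0) (y M 0) = 0 := by
      have : ∀ z : ℤ → ℝ, trunc N (trunc N z - trunc M z) = 0 := fun z => by
        ext k; simp only [trunc, Pi.sub_apply, Pi.zero_apply]
        split_ifs with h1 h2
        · ring
        · omega
        · rfl
      rw [x0, x0, y0, y0, diffEnergy, this, this]; simp [pairing]
    rw [k0, zero_add, ← hε] at k1
    have k2 : diffEnergy N (x N t) (y N t) (x M t) (y M t) ≤ C * T * Real.exp (C * T) * ε := by
      refine k1.trans ?_
      calc _ ≤ C * ε * T * Real.exp (C * T) := by gcongr <;> exact ht.2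
        _ = _ := by ring
    have k3 := ENNReal.ofReal_le_ofReal k2
    rw [ofReal_diffEnergy] at k3
    have tail : ∀ z z' : ℤ → ℝ, sqNorm (powWeight 4) z ≤ K → sqNorm (powWeight 4) z' ≤ K →
        sqNorm (powWeight 2) ((z - z') - trunc N (z - z')) ≤ ENNReal.ofReal (ε * (4 * K)) :=
      fun z z' hz hz' => (le_sqNorm_powWeight (by norm_num : 2 ≤ 3) _).trans (sqNorm_sub_trunc_le' hz hz')
    have fin : ∀ z z' : ℤ → ℝ, sqNorm (powWeight 4) z ≤ K → sqNorm (powWeight 4) z' ≤ K →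
        sqNorm (powWeight 2) (trunc N (z - z')) ≤ ENNReal.ofReal (C * T * Real.exp (C * T) * ε) →
        sqNorm (powWeight 2) (z - z') ≤ ENNReal.ofReal (B * ε) := by
      intro z z' hz hz' hh
      have e : z - z' = trunc N (z - z') + ((z - z') - trunc N (z - z')) := by abel
      rw [e]
      refine (sqNorm_add_le _ _ _).trans ?_
      calc _ ≤ 2 * (ENNReal.ofReal (C * T * Real.exp (C * T) * ε) + ENNReal.ofReal (ε * (4 * K))) := by
            gcongr; exact tail z z' hz hz'
        _ = ENNReal.ofReal (B * ε) := by
            have := K.2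
            rw [← ENNReal.ofReal_add (by positivity) (by positivity),
              show (2 : ℝ≥0∞) = ENNReal.ofReal 2 by simp, ← ENNReal.ofReal_mul (by norm_num), hBdef]
            congr 1; ring
    exact ⟨fin _ _ (hK N t ht).1 (hK M t ht).1 (le_self_add.trans k3),
      fin _ _ (hK N t ht).2 (hK M t ht).2 (le_add_self.trans k3)⟩
  have lim0 : Tendsto (fun N : ℕ => B * (1 / ((N : ℝ) + 1) ^ 2)) atTop (𝓝 0) := by
    have := (tendsto_one_div_add_atTop_nhds_zero_nat (𝕜 := ℝ)).pow 2
    simpa using this.const_mul B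
  have exlim : ∀ z : ℕ → ℝ → ℤ → ℝ, (∀ N M : ℕ, N ≤ M → ∀ t ∈ Icc 0 T,
      sqNorm (powWeight 2) (z N t - z M t) ≤ ENNReal.ofReal (B * (1 / ((N : ℝ) + 1) ^ 2))) →
      (∀ N t, OddModes (z N t)) →
      ∃ Z : ℝ → ℤ → ℝ, (∀ t, OddModes (Z t)) ∧
        (∀ t ∈ Icc 0 T, ∀ k, Tendsto (fun N => z N t k) atTop (𝓝 (Z t k))) ∧
        ∀ N, ∀ t ∈ Icc 0 T, sqNorm (powWeight 2) (z N t - Z t) ≤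
          ENNReal.ofReal (B * (1 / ((N : ℝ) + 1) ^ 2)) := by
    intro z hz hzm
    have h1 : ∀ t k, ∃ l, t ∈ Icc 0 T → Tendsto (fun N => z N t k) atTop (𝓝 l) := by
      intro t k
      by_cases ht : t ∈ Icc 0 T
      · have : CauchySeq fun N => z N t k := by
          refine cauchySeq_of_le_tendsto_0' (fun N : ℕ => Real.sqrt (B * (1 / ((N : ℝ) + 1) ^ 2))) ?_ ?_
          · intro N M hNM
            rw [Real.dist_eq]
            exact abs_le_of_sqNorm_le (by positivity) (hz N M hNM t ht) k
          · have h5 := (Real.continuous_sqrt.tendsto 0).comp lim0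
            rw [Real.sqrt_zero] at h5
            exact h5
        obtain ⟨l, hl⟩ := cauchySeq_tendsto_of_complete this
        exact ⟨l, fun _ => hl⟩
      · exact ⟨0, fun h => absurd h ht⟩
    choose Z hZ using h1
    refine ⟨fun t k => if t ∈ Icc 0 T then Z t k else 0, fun t => ?_, fun t ht k => ?_, fun N t ht => ?_⟩
    · by_cases ht : t ∈ Icc 0 T
      · simp only [if_pos ht]
        refine ⟨fun k => ?_, ?_⟩
        · refine tendsto_nhds_unique (hZ t (-k) ht) ?_
          simp_rw [(hzm _ t).odd]
          exact (hZ t k ht).neg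
        · refine tendsto_nhds_unique (hZ t 1 ht) ?_
          simp_rw [(hzm _ t).one]
          exact tendsto_const_nhds
      · simp only [if_neg ht]; exact oddModes_zero
    · simp only [if_pos ht]; exact hZ t k ht
    · simp only [if_pos ht]
      exact sqNorm_le_of_tendsto (z := fun M => z N t - z M t) (fun k => (hZ t k ht).const_sub (z N t k))
        ((eventually_ge_atTop N).mono fun M hM => hz N M hM t ht)
  obtain ⟨X, hXm, hXl, hXN⟩ := exlim x (fun N M h t ht => (cauchy N M h t ht).1) fun N t => (hx N t).2
  obtain ⟨Y, hYm, hYl, hYN⟩ := exlim y (fun N M h t ht => (cauchy N M h t ht).2) fun N t => (hy N t).2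
  have limw : ∀ R, ∃ B : ℝ≥0, ∀ w, IsWeight R w → ∀ t ∈ Icc 0 T,
      sqNorm w (X t) ≤ B * (sqNorm w u + sqNorm w v) ∧ sqNorm w (Y t) ≤ B * (sqNorm w u + sqNorm w v) := by
    intro R
    obtain ⟨B, hB⟩ := bound R
    exact ⟨B, fun w hw t ht =>
      ⟨sqNorm_le_of_tendsto (hXl t ht) (Eventually.of_forall fun N => le_self_add.trans (hB w hw N t ht)),
        sqNorm_le_of_tendsto (hYl t ht) (Eventually.of_forall fun N => le_add_self.trans (hB w hw N t ht))⟩⟩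
  have tailX : ∀ ε : ℝ≥0, 0 < ε → ∃ L : ℕ, ∀ t ∈ Icc 0 T,
      sqNorm (powWeight m) (X t - trunc L (X t)) ≤ ε ∧ sqNorm (powWeight m) (Y t - trunc L (Y t)) ≤ ε := by
    intro ε hε
    obtain ⟨B', hB'⟩ := limw (m + 1)
    have h1 : Tendsto (fun L => (B' : ℝ≥0∞) * (sqNorm (tailWeight m L) u + sqNorm (tailWeight m L) v))
        atTop (𝓝 0) := by
      have := (tendsto_sqNorm_tailWeight hum).add (tendsto_sqNorm_tailWeight hvm)
      simpa using ENNReal.Tendsto.const_mul this (Or.inr (ENNReal.coe_ne_top (r := B')))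
    obtain ⟨L, hL⟩ := (ENNReal.tendsto_nhds_zero.1 h1 ε (by exact_mod_cast hε)).exists
    refine ⟨L, fun t ht => ⟨?_, ?_⟩⟩
    · exact (sqNorm_sub_trunc_le_tailWeight _ _ _).trans
        ((hB' _ (isWeight_tailWeight m L) t ht).1.trans hL)
    · exact (sqNorm_sub_trunc_le_tailWeight _ _ _).trans
        ((hB' _ (isWeight_tailWeight m L) t ht).2.trans hL)
  have fin : ∀ t ∈ Icc 0 T, sqNorm (powWeight m) (X t) ≠ ⊤ ∧ sqNorm (powWeight m) (Y t) ≠ ⊤ := by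
    obtain ⟨B', hB'⟩ := limw m
    intro t ht
    have := hB' _ (isWeight_powWeight m) t ht
    have h : (B' : ℝ≥0∞) * (sqNorm (powWeight m) u + sqNorm (powWeight m) v) ≠ ⊤ := by finiteness
    exact ⟨ne_top_of_le_ne_top h this.1, ne_top_of_le_ne_top h this.2⟩
  -- The entries of the limit are continuous; with uniformly small tails it is continuous in norm.
  have coord : ∀ (z : ℕ → ℝ → ℤ → ℝ) (Z : ℝ → ℤ → ℝ), (∀ N t, OddModes (z N t)) → (∀ t, OddModes (Z t)) →
      (∀ N, ∀ t ∈ Icc 0 T, ∀ k : ℤ, 2 ≤ k.natAbs → k.natAbs ≤ N →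
        ContinuousWithinAt (fun s => z N s k) (Icc 0 T) t) →
      (∀ N, ∀ t ∈ Icc 0 T, sqNorm (powWeight 2) (z N t - Z t) ≤
          ENNReal.ofReal (B * (1 / ((N : ℝ) + 1) ^ 2))) →
      ∀ t ∈ Icc 0 T, ∀ k, ContinuousWithinAt (fun s => Z s k) (Icc 0 T) t := by
    intro z Z hz hZ hc hzZ t ht k
    rcases le_or_gt 2 k.natAbs with h2 | h2
    · have hu : TendstoUniformlyOn (fun N t => z N t k) (fun t => Z t k) atTop (Icc 0 T) := by
        rw [Metric.tendstoUniformlyOn_iff]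
        intro ε hε
        have h3 : Tendsto (fun N : ℕ => Real.sqrt (B * (1 / ((N : ℝ) + 1) ^ 2))) atTop (𝓝 0) := by
          have h5 := (Real.continuous_sqrt.tendsto 0).comp lim0
          rw [Real.sqrt_zero] at h5
          exact h5
        filter_upwards [h3.eventually_lt_const hε] with N hN s hs
        rw [dist_comm, Real.dist_eq]
        exact (abs_le_of_sqNorm_le (by positivity) (hzZ N s hs) k).trans_lt hN
      refine hu.continuousOn (Eventually.frequently ?_) t ht
      filter_upwards [eventually_ge_atTop k.natAbs] with N hN s hs
      exact hc N s hs k h2 hN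
    · simp_rw [fun s => (hZ s).eq_zero' h2]
      exact continuousWithinAt_const
  have contX : ContIn m T X := ⟨fun t _ => hXm t, fun t ht => (fin t ht).1, fun t ht =>
    tendsto_sqNorm_sub ht (coord x X (fun N t => (hx N t).2) hXm
      (fun N t ht k h2 hk => (hd N t ht k h2 hk).1.continuousWithinAt) hXN t ht)
      fun ε hε => (tailX ε hε).imp fun L hL t ht => (hL t ht).1⟩
  have contY : ContIn m T Y := ⟨fun t _ => hYm t, fun t ht => (fin t ht).2, fun t ht =>
    tendsto_sqNorm_sub ht (coord y Y (fun N t => (hy N t).2) hYm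
      (fun N t ht k h2 hk => (hd N t ht k h2 hk).2.continuousWithinAt) hYN t ht)
      fun ε hε => (tailX ε hε).imp fun L hL t ht => (hL t ht).2⟩
  -- The derivatives of the entries converge uniformly, so the limit solves the equations.
  have KX : ∀ t ∈ Icc 0 T, sqNorm (powWeight 2) (X t) ≤ K ∧ sqNorm (powWeight 2) (Y t) ≤ K :=
    fun t ht => ⟨sqNorm_le_of_tendsto (hXl t ht) (Eventually.of_forall fun N =>
        (le_sqNorm_powWeight (by norm_num) _).trans (hK N t ht).1),
      sqNorm_le_of_tendsto (hYl t ht) (Eventually.of_forall fun N =>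
        (le_sqNorm_powWeight (by norm_num) _).trans (hK N t ht).2)⟩
  have Kx : ∀ N, ∀ t ∈ Icc 0 T, sqNorm (powWeight 2) (x N t) ≤ K ∧ sqNorm (powWeight 2) (y N t) ≤ K :=
    fun N t ht => ⟨(le_sqNorm_powWeight (by norm_num) _).trans (hK N t ht).1,
      (le_sqNorm_powWeight (by norm_num) _).trans (hK N t ht).2⟩
  obtain ⟨C1, hC1⟩ := exists_sqNorm_rhsLin_le 1 le_rfl
  have pass : ∀ (p q : ℕ → ℝ → ℤ → ℝ) (P Q : ℝ → ℤ → ℝ), (∀ N t, OddModes (p N t)) →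
      (∀ N t, OddModes (q N t)) → ContIn m T P → ContIn m T Q →
      (∀ t ∈ Icc 0 T, sqNorm (powWeight 2) (P t) ≤ K) →
      (∀ N, ∀ t ∈ Icc 0 T, sqNorm (powWeight 2) (p N t) ≤ K) →
      (∀ N, ∀ t ∈ Icc 0 T, sqNorm (powWeight 2) (q N t) ≤ K) →
      (∀ N, ∀ t ∈ Icc 0 T, sqNorm (powWeight 2) (p N t - P t) ≤
        ENNReal.ofReal (B * (1 / ((N : ℝ) + 1) ^ 2))) →
      (∀ N, ∀ t ∈ Icc 0 T, sqNorm (powWeight 2) (q N t - Q t) ≤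
        ENNReal.ofReal (B * (1 / ((N : ℝ) + 1) ^ 2))) →
      (∀ t ∈ Icc 0 T, ∀ k, Tendsto (fun N => p N t k) atTop (𝓝 (P t k))) →
      (∀ N, ∀ t ∈ Icc 0 T, ∀ k : ℤ, 2 ≤ k.natAbs → k.natAbs ≤ N →
        HasDerivWithinAt (fun s => p N s k) (rhs (p N t) (q N t) k) (Icc 0 T) t) →
      ∀ t ∈ Icc 0 T, ∀ k : ℤ, 2 ≤ k.natAbs →
        HasDerivWithinAt (fun s => P s k) (rhs (P t) (Q t) k) (Icc 0 T) t := by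
    intro p q P Q hp hq hP hQ KP Kp Kq hpP hqQ hlim hder t ht k h2
    refine hasDerivWithinAt_of_uniform_limit (f := fun N s => p N s k)
      (g := fun N s => rhs (p N s) (q N s) k) (G := fun s => rhs (P s) (Q s) k)
      (convex_Icc 0 T) ?_ (fun s hs => hlim s hs k) ?_ ht ?_
    · filter_upwards [eventually_ge_atTop k.natAbs] with N hN s hs
      exact hder N s hs k h2 hN
    · rw [Metric.tendstoUniformlyOn_iff]
      intro ε hε
      have h3 : Tendsto (fun N : ℕ => Real.sqrt (C1 * (1 + 2 * K) * (2 * (B * (1 / ((N : ℝ) + 1) ^ 2)))))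
          atTop (𝓝 0) := by
        have h4 := (lim0.const_mul 2).const_mul (C1 * (1 + 2 * K) : ℝ)
        rw [mul_zero, mul_zero] at h4
        have h5 := (Real.continuous_sqrt.tendsto 0).comp h4
        rw [Real.sqrt_zero] at h5
        exact h5
      filter_upwards [h3.eventually_lt_const hε] with N hN s hs
      rw [dist_comm, Real.dist_eq]
      have hK0 := K.2
      have hC0 := C1.2
      refine (abs_le_of_sqNorm_le (s := 1) (x := rhs (p N s) (q N s) - rhs (P s) (Q s))
        (by positivity) ?_ k).trans_lt hN
      rw [rhs_sub' ⟨hp N s, ne_top_of_le_ne_top (by simp) (Kp N s hs)⟩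
        ⟨hq N s, ne_top_of_le_ne_top (by simp) (Kq N s hs)⟩ (hP.adm (by omega) hs)
        (hQ.adm (by omega) hs)]
      refine (hC1 _ _ _ _ (hP.modes s hs) (hq N s) ((hp N s).sub (hP.modes s hs))
        ((hq N s).sub (hQ.modes s hs))).trans ?_
      calc _ ≤ (C1 : ℝ≥0∞) * (1 + K + K) * (ENNReal.ofReal (B * (1 / ((N : ℝ) + 1) ^ 2))
            + ENNReal.ofReal (B * (1 / ((N : ℝ) + 1) ^ 2))) := by
            gcongr
            exacts [KP s hs, Kq N s hs, hpP N s hs, hqQ N s hs]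
        _ = ENNReal.ofReal (C1 * (1 + 2 * K) * (2 * (B * (1 / ((N : ℝ) + 1) ^ 2)))) := by
            rw [← ENNReal.ofReal_add (by positivity) (by positivity), ← two_mul,
              ENNReal.ofReal_mul (p := C1 * (1 + 2 * K)) (by positivity),
              ENNReal.ofReal_mul (p := (C1 : ℝ)) (by positivity),
              ENNReal.ofReal_add (p := 1) (by positivity) (by positivity),
              ENNReal.ofReal_mul (p := 2) (q := (K : ℝ)) (by positivity)]
            simp only [ENNReal.ofReal_coe_nnreal, ENNReal.ofReal_one, ENNReal.ofReal_ofNat]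
            ring
    · exact continuousWithinAt_of_tendsto_sqNorm (s := 1) (f := fun s => rhs (P s) (Q s))
        (ContIn.tendsto_rhs le_rfl (hP.of_le (by omega)) (hQ.of_le (by omega)) ht) k
  refine ⟨X, Y, ⟨?_, ?_, contX, contY,
    fun L => ⟨hXm, hYm, fun t ht k h2 _ => ?_, fun t ht k h2 _ => ?_⟩⟩, fun t ht => ?_⟩
  · ext k
    refine tendsto_nhds_unique (hXl 0 h00 k) (tendsto_const_nhds.congr' ?_)
    filter_upwards [eventually_ge_atTop k.natAbs] with N hN
    rw [x0, trunc, if_pos hN]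
  · ext k
    refine tendsto_nhds_unique (hYl 0 h00 k) (tendsto_const_nhds.congr' ?_)
    filter_upwards [eventually_ge_atTop k.natAbs] with N hN
    rw [y0, trunc, if_pos hN]
  · exact pass x y X Y (fun N t => (hx N t).2) (fun N t => (hy N t).2) contX contY
      (fun t ht => (KX t ht).1) (fun N t ht => (Kx N t ht).1) (fun N t ht => (Kx N t ht).2) hXN hYN hXl
      (fun N t ht k h2 hk => (hd N t ht k h2 hk).1) t ht k h2
  · exact pass y x Y X (fun N t => (hy N t).2) (fun N t => (hx N t).2) contY contX
      (fun t ht => (KX t ht).2) (fun N t ht => (Kx N t ht).2) (fun N t ht => (Kx N t ht).1) hYN hXN hYl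
      (fun N t ht k h2 hk => (hd N t ht k h2 hk).2) t ht k h2
  · refine sqNorm_le_of_tendsto (hXl t ht) (Eventually.of_forall fun N => ?_)
    have := hbase _ (isWeight_powWeight 2) N T _ (x N) (y N) (sol N) (fun t => (hx N t).1)
      (fun t => (hy N t).1) (hb N) t ht
    rw [x0, y0] at this
    exact le_self_add.trans (this.trans (mul_le_mul' le_rfl
      (add_le_add (sqNorm_trunc_le _ _ _) (sqNorm_trunc_le _ _ _))))

/-! ### Trigonometric series -/

/-- The sine series `½ ∑ aₙ sin (n θ)` over `n ∈ ℤ`, equal to the sum over `n ≥ 1` if `a` is odd. -/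
def sinS (a : ℤ → ℝ) (θ : ℝ) : ℝ := (∑' n : ℤ, a n * Real.sin (n * θ)) / 2

/-- The cosine series `∑ aₙ cos (n θ)` over `n ∈ ℤ`. -/
def cosS (a : ℤ → ℝ) (θ : ℝ) : ℝ := ∑' n : ℤ, a n * Real.cos (n * θ)

/-- Multiplication of the coefficients by the frequency. -/
def freq (a : ℤ → ℝ) (n : ℤ) : ℝ := n * a n

lemma summable_abs_of_absSum {a : ℤ → ℝ} (ha : absSum a ≠ ⊤) : Summable fun n => |a n| :=
  (summable_of_tsum_enorm_ne_top ha).abs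

lemma summable_mul_sin {a : ℤ → ℝ} (ha : absSum a ≠ ⊤) (θ : ℝ) :
    Summable fun n : ℤ => a n * Real.sin (n * θ) :=
  Summable.of_norm_bounded (summable_abs_of_absSum ha) fun n => by
    rw [norm_mul, Real.norm_eq_abs]
    exact mul_le_of_le_one_right (abs_nonneg _) (Real.abs_sin_le_one _)

lemma summable_mul_cos {a : ℤ → ℝ} (ha : absSum a ≠ ⊤) (θ : ℝ) :
    Summable fun n : ℤ => a n * Real.cos (n * θ) :=
  Summable.of_norm_bounded (summable_abs_of_absSum ha) fun n => by
    rw [norm_mul, Real.norm_eq_abs]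
    exact mul_le_of_le_one_right (abs_nonneg _) (Real.abs_cos_le_one _)

lemma continuous_sinS {a : ℤ → ℝ} (ha : absSum a ≠ ⊤) : Continuous (sinS a) := by
  refine Continuous.div_const (continuous_tsum (fun n => by fun_prop) (summable_abs_of_absSum ha)
    fun n θ => ?_) 2
  rw [norm_mul, Real.norm_eq_abs]
  exact mul_le_of_le_one_right (abs_nonneg _) (Real.abs_sin_le_one _)

lemma continuous_cosS {a : ℤ → ℝ} (ha : absSum a ≠ ⊤) : Continuous (cosS a) := by
  refine continuous_tsum (fun n => by fun_prop) (summable_abs_of_absSum ha) fun n θ => ?_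
  rw [norm_mul, Real.norm_eq_abs]
  exact mul_le_of_le_one_right (abs_nonneg _) (Real.abs_cos_le_one _)

lemma absSum_ne_top_of_freq {a : ℤ → ℝ} (ha : absSum (freq a) ≠ ⊤) : absSum a ≠ ⊤ := by
  have h : absSum a ≤ absSum (freq a) + ‖a 0‖ₑ := by
    have e : (‖a 0‖ₑ : ℝ≥0∞) = ∑' n : ℤ, if n = 0 then ‖a 0‖ₑ else 0 := by rw [tsum_ite_eq]
    rw [e, absSum, absSum, ← ENNReal.tsum_add]
    refine ENNReal.tsum_le_tsum fun n => ?_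
    rcases eq_or_ne n 0 with rfl | hn
    · simp
    · refine le_trans ?_ le_self_add
      unfold freq
      rw [enorm_mul]
      refine le_mul_of_one_le_left zero_le ?_
      rw [Real.enorm_eq_ofReal_abs, ← ENNReal.ofReal_one]
      exact ENNReal.ofReal_le_ofReal (by exact_mod_cast Int.one_le_abs hn)
  exact ne_top_of_le_ne_top (by finiteness) h

lemma hasDerivAt_sinS {a : ℤ → ℝ} (ha : absSum (freq a) ≠ ⊤) (θ : ℝ) :
    HasDerivAt (sinS a) (cosS (freq a) θ / 2) θ := by
  refine HasDerivAt.div_const (hasDerivAt_tsum (summable_abs_of_absSum ha)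
    (g' := fun (n : ℤ) θ => freq a n * Real.cos (n * θ)) (fun n y => ?_) (fun n y => ?_) (y₀ := 0)
    (summable_mul_sin (absSum_ne_top_of_freq ha) 0) θ) 2
  · refine ((((hasDerivAt_id y).const_mul (n : ℝ)).sin).const_mul (a n)).congr_deriv ?_
    unfold freq; simp; ring
  · rw [norm_mul, Real.norm_eq_abs]
    exact mul_le_of_le_one_right (abs_nonneg _) (Real.abs_cos_le_one _)

lemma hasDerivAt_cosS {a : ℤ → ℝ} (ha : absSum (freq a) ≠ ⊤) (θ : ℝ) :
    HasDerivAt (cosS a) (-2 * sinS (freq a) θ) θ := by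
  have e : -2 * sinS (freq a) θ = ∑' n : ℤ, -(freq a n * Real.sin (n * θ)) := by
    rw [tsum_neg, sinS]; ring
  rw [e]
  refine hasDerivAt_tsum (summable_abs_of_absSum ha)
    (g' := fun (n : ℤ) θ => -(freq a n * Real.sin (n * θ))) (fun n y => ?_) (fun n y => ?_) (y₀ := 0)
    (summable_mul_cos (absSum_ne_top_of_freq ha) 0) θ
  · refine ((((hasDerivAt_id y).const_mul (n : ℝ)).cos).const_mul (a n)).congr_deriv ?_
    unfold freq; simp; ring
  · rw [norm_neg, norm_mul, Real.norm_eq_abs]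
    exact mul_le_of_le_one_right (abs_nonneg _) (Real.abs_sin_le_one _)

lemma sinS_zero (a : ℤ → ℝ) : sinS a 0 = 0 := by simp [sinS]

lemma sinS_neg (a : ℤ → ℝ) (θ : ℝ) : sinS a (-θ) = -sinS a θ := by
  unfold sinS; rw [← neg_div, ← tsum_neg]
  congr 1
  exact tsum_congr fun n => by rw [mul_neg, Real.sin_neg]; ring

lemma sinS_periodic (a : ℤ → ℝ) : Function.Periodic (sinS a) (2 * Real.pi) := fun θ => by
  unfold sinS; congr 1
  exact tsum_congr fun n => by rw [mul_add, Real.sin_add_int_mul_two_pi]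

lemma cosS_periodic (a : ℤ → ℝ) : Function.Periodic (cosS a) (2 * Real.pi) := fun θ => by
  unfold cosS
  exact tsum_congr fun n => by rw [mul_add, Real.cos_add_int_mul_two_pi]

lemma sinS_add {a b : ℤ → ℝ} (ha : absSum a ≠ ⊤) (hb : absSum b ≠ ⊤) (θ : ℝ) :
    sinS (a + b) θ = sinS a θ + sinS b θ := by
  unfold sinS
  rw [← add_div, ← (summable_mul_sin ha θ).tsum_add (summable_mul_sin hb θ)]
  congr 1; exact tsum_congr fun n => by simp only [Pi.add_apply]; ring

lemma sinS_sub {a b : ℤ → ℝ} (ha : absSum a ≠ ⊤) (hb : absSum b ≠ ⊤) (θ : ℝ) :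
    sinS (a - b) θ = sinS a θ - sinS b θ := by
  unfold sinS
  rw [← sub_div, ← (summable_mul_sin ha θ).tsum_sub (summable_mul_sin hb θ)]
  congr 1; exact tsum_congr fun n => by simp only [Pi.sub_apply]; ring

lemma sinS_smul (c : ℝ) (a : ℤ → ℝ) (θ : ℝ) : sinS (c • a) θ = c * sinS a θ := by
  unfold sinS
  rw [← mul_div_assoc, ← tsum_mul_left]
  congr 1; exact tsum_congr fun n => by simp only [Pi.smul_apply, smul_eq_mul]; ring

lemma tsum_eq_zero_of_odd {f : ℤ → ℝ} (h : ∀ n, f (-n) = -f n) : ∑' n, f n = 0 := by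
  have h1 : ∑' n, f n = -∑' n, f n := by
    rw [← tsum_neg, ← (Equiv.neg ℤ).tsum_eq]
    exact tsum_congr fun n => by rw [Equiv.neg_apply, h]
  linarith

lemma cosS_mul_sinS {p b : ℤ → ℝ} (hp : absSum p ≠ ⊤) (hb : absSum b ≠ ⊤)
    (hpe : ∀ i, p (-i) = p i) (θ : ℝ) : cosS p θ * sinS b θ = sinS (conv p b) θ := by
  have hs : Summable (Function.uncurry fun m i : ℤ => p i * b (m - i) * Real.sin (m * θ)) := by
    have h1 := (summable_abs_of_absSum hp).mul_of_nonneg (summable_abs_of_absSum hb)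
      (fun _ => abs_nonneg _) (fun _ => abs_nonneg _)
    have h2 : Function.Injective fun q : ℤ × ℤ => (q.2, q.1 - q.2) := by
      rintro ⟨a, b⟩ ⟨c, d⟩ h
      simp only [Prod.mk.injEq] at h ⊢
      omega
    refine Summable.of_norm_bounded (h1.comp_injective h2) fun q => ?_
    rw [Function.uncurry, norm_mul, norm_mul]
    exact mul_le_of_le_one_right (by positivity) (Real.abs_sin_le_one _)
  have e1 : sinS (conv p b) θ = (∑' m : ℤ, ∑' i : ℤ, p i * b (m - i) * Real.sin (m * θ)) / 2 := by
    unfold sinS conv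
    congr 1; exact tsum_congr fun m => by rw [tsum_mul_right]
  have e2 : ∀ i : ℤ, ∑' m : ℤ, p i * b (m - i) * Real.sin (m * θ) =
      (p i * Real.cos (i * θ)) * (∑' n : ℤ, b n * Real.sin (n * θ)) +
        (p i * Real.sin (i * θ)) * (∑' n : ℤ, b n * Real.cos (n * θ)) := by
    intro i
    rw [← tsum_mul_left, ← tsum_mul_left, ← ((summable_mul_sin hb θ).mul_left _).tsum_add
      ((summable_mul_cos hb θ).mul_left _), ← (Equiv.addRight i).tsum_eq]
    refine tsum_congr fun n => ?_
    rw [Equiv.coe_addRight, add_sub_cancel_right]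
    push_cast
    rw [add_mul, Real.sin_add]; ring
  rw [e1, ← hs.tsum_comm, tsum_congr e2, ((summable_mul_cos hp θ).mul_right _).tsum_add
    ((summable_mul_sin hp θ).mul_right _), tsum_mul_right, tsum_mul_right,
    tsum_eq_zero_of_odd (f := fun i : ℤ => p i * Real.sin (i * θ)) (fun i => by
      rw [hpe]; push_cast; rw [neg_mul, Real.sin_neg]; ring)]
  unfold cosS sinS; ring

lemma tsum_shift (f : ℤ → ℝ) (j : ℤ) : ∑' n, f (n + j) = ∑' n, f n := (Equiv.addRight j).tsum_eq f

lemma absSum_shift {a : ℤ → ℝ} (ha : absSum a ≠ ⊤) (j : ℤ) : absSum (fun n => a (n + j)) ≠ ⊤ := by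
  unfold absSum at *
  have := (Equiv.addRight j).tsum_eq (fun n => ‖a n‖ₑ)
  simp only [Equiv.coe_addRight] at this
  rwa [this]

lemma sin_mul_cosS {p : ℤ → ℝ} (hp : absSum p ≠ ⊤) (θ : ℝ) :
    Real.sin θ * cosS p θ = sinS (fun n => p (n + -1) - p (n + 1)) θ := by
  have h := sinS_sub (absSum_shift hp (-1)) (absSum_shift hp 1) θ
  have e : (fun n => p (n + -1) - p (n + 1)) = (fun n => p (n + -1)) - fun n => p (n + 1) := rfl
  rw [e, h]
  unfold sinS cosS
  rw [← tsum_shift (fun n : ℤ => p (n + -1) * Real.sin (n * θ)) 1,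
    ← tsum_shift (fun n : ℤ => p (n + 1) * Real.sin (n * θ)) (-1), ← tsum_mul_left, ← sub_div,
    ← Summable.tsum_sub, ← tsum_div_const]
  · refine tsum_congr fun n => ?_
    rw [add_neg_cancel_right, neg_add_cancel_right]
    push_cast
    rw [show ((n : ℝ) + 1) * θ = n * θ + θ by ring, show ((n : ℝ) + -1) * θ = n * θ - θ by ring,
      Real.sin_add, Real.sin_sub]; ring
  · refine Summable.of_norm_bounded (summable_abs_of_absSum hp) fun n => ?_
    rw [add_neg_cancel_right, norm_mul, Real.norm_eq_abs]
    exact mul_le_of_le_one_right (abs_nonneg _) (Real.abs_sin_le_one _)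
  · refine Summable.of_norm_bounded (summable_abs_of_absSum hp) fun n => ?_
    rw [neg_add_cancel_right, norm_mul, Real.norm_eq_abs]
    exact mul_le_of_le_one_right (abs_nonneg _) (Real.abs_sin_le_one _)

lemma cos_mul_sinS {p : ℤ → ℝ} (hp : absSum p ≠ ⊤) (θ : ℝ) :
    Real.cos θ * sinS p θ = sinS (cosMul p) θ := by
  have e : cosMul p = (1 / 2 : ℝ) • ((fun n => p (n + 1)) + fun n => p (n + -1)) := by
    ext n; simp only [cosMul, Pi.smul_apply, Pi.add_apply, smul_eq_mul, sub_eq_add_neg]; ring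
  rw [e, sinS_smul, sinS_add (absSum_shift hp 1) (absSum_shift hp (-1))]
  unfold sinS
  rw [← tsum_shift (fun n : ℤ => p (n + -1) * Real.sin (n * θ)) 1,
    ← tsum_shift (fun n : ℤ => p (n + 1) * Real.sin (n * θ)) (-1), ← add_div,
    ← Summable.tsum_add, ← mul_div_assoc, ← tsum_mul_left, ← mul_div_assoc, ← tsum_mul_left]
  · congr 1
    refine tsum_congr fun n => ?_
    rw [add_neg_cancel_right, neg_add_cancel_right]
    push_cast
    rw [show ((n : ℝ) + 1) * θ = n * θ + θ by ring, show ((n : ℝ) + -1) * θ = n * θ - θ by ring,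
      Real.sin_add, Real.sin_sub]; ring
  · refine Summable.of_norm_bounded (summable_abs_of_absSum hp) fun n => ?_
    rw [neg_add_cancel_right, norm_mul, Real.norm_eq_abs]
    exact mul_le_of_le_one_right (abs_nonneg _) (Real.abs_sin_le_one _)
  · refine Summable.of_norm_bounded (summable_abs_of_absSum hp) fun n => ?_
    rw [add_neg_cancel_right, norm_mul, Real.norm_eq_abs]
    exact mul_le_of_le_one_right (abs_nonneg _) (Real.abs_sin_le_one _)

/-! ### The Hilbert transform of a sine series -/

/-- The trigonometric polynomial `1 + 2 ∑_{0 < j < n} cos (j y) + cos (n y)`, which equals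
`cot (y / 2) sin (n y)`; it is zero for `n = 0`. -/
def dirichlet : ℕ → ℝ → ℝ
  | 0, _ => 0
  | n + 1, y => dirichlet n y + (Real.cos ((n + 1 : ℕ) * y) + Real.cos (n * y))

lemma continuous_dirichlet (n : ℕ) : Continuous (dirichlet n) := by
  induction n with
  | zero => exact continuous_const
  | succ n ih =>
    have : dirichlet (n + 1) = fun y => dirichlet n y + (Real.cos ((n + 1 : ℕ) * y) + Real.cos (n * y)) :=
      rfl
    rw [this]; fun_prop

lemma abs_dirichlet_le (n : ℕ) (y : ℝ) : |dirichlet n y| ≤ 2 * n := by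
  induction n with
  | zero => simp [dirichlet]
  | succ n ih =>
    rw [dirichlet]
    have h1 := Real.abs_cos_le_one ((n + 1 : ℕ) * y)
    have h2 := Real.abs_cos_le_one ((n : ℕ) * y)
    calc _ ≤ |dirichlet n y| + (|Real.cos ((n + 1 : ℕ) * y)| + |Real.cos (n * y)|) :=
          (abs_add_le _ _).trans (add_le_add_right (abs_add_le _ _) _)
      _ ≤ 2 * n + (1 + 1) := by gcongr
      _ = _ := by push_cast; ring

lemma cot_mul_sin_eq_dirichlet (n : ℕ) {y : ℝ} (hy : Real.sin (y / 2) ≠ 0) :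
    Real.cot (y / 2) * Real.sin (n * y) = dirichlet n y := by
  induction n with
  | zero => simp [dirichlet]
  | succ n ih =>
    rw [dirichlet, ← ih, Real.cot_eq_cos_div_sin]
    have e1 : (((n + 1 : ℕ) : ℝ)) * y = n * y + 2 * (y / 2) := by push_cast; ring
    rw [e1, Real.sin_add, Real.cos_add, Real.sin_two_mul, Real.cos_two_mul]
    field_simp
    have := Real.sin_sq_add_cos_sq (y / 2)
    have h3 : Real.sin (y / 2) ^ 2 = 1 - Real.cos (y / 2) ^ 2 := by linarith
    ring_nf
    ring_nf at h3
    rw [h3]; ring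

lemma integral_cos_nat (n : ℕ) (hn : n ≠ 0) : ∫ y in (0 : ℝ)..Real.pi, Real.cos (n * y) = 0 := by
  have hn' : (n : ℝ) ≠ 0 := by exact_mod_cast hn
  rw [intervalIntegral.integral_comp_mul_left (fun y => Real.cos y) hn', integral_cos]
  simp [Real.sin_nat_mul_pi]

lemma integral_dirichlet (n : ℕ) (hn : n ≠ 0) :
    ∫ y in (0 : ℝ)..Real.pi, dirichlet n y = Real.pi := by
  induction n with
  | zero => exact absurd rfl hn
  | succ n ih =>
    have hi : ∀ k : ℕ, IntervalIntegrable (fun y => Real.cos (k * y)) volume 0 Real.pi := fun k =>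
      (by fun_prop : Continuous fun y : ℝ => Real.cos (k * y)).intervalIntegrable _ _
    simp only [dirichlet]
    rw [intervalIntegral.integral_add ((continuous_dirichlet n).intervalIntegrable _ _)
      ((hi (n + 1)).add (hi n)), intervalIntegral.integral_add (hi (n + 1)) (hi n),
      integral_cos_nat (n + 1) (by omega)]
    rcases eq_or_ne n 0 with rfl | h0
    · simp [dirichlet]
    · rw [ih h0, integral_cos_nat n h0]; ring

/-- `cot (y / 2) sin (n y)` for `n ∈ ℤ`. -/
def dirichletInt (n : ℤ) (y : ℝ) : ℝ := n.sign * dirichlet n.natAbs y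

lemma cot_mul_sin_eq (n : ℤ) {y : ℝ} (hy : Real.sin (y / 2) ≠ 0) :
    Real.cot (y / 2) * Real.sin (n * y) = dirichletInt n y := by
  unfold dirichletInt
  rw [← cot_mul_sin_eq_dirichlet _ hy]
  rcases lt_trichotomy n 0 with h | rfl | h
  · rw [Int.sign_eq_neg_one_of_neg h, Nat.cast_natAbs, abs_of_neg h]; push_cast
    simp only [neg_mul, Real.sin_neg, mul_neg, neg_neg, one_mul]
  · simp
  · rw [Int.sign_eq_one_of_pos h, Nat.cast_natAbs, abs_of_pos h]; push_cast; ring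

lemma integral_dirichletInt (n : ℤ) :
    ∫ y in (0 : ℝ)..Real.pi, dirichletInt n y = n.sign * Real.pi := by
  unfold dirichletInt
  rw [intervalIntegral.integral_const_mul]
  rcases eq_or_ne n 0 with rfl | h
  · simp
  · rw [integral_dirichlet _ (by omega)]

lemma abs_dirichletInt_le (n : ℤ) (y : ℝ) : |dirichletInt n y| ≤ 2 * |(n : ℝ)| := by
  unfold dirichletInt
  rw [abs_mul]
  calc _ ≤ 1 * (2 * (n.natAbs : ℝ)) := by
        gcongr
        · exact abs_sign_le n
        · exact abs_dirichlet_le _ _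
    _ = _ := by rw [one_mul, Nat.cast_natAbs, Int.cast_abs]

/-- The Hilbert transform of a sine series is the conjugate cosine series. Folding the integral at the
singularity turns the kernel into bounded trigonometric polynomials, so the limit is an integral. -/
lemma hilbertTransform_sinS {a : ℤ → ℝ} (ha : absSum (freq a) ≠ ⊤) (θ : ℝ) :
    hilbertTransform (sinS a) θ = cosS (fun n => -(n.sign * a n)) θ / 2 := by
  have ha0 := absSum_ne_top_of_freq ha
  set G : ℤ → ℝ → ℝ := fun n y => -(a n * Real.cos (n * θ) * dirichletInt n y) with hG
  have hGc : ∀ n, Continuous (G n) := fun n => by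
    have : Continuous (dirichletInt n) := continuous_const.mul (continuous_dirichlet _)
    simp only [hG]; fun_prop
  have hGb : ∀ n y, ‖G n y‖ ≤ 2 * |freq a n| := fun n y => by
    simp only [hG, norm_neg, norm_mul, Real.norm_eq_abs, freq, abs_mul]
    calc _ ≤ |a n| * 1 * (2 * |(n : ℝ)|) := by
          gcongr
          · exact Real.abs_cos_le_one _
          · exact abs_dirichletInt_le n y
      _ = _ := by ring
  have hsum : Summable fun n => 2 * |freq a n| := (summable_abs_of_absSum ha).mul_left 2
  have hcont : Continuous fun y => ∑' n, G n y := continuous_tsum hGc hsum hGb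
  have hint : ∫ y in (0 : ℝ)..Real.pi, ∑' n, G n y = ∑' n, ∫ y in (0 : ℝ)..Real.pi, G n y := by
    refine ((intervalIntegral.hasSum_integral_of_dominated_convergence (fun n _ => 2 * |freq a n|)
      (fun n => (hGc n).aestronglyMeasurable) (fun n => Eventually.of_forall fun y _ => hGb n y)
      (Eventually.of_forall fun _ _ => hsum) (by simp)
      (Eventually.of_forall fun y _ => ?_)).tsum_eq).symm
    exact (Summable.of_norm_bounded hsum fun n => hGb n y).hasSum
  have hlim : Tendsto (fun ε : ℝ => (∫ x in (θ - Real.pi)..(θ - ε), Real.cot ((θ - x) / 2) * sinS a x) +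
      ∫ x in (θ + ε)..(θ + Real.pi), Real.cot ((θ - x) / 2) * sinS a x) (𝓝[>] (0 : ℝ))
      (𝓝 (∫ y in (0 : ℝ)..Real.pi, ∑' n, G n y)) := by
    have h1 : Tendsto (fun ε : ℝ => ∫ y in ε..Real.pi, ∑' n, G n y) (𝓝[>] (0 : ℝ))
        (𝓝 (∫ y in (0 : ℝ)..Real.pi, ∑' n, G n y)) := by
      have h2 : Continuous fun ε : ℝ => ∫ y in ε..Real.pi, ∑' n, G n y := by
        have : (fun ε : ℝ => ∫ y in ε..Real.pi, ∑' n, G n y) =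
            fun ε : ℝ => -∫ y in Real.pi..ε, ∑' n, G n y := by
          ext ε; exact intervalIntegral.integral_symm _ _
        rw [this]
        exact (intervalIntegral.continuous_primitive (fun _ _ => hcont.intervalIntegrable _ _) _).neg
      exact (h2.tendsto 0).mono_left nhdsWithin_le_nhds
    refine h1.congr' ?_
    filter_upwards [Ioo_mem_nhdsGT Real.pi_pos] with ε hε
    have e1 : ∫ x in (θ - Real.pi)..(θ - ε), Real.cot ((θ - x) / 2) * sinS a x =
        ∫ y in ε..Real.pi, Real.cot (y / 2) * sinS a (θ - y) := by
      rw [← intervalIntegral.integral_comp_sub_left (fun x => Real.cot ((θ - x) / 2) * sinS a x) θ]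
      simp only [sub_sub_cancel]
    have e2 : ∫ x in (θ + ε)..(θ + Real.pi), Real.cot ((θ - x) / 2) * sinS a x =
        ∫ y in ε..Real.pi, -(Real.cot (y / 2) * sinS a (θ + y)) := by
      rw [← intervalIntegral.integral_comp_add_left (fun x => Real.cot ((θ - x) / 2) * sinS a x) θ]
      refine intervalIntegral.integral_congr fun y _ => ?_
      rw [show (θ - (θ + y)) / 2 = -(y / 2) by ring, Real.cot_eq_cos_div_sin, Real.cot_eq_cos_div_sin,
        Real.sin_neg, Real.cos_neg, div_neg]; ring
    have hsin : ∀ y ∈ uIcc ε Real.pi, Real.sin (y / 2) ≠ 0 := fun y hy => by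
      rw [uIcc_of_le hε.2.le] at hy
      exact (Real.sin_pos_of_pos_of_lt_pi (by linarith [hy.1, hε.1]) (by linarith [hy.2, Real.pi_pos])).ne'
    have hcot : ContinuousOn (fun y => Real.cot (y / 2)) (uIcc ε Real.pi) := by
      have : (fun y => Real.cot (y / 2)) = fun y => Real.cos (y / 2) / Real.sin (y / 2) := by
        ext y; exact Real.cot_eq_cos_div_sin _
      rw [this]
      exact ContinuousOn.div (by fun_prop) (by fun_prop) hsin
    have hc := continuous_sinS ha0
    rw [e1, e2, ← intervalIntegral.integral_add]
    · refine intervalIntegral.integral_congr fun y hy => ?_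
      have hy' := hsin y hy
      have e3 : ∀ n : ℤ, G n y = Real.cot (y / 2) *
          ((a n * Real.sin (n * (θ - y))) - (a n * Real.sin (n * (θ + y)))) / 2 := fun n => by
        simp only [hG]
        rw [← cot_mul_sin_eq n hy', mul_sub (n : ℝ) θ y, mul_add (n : ℝ) θ y, Real.sin_sub, Real.sin_add]; ring
      rw [tsum_congr e3, tsum_div_const, tsum_mul_left,
        (summable_mul_sin ha0 _).tsum_sub (summable_mul_sin ha0 _)]
      unfold sinS; ring
    · exact (hcot.mul (by fun_prop)).intervalIntegrable
    · exact (hcot.mul (by fun_prop)).neg.intervalIntegrable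
  rw [hilbertTransform, hlim.limUnder_eq, hint, cosS, ← tsum_mul_left, ← tsum_div_const]
  refine tsum_congr fun n => ?_
  simp only [hG]
  rw [intervalIntegral.integral_neg, intervalIntegral.integral_const_mul, integral_dirichletInt]
  have := Real.pi_pos
  field_simp

lemma velocity_sinS {a b : ℤ → ℝ} (ha : absSum (freq a) ≠ ⊤)
    (hb : ∀ n : ℤ, freq b n = -(n.sign * a n)) : velocity (sinS a) = sinS b := by
  have e : freq b = fun n => -(n.sign * a n) := funext hb
  have hfb : absSum (freq b) ≠ ⊤ := by
    refine ne_top_of_le_ne_top (absSum_ne_top_of_freq ha) (ENNReal.tsum_le_tsum fun n => ?_)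
    rw [hb, enorm_neg]
    exact enorm_le_of_abs_le (by
      rw [abs_mul]; exact mul_le_of_le_one_left (abs_nonneg _) (abs_sign_le n))
  ext θ
  unfold velocity
  simp_rw [hilbertTransform_sinS ha, ← e]
  rw [intervalIntegral.integral_eq_sub_of_hasDerivAt (fun x _ => hasDerivAt_sinS hfb x)
    (((continuous_cosS hfb).div_const 2).intervalIntegrable _ _), sinS_zero, sub_zero]

/-! ### States and the equation in terms of coefficients -/

/-- The sine coefficients of the odd function `ξ` for which `∂_θ ξ / sin θ` has the sine coefficients `x`.
At `n = 0` the quotient is zero by convention, the correct value for an odd sequence. -/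
def profCoeff (x : ℤ → ℝ) (n : ℤ) : ℝ := (x (n + 1) - x (n - 1)) / (2 * n)

/-- The odd function `ξ` with `∂_θ ξ = sin θ sinS x`. -/
def profile (x : ℤ → ℝ) : ℝ → ℝ := sinS (profCoeff x)

/-- The velocity of `profile x`. -/
def profVel (x : ℤ → ℝ) : ℝ → ℝ := sinS (velCoeff x)

/-- The coefficients of `∂_θ ξ` as the cosine series `½ ∑ aₙ cos (n θ)` over `n ∈ ℤ`. -/
def halfDiff (x : ℤ → ℝ) (n : ℤ) : ℝ := (x (n + 1) - x (n - 1)) / 2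

lemma freq_profCoeff_of_ne (x : ℤ → ℝ) {n : ℤ} (hn : n ≠ 0) : freq (profCoeff x) n = halfDiff x n := by
  have : (n : ℝ) ≠ 0 := by exact_mod_cast hn
  unfold freq profCoeff halfDiff; field_simp

lemma OddModes.freq_profCoeff {x : ℤ → ℝ} (hx : OddModes x) : freq (profCoeff x) = halfDiff x := by
  ext n
  rcases eq_or_ne n 0 with rfl | hn
  · simp [freq, halfDiff, hx.one, hx.neg_one]
  · exact freq_profCoeff_of_ne x hn

lemma enorm_halfDiff_le (x : ℤ → ℝ) (n : ℤ) : ‖halfDiff x n‖ₑ ≤ ‖x (n + 1)‖ₑ + ‖x (n - 1)‖ₑ := by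
  refine le_trans ?_ (enorm_sub_le (a := x (n + 1)) (b := x (n - 1)))
  exact enorm_le_of_abs_le (by
    unfold halfDiff; rw [abs_div, abs_two]
    have := abs_nonneg (x (n + 1) - x (n - 1)); linarith)

lemma absSum_halfDiff {x : ℤ → ℝ} (hx : absSum x ≠ ⊤) : absSum (halfDiff x) ≠ ⊤ :=
  ne_top_of_le_ne_top (ENNReal.mul_ne_top (by simp) hx) (absSum_le_of_neighbours (enorm_halfDiff_le x))

lemma absSum_freq_profCoeff {x : ℤ → ℝ} (hx : absSum x ≠ ⊤) : absSum (freq (profCoeff x)) ≠ ⊤ := by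
  refine ne_top_of_le_ne_top (absSum_halfDiff hx) (ENNReal.tsum_le_tsum fun n => ?_)
  rcases eq_or_ne n 0 with rfl | hn
  · simp [freq]
  · rw [freq_profCoeff_of_ne x hn]

lemma sin_mul_sinS {x : ℤ → ℝ} (hx : absSum x ≠ ⊤) (θ : ℝ) :
    Real.sin θ * sinS x θ = cosS (halfDiff x) θ / 2 := by
  have h1 : Summable fun n : ℤ => x (n + 1) * Real.cos (n * θ) := summable_mul_cos (absSum_shift hx 1) θ
  have h2 : Summable fun n : ℤ => x (n + -1) * Real.cos (n * θ) :=
    summable_mul_cos (absSum_shift hx (-1)) θ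
  have e : cosS (halfDiff x) θ = (∑' n : ℤ, x (n + 1) * Real.cos (n * θ)
      - ∑' n : ℤ, x (n + -1) * Real.cos (n * θ)) / 2 := by
    rw [← h1.tsum_sub h2, ← tsum_div_const]
    exact tsum_congr fun n => by unfold halfDiff; rw [sub_eq_add_neg n]; ring
  rw [e, ← tsum_shift (fun n : ℤ => x (n + 1) * Real.cos (n * θ)) (-1),
    ← tsum_shift (fun n : ℤ => x (n + -1) * Real.cos (n * θ)) 1, ← Summable.tsum_sub]
  · unfold sinS
    have e2 : ∀ n : ℤ, x (n + -1 + 1) * Real.cos ((n + -1 : ℤ) * θ)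
        - x (n + 1 + -1) * Real.cos ((n + 1 : ℤ) * θ) = 2 * Real.sin θ * (x n * Real.sin (n * θ)) := by
      intro n
      rw [add_neg_cancel_right, neg_add_cancel_right]
      push_cast
      rw [show ((n : ℝ) + 1) * θ = n * θ + θ by ring, show ((n : ℝ) + -1) * θ = n * θ - θ by ring,
        Real.cos_add, Real.cos_sub]; ring
    rw [tsum_congr e2, tsum_mul_left]; ring
  · refine Summable.of_norm_bounded (summable_abs_of_absSum hx) fun n => ?_
    rw [neg_add_cancel_right, norm_mul, Real.norm_eq_abs]
    exact mul_le_of_le_one_right (abs_nonneg _) (Real.abs_cos_le_one _)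
  · refine Summable.of_norm_bounded (summable_abs_of_absSum hx) fun n => ?_
    rw [add_neg_cancel_right, norm_mul, Real.norm_eq_abs]
    exact mul_le_of_le_one_right (abs_nonneg _) (Real.abs_cos_le_one _)

lemma hasDerivAt_profile {x : ℤ → ℝ} (hx : OddModes x) (ha : absSum x ≠ ⊤) (θ : ℝ) :
    HasDerivAt (profile x) (Real.sin θ * sinS x θ) θ := by
  rw [sin_mul_sinS ha, ← hx.freq_profCoeff]
  exact hasDerivAt_sinS (absSum_freq_profCoeff ha) θ

lemma freq_velCoeff (x : ℤ → ℝ) (n : ℤ) : freq (velCoeff x) n = -(n.sign * profCoeff x n) := by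
  rcases eq_or_ne n 0 with rfl | hn
  · simp [freq]
  · have : (n : ℝ) ≠ 0 := by exact_mod_cast hn
    unfold freq velCoeff velSecond profCoeff; field_simp

lemma freq_freq_velCoeff (x : ℤ → ℝ) : freq (freq (velCoeff x)) = -velSecond x := by
  ext n
  rcases eq_or_ne n 0 with rfl | hn
  · simp [freq, velSecond]
  · have : (n : ℝ) ≠ 0 := by exact_mod_cast hn
    simp only [freq, velCoeff, Pi.neg_apply]; field_simp

lemma velocity_profile {x : ℤ → ℝ} (ha : absSum x ≠ ⊤) : velocity (profile x) = profVel x :=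
  velocity_sinS (absSum_freq_profCoeff ha) (freq_velCoeff x)

lemma absSum_neg {x : ℤ → ℝ} (hx : absSum x ≠ ⊤) : absSum (-x) ≠ ⊤ := by
  simpa [absSum] using hx

lemma absSum_velSecond {x : ℤ → ℝ} (hx : absSum x ≠ ⊤) : absSum (velSecond x) ≠ ⊤ :=
  ne_top_of_le_ne_top (ENNReal.mul_ne_top (by simp) hx) (absSum_le_of_neighbours (enorm_velSecond_le x))

lemma absSum_freq_freq_velCoeff {x : ℤ → ℝ} (hx : absSum x ≠ ⊤) :
    absSum (freq (freq (velCoeff x))) ≠ ⊤ := by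
  rw [freq_freq_velCoeff]; exact absSum_neg (absSum_velSecond hx)

lemma hasDerivAt_profVel {x : ℤ → ℝ} (hx : absSum x ≠ ⊤) (θ : ℝ) :
    HasDerivAt (profVel x) (cosS (freq (velCoeff x)) θ / 2) θ :=
  hasDerivAt_sinS (absSum_ne_top_of_freq (absSum_freq_freq_velCoeff hx)) θ

lemma sinS_neg_coeff (a : ℤ → ℝ) (θ : ℝ) : sinS (-a) θ = -sinS a θ := by
  have := sinS_smul (-1) a θ
  simpa using this

lemma hasDerivAt_deriv_profVel {x : ℤ → ℝ} (hx : absSum x ≠ ⊤) (θ : ℝ) :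
    HasDerivAt (fun θ => cosS (freq (velCoeff x)) θ / 2) (sinS (velSecond x) θ) θ := by
  refine ((hasDerivAt_cosS (absSum_freq_freq_velCoeff hx) θ).div_const 2).congr_deriv ?_
  rw [freq_freq_velCoeff, sinS_neg_coeff]; ring

lemma Adm.absSum {x : ℤ → ℝ} (hx : Adm x) : absSum x ≠ ⊤ := absSum_ne_top hx.finite

lemma Adm.absSum_freq {x : ℤ → ℝ} (hx : Adm x) : MHD1D.absSum (freq x) ≠ ⊤ :=
  absSum_freq_ne_top hx.finite

lemma Adm.absSum_freq_halfDiff {x : ℤ → ℝ} (hx : Adm x) : MHD1D.absSum (freq (halfDiff x)) ≠ ⊤ := by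
  have h : ∀ n, ‖freq (halfDiff x) n‖ₑ ≤ ‖(fun k : ℤ => 2 * freq x k) (n + 1)‖ₑ
      + ‖(fun k : ℤ => 2 * freq x k) (n - 1)‖ₑ := by
    intro n
    simp only [Real.enorm_eq_ofReal_abs]
    rw [← ENNReal.ofReal_add (abs_nonneg _) (abs_nonneg _)]
    apply ENNReal.ofReal_le_ofReal
    have key : ∀ k n : ℤ, |n| ≤ |k| + 1 → |(n : ℝ) * x k| ≤ |2 * freq x k| := by
      intro k n hk
      by_cases h : |k| < 2
      · rw [hx.eq_zero h]; simp
      · unfold freq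
        rw [abs_mul, abs_mul, abs_mul, ← mul_assoc, abs_two]
        gcongr
        have : |n| ≤ 2 * |k| := by omega
        exact_mod_cast this
    have k1 := key (n + 1) n (by rw [abs_le]; rcases abs_cases (n + 1) with h | h <;> omega)
    have k2 := key (n - 1) n (by rw [abs_le]; rcases abs_cases (n - 1) with h | h <;> omega)
    calc |freq (halfDiff x) n| = |(n * x (n + 1) - n * x (n - 1)) / 2| := by
          unfold freq halfDiff; congr 1; ring
      _ ≤ (|n * x (n + 1)| + |n * x (n - 1)|) / 2 := by
          rw [abs_div, abs_two]; gcongr; exact abs_sub _ _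
      _ ≤ _ := by linarith [abs_nonneg (n * x (n + 1)), abs_nonneg (n * x (n - 1))]
  refine ne_top_of_le_ne_top (ENNReal.mul_ne_top (by simp) ?_) (absSum_le_of_neighbours (y := fun k : ℤ => 2 * freq x k) h)
  unfold MHD1D.absSum
  simp_rw [enorm_mul]
  rw [ENNReal.tsum_mul_left]
  exact ENNReal.mul_ne_top (by simp) hx.absSum_freq

/-- Differentiation of `∂_θ ξ` as a product and as a cosine series. -/
lemma Adm.second_deriv {x : ℤ → ℝ} (hx : Adm x) (θ : ℝ) :
    Real.cos θ * sinS x θ + Real.sin θ * (cosS (freq x) θ / 2) = -sinS (freq (halfDiff x)) θ := by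
  have h1 : HasDerivAt (fun θ => Real.sin θ * sinS x θ)
      (Real.cos θ * sinS x θ + Real.sin θ * (cosS (freq x) θ / 2)) θ :=
    (Real.hasDerivAt_sin θ).mul (hasDerivAt_sinS hx.absSum_freq θ)
  have h2 : HasDerivAt (fun θ => Real.sin θ * sinS x θ) (-sinS (freq (halfDiff x)) θ) θ := by
    have : (fun θ => Real.sin θ * sinS x θ) = fun θ => cosS (halfDiff x) θ / 2 := by
      ext θ; exact sin_mul_sinS hx.absSum θ
    rw [this]
    refine ((hasDerivAt_cosS hx.absSum_freq_halfDiff θ).div_const 2).congr_deriv ?_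
    ring
  exact h1.unique h2

lemma ladder_sub_ladder {N n : ℤ} (hn : 1 ≤ n) :
    ladder N (n - 1) - ladder N (n + 1) = if N = n then 1 else 0 := by
  unfold ladder
  have e1 : Even (N - 1 - (n - 1)) ↔ Even (N - n) := by rw [show N - 1 - (n - 1) = N - n by ring]
  have e2 : Even (N - 1 - (n + 1)) ↔ Even (N - n) := by
    rw [show N - 1 - (n + 1) = N - n - 2 by ring]; simp [Int.even_sub]
  simp only [e1, e2]
  rw [abs_of_nonneg (by omega : 0 ≤ n - 1), abs_of_nonneg (by omega : 0 ≤ n + 1)]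
  by_cases hN : N = n
  · subst hN; simp
  · rw [if_neg hN]
    by_cases hE : Even (N - n)
    · obtain ⟨j, hj⟩ := hE
      by_cases h1 : n - 1 < N
      · rw [if_pos ⟨h1, ⟨j, hj⟩⟩, if_pos ⟨by omega, ⟨j, hj⟩⟩]; ring
      · rw [if_neg (fun h => h1 h.1), if_neg (fun h => h1 (by omega))]; ring
    · rw [if_neg (fun h => hE h.2), if_neg (fun h => hE h.2)]; ring

lemma tsum_two_points (n : ℤ) (A B : ℝ) :
    ∑' k : ℤ, ((if k = n + 1 then A else 0) + (if k = n - 1 then B else 0)) = A + B := by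
  rw [Summable.tsum_add, tsum_ite_eq, tsum_ite_eq]
  · exact (hasSum_ite_eq (n + 1) A).summable
  · exact (hasSum_ite_eq (n - 1) B).summable

lemma Adm.primQuot_sub {x : ℤ → ℝ} (hx : Adm x) {n : ℤ} (hn : 1 ≤ n) :
    primQuot x (n - 1) - primQuot x (n + 1) = profCoeff x n := by
  have hn0 : (n : ℝ) ≠ 0 := by exact_mod_cast (by omega : n ≠ 0)
  unfold primQuot
  rw [← (summable_primKer hx _).tsum_sub (summable_primKer hx _)]
  have e : ∀ k : ℤ, primKer (n - 1) k * x k - primKer (n + 1) k * x k =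
      (if k = n + 1 then x (n + 1) / (2 * n) else 0) + (if k = n - 1 then -x (n - 1) / (2 * n) else 0) := by
    intro k
    unfold primKer
    by_cases hk : 2 ≤ k
    · rw [if_pos hk, if_pos hk]
      have h1 := ladder_sub_ladder (N := k - 1) hn
      have h2 := ladder_sub_ladder (N := k + 1) hn
      have : ((ladder (k - 1) (n - 1) / (k - 1) - ladder (k + 1) (n - 1) / (k + 1)) / 2 * x k
          - (ladder (k - 1) (n + 1) / (k - 1) - ladder (k + 1) (n + 1) / (k + 1)) / 2 * x k) =
          ((ladder (k - 1) (n - 1) - ladder (k - 1) (n + 1)) / (k - 1)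
            - (ladder (k + 1) (n - 1) - ladder (k + 1) (n + 1)) / (k + 1)) / 2 * x k := by ring
      rw [this, h1, h2]
      by_cases a1 : k = n + 1
      · subst a1
        rw [if_pos (by omega), if_neg (by omega), if_pos rfl, if_neg (by omega),
          show ((n + 1 : ℤ) : ℝ) - 1 = n by push_cast; ring, zero_div, sub_zero, add_zero]
        field_simp
      · by_cases a2 : k = n - 1
        · subst a2
          rw [if_neg (by omega), if_pos (by omega), if_neg (by omega), if_pos rfl,
            show ((n - 1 : ℤ) : ℝ) + 1 = n by push_cast; ring, zero_div, zero_sub, zero_add]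
          field_simp
        · rw [if_neg (by omega), if_neg (by omega), if_neg a1, if_neg a2]; ring
    · rw [if_neg hk, if_neg hk, if_neg (by omega)]
      by_cases a2 : k = n - 1
      · rw [if_pos a2, ← a2, hx.eq_zero (by rw [abs_lt]; omega)]; simp
      · rw [if_neg a2]; ring
  rw [tsum_congr e, tsum_two_points, profCoeff]; ring

lemma Adm.velQuot_sub {x : ℤ → ℝ} (hx : Adm x) {n : ℤ} (hn : 1 ≤ n) :
    velQuot x (n - 1) - velQuot x (n + 1) = velCoeff x n := by
  have hn0 : (n : ℝ) ≠ 0 := by exact_mod_cast (by omega : n ≠ 0)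
  unfold velQuot
  rw [← (summable_velKer hx _).tsum_sub (summable_velKer hx _)]
  have e : ∀ k : ℤ, velKer (n - 1) k * x k - velKer (n + 1) k * x k =
      (if k = n + 1 then -x (n + 1) / (2 * n ^ 2) else 0) +
        (if k = n - 1 then x (n - 1) / (2 * n ^ 2) else 0) := by
    intro k
    unfold velKer
    by_cases hk : 2 ≤ k
    · rw [if_pos hk, if_pos hk]
      have h1 := ladder_sub_ladder (N := k - 1) hn
      have h2 := ladder_sub_ladder (N := k + 1) hn
      have : (-(ladder (k - 1) (n - 1) / (k - 1) ^ 2 - ladder (k + 1) (n - 1) / (k + 1) ^ 2) / 2 * x k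
          - -(ladder (k - 1) (n + 1) / (k - 1) ^ 2 - ladder (k + 1) (n + 1) / (k + 1) ^ 2) / 2 * x k) =
          -((ladder (k - 1) (n - 1) - ladder (k - 1) (n + 1)) / (k - 1) ^ 2
            - (ladder (k + 1) (n - 1) - ladder (k + 1) (n + 1)) / (k + 1) ^ 2) / 2 * x k := by ring
      rw [this, h1, h2]
      by_cases a1 : k = n + 1
      · subst a1
        rw [if_pos (by omega), if_neg (by omega), if_pos rfl, if_neg (by omega),
          show ((n + 1 : ℤ) : ℝ) - 1 = n by push_cast; ring, zero_div, sub_zero, add_zero]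
        field_simp
      · by_cases a2 : k = n - 1
        · subst a2
          rw [if_neg (by omega), if_pos (by omega), if_neg (by omega), if_pos rfl,
            show ((n - 1 : ℤ) : ℝ) + 1 = n by push_cast; ring, zero_div, zero_sub, zero_add]
          field_simp
        · rw [if_neg (by omega), if_neg (by omega), if_neg a1, if_neg a2]; ring
    · rw [if_neg hk, if_neg hk, if_neg (by omega)]
      by_cases a2 : k = n - 1
      · rw [if_pos a2, ← a2, hx.eq_zero (by rw [abs_lt]; omega)]; simp
      · rw [if_neg a2]; ring
  rw [tsum_congr e, tsum_two_points, velCoeff, velSecond, Int.sign_eq_one_of_pos (by omega)]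
  push_cast; field_simp; ring

lemma eq_of_even_of_odd {p c : ℤ → ℝ} (hp : ∀ i, p (-i) = p i) (hc : ∀ i, c (-i) = -c i)
    (h : ∀ n : ℤ, 1 ≤ n → p (n - 1) - p (n + 1) = c n) : (fun n => p (n + -1) - p (n + 1)) = c := by
  ext n
  rcases lt_trichotomy n 0 with hn | rfl | hn
  · have h1 := h (-n) (by omega)
    rw [hc, show -n - 1 = -(n + 1) by ring, show -n + 1 = -(n + -1) by ring, hp, hp] at h1
    linarith
  · have h1 := hc 0
    have h2 := hp 1
    simp only [neg_zero] at h1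
    simp only [zero_add]
    linarith
  · exact h n (by omega)

lemma profCoeff_neg {x : ℤ → ℝ} (hx : OddModes x) (n : ℤ) : profCoeff x (-n) = -profCoeff x n := by
  unfold profCoeff
  rw [show -n + 1 = -(n - 1) by ring, show -n - 1 = -(n + 1) by ring, hx.odd, hx.odd]
  push_cast
  rw [mul_neg, div_neg]; ring

lemma Adm.profile_eq {x : ℤ → ℝ} (hx : Adm x) (θ : ℝ) :
    profile x θ = Real.sin θ * cosS (primQuot x) θ := by
  rw [sin_mul_cosS hx.absSum_primQuot, eq_of_even_of_odd primQuot_neg (profCoeff_neg hx.toOddModes)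
    (fun n hn => hx.primQuot_sub hn)]
  rfl

lemma Adm.profVel_eq {x : ℤ → ℝ} (hx : Adm x) (θ : ℝ) :
    profVel x θ = Real.sin θ * cosS (velQuot x) θ := by
  rw [sin_mul_cosS hx.absSum_velQuot, eq_of_even_of_odd velQuot_neg (velCoeff_neg hx.toOddModes)
    (fun n hn => hx.velQuot_sub hn)]
  rfl

/-! ### The equation for the profiles -/

lemma absSum_conv {a b : ℤ → ℝ} (ha : absSum a ≠ ⊤) (hb : absSum b ≠ ⊤) : absSum (conv a b) ≠ ⊤ := by
  refine ne_top_of_le_ne_top (ENNReal.mul_ne_top ha hb) ?_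
  calc absSum (conv a b) ≤ ∑' m : ℤ, ∑' i : ℤ, ‖a i‖ₑ * ‖b (m - i)‖ₑ := by
        refine ENNReal.tsum_le_tsum fun m => ?_
        unfold conv
        refine enorm_tsum_le_tsum_enorm.trans (le_of_eq (tsum_congr fun i => enorm_mul _ _))
    _ = ∑' i : ℤ, ‖a i‖ₑ * absSum b := by
        rw [ENNReal.tsum_comm]
        refine tsum_congr fun i => ?_
        rw [ENNReal.tsum_mul_left, ENNReal_tsum_shift (fun n => ‖b n‖ₑ) i]
        rfl
    _ = _ := by rw [ENNReal.tsum_mul_right]; rfl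

lemma absSum_smul {a : ℤ → ℝ} (c : ℝ) (ha : absSum a ≠ ⊤) : absSum (c • a) ≠ ⊤ := by
  unfold absSum at *
  simp only [Pi.smul_apply, smul_eq_mul, enorm_mul]
  rw [ENNReal.tsum_mul_left]
  exact ENNReal.mul_ne_top (by simp) ha

lemma absSum_add {a b : ℤ → ℝ} (ha : absSum a ≠ ⊤) (hb : absSum b ≠ ⊤) : absSum (a + b) ≠ ⊤ := by
  refine ne_top_of_le_ne_top (ENNReal.add_ne_top.2 ⟨ha, hb⟩) ?_
  unfold absSum
  rw [← ENNReal.tsum_add]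
  exact ENNReal.tsum_le_tsum fun n => enorm_add_le _ _

lemma absSum_sub {a b : ℤ → ℝ} (ha : absSum a ≠ ⊤) (hb : absSum b ≠ ⊤) : absSum (a - b) ≠ ⊤ := by
  rw [sub_eq_add_neg]; exact absSum_add ha (absSum_neg hb)

lemma absSum_cosMul {x : ℤ → ℝ} (hx : absSum x ≠ ⊤) : absSum (cosMul x) ≠ ⊤ :=
  ne_top_of_le_ne_top (ENNReal.mul_ne_top (by simp) hx) (absSum_le_of_neighbours (enorm_cosMul_le x))

lemma absSum_profCoeff {x : ℤ → ℝ} (hx : absSum x ≠ ⊤) : absSum (profCoeff x) ≠ ⊤ :=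
  absSum_ne_top_of_freq (absSum_freq_profCoeff hx)

lemma bandS_eq (x : ℤ → ℝ) :
    band symS x = cosMul (freq (halfDiff x) - (4 : ℝ) • profCoeff x) := by
  have h : ∀ n : ℤ, symS n * (x (n + 1) - x (n - 1)) =
      (freq (halfDiff x) n - 4 * profCoeff x n) / 2 := by
    intro n
    rcases eq_or_ne n 0 with rfl | hn
    · simp [symS, freq, profCoeff]
    · have : (n : ℝ) ≠ 0 := by exact_mod_cast hn
      unfold symS freq halfDiff profCoeff; field_simp; ring
  ext k
  have h1 := h (k + 1)
  have h2 := h (k - 1)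
  rw [show k + 1 + 1 = k + 2 by ring, add_sub_cancel_right] at h1
  rw [sub_add_cancel, show k - 1 - 1 = k - 2 by ring] at h2
  simp only [band, cosMul, Pi.sub_apply, Pi.smul_apply, smul_eq_mul]
  rw [h1, h2]; ring

lemma bandR_eq (y : ℤ → ℝ) :
    band symR y = cosMul ((-8 : ℝ) • velCoeff y - (2 : ℝ) • velSecond y) := by
  have h : ∀ n : ℤ, symR n * (y (n + 1) - y (n - 1)) =
      (-8 * velCoeff y n - 2 * velSecond y n) / 2 := by
    intro n
    rcases eq_or_ne n 0 with rfl | hn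
    · simp [symR, velCoeff, velSecond]
    · have : (n : ℝ) ≠ 0 := by exact_mod_cast hn
      unfold symR velCoeff velSecond; field_simp; ring
  ext k
  have h1 := h (k + 1)
  have h2 := h (k - 1)
  rw [show k + 1 + 1 = k + 2 by ring, add_sub_cancel_right] at h1
  rw [sub_add_cancel, show k - 1 - 1 = k - 2 by ring] at h2
  simp only [band, cosMul, Pi.sub_apply, Pi.smul_apply, smul_eq_mul]
  rw [h1, h2]; ring

lemma absSum_velCoeff {x : ℤ → ℝ} (hx : absSum x ≠ ⊤) : absSum (velCoeff x) ≠ ⊤ :=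
  ne_top_of_le_ne_top (ENNReal.mul_ne_top (by simp) hx) (absSum_le_of_neighbours (enorm_velCoeff_le x))

lemma Adm.absSum_bandS {x : ℤ → ℝ} (hx : Adm x) : MHD1D.absSum (band symS x) ≠ ⊤ := by
  rw [bandS_eq]
  exact MHD1D.absSum_cosMul
    (absSum_sub hx.absSum_freq_halfDiff (absSum_smul _ (absSum_profCoeff hx.absSum)))

lemma absSum_bandR {x : ℤ → ℝ} (hx : absSum x ≠ ⊤) : absSum (band symR x) ≠ ⊤ := by
  rw [bandR_eq]
  exact absSum_cosMul (absSum_sub (absSum_smul _ (absSum_velCoeff hx)) (absSum_smul _ (absSum_velSecond hx)))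

lemma rhs_eq (x y : ℤ → ℝ) : rhs x y = band symS x + band symR y + (conv (primQuot x) (velSecond y)
    - conv (velQuot y) (cosMul x) - (1 / 2 : ℝ) • conv (freq x) (velCoeff y)) := by
  ext k
  simp only [rhs, bilin, bilinZero, bilinTransport, Pi.add_apply, Pi.sub_apply, Pi.smul_apply,
    smul_eq_mul]
  change _ = band symS x k + band symR y k + (conv (primQuot x) (velSecond y) k
    - conv (velQuot y) (cosMul x) k - 1 / 2 * conv (fun l => (l : ℝ) * x l) (velCoeff y) k)
  ring

lemma absSum_rhs {x y : ℤ → ℝ} (hx : Adm x) (hy : Adm y) : absSum (rhs x y) ≠ ⊤ := by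
  rw [rhs_eq]
  exact absSum_add (absSum_add hx.absSum_bandS (absSum_bandR hy.absSum)) (absSum_sub (absSum_sub
    (absSum_conv hx.absSum_primQuot hy.absSum_velSecond)
    (absSum_conv hy.absSum_velQuot hx.absSum_cosMul)) (absSum_smul _
    (absSum_conv hx.absSum_freq hy.absSum_velCoeff)))

/-- The right-hand side `{ξ / 2 + v(ζ), sin 2θ} + {ξ, v(ζ)}` for the profiles `ξ`, `ζ` with coefficients
`x`, `y`, with the derivatives written out as series. -/
def evol (x y : ℤ → ℝ) (θ : ℝ) : ℝ :=
  (profile x θ / 2 + profVel y θ) * (2 * Real.cos (2 * θ))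
    - Real.sin (2 * θ) * (Real.sin θ * sinS x θ / 2 + cosS (freq (velCoeff y)) θ / 2)
    + (profile x θ * (cosS (freq (velCoeff y)) θ / 2) - profVel y θ * (Real.sin θ * sinS x θ))

lemma Adm.sinS_rhs {x y : ℤ → ℝ} (hx : Adm x) (hy : Adm y) (θ : ℝ) :
    sinS (rhs x y) θ = Real.cos θ * (sinS (freq (halfDiff x)) θ - 4 * profile x θ)
      + Real.cos θ * (-8 * profVel y θ - 2 * sinS (velSecond y) θ)
      + (cosS (primQuot x) θ * sinS (velSecond y) θ - cosS (velQuot y) θ * (Real.cos θ * sinS x θ)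
        - 1 / 2 * (cosS (freq x) θ * profVel y θ)) := by
  have c1 := absSum_conv hx.absSum_primQuot hy.absSum_velSecond
  have c2 := absSum_conv hy.absSum_velQuot hx.absSum_cosMul
  have c3 := absSum_conv hx.absSum_freq hy.absSum_velCoeff
  have b1 := absSum_sub hx.absSum_freq_halfDiff (absSum_smul 4 (absSum_profCoeff hx.absSum))
  have b2 := absSum_sub (absSum_smul (-8) hy.absSum_velCoeff)
    (absSum_smul 2 hy.absSum_velSecond)
  rw [rhs_eq, sinS_add (absSum_add hx.absSum_bandS (absSum_bandR hy.absSum))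
    (absSum_sub (absSum_sub c1 c2) (absSum_smul _ c3)),
    sinS_add hx.absSum_bandS (absSum_bandR hy.absSum), sinS_sub (absSum_sub c1 c2) (absSum_smul _ c3),
    sinS_sub c1 c2, sinS_smul, bandS_eq, bandR_eq, ← cos_mul_sinS b1, ← cos_mul_sinS b2,
    sinS_sub hx.absSum_freq_halfDiff (absSum_smul 4 (absSum_profCoeff hx.absSum)),
    sinS_sub (absSum_smul (-8) hy.absSum_velCoeff) (absSum_smul 2 hy.absSum_velSecond),
    sinS_smul, sinS_smul, sinS_smul,
    ← cosS_mul_sinS hx.absSum_primQuot hy.absSum_velSecond primQuot_neg,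
    ← cosS_mul_sinS hy.absSum_velQuot hx.absSum_cosMul velQuot_neg,
    ← cosS_mul_sinS hx.absSum_freq hy.absSum_velCoeff (fun i => by
      unfold freq; rw [hx.odd]; push_cast; ring), ← cos_mul_sinS hx.absSum]
  rfl

lemma hasDerivAt_evol {x y : ℤ → ℝ} (hx : Adm x) (hy : Adm y) (θ : ℝ) :
    HasDerivAt (evol x y) (Real.sin θ * sinS (rhs x y) θ) θ := by
  have d1 := hasDerivAt_profile hx.toOddModes hx.absSum θ
  have d2 := hasDerivAt_profVel hy.absSum θ
  have d3 := hasDerivAt_deriv_profVel hy.absSum θ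
  have d4 : HasDerivAt (fun θ => Real.sin θ * sinS x θ)
      (Real.cos θ * sinS x θ + Real.sin θ * (cosS (freq x) θ / 2)) θ :=
    (Real.hasDerivAt_sin θ).mul (hasDerivAt_sinS hx.absSum_freq θ)
  have d5 : HasDerivAt (fun θ : ℝ => 2 * θ) 2 θ := by simpa using (hasDerivAt_id θ).const_mul 2
  have key := ((((d1.div_const 2).add d2).mul (d5.cos.const_mul 2)).sub
    (d5.sin.mul ((d4.div_const 2).add d3))).add ((d1.mul d3).sub (d2.mul d4))
  refine key.congr_deriv ?_
  rw [hx.sinS_rhs hy, ← neg_eq_iff_eq_neg.2 (hx.second_deriv θ)]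
  simp only [Pi.add_apply]
  rw [hx.profile_eq, hy.profVel_eq, Real.sin_two_mul]
  ring

lemma eq_of_hasDerivAt_eq {f g f' : ℝ → ℝ} (hf : ∀ θ, HasDerivAt f (f' θ) θ)
    (hg : ∀ θ, HasDerivAt g (f' θ) θ) (h0 : f 0 = g 0) : f = g := by
  ext θ
  have := is_const_of_deriv_eq_zero (f := fun θ => f θ - g θ)
    (fun θ => ((hf θ).sub (hg θ)).differentiableAt) (fun θ => by
      have := ((hf θ).fun_sub (hg θ)).deriv
      rw [this, sub_self]) θ 0
  linarith

lemma evol_periodic (x y : ℤ → ℝ) : Function.Periodic (evol x y) (2 * Real.pi) := fun θ => by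
  have e : 2 * (θ + 2 * Real.pi) = 2 * θ + (2 : ℕ) * (2 * Real.pi) := by push_cast; ring
  unfold evol profile profVel
  rw [sinS_periodic _ θ, sinS_periodic _ θ, sinS_periodic _ θ, cosS_periodic _ θ, Real.sin_add_two_pi,
    e, Real.cos_add_nat_mul_two_pi, Real.sin_add_nat_mul_two_pi]

lemma evol_zero (x y : ℤ → ℝ) : evol x y 0 = 0 := by
  simp [evol, profile, profVel, sinS_zero]

/-- The equations keep the absence of the modes of frequency `±1`: the coefficient in question is
the mean of the derivative of a periodic function. -/
lemma rhs_one {x y : ℤ → ℝ} (hx : Adm x) (hy : Adm y) : rhs x y 1 = 0 := by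
  set f := rhs x y with hf
  have hfa : absSum f ≠ ⊤ := absSum_rhs hx hy
  have hodd : ∀ k, f (-k) = -f k := rhs_neg hx.toOddModes hy.toOddModes
  have e : cosS (halfDiff f) = fun θ => cosS (freq (profCoeff f)) θ + f 1 := by
    ext θ
    have h1 : halfDiff f = freq (profCoeff f) + fun n => if n = 0 then f 1 else 0 := by
      ext n
      rcases eq_or_ne n 0 with rfl | hn
      · have : halfDiff f 0 = f 1 := by
          unfold halfDiff
          rw [zero_add, zero_sub, hodd]; ring
        rw [this]; simp [freq]
      · simp [freq_profCoeff_of_ne f hn, hn]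
    rw [h1]
    unfold cosS
    have h2 : ∀ n : ℤ, (freq (profCoeff f) + fun n : ℤ => if n = 0 then f 1 else 0) n * Real.cos (n * θ) =
        freq (profCoeff f) n * Real.cos (n * θ) + if n = 0 then f 1 else 0 := by
      intro n
      by_cases hn : n = 0
      · subst hn; simp
      · simp [hn]
    rw [tsum_congr h2, (summable_mul_cos (absSum_freq_profCoeff hfa) θ).tsum_add
      (hasSum_ite_eq 0 (f 1)).summable, tsum_ite_eq]
  have h1 : ∀ θ, HasDerivAt (fun θ => evol x y θ) (cosS (freq (profCoeff f)) θ / 2 + f 1 / 2) θ :=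
    fun θ => by
      have := hasDerivAt_evol hx hy θ
      rw [← hf, sin_mul_sinS hfa, e] at this
      exact this.congr_deriv (by ring)
  have h2 : ∀ θ, HasDerivAt (fun θ => profile f θ + θ * (f 1 / 2))
      (cosS (freq (profCoeff f)) θ / 2 + f 1 / 2) θ := fun θ =>
    ((hasDerivAt_sinS (absSum_freq_profCoeff hfa) θ).add
      ((hasDerivAt_id θ).mul_const (f 1 / 2))).congr_deriv (by ring)
  have h3 := eq_of_hasDerivAt_eq h1 h2 (by simp [evol_zero, profile, sinS_zero])
  have h4 := congrFun h3 (2 * Real.pi)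
  have h5 := evol_periodic x y 0
  have h6 := sinS_periodic (profCoeff f) 0
  rw [zero_add] at h5 h6
  simp only [profile] at h4
  rw [h5, h6, evol_zero, sinS_zero] at h4
  have := Real.pi_pos
  have h7 : Real.pi * f 1 = 0 := by linarith
  exact (mul_eq_zero.1 h7).resolve_left this.ne'

lemma oddModes_rhs {x y : ℤ → ℝ} (hx : Adm x) (hy : Adm y) : OddModes (rhs x y) :=
  ⟨rhs_neg hx.toOddModes hy.toOddModes, rhs_one hx hy⟩

/-- The right-hand side of the equation is again a profile, with coefficients `rhs x y`. -/
lemma evol_eq_profile {x y : ℤ → ℝ} (hx : Adm x) (hy : Adm y) : evol x y = profile (rhs x y) :=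
  eq_of_hasDerivAt_eq (hasDerivAt_evol hx hy)
    (fun θ => hasDerivAt_profile (oddModes_rhs hx hy) (absSum_rhs hx hy) θ)
    (by simp [evol_zero, profile, sinS_zero])

lemma profile_add {x y : ℤ → ℝ} (hx : absSum x ≠ ⊤) (hy : absSum y ≠ ⊤) (θ : ℝ) :
    profile (x + y) θ = profile x θ + profile y θ := by
  have e : profCoeff (x + y) = profCoeff x + profCoeff y := by
    ext n; simp only [profCoeff, Pi.add_apply]; ring
  unfold profile; rw [e, sinS_add (absSum_profCoeff hx) (absSum_profCoeff hy)]

lemma profile_smul (c : ℝ) (x : ℤ → ℝ) (θ : ℝ) : profile (c • x) θ = c * profile x θ := by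
  have e : profCoeff (c • x) = c • profCoeff x := by
    ext n; simp only [profCoeff, Pi.smul_apply, smul_eq_mul]; ring
  unfold profile; rw [e, sinS_smul]

lemma profile_sub {x y : ℤ → ℝ} (hx : absSum x ≠ ⊤) (hy : absSum y ≠ ⊤) (θ : ℝ) :
    profile (x - y) θ = profile x θ - profile y θ := by
  have e : profCoeff (x - y) = profCoeff x - profCoeff y := by
    ext n; simp only [profCoeff, Pi.sub_apply]; ring
  unfold profile; rw [e, sinS_sub (absSum_profCoeff hx) (absSum_profCoeff hy)]

lemma cosS_add {a b : ℤ → ℝ} (ha : absSum a ≠ ⊤) (hb : absSum b ≠ ⊤) (θ : ℝ) :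
    cosS (a + b) θ = cosS a θ + cosS b θ := by
  unfold cosS
  rw [← (summable_mul_cos ha θ).tsum_add (summable_mul_cos hb θ)]
  exact tsum_congr fun n => by simp only [Pi.add_apply]; ring

lemma cosS_smul (c : ℝ) (a : ℤ → ℝ) (θ : ℝ) : cosS (c • a) θ = c * cosS a θ := by
  unfold cosS
  rw [← tsum_mul_left]
  exact tsum_congr fun n => by simp only [Pi.smul_apply, smul_eq_mul]; ring

lemma hasDerivAt_sin_two_mul (θ : ℝ) :
    HasDerivAt (fun θ : ℝ => Real.sin (2 * θ)) (2 * Real.cos (2 * θ)) θ := by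
  have : HasDerivAt (fun θ : ℝ => 2 * θ) 2 θ := by simpa using (hasDerivAt_id θ).const_mul 2
  exact this.sin.congr_deriv (by ring)

/-- Change to the variables `η⁺ + η⁻` and `η⁺ - η⁻`: both equations of the system. -/
lemma system_profile {p q : ℤ → ℝ} (hp : Adm p) (hq : Adm q) :
    (∀ θ, opLplus (profile p) θ + nonlin₁ (profile p) (profile q) θ =
      profile ((1 / 2 : ℝ) • (rhs (p + q) (p - q) + rhs (p - q) (p + q))) θ) ∧
    ∀ θ, opLminus (profile q) θ + nonlin₂ (profile p) (profile q) θ =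
      profile ((1 / 2 : ℝ) • (rhs (p + q) (p - q) - rhs (p - q) (p + q))) θ := by
  have hs := hp.add hq
  have hd := hp.sub hq
  have hvp := velocity_profile hp.absSum
  have hvq := velocity_profile hq.absSum
  have vc : ∀ c : ℝ, velCoeff (p + c • q) = velCoeff p + c • velCoeff q := fun c => by
    rw [velCoeff_add, velCoeff_smul]
  have fvc : ∀ c : ℝ, freq (velCoeff (p + c • q)) = freq (velCoeff p) + c • freq (velCoeff q) :=
    fun c => by
      rw [vc]; ext n; simp only [freq, Pi.add_apply, Pi.smul_apply, smul_eq_mul]; ring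
  have f1 := absSum_ne_top_of_freq (absSum_freq_freq_velCoeff hp.absSum)
  have f2 := absSum_ne_top_of_freq (absSum_freq_freq_velCoeff hq.absSum)
  have lin : ∀ c θ, evol (p + c • q) (p + (-c) • q) θ =
      ((profile p θ + c * profile q θ) / 2 + (profVel p θ - c * profVel q θ)) * (2 * Real.cos (2 * θ))
      - Real.sin (2 * θ) * (Real.sin θ * (sinS p θ + c * sinS q θ) / 2
        + (cosS (freq (velCoeff p)) θ - c * cosS (freq (velCoeff q)) θ) / 2)
      + ((profile p θ + c * profile q θ) * ((cosS (freq (velCoeff p)) θ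
        - c * cosS (freq (velCoeff q)) θ) / 2)
        - (profVel p θ - c * profVel q θ) * (Real.sin θ * (sinS p θ + c * sinS q θ))) := by
    intro c θ
    unfold evol
    rw [profile_add hp.absSum (absSum_smul c hq.absSum), profile_smul,
      sinS_add hp.absSum (absSum_smul c hq.absSum), sinS_smul, fvc, cosS_add f1 (absSum_smul _ f2),
      cosS_smul]
    unfold profVel
    rw [vc, sinS_add (absSum_velCoeff hp.absSum) (absSum_smul _ (absSum_velCoeff hq.absSum)), sinS_smul]
    ring
  have l1 := lin 1
  have l2 := lin (-1)
  simp only [neg_neg, one_smul, neg_smul, ← sub_eq_add_neg] at l1 l2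
  rw [evol_eq_profile hs hd] at l1
  rw [evol_eq_profile hd hs] at l2
  have dp := fun θ => hasDerivAt_profile hp.toOddModes hp.absSum θ
  have dq := fun θ => hasDerivAt_profile hq.toOddModes hq.absSum θ
  have dvp := fun θ => hasDerivAt_profVel hp.absSum θ
  have dvq := fun θ => hasDerivAt_profVel hq.absSum θ
  constructor
  · intro θ
    rw [profile_smul, profile_add (absSum_rhs hs hd) (absSum_rhs hd hs), l1, l2]
    unfold opLplus nonlin₁ bracket
    rw [hvp, hvq, (hasDerivAt_sin_two_mul θ).deriv, (dp θ).deriv, (dq θ).deriv, (dvp θ).deriv,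
      (dvq θ).deriv, (((dp θ).div_const 2).fun_add (dvp θ)).deriv]
    ring
  · intro θ
    rw [profile_smul, profile_sub (absSum_rhs hs hd) (absSum_rhs hd hs), l1, l2]
    unfold opLminus nonlin₂ bracket
    rw [hvp, hvq, (hasDerivAt_sin_two_mul θ).deriv, (dp θ).deriv, (dq θ).deriv, (dvp θ).deriv,
      (dvq θ).deriv, (((dq θ).div_const 2).fun_sub (dvq θ)).deriv]
    ring

/-! ### Time derivatives of the coefficients -/

lemma bilin_zero_left (y : ℤ → ℝ) : bilin 0 y = 0 := by
  simpa using bilin_smul_left 0 0 y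

lemma rhs_eq_rhsLin (x y : ℤ → ℝ) : rhs x y = rhsLin 0 y x y := by
  unfold rhsLin
  rw [bilin_zero_left, add_zero]; rfl

lemma rhsLin_eq {x y u v : ℤ → ℝ} (hx : Adm x) (hy : Adm y) (hu : Adm u) (hv : Adm v) :
    rhsLin x y u v = (rhs (x + u) y - rhs x y) + (rhs x (y + v) - rhs x y) := by
  ext k
  have h1 := congrFun (band_add symS x u) k
  have h2 := congrFun (band_add symR y v) k
  have h3 := congrFun (bilin_add_left hx hu hy) k
  have h4 := congrFun (bilin_add_right hx hy hv) k
  simp only [Pi.add_apply] at h1 h2 h3 h4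
  simp only [rhsLin, rhs, Pi.add_apply, Pi.sub_apply, h1, h2, h3, h4]
  ring

lemma oddModes_rhsLin {x y u v : ℤ → ℝ} (hx : Adm x) (hy : Adm y) (hu : Adm u) (hv : Adm v) :
    OddModes (rhsLin x y u v) := by
  rw [rhsLin_eq hx hy hu hv]
  exact ((oddModes_rhs (hx.add hu) hy).sub (oddModes_rhs hx hy)).add
    ((oddModes_rhs hx (hy.add hv)).sub (oddModes_rhs hx hy))

lemma rhsLin_sub {x y u v x' y' u' v' : ℤ → ℝ} (hx : Adm x) (hy : Adm y) (hu : Adm u) (hv : Adm v)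
    (hx' : Adm x') (hy' : Adm y') (hu' : Adm u') (hv' : Adm v') :
    rhsLin x y u v - rhsLin x' y' u' v' =
      rhsLin x' y' (u - u') (v - v') + (bilin u (y - y') + bilin (x - x') v) := by
  unfold rhsLin
  rw [band_sub, band_sub, bilin_sub_left hu hu' hy', bilin_sub_right hx' hv hv',
    bilin_sub_right hu hy hy', bilin_sub_left hx hx' hv]
  abel

lemma rhsLin_smul (c : ℝ) (x y u v : ℤ → ℝ) : rhsLin x y (c • u) (c • v) = c • rhsLin x y u v := by
  unfold rhsLin
  rw [band_smul, band_smul, bilin_smul_left, bilin_smul_right]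
  simp only [smul_add]

lemma exists_sqNorm_bilin_pow_le (s : ℕ) (hs : 1 ≤ s) : ∃ C : ℝ≥0, ∀ x y : ℤ → ℝ,
    OddModes x → OddModes y → sqNorm (powWeight s) (bilin x y) ≤
      C * (sqNorm (powWeight (s + 1)) x * sqNorm (powWeight (s + 1)) y) := by
  obtain ⟨C, hC⟩ := exists_sqNorm_bilin_le s
  refine ⟨C * 2, fun x y hx hy => (hC _ (isWeight_powWeight s) x y hx hy).trans ?_⟩
  rw [raise_powWeight]
  calc _ ≤ (C : ℝ≥0∞) * (sqNorm (powWeight (s + 1)) x * sqNorm (powWeight (s + 1)) y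
        + sqNorm (powWeight (s + 1)) x * sqNorm (powWeight (s + 1)) y) := by
        gcongr <;> exact le_sqNorm_powWeight (by omega) _
    _ = _ := by push_cast; ring

lemma sqNorm_rhs_ne_top {s : ℕ} (hs : 1 ≤ s) {x y : ℤ → ℝ} (hx : OddModes x) (hy : OddModes y)
    (hx' : sqNorm (powWeight (s + 1)) x ≠ ⊤) (hy' : sqNorm (powWeight (s + 1)) y ≠ ⊤) :
    sqNorm (powWeight s) (rhs x y) ≠ ⊤ := by
  obtain ⟨C, hC⟩ := exists_sqNorm_rhsLin_le s hs
  rw [rhs_eq_rhsLin]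
  refine ne_top_of_le_ne_top ?_ (hC 0 y x y oddModes_zero hy hx hy)
  rw [sqNorm_zero]
  finiteness

lemma ContIn.rhs {s : ℕ} (hs : 1 ≤ s) {T : ℝ} {x y : ℝ → ℤ → ℝ} (hx : ContIn (s + 1) T x)
    (hy : ContIn (s + 1) T y) : ContIn s T (fun t => rhs (x t) (y t)) where
  modes t ht := oddModes_rhs (hx.adm (by omega) ht) (hy.adm (by omega) ht)
  finite t ht := sqNorm_rhs_ne_top hs (hx.modes t ht) (hy.modes t ht) (hx.finite t ht) (hy.finite t ht)
  tendsto t ht := ContIn.tendsto_rhs hs hx hy ht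

lemma ContIn.rhsLin {s : ℕ} (hs : 1 ≤ s) {T : ℝ} {x y u v : ℝ → ℤ → ℝ} (hx : ContIn (s + 1) T x)
    (hy : ContIn (s + 1) T y) (hu : ContIn (s + 1) T u) (hv : ContIn (s + 1) T v) :
    ContIn s T (fun t => rhsLin (x t) (y t) (u t) (v t)) := by
  have h2 : 2 ≤ s + 1 := by omega
  obtain ⟨C, hC⟩ := exists_sqNorm_rhsLin_le s hs
  obtain ⟨C', hC'⟩ := exists_sqNorm_bilin_pow_le s hs
  refine ⟨fun t ht => oddModes_rhsLin (hx.adm h2 ht) (hy.adm h2 ht) (hu.adm h2 ht) (hv.adm h2 ht),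
    fun t ht => ?_, fun t ht => ?_⟩
  · refine ne_top_of_le_ne_top ?_ (hC _ _ _ _ (hx.modes t ht) (hy.modes t ht) (hu.modes t ht)
      (hv.modes t ht))
    have := hx.finite t ht; have := hy.finite t ht; have := hu.finite t ht; have := hv.finite t ht
    finiteness
  · set X := sqNorm (powWeight (s + 1)) (x t)
    set Y := sqNorm (powWeight (s + 1)) (y t)
    set U := sqNorm (powWeight (s + 1)) (u t)
    set V := sqNorm (powWeight (s + 1)) (v t)
    have hX : X ≠ ⊤ := hx.finite t ht
    have hY : Y ≠ ⊤ := hy.finite t ht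
    have hU : U ≠ ⊤ := hu.finite t ht
    have hV : V ≠ ⊤ := hv.finite t ht
    have h0 : Tendsto (fun r => sqNorm (powWeight (s + 1)) (x r - x t)
        + sqNorm (powWeight (s + 1)) (y r - y t) + sqNorm (powWeight (s + 1)) (u r - u t)
        + sqNorm (powWeight (s + 1)) (v r - v t)) (𝓝[Icc 0 T] t) (𝓝 0) := by
      simpa using (((hx.tendsto t ht).add (hy.tendsto t ht)).add (hu.tendsto t ht)).add (hv.tendsto t ht)
    refine tendsto_zero_of_le_const_mul (A := 2 * (C * (1 + X + Y) + 2 * (C' * (2 * (1 + U))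
      + C' * (2 * (1 + V))))) (by finiteness) h0 ?_
    filter_upwards [hu.eventually_le ht, hv.eventually_le ht, self_mem_nhdsWithin] with r hru hrv hrs
    set dx := sqNorm (powWeight (s + 1)) (x r - x t)
    set dy := sqNorm (powWeight (s + 1)) (y r - y t)
    set du := sqNorm (powWeight (s + 1)) (u r - u t)
    set dv := sqNorm (powWeight (s + 1)) (v r - v t)
    have i1 : du + dv ≤ dx + dy + du + dv := by rw [add_assoc (dx + dy)]; exact le_add_self
    have i2 : dy ≤ dx + dy + du + dv := by rw [add_assoc, add_comm dx dy, add_assoc]; exact le_self_add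
    have i3 : dx ≤ dx + dy + du + dv := by rw [add_assoc, add_assoc]; exact le_self_add
    rw [rhsLin_sub (hx.adm h2 hrs) (hy.adm h2 hrs) (hu.adm h2 hrs) (hv.adm h2 hrs) (hx.adm h2 ht)
      (hy.adm h2 ht) (hu.adm h2 ht) (hv.adm h2 ht)]
    calc _ ≤ 2 * (C * (1 + X + Y) * (du + dv) + 2 * (C' * (2 * (1 + U) * dy) + C' * (dx * (2 * (1 + V))))) := by
          refine (sqNorm_add_le _ _ _).trans (mul_le_mul' le_rfl (add_le_add ?_ ?_))
          · exact hC _ _ _ _ (hx.modes t ht) (hy.modes t ht) ((hu.modes r hrs).sub (hu.modes t ht))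
              ((hv.modes r hrs).sub (hv.modes t ht))
          · refine (sqNorm_add_le _ _ _).trans (mul_le_mul' le_rfl (add_le_add ?_ ?_))
            · exact (hC' _ _ (hu.modes r hrs) ((hy.modes r hrs).sub (hy.modes t ht))).trans
                (mul_le_mul' le_rfl (mul_le_mul' hru le_rfl))
            · exact (hC' _ _ ((hx.modes r hrs).sub (hx.modes t ht)) (hv.modes r hrs)).trans
                (mul_le_mul' le_rfl (mul_le_mul' le_rfl hrv))
      _ ≤ 2 * (C * (1 + X + Y) * (dx + dy + du + dv) + 2 * (C' * (2 * (1 + U) * (dx + dy + du + dv))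
          + C' * ((dx + dy + du + dv) * (2 * (1 + V))))) :=
          mul_le_mul' le_rfl (add_le_add (mul_le_mul' le_rfl i1) (mul_le_mul' le_rfl (add_le_add
            (mul_le_mul' le_rfl (mul_le_mul' le_rfl i2)) (mul_le_mul' le_rfl (mul_le_mul' i3 le_rfl)))))
      _ = _ := by ring

/-- `f` is the derivative of `x` in time, in the norm of `h^s`. -/
def HasSeqDeriv (s : ℕ) (T : ℝ) (x f : ℝ → ℤ → ℝ) : Prop :=
  ∀ t ∈ Icc 0 T, Tendsto (fun r => sqNorm (powWeight s) ((r - t)⁻¹ • (x r - x t) - f t))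
    (𝓝[Icc 0 T \ {t}] t) (𝓝 0)

lemma sqNorm_le_of_trunc {w : ℕ → ℝ≥0} {z : ℤ → ℝ} {b : ℝ≥0∞} (h : ∀ L, sqNorm w (trunc L z) ≤ b) :
    sqNorm w z ≤ b := by
  refine sqNorm_le_of_tendsto (z := fun L => trunc L z) (fun k => ?_) (Eventually.of_forall h)
  refine tendsto_const_nhds.congr' ?_
  filter_upwards [eventually_ge_atTop k.natAbs] with L hL
  rw [trunc, if_pos hL]

/-- If the entries are differentiable and the entrywise derivative is continuous in `h^s`, it is
the derivative in `h^s`. -/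
lemma hasSeqDeriv_of_entries {s : ℕ} {T : ℝ} {x f : ℝ → ℤ → ℝ}
    (hd : ∀ t ∈ Icc 0 T, ∀ k, HasDerivWithinAt (fun r => x r k) (f t k) (Icc 0 T) t)
    (hf : ContIn s T f) : HasSeqDeriv s T x f := by
  intro t ht
  rw [ENNReal.tendsto_nhds_zero]
  intro ε' hε'
  obtain ⟨ε, hε0, hε⟩ := ENNReal.lt_iff_exists_nnreal_btwn.1 hε'
  have hev := ENNReal.tendsto_nhds_zero.1 (hf.tendsto t ht) ε hε0
  obtain ⟨δ, hδ, hball⟩ := Metric.mem_nhdsWithin_iff.1 hev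
  set S := Icc 0 T ∩ Metric.ball t δ with hS
  have hSc : Convex ℝ S := (convex_Icc 0 T).inter (convex_ball t δ)
  have htS : t ∈ S := ⟨ht, Metric.mem_ball_self hδ⟩
  have hmem : S \ {t} ∈ 𝓝[Icc 0 T \ {t}] t := by
    have h1 : Metric.ball t δ ∈ 𝓝[Icc 0 T \ {t}] t := mem_nhdsWithin_of_mem_nhds (Metric.ball_mem_nhds t hδ)
    filter_upwards [self_mem_nhdsWithin, h1] with r hr hr'
    exact ⟨⟨hr.1, hr'⟩, hr.2⟩
  filter_upwards [hmem] with r hr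
  refine le_trans ?_ hε.le
  have hrt : r - t ≠ 0 := sub_ne_zero.2 hr.2
  refine sqNorm_le_of_trunc fun L => ?_
  set q : ℝ → ℤ → ℝ := fun ρ => x ρ - x t - (ρ - t) • f t with hq
  set c := trunc L (q r) with hc
  have hcs : SupportedIn L c := supportedIn_trunc _ _
  set w := powWeight s
  set A := pairing w c c with hA
  have hA0 : 0 ≤ A := pairing_self_nonneg _ _
  have hpair : ∀ z : ℤ → ℝ, pairing w c z =
      ∑ k ∈ Finset.Icc (-(L : ℤ)) L, (w k.natAbs : ℝ) ^ 2 * c k * z k := fun z =>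
    tsum_eq_sum_of_supported fun k hk => by rw [hcs k hk]; ring
  have hder : ∀ ρ ∈ S, HasDerivWithinAt (fun ρ => pairing w c (q ρ)) (pairing w c (f ρ - f t)) S ρ := by
    intro ρ hρ
    simp_rw [hpair]
    refine HasDerivWithinAt.fun_sum fun k _ => HasDerivWithinAt.const_mul _ ?_
    have := ((hd ρ hρ.1 k).sub_const (x t k)).sub
      (((hasDerivWithinAt_id ρ (Icc 0 T)).sub_const t).mul_const (f t k))
    exact (this.mono inter_subset_left).congr_deriv (by simp)
  have hbound : ∀ ρ ∈ S, ‖pairing w c (f ρ - f t)‖ ≤ Real.sqrt (A * ε) := by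
    intro ρ hρ
    refine abs_le_of_enorm_sq_le (Real.sqrt_nonneg _) ((pairing_sq_le _ _ _).trans ?_)
    rw [Real.sq_sqrt (by positivity), ENNReal.ofReal_mul hA0, ← pairing_self w hcs,
      ENNReal.ofReal_coe_nnreal]
    exact mul_le_mul' le_rfl (hball ⟨hρ.2, hρ.1⟩)
  have hmv := hSc.norm_image_sub_le_of_norm_hasDerivWithin_le hder hbound htS hr.1
  have e1 : pairing w c (q r) = A := by
    rw [hA, hpair, hpair]
    refine Finset.sum_congr rfl fun k hk => ?_
    rw [Finset.mem_Icc] at hk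
    simp only [hc, trunc, if_pos (show k.natAbs ≤ L by omega)]
  have e2 : pairing w c (q t) = 0 := by
    have : q t = 0 := by simp [hq]
    rw [this]; simp [pairing]
  rw [e1, e2, sub_zero, Real.norm_eq_abs, abs_of_nonneg hA0, Real.norm_eq_abs] at hmv
  have hA2 : A ≤ ε * (r - t) ^ 2 := by
    rcases hA0.eq_or_lt with h | h
    · rw [← h]; positivity
    · have h1 : A ^ 2 ≤ A * ε * (r - t) ^ 2 := by
        calc A ^ 2 ≤ (Real.sqrt (A * ε) * |r - t|) ^ 2 := by gcongr
          _ = _ := by rw [mul_pow, Real.sq_sqrt (by positivity), sq_abs]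
      have : A * A ≤ A * (ε * (r - t) ^ 2) := by linarith
      exact le_of_mul_le_mul_left this h
  have e3 : trunc L ((r - t)⁻¹ • (x r - x t) - f t) = (r - t)⁻¹ • c := by
    ext k
    simp only [hc, trunc, hq, Pi.sub_apply, Pi.smul_apply, smul_eq_mul]
    split_ifs
    · field_simp
    · ring
  rw [e3, sqNorm_smul', pairing_self w hcs]
  calc _ ≤ ‖(r - t)⁻¹‖ₑ ^ 2 * ENNReal.ofReal (ε * (r - t) ^ 2) := by gcongr
    _ = ε := by
      rw [Real.enorm_eq_ofReal_abs, ← ENNReal.ofReal_pow (abs_nonneg _), ← ENNReal.ofReal_mul (by positivity),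
        sq_abs, ← ENNReal.ofReal_coe_nnreal]
      congr 1; field_simp

/-- The time derivative of the right-hand side. -/
lemma HasSeqDeriv.rhs {s : ℕ} (hs : 1 ≤ s) {T : ℝ} {x y f g : ℝ → ℤ → ℝ} (hx : ContIn (s + 1) T x)
    (hy : ContIn (s + 1) T y) (hf : ContIn (s + 1) T f) (hg : ContIn (s + 1) T g)
    (hxf : HasSeqDeriv (s + 1) T x f) (hyg : HasSeqDeriv (s + 1) T y g) :
    HasSeqDeriv s T (fun t => rhs (x t) (y t)) (fun t => rhsLin (x t) (y t) (f t) (g t)) := by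
  have h2 : 2 ≤ s + 1 := by omega
  obtain ⟨C, hC⟩ := exists_sqNorm_rhsLin_le s hs
  obtain ⟨C', hC'⟩ := exists_sqNorm_bilin_pow_le s hs
  intro t ht
  have hle : 𝓝[Icc 0 T \ {t}] t ≤ 𝓝[Icc 0 T] t := nhdsWithin_mono _ sdiff_subset
  set Dx : ℝ → ℤ → ℝ := fun r => (r - t)⁻¹ • (x r - x t)
  set Dy : ℝ → ℤ → ℝ := fun r => (r - t)⁻¹ • (y r - y t)
  have h0 : Tendsto (fun r => sqNorm (powWeight (s + 1)) (Dx r - f t)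
      + sqNorm (powWeight (s + 1)) (Dy r - g t) + sqNorm (powWeight (s + 1)) (y r - y t))
      (𝓝[Icc 0 T \ {t}] t) (𝓝 0) := by
    simpa using ((hxf t ht).add (hyg t ht)).add ((hy.tendsto t ht).mono_left hle)
  have hX := hx.finite t ht
  have hY := hy.finite t ht
  have hF := hf.finite t ht
  refine tendsto_zero_of_le_const_mul (A := 2 * (C * (1 + sqNorm (powWeight (s + 1)) (x t)
    + 2 * (1 + sqNorm (powWeight (s + 1)) (y t))) + C' * sqNorm (powWeight (s + 1)) (f t)))
    (by finiteness) h0 ?_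
  filter_upwards [hle (hy.eventually_le ht), self_mem_nhdsWithin] with r hry hrs
  have hr := hrs.1
  have aDx : Adm (Dx r) := ((hx.adm h2 hr).sub (hx.adm h2 ht)).smul _
  have aDy : Adm (Dy r) := ((hy.adm h2 hr).sub (hy.adm h2 ht)).smul _
  have key : (r - t)⁻¹ • (MHD1D.rhs (x r) (y r) - MHD1D.rhs (x t) (y t))
      - MHD1D.rhsLin (x t) (y t) (f t) (g t) =
      MHD1D.rhsLin (x t) (y r) (Dx r - f t) (Dy r - g t) + bilin (f t) (y r - y t) := by
    rw [rhs_sub' (hx.adm h2 hr) (hy.adm h2 hr) (hx.adm h2 ht) (hy.adm h2 ht), ← rhsLin_smul]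
    unfold MHD1D.rhsLin
    rw [band_sub, band_sub, bilin_sub_left aDx (hf.adm h2 ht) (hy.adm h2 hr),
      bilin_sub_right (hx.adm h2 ht) aDy (hg.adm h2 ht),
      bilin_sub_right (hf.adm h2 ht) (hy.adm h2 hr) (hy.adm h2 ht)]
    abel
  rw [key]
  set a := sqNorm (powWeight (s + 1)) (Dx r - f t)
  set b := sqNorm (powWeight (s + 1)) (Dy r - g t)
  set c := sqNorm (powWeight (s + 1)) (y r - y t)
  calc _ ≤ 2 * (C * (1 + sqNorm (powWeight (s + 1)) (x t) + 2 * (1 + sqNorm (powWeight (s + 1)) (y t)))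
        * (a + b) + C' * (sqNorm (powWeight (s + 1)) (f t) * c)) := by
        refine (sqNorm_add_le _ _ _).trans (mul_le_mul' le_rfl (add_le_add ?_ ?_))
        · exact (hC _ _ _ _ (hx.modes t ht) (hy.modes r hr) (aDx.toOddModes.sub (hf.modes t ht))
            (aDy.toOddModes.sub (hg.modes t ht))).trans
            (mul_le_mul' (mul_le_mul' le_rfl (add_le_add le_rfl hry)) le_rfl)
        · exact hC' _ _ (hf.modes t ht) ((hy.modes r hr).sub (hy.modes t ht))
    _ ≤ 2 * (C * (1 + sqNorm (powWeight (s + 1)) (x t) + 2 * (1 + sqNorm (powWeight (s + 1)) (y t)))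
        * (a + b + c) + C' * (sqNorm (powWeight (s + 1)) (f t) * (a + b + c))) :=
        mul_le_mul' le_rfl (add_le_add (mul_le_mul' le_rfl le_self_add)
          (mul_le_mul' le_rfl (mul_le_mul' le_rfl le_add_self)))
    _ = _ := by ring

lemma IsSeqSolution.hasDerivWithinAt_left {m : ℕ} (hm : 2 ≤ m) {T : ℝ} {u v : ℤ → ℝ}
    {x y : ℝ → ℤ → ℝ} (h : IsSeqSolution m T u v x y) {t : ℝ} (ht : t ∈ Icc 0 T) (k : ℤ) :
    HasDerivWithinAt (fun s => x s k) (rhs (x t) (y t) k) (Icc 0 T) t := by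
  rcases le_or_gt 2 k.natAbs with h2 | h2
  · exact (h.solves k.natAbs).deriv_left t ht k h2 le_rfl
  · rw [(oddModes_rhs (h.cont_left.adm hm ht) (h.cont_right.adm hm ht)).eq_zero' h2]
    simp_rw [fun s => ((h.solves 0).modes_left s).eq_zero' h2]
    exact hasDerivWithinAt_const _ _ _

lemma IsSeqSolution.symm {m : ℕ} {T : ℝ} {u v : ℤ → ℝ} {x y : ℝ → ℤ → ℝ}
    (h : IsSeqSolution m T u v x y) : IsSeqSolution m T v u y x :=
  ⟨h.init_right, h.init_left, h.cont_right, h.cont_left, fun L => (h.solves L).symm⟩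

/-- Two continuous time derivatives, each at the cost of one derivative in space. -/
lemma IsSeqSolution.exists_derivs {s : ℕ} (hs : 1 ≤ s) {T : ℝ} {u v : ℤ → ℝ}
    {x y : ℝ → ℤ → ℝ} (h : IsSeqSolution (s + 2) T u v x y) :
    ∃ x₁ x₂ : ℝ → ℤ → ℝ, ContIn (s + 1) T x₁ ∧ ContIn s T x₂ ∧ HasSeqDeriv (s + 1) T x x₁ ∧
      HasSeqDeriv s T x₁ x₂ ∧ x₁ = fun t => rhs (x t) (y t) := by
  have hx := h.cont_left
  have hy := h.cont_right
  have hf : ContIn (s + 1) T (fun t => rhs (x t) (y t)) := ContIn.rhs (by omega) hx hy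
  have hg : ContIn (s + 1) T (fun t => rhs (y t) (x t)) := ContIn.rhs (by omega) hy hx
  have hx' := hx.of_le (show s + 1 ≤ s + 2 by omega)
  have hy' := hy.of_le (show s + 1 ≤ s + 2 by omega)
  have d1 : HasSeqDeriv (s + 1) T x (fun t => rhs (x t) (y t)) :=
    hasSeqDeriv_of_entries (fun t ht k => h.hasDerivWithinAt_left (by omega) ht k) hf
  have d2 : HasSeqDeriv (s + 1) T y (fun t => rhs (y t) (x t)) :=
    hasSeqDeriv_of_entries (fun t ht k => h.symm.hasDerivWithinAt_left (by omega) ht k) hg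
  exact ⟨_, _, hf, ContIn.rhsLin hs hx' hy' hf hg, d1, HasSeqDeriv.rhs hs hx' hy' hf hg d1 d2, rfl⟩

/-! ### Fourier coefficients and weak derivatives -/

lemma neg_pi_lt_pi : -Real.pi < Real.pi := neg_lt_self Real.pi_pos

/-- The real part of `c e^{-inθ}`. -/
def wave (c : ℂ) (n : ℤ) (θ : ℝ) : ℝ := c.re * Real.cos (n * θ) + c.im * Real.sin (n * θ)

/-- The complex Fourier coefficient `(1 / 2π) ∫ f e^{-inθ}` over one period. -/
def fourierC (f : ℝ → ℝ) (n : ℤ) : ℂ := fourierCoeffOn neg_pi_lt_pi (fun θ => (f θ : ℂ)) n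

lemma contDiff_wave (c : ℂ) (n : ℤ) : ContDiff ℝ ∞ (wave c n) := by
  unfold wave; fun_prop

lemma wave_periodic (c : ℂ) (n : ℤ) : Function.Periodic (wave c n) (2 * Real.pi) := fun θ => by
  unfold wave
  rw [mul_add, Real.cos_add_int_mul_two_pi, Real.sin_add_int_mul_two_pi]

lemma deriv_wave (c : ℂ) (n : ℤ) : deriv (wave c n) = wave (c * -(Complex.I * n)) n := by
  ext θ
  have h : HasDerivAt (fun θ : ℝ => (n : ℝ) * θ) n θ := by
    simpa using (hasDerivAt_id θ).const_mul (n : ℝ)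
  have h2 := (h.cos.const_mul c.re).add (h.sin.const_mul c.im)
  have h3 : HasDerivAt (wave c n) (wave (c * -(Complex.I * n)) n θ) θ := by
    refine h2.congr_deriv ?_
    simp [wave]; ring
  exact h3.deriv

lemma iteratedDeriv_wave (k : ℕ) (c : ℂ) (n : ℤ) :
    iteratedDeriv k (wave c n) = wave (c * (-(Complex.I * n)) ^ k) n := by
  induction k generalizing c with
  | zero => simp
  | succ k ih => rw [iteratedDeriv_succ', deriv_wave, ih, pow_succ', mul_assoc]

lemma memL2_of_continuous {f : ℝ → ℝ} (hf : Continuous f) : MemL2 f := by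
  obtain ⟨C, hC⟩ := isCompact_Icc.exists_bound_of_continuousOn (s := Icc (-Real.pi) Real.pi)
    hf.continuousOn
  exact MemLp.of_bound hf.aestronglyMeasurable C
    ((ae_restrict_mem measurableSet_Ioc).mono fun θ hθ => hC θ (Ioc_subset_Icc_self hθ))

lemma MemL2.ofReal {f : ℝ → ℝ} (hf : MemL2 f) :
    MemLp (fun θ => (f θ : ℂ)) 2 (volume.restrict (Ioc (-Real.pi) Real.pi)) := MemLp.ofReal hf

lemma fourierC_eq (f : ℝ → ℝ) (n : ℤ) : fourierC f n =
    ((2 * Real.pi)⁻¹ : ℝ) * ∫ θ in Ioc (-Real.pi) Real.pi, Complex.exp (-(n * θ * Complex.I)) * f θ := by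
  rw [fourierC, fourierCoeffOn_eq_integral, intervalIntegral.integral_of_le neg_pi_lt_pi.le]
  have e : Real.pi - -Real.pi = 2 * Real.pi := by ring
  rw [e, one_div, Complex.real_smul]
  congr 1
  refine integral_congr_ae (ae_of_all _ fun θ => ?_)
  simp only [smul_eq_mul]
  congr 1
  have : (Real.pi : ℂ) ≠ 0 := by exact_mod_cast Real.pi_ne_zero
  rw [fourier_coe_apply]
  congr 1
  push_cast
  field_simp

lemma l2Inner_wave {f : ℝ → ℝ} (hf : MemL2 f) (c : ℂ) (n : ℤ) :
    l2Inner f (wave c n) = 2 * Real.pi * (c * fourierC f n).re := by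
  have hi : IntegrableOn (fun θ : ℝ => c * (Complex.exp (-(n * θ * Complex.I)) * f θ))
      (Ioc (-Real.pi) Real.pi) := by
    refine Integrable.const_mul ?_ c
    refine Integrable.bdd_mul (c := 1) (MemLp.integrable (by norm_num) hf.ofReal) ?_ ?_
    · exact Continuous.aestronglyMeasurable (by fun_prop)
    · refine ae_of_all _ fun θ => ?_
      rw [Complex.norm_exp]; simp
  rw [fourierC_eq, l2Inner, intervalIntegral.integral_of_le neg_pi_lt_pi.le]
  have e1 : c * (((2 * Real.pi : ℝ)⁻¹ : ℝ) * ∫ θ in Ioc (-Real.pi) Real.pi,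
      Complex.exp (-(n * θ * Complex.I)) * f θ) = ((2 * Real.pi : ℝ)⁻¹ : ℝ) *
      ∫ θ in Ioc (-Real.pi) Real.pi, c * (Complex.exp (-(n * θ * Complex.I)) * f θ) := by
    rw [integral_const_mul]; ring
  have e2 := integral_re hi
  simp only [RCLike.re_to_complex] at e2
  rw [e1, Complex.re_ofReal_mul, ← e2, ← mul_assoc, mul_inv_cancel₀ (by positivity), one_mul]
  refine integral_congr_ae (ae_of_all _ fun θ => ?_)
  simp only [wave]
  have : (-(n * θ * Complex.I) : ℂ) = ((-(n * θ) : ℝ) : ℂ) * Complex.I := by push_cast; ring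
  rw [this, Complex.exp_mul_I, ← Complex.ofReal_cos, ← Complex.ofReal_sin, Real.cos_neg, Real.sin_neg]
  generalize Real.cos (n * θ) = a
  generalize Real.sin (n * θ) = b
  simp; ring

/-- A complex number is determined by the real parts of its multiples. -/
lemma eq_of_re_mul_eq {a b : ℂ} (h : ∀ c : ℂ, (c * a).re = (c * b).re) : a = b := by
  apply Complex.ext
  · simpa using h 1
  · have := h Complex.I
    simpa using this

lemma l2Inner_add_left {f g h : ℝ → ℝ} (hf : MemL2 f) (hg : MemL2 g) (hh : MemL2 h) :
    l2Inner (f + g) h = l2Inner f h + l2Inner g h := by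
  unfold l2Inner
  have hfh := MemLp.integrable_mul hf hh
  have hgh := MemLp.integrable_mul hg hh
  simp only [intervalIntegral.integral_of_le neg_pi_lt_pi.le]
  refine Eq.trans ?_ (integral_add hfh hgh)
  refine integral_congr_ae (ae_of_all _ fun θ => ?_)
  simp only [Pi.add_apply]; exact add_mul _ _ _

lemma l2Inner_smul_left (c : ℝ) (f h : ℝ → ℝ) : l2Inner (c • f) h = c * l2Inner f h := by
  unfold l2Inner
  rw [← intervalIntegral.integral_const_mul]
  refine intervalIntegral.integral_congr fun θ _ => ?_
  simp only [Pi.smul_apply, smul_eq_mul]; ring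

lemma memL2_wave (c : ℂ) (n : ℤ) : MemL2 (wave c n) := memL2_of_continuous (contDiff_wave c n).continuous

lemma MemL2.add {f g : ℝ → ℝ} (hf : MemL2 f) (hg : MemL2 g) : MemL2 (f + g) := MemLp.add hf hg
lemma MemL2.smul {f : ℝ → ℝ} (c : ℝ) (hf : MemL2 f) : MemL2 (c • f) := MemLp.const_smul hf c

lemma fourierC_add {f g : ℝ → ℝ} (hf : MemL2 f) (hg : MemL2 g) (n : ℤ) :
    fourierC (f + g) n = fourierC f n + fourierC g n := by
  refine eq_of_re_mul_eq fun c => ?_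
  have := l2Inner_add_left hf hg (memL2_wave c n)
  rw [l2Inner_wave hf, l2Inner_wave hg, l2Inner_wave (hf.add hg), ← mul_add] at this
  rw [mul_add, Complex.add_re]
  exact mul_left_cancel₀ (by positivity) this

lemma fourierC_smul {f : ℝ → ℝ} (c : ℝ) (hf : MemL2 f) (n : ℤ) :
    fourierC (c • f) n = c * fourierC f n := by
  refine eq_of_re_mul_eq fun d => ?_
  have := l2Inner_smul_left c f (wave d n)
  rw [l2Inner_wave hf, l2Inner_wave (hf.smul c), mul_left_comm] at this
  rw [mul_left_comm, Complex.re_ofReal_mul]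
  exact mul_left_cancel₀ (by positivity) this

lemma l2Norm_sq (f : ℝ → ℝ) : l2Norm f ^ 2 = l2Inner f f := by
  rw [l2Norm, Real.sq_sqrt, l2Inner]
  · simp only [sq]
  · exact intervalIntegral.integral_nonneg neg_pi_lt_pi.le fun θ _ => sq_nonneg _

/-- Parseval's identity. -/
lemma MemL2.hasSum_sq {f : ℝ → ℝ} (hf : MemL2 f) :
    HasSum (fun n => 2 * Real.pi * ‖fourierC f n‖ ^ 2) (l2Norm f ^ 2) := by
  have h := (hasSum_sq_fourierCoeffOn neg_pi_lt_pi hf.ofReal).mul_left (2 * Real.pi)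
  have e : 2 * Real.pi * ((Real.pi - -Real.pi)⁻¹ •
      ∫ θ in (-Real.pi)..Real.pi, ‖(f θ : ℂ)‖ ^ 2) = l2Norm f ^ 2 := by
    have e1 : Real.pi - -Real.pi = 2 * Real.pi := by ring
    rw [e1, smul_eq_mul, ← mul_assoc, mul_inv_cancel₀ (by positivity), one_mul, l2Norm_sq, l2Inner]
    refine intervalIntegral.integral_congr fun θ _ => ?_
    simp [sq]
  rw [e] at h
  exact h

/-- Parseval's identity for the inner product. -/
lemma hasSum_l2Inner {f g : ℝ → ℝ} (hf : MemL2 f) (hg : MemL2 g) :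
    HasSum (fun n => 2 * Real.pi * (fourierC f n * starRingEnd ℂ (fourierC g n)).re) (l2Inner f g) := by
  have h1 := (hf.add hg).hasSum_sq
  have h := (h1.sub (hf.hasSum_sq.add hg.hasSum_sq)).mul_left (1 / 2)
  have comm : l2Inner g f = l2Inner f g := by
    unfold l2Inner
    exact intervalIntegral.integral_congr fun θ _ => mul_comm _ _
  have comm2 : ∀ h, l2Inner h (f + g) = l2Inner (f + g) h := fun h => by
    unfold l2Inner
    exact intervalIntegral.integral_congr fun θ _ => mul_comm _ _
  have e : 1 / 2 * (l2Norm (f + g) ^ 2 - (l2Norm f ^ 2 + l2Norm g ^ 2)) = l2Inner f g := by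
    rw [l2Norm_sq, l2Norm_sq, l2Norm_sq, l2Inner_add_left hf hg (hf.add hg), comm2, comm2,
      l2Inner_add_left hf hg hf, l2Inner_add_left hf hg hg, comm]
    ring
  rw [e] at h
  have e2 : ∀ n, 1 / 2 * (2 * Real.pi * ‖fourierC (f + g) n‖ ^ 2 - (2 * Real.pi * ‖fourierC f n‖ ^ 2 +
      2 * Real.pi * ‖fourierC g n‖ ^ 2)) =
      2 * Real.pi * (fourierC f n * starRingEnd ℂ (fourierC g n)).re := fun n => by
    rw [fourierC_add hf hg, ← Complex.normSq_eq_norm_sq, ← Complex.normSq_eq_norm_sq,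
      ← Complex.normSq_eq_norm_sq, Complex.normSq_add]
    ring
  simpa only [e2] using h

/-- Riesz–Fischer. -/
lemma exists_memL2_fourierC {c : ℤ → ℂ} (hc : ∀ n, c (-n) = starRingEnd ℂ (c n))
    (hs : Summable fun n => ‖c n‖ ^ 2) :
    ∃ g : ℝ → ℝ, Function.Periodic g (2 * Real.pi) ∧ MemL2 g ∧ ∀ n, fourierC g n = c n := by
  have : Fact (0 < 2 * Real.pi) := ⟨Real.two_pi_pos⟩
  have hmem : Memℓp c 2 := by
    rw [memℓp_gen_iff (by norm_num)]
    simpa using hs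
  set G : Lp ℂ 2 (@AddCircle.haarAddCircle (2 * Real.pi) _) := fourierBasis.repr.symm ⟨c, hmem⟩ with hG
  have hGc : ∀ n, fourierCoeff G n = c n := fun n => by
    rw [← fourierBasis_repr, hG, LinearIsometryEquiv.apply_symm_apply]
  set h : ℝ → ℂ := fun θ => G (θ : AddCircle (2 * Real.pi)) with hh
  have hhL : MemLp h 2 (volume.restrict (Ioc (-Real.pi) Real.pi)) := by
    have h1 : MemLp G 2 (volume : Measure (AddCircle (2 * Real.pi))) := (Lp.memLp G).of_haarAddCircle
    have h2 := AddCircle.measurePreserving_mk (2 * Real.pi) (-Real.pi)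
    have e : -Real.pi + 2 * Real.pi = Real.pi := by ring
    rw [e] at h2
    exact h1.comp_measurePreserving h2
  have hcoef : ∀ n : ℤ, (((2 * Real.pi)⁻¹ : ℝ) : ℂ) *
      ∫ θ in Ioc (-Real.pi) Real.pi, Complex.exp (-(n * θ * Complex.I)) * h θ = c n := fun n => by
    rw [← hGc, fourierCoeff_eq_intervalIntegral _ _ (-Real.pi)]
    have e : -Real.pi + 2 * Real.pi = Real.pi := by ring
    rw [e, intervalIntegral.integral_of_le neg_pi_lt_pi.le, one_div, Complex.real_smul]
    congr 1
    refine integral_congr_ae (ae_of_all _ fun θ => ?_)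
    simp only [smul_eq_mul, hh]
    congr 1
    have : (Real.pi : ℂ) ≠ 0 := by exact_mod_cast Real.pi_ne_zero
    rw [fourier_coe_apply]
    congr 1
    push_cast
    field_simp
  have hint : ∀ n : ℤ, IntegrableOn (fun θ : ℝ => Complex.exp (-(n * θ * Complex.I)) * h θ)
      (Ioc (-Real.pi) Real.pi) := fun n => by
    refine Integrable.bdd_mul (c := 1) (hhL.integrable (by norm_num)) ?_ ?_
    · exact Continuous.aestronglyMeasurable (by fun_prop)
    · refine ae_of_all _ fun θ => ?_
      rw [Complex.norm_exp]; simp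
  refine ⟨fun θ => (h θ).re, fun θ => ?_, hhL.re, fun n => ?_⟩
  · simp only [hh, AddCircle.coe_add_period]
  · -- the real part has the coefficients `(c n + conj (c (-n))) / 2`
    have e : ∀ θ : ℝ, Complex.exp (-(n * θ * Complex.I)) * (((h θ).re : ℝ) : ℂ) =
        2⁻¹ * (Complex.exp (-(n * θ * Complex.I)) * h θ +
          starRingEnd ℂ (Complex.exp (-((-n : ℤ) * θ * Complex.I)) * h θ)) := fun θ => by
      rw [Complex.re_eq_add_conj, map_mul, ← Complex.exp_conj]
      simp; ring
    have hint' : IntegrableOn (fun θ : ℝ => starRingEnd ℂ (Complex.exp (-((-n : ℤ) * θ * Complex.I)) * h θ))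
        (Ioc (-Real.pi) Real.pi) :=
      (LinearIsometryEquiv.integrable_comp_iff Complex.conjLIE).2 (hint (-n))
    rw [fourierC_eq]
    simp_rw [e]
    rw [integral_const_mul, integral_add (hint n) hint', integral_conj]
    have h1 := hcoef n
    have h2 := congrArg (starRingEnd ℂ) (hcoef (-n))
    rw [hc, Complex.conj_conj, map_mul] at h2
    rw [Complex.conj_ofReal] at h2
    linear_combination (1 / 2 : ℂ) * h1 + (1 / 2 : ℂ) * h2

lemma Periodic_deriv {f : ℝ → ℝ} {c : ℝ} (hf : Function.Periodic f c) : Function.Periodic (deriv f) c :=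
  fun θ => by rw [← deriv_comp_add_const]; congr 1; exact funext hf

lemma fourierC_deriv {φ : ℝ → ℝ} (hφ : ContDiff ℝ 1 φ) (hp : Function.Periodic φ (2 * Real.pi)) (n : ℤ) :
    fourierC (deriv φ) n = Complex.I * n * fourierC φ n := by
  have hc := (hφ.continuous_deriv le_rfl)
  refine eq_of_re_mul_eq fun c => ?_
  have h1 := l2Inner_wave (memL2_of_continuous hc) c n
  have h2 := l2Inner_wave (memL2_of_continuous hφ.continuous) (c * -(Complex.I * n)) n
  rw [← deriv_wave] at h2
  have h3 : l2Inner (deriv φ) (wave c n) = -l2Inner φ (deriv (wave c n)) := by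
    have hw := contDiff_wave c n
    have := intervalIntegral.integral_deriv_mul_eq_sub (a := -Real.pi) (b := Real.pi)
      (u := φ) (v := wave c n) (u' := deriv φ) (v' := deriv (wave c n))
      (fun θ _ => (hφ.differentiable (by simp) θ).hasDerivAt)
      (fun θ _ => (hw.differentiable (by simp) θ).hasDerivAt)
      (hc.intervalIntegrable _ _) ((hw.continuous_deriv (by simp)).intervalIntegrable _ _)
    have e : wave c n Real.pi = wave c n (-Real.pi) := by
      rw [← wave_periodic c n (-Real.pi)]; congr 1; ring
    have e' : φ Real.pi = φ (-Real.pi) := by rw [← hp (-Real.pi)]; congr 1; ring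
    rw [e, e', sub_self, intervalIntegral.integral_add] at this
    · unfold l2Inner; linarith
    · exact (hc.mul hw.continuous).intervalIntegrable _ _
    · exact (hφ.continuous.mul (hw.continuous_deriv (by simp))).intervalIntegrable _ _
  rw [h1, h2] at h3
  have h4 : 2 * Real.pi * (c * fourierC (deriv φ) n).re =
      2 * Real.pi * -(c * -(Complex.I * n) * fourierC φ n).re := by linarith
  rw [mul_left_cancel₀ (by positivity) h4, ← Complex.neg_re]
  congr 1; ring

lemma periodic_iteratedDeriv {φ : ℝ → ℝ} {c : ℝ} (hp : Function.Periodic φ c) (k : ℕ) :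
    Function.Periodic (iteratedDeriv k φ) c := by
  induction k with
  | zero => simpa using hp
  | succ k ih => rw [iteratedDeriv_succ]; exact Periodic_deriv ih

lemma fourierC_iteratedDeriv {φ : ℝ → ℝ} (hφ : ContDiff ℝ ∞ φ) (hp : Function.Periodic φ (2 * Real.pi))
    (k : ℕ) (n : ℤ) : fourierC (iteratedDeriv k φ) n = (Complex.I * n) ^ k * fourierC φ n := by
  induction k with
  | zero => simp
  | succ k ih =>
    have h : ContDiff ℝ ((1 + k : ℕ) : WithTop ℕ∞) φ := hφ.of_le (by exact_mod_cast le_top)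
    have h' := h.iterate_deriv' 1 k
    rw [← iteratedDeriv_eq_iterate] at h'
    rw [iteratedDeriv_succ, fourierC_deriv (by exact_mod_cast h') (periodic_iteratedDeriv hp k), ih, pow_succ']
    ring

/-- The Fourier coefficients of a weak derivative. -/
lemma IsWeakDeriv.fourierC_eq {k : ℕ} {f g : ℝ → ℝ} (hf : MemL2 f) (h : IsWeakDeriv k f g) (n : ℤ) :
    fourierC g n = (Complex.I * n) ^ k * fourierC f n := by
  refine eq_of_re_mul_eq fun c => ?_
  have h1 := h.integral_eq (wave c n) (contDiff_wave c n) (wave_periodic c n)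
  rw [iteratedDeriv_wave, l2Inner_wave hf, l2Inner_wave h.memL2] at h1
  have h2 : ((-1 : ℝ) ^ k) * (-1) ^ k = 1 := by rw [← mul_pow]; norm_num
  have e : c * (-(Complex.I * n)) ^ k * fourierC f n =
      ((-1 : ℝ) ^ k : ℝ) * (c * ((Complex.I * n) ^ k * fourierC f n)) := by
    rw [neg_pow]; push_cast; ring
  rw [e, Complex.re_ofReal_mul] at h1
  have h3 : 2 * Real.pi * (c * fourierC g n).re =
      2 * Real.pi * (c * ((Complex.I * n) ^ k * fourierC f n)).re := by
    linear_combination (-(-1 : ℝ) ^ k) * h1 + (2 * Real.pi * (c * ((Complex.I * n) ^ k * fourierC f n)).re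
      - 2 * Real.pi * (c * fourierC g n).re) * h2
  exact mul_left_cancel₀ (by positivity) h3

lemma isWeakDeriv_of_fourierC {k : ℕ} {f g : ℝ → ℝ} (hf : MemL2 f) (hgp : Function.Periodic g (2 * Real.pi))
    (hg : MemL2 g) (h : ∀ n, fourierC g n = (Complex.I * n) ^ k * fourierC f n) : IsWeakDeriv k f g := by
  refine ⟨hgp, hg, fun φ hφ hp => ?_⟩
  have hφ' : Continuous (iteratedDeriv k φ) := hφ.continuous_iteratedDeriv k (by exact_mod_cast le_top)
  have h1 := hasSum_l2Inner hf (memL2_of_continuous hφ')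
  have h2 := (hasSum_l2Inner hg (memL2_of_continuous hφ.continuous)).mul_left ((-1) ^ k)
  refine (h1.tsum_eq.symm.trans (tsum_congr fun n => ?_)).trans h2.tsum_eq
  have e : fourierC f n * starRingEnd ℂ (fourierC (iteratedDeriv k φ) n) =
      ((-1 : ℝ) ^ k : ℝ) * (fourierC g n * starRingEnd ℂ (fourierC φ n)) := by
    rw [h, fourierC_iteratedDeriv hφ hp, map_mul, map_pow, map_mul, Complex.conj_I, map_intCast, neg_mul,
      neg_pow]
    push_cast; ring
  rw [e, Complex.re_ofReal_mul]; ring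

/-- The Fourier symbol `∑_{k ≤ m} n^{2k}` of the squared `H^m` norm. -/
def sobSymbol (m : ℕ) (n : ℤ) : ℝ := ∑ k ∈ Finset.range (m + 1), (n : ℝ) ^ (2 * k)

lemma norm_I_mul_pow_sq (k : ℕ) (n : ℤ) (z : ℂ) :
    ‖(Complex.I * n) ^ k * z‖ ^ 2 = (n : ℝ) ^ (2 * k) * ‖z‖ ^ 2 := by
  rw [norm_mul, norm_pow, norm_mul, Complex.norm_I, one_mul, Complex.norm_intCast, mul_pow, ← pow_mul,
    mul_comm k 2, pow_mul, sq_abs, ← pow_mul]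

lemma MemH.hasSum_hNorm_sq {m : ℕ} {f : ℝ → ℝ} (h : MemH m f) :
    HasSum (fun n => 2 * Real.pi * (sobSymbol m n * ‖fourierC f n‖ ^ 2)) (hNorm m f ^ 2) := by
  have hk : ∀ k ∈ Finset.range (m + 1),
      HasSum (fun n : ℤ => 2 * Real.pi * ((n : ℝ) ^ (2 * k) * ‖fourierC f n‖ ^ 2))
        (l2Norm (weakDeriv k f) ^ 2) := fun k hk => by
    have hex := h.exists_weakDeriv k (by simpa [Nat.lt_succ_iff] using hk)
    have hw : IsWeakDeriv k f (weakDeriv k f) := by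
      unfold weakDeriv; rw [dif_pos hex]; exact hex.choose_spec
    have := hw.memL2.hasSum_sq
    simp only [hw.fourierC_eq h.memL2, norm_I_mul_pow_sq] at this
    exact this
  have := hasSum_sum hk
  rw [hNorm, Real.sq_sqrt (Finset.sum_nonneg fun _ _ => sq_nonneg _)]
  convert this using 1
  ext n
  rw [sobSymbol, Finset.sum_mul, Finset.mul_sum]

lemma conj_fourierC {f : ℝ → ℝ} (hf : MemL2 f) (n : ℤ) :
    fourierC f (-n) = starRingEnd ℂ (fourierC f n) := by
  refine eq_of_re_mul_eq fun c => ?_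
  have h1 := l2Inner_wave hf c (-n)
  have h2 := l2Inner_wave hf (starRingEnd ℂ c) n
  have e : wave c (-n) = wave (starRingEnd ℂ c) n := by
    ext θ; simp [wave]
  rw [e, h2] at h1
  have := mul_left_cancel₀ (by positivity) h1
  rw [← this, ← Complex.conj_re, map_mul, Complex.conj_conj]

lemma memH_of_summable {m : ℕ} {f : ℝ → ℝ} (hp : Function.Periodic f (2 * Real.pi)) (hf : MemL2 f)
    (hs : Summable fun n => sobSymbol m n * ‖fourierC f n‖ ^ 2) : MemH m f := by
  refine ⟨hp, hf, fun k hk => ?_⟩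
  obtain ⟨g, hgp, hg, hgc⟩ := exists_memL2_fourierC (c := fun n => (Complex.I * n) ^ k * fourierC f n)
    (fun n => by rw [conj_fourierC hf, map_mul, map_pow, map_mul, Complex.conj_I, map_intCast]; push_cast; ring)
    (by
      refine Summable.of_nonneg_of_le (fun n => sq_nonneg _) (fun n => ?_) hs
      rw [norm_I_mul_pow_sq, sobSymbol]
      refine mul_le_mul_of_nonneg_right ?_ (sq_nonneg _)
      exact Finset.single_le_sum (f := fun k => (n : ℝ) ^ (2 * k))
        (fun j _ => by rw [pow_mul]; positivity) (Finset.mem_range.2 (by omega)))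
  exact ⟨g, isWeakDeriv_of_fourierC hf hgp hg hgc⟩

lemma MemH.add {m : ℕ} {f g : ℝ → ℝ} (hf : MemH m f) (hg : MemH m g) : MemH m (f + g) := by
  refine ⟨hf.periodic.add hg.periodic, hf.memL2.add hg.memL2, fun k hk => ?_⟩
  obtain ⟨f', hf'⟩ := hf.exists_weakDeriv k hk
  obtain ⟨g', hg'⟩ := hg.exists_weakDeriv k hk
  refine ⟨f' + g', isWeakDeriv_of_fourierC (hf.memL2.add hg.memL2) (hf'.periodic.add hg'.periodic)
    (hf'.memL2.add hg'.memL2) fun n => ?_⟩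
  rw [fourierC_add hf'.memL2 hg'.memL2, fourierC_add hf.memL2 hg.memL2, hf'.fourierC_eq hf.memL2,
    hg'.fourierC_eq hg.memL2, mul_add]

lemma MemH.smul {m : ℕ} {f : ℝ → ℝ} (c : ℝ) (hf : MemH m f) : MemH m (c • f) := by
  refine ⟨fun θ => by simp only [Pi.smul_apply, hf.periodic θ], hf.memL2.smul c, fun k hk => ?_⟩
  obtain ⟨f', hf'⟩ := hf.exists_weakDeriv k hk
  refine ⟨c • f', isWeakDeriv_of_fourierC (hf.memL2.smul c)
    (fun θ => by simp only [Pi.smul_apply, hf'.periodic θ]) (hf'.memL2.smul c) fun n => ?_⟩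
  rw [fourierC_smul c hf'.memL2, fourierC_smul c hf.memL2, hf'.fourierC_eq hf.memL2]
  ring

/-! ### States as sequences of sine coefficients -/

lemma integral_cos_int (n : ℤ) :
    ∫ θ in (-Real.pi)..Real.pi, Real.cos (n * θ) = if n = 0 then 2 * Real.pi else 0 := by
  split_ifs with h
  · subst h; simp; ring
  · have hn' : (n : ℝ) ≠ 0 := by exact_mod_cast h
    rw [intervalIntegral.integral_comp_mul_left (fun y => Real.cos y) hn', integral_cos]
    simp [Real.sin_int_mul_pi]

lemma integral_sin_int (n : ℤ) : ∫ θ in (-Real.pi)..Real.pi, Real.sin (n * θ) = 0 := by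
  rcases eq_or_ne n 0 with rfl | h
  · simp
  · have hn' : (n : ℝ) ≠ 0 := by exact_mod_cast h
    rw [intervalIntegral.integral_comp_mul_left (fun y => Real.sin y) hn', integral_sin]
    simp

lemma integral_sin_mul_wave (c : ℂ) (k n : ℤ) :
    ∫ θ in (-Real.pi)..Real.pi, Real.sin (k * θ) * wave c n θ =
      c.im * Real.pi * ((if k = n then 1 else 0) - (if k = -n then 1 else 0)) := by
  have e : ∀ θ : ℝ, Real.sin (k * θ) * wave c n θ =
      (c.re / 2 * Real.sin ((k + n : ℤ) * θ) + c.re / 2 * Real.sin ((k - n : ℤ) * θ)) +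
      (c.im / 2 * Real.cos ((k - n : ℤ) * θ) - c.im / 2 * Real.cos ((k + n : ℤ) * θ)) := fun θ => by
    push_cast
    rw [add_mul, sub_mul, Real.sin_add, Real.sin_sub, Real.cos_add, Real.cos_sub, wave]; ring
  simp_rw [e]
  rw [intervalIntegral.integral_add, intervalIntegral.integral_add, intervalIntegral.integral_sub]
  · simp only [intervalIntegral.integral_const_mul, integral_sin_int, integral_cos_int, sub_eq_zero,
      add_eq_zero_iff_eq_neg]
    split_ifs <;> ring
  all_goals exact Continuous.intervalIntegrable (by fun_prop) _ _

lemma fourierC_sinS {x : ℤ → ℝ} (hodd : ∀ k, x (-k) = -x k) (ha : absSum x ≠ ⊤) (n : ℤ) :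
    fourierC (sinS x) n = -(Complex.I / 2) * x n := by
  refine eq_of_re_mul_eq fun c => ?_
  have hc := (contDiff_wave c n).continuous
  have hb : ∀ (k : ℤ) (θ : ℝ), ‖x k / 2 * (Real.sin (k * θ) * wave c n θ)‖ ≤ (|c.re| + |c.im|) * |x k| :=
    fun k θ => by
    have h1 : |wave c n θ| ≤ |c.re| + |c.im| := by
      refine (abs_add_le _ _).trans ?_
      rw [abs_mul, abs_mul]
      exact add_le_add (mul_le_of_le_one_right (abs_nonneg _) (Real.abs_cos_le_one _))
        (mul_le_of_le_one_right (abs_nonneg _) (Real.abs_sin_le_one _))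
    rw [Real.norm_eq_abs, abs_mul, abs_mul, abs_div, abs_two, mul_comm _ |x k|]
    have h2 : |Real.sin (k * θ)| * |wave c n θ| ≤ 1 * (|c.re| + |c.im|) :=
      mul_le_mul (Real.abs_sin_le_one _) h1 (abs_nonneg _) zero_le_one
    have h3 := abs_nonneg (x k)
    refine mul_le_mul (by linarith) (by linarith) (by positivity) h3
  have hs : Summable fun k => (|c.re| + |c.im|) * |x k| := (summable_abs_of_absSum ha).mul_left _
  have h := intervalIntegral.hasSum_integral_of_dominated_convergence (a := -Real.pi) (b := Real.pi)
    (μ := volume) (F := fun (k : ℤ) θ => x k / 2 * (Real.sin (k * θ) * wave c n θ))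
    (f := fun θ => sinS x θ * wave c n θ)
    (fun k _ => (|c.re| + |c.im|) * |x k|)
    (fun k => Continuous.aestronglyMeasurable (by fun_prop))
    (fun k => Eventually.of_forall fun θ _ => hb k θ)
    (Eventually.of_forall fun _ _ => hs) (by simp)
    (Eventually.of_forall fun θ _ => by
      have := ((summable_mul_sin ha θ).hasSum.mul_right (wave c n θ / 2))
      have e : sinS x θ * wave c n θ = (∑' k : ℤ, x k * Real.sin (k * θ)) * (wave c n θ / 2) := by
        unfold sinS; ring
      have e2 : (fun k : ℤ => x k * Real.sin (k * θ) * (wave c n θ / 2)) =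
          fun k : ℤ => x k / 2 * (Real.sin (k * θ) * wave c n θ) := by ext k; ring
      rw [e, ← e2]; exact this)
  have h1 := l2Inner_wave (memL2_of_continuous (continuous_sinS ha)) c n
  rw [l2Inner, ← h.tsum_eq] at h1
  have h2 : ∀ k : ℤ, (∫ θ in (-Real.pi)..Real.pi, x k / 2 * (Real.sin (k * θ) * wave c n θ)) =
      (if k = n then x n / 2 * (c.im * Real.pi) else 0) + if k = -n then x n / 2 * (c.im * Real.pi) else 0 :=
    fun k => by
    rw [intervalIntegral.integral_const_mul, integral_sin_mul_wave]
    by_cases h1 : k = n <;> by_cases h2 : k = -n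
    · have : x n = 0 := by have := hodd n; rw [← h2, h1] at this; linarith
      simp [h1, ← h2, this]
    · rw [if_pos h1, if_neg h2, if_pos h1, if_neg h2, h1]; ring
    · rw [if_neg h1, if_pos h2, if_neg h1, if_pos h2, h2, hodd]; ring
    · simp [h1, h2]
  rw [tsum_congr h2, Summable.tsum_add, tsum_ite_eq, tsum_ite_eq] at h1
  · have h3 : 2 * Real.pi * (c * fourierC (sinS x) n).re =
        2 * Real.pi * (c * (-(Complex.I / 2) * x n)).re := by
      rw [← h1]; simp; ring
    exact mul_left_cancel₀ (by positivity) h3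
  · exact (hasSum_ite_eq _ _).summable
  · exact (hasSum_ite_eq _ _).summable

/-- The sine coefficients of `2 √π u` in the normalisation of `sinS`; the factor removes the one in
`weighted`. -/
def sineModes (u : ℝ → ℝ) (n : ℤ) : ℝ := -(4 * Real.sqrt Real.pi) * (fourierC u n).im

/-- The odd function `u` with `sineModes u = x`. -/
def sineFun (x : ℤ → ℝ) : ℝ → ℝ := (2 * Real.sqrt Real.pi)⁻¹ • sinS x

lemma continuous_sineFun {x : ℤ → ℝ} (ha : absSum x ≠ ⊤) : Continuous (sineFun x) :=
  (continuous_sinS ha).const_smul _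

lemma sineFun_smul (c : ℝ) (x : ℤ → ℝ) : sineFun (c • x) = c • sineFun x := by
  ext θ; simp only [sineFun, Pi.smul_apply, sinS_smul, smul_eq_mul]; ring

lemma sineFun_periodic (x : ℤ → ℝ) : Function.Periodic (sineFun x) (2 * Real.pi) := fun θ => by
  simp only [sineFun, Pi.smul_apply, sinS_periodic x θ]

lemma fourierC_sineFun {x : ℤ → ℝ} (hodd : ∀ k, x (-k) = -x k) (ha : absSum x ≠ ⊤) (n : ℤ) :
    fourierC (sineFun x) n = ((-(4 * Real.sqrt Real.pi)⁻¹ * x n : ℝ) : ℂ) * Complex.I := by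
  rw [sineFun, fourierC_smul _ (memL2_of_continuous (continuous_sinS ha)), fourierC_sinS hodd ha]
  push_cast
  rw [mul_inv, mul_inv]
  ring

lemma norm_fourierC_sineFun_sq {x : ℤ → ℝ} (hodd : ∀ k, x (-k) = -x k) (ha : absSum x ≠ ⊤) (n : ℤ) :
    ‖fourierC (sineFun x) n‖ ^ 2 = x n ^ 2 / (16 * Real.pi) := by
  rw [fourierC_sineFun hodd ha, norm_mul, Complex.norm_I, mul_one, Complex.norm_real, Real.norm_eq_abs,
    sq_abs, mul_pow, neg_sq, inv_pow, mul_pow, Real.sq_sqrt Real.pi_pos.le]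
  have := Real.pi_pos
  field_simp
  ring

lemma sineModes_sineFun {x : ℤ → ℝ} (hodd : ∀ k, x (-k) = -x k) (ha : absSum x ≠ ⊤) :
    sineModes (sineFun x) = x := by
  ext n
  have := Real.sqrt_pos.2 Real.pi_pos
  rw [sineModes, fourierC_sineFun hodd ha, Complex.im_ofReal_mul, Complex.I_im]
  field_simp

lemma sineModes_neg {u : ℝ → ℝ} (hu : MemL2 u) (n : ℤ) : sineModes u (-n) = -sineModes u n := by
  unfold sineModes; rw [conj_fourierC hu, Complex.conj_im]; ring

lemma sineModes_add {u v : ℝ → ℝ} (hu : MemL2 u) (hv : MemL2 v) :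
    sineModes (u + v) = sineModes u + sineModes v := by
  ext n
  simp only [sineModes, Pi.add_apply, fourierC_add hu hv, Complex.add_im]; ring

lemma sineModes_smul {u : ℝ → ℝ} (c : ℝ) (hu : MemL2 u) : sineModes (c • u) = c • sineModes u := by
  ext n
  simp only [sineModes, Pi.smul_apply, fourierC_smul c hu, Complex.im_ofReal_mul, smul_eq_mul]; ring

/-- Equivalence of the two Sobolev weights, in the direction that needs a constant. -/
lemma pow_weight_le_sobSymbol {s m : ℕ} (h : s ≤ m) (n : ℤ) :
    (((n.natAbs : ℝ) + 1) ^ s) ^ 2 ≤ 4 ^ s * sobSymbol m n := by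
  have hn : ((n.natAbs : ℝ)) ^ 2 = (n : ℝ) ^ 2 := by rw [Nat.cast_natAbs, Int.cast_abs, sq_abs]
  have hpos : ∀ k ∈ Finset.range (m + 1), 0 ≤ (n : ℝ) ^ (2 * k) := fun k _ => by
    rw [pow_mul]; positivity
  have h1 : (n : ℝ) ^ (2 * s) ≤ sobSymbol m n :=
    Finset.single_le_sum (f := fun k => (n : ℝ) ^ (2 * k)) hpos (Finset.mem_range.2 (by omega))
  have h0 : (1 : ℝ) ≤ sobSymbol m n := by
    unfold sobSymbol
    simpa using Finset.single_le_sum (f := fun k => (n : ℝ) ^ (2 * k)) hpos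
      (Finset.mem_range.2 (Nat.succ_pos m))
  rw [← pow_mul, mul_comm s 2, pow_mul]
  rcases Nat.eq_zero_or_pos n.natAbs with h2 | h2
  · rw [h2]
    have : (1 : ℝ) ≤ 4 ^ s := one_le_pow₀ (by norm_num)
    simp; nlinarith
  · have h3 : (1 : ℝ) ≤ n.natAbs := by exact_mod_cast h2
    calc (((n.natAbs : ℝ) + 1) ^ 2) ^ s ≤ (4 * (n : ℝ) ^ 2) ^ s := by
          rw [← hn]; gcongr; nlinarith
      _ = 4 ^ s * (n : ℝ) ^ (2 * s) := by rw [mul_pow, pow_mul]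
      _ ≤ _ := by gcongr

lemma sobSymbol_le (m : ℕ) (n : ℤ) :
    sobSymbol m n ≤ (m + 1) * (((n.natAbs : ℝ) + 1) ^ m) ^ 2 := by
  have hn : ((n.natAbs : ℝ)) ^ 2 = (n : ℝ) ^ 2 := by rw [Nat.cast_natAbs, Int.cast_abs, sq_abs]
  have h : ∀ k ∈ Finset.range (m + 1), (n : ℝ) ^ (2 * k) ≤ (((n.natAbs : ℝ) + 1) ^ m) ^ 2 := fun k hk => by
    have hk' : k ≤ m := by simpa [Nat.lt_succ_iff] using hk
    have h0 : (0 : ℝ) ≤ n.natAbs := by positivity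
    rw [← pow_mul, mul_comm m 2, pow_mul, pow_mul, ← hn]
    calc (((n.natAbs : ℝ)) ^ 2) ^ k ≤ (((n.natAbs : ℝ) + 1) ^ 2) ^ k := by gcongr; linarith
      _ ≤ _ := pow_le_pow_right₀ (by nlinarith) hk'
  calc sobSymbol m n ≤ ∑ k ∈ Finset.range (m + 1), (((n.natAbs : ℝ) + 1) ^ m) ^ 2 := Finset.sum_le_sum h
    _ = _ := by simp

lemma enorm_weight_mul_sq (s : ℕ) (a : ℝ) (n : ℤ) :
    ((powWeight s n.natAbs : ℝ≥0∞) * ‖a‖ₑ) ^ 2 = ENNReal.ofReal ((((n.natAbs : ℝ) + 1) ^ s) ^ 2 * a ^ 2) := by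
  have h1 : (powWeight s n.natAbs : ℝ≥0∞) = ENNReal.ofReal (((n.natAbs : ℝ) + 1) ^ s) := by
    rw [powWeight, ENNReal.ofReal, Real.toNNReal_pow (by positivity), Real.toNNReal_add (by positivity) zero_le_one,
      Real.toNNReal_natCast, Real.toNNReal_one]
  rw [h1, Real.enorm_eq_ofReal_abs, ← ENNReal.ofReal_mul (by positivity), ← ENNReal.ofReal_pow (by positivity),
    mul_pow, sq_abs]

lemma sqNorm_sineModes_le {s m : ℕ} (hs : s ≤ m) {u : ℝ → ℝ} (hu : MemH m u) :
    sqNorm (powWeight s) (sineModes u) ≤ ENNReal.ofReal (8 * 4 ^ s * hNorm m u ^ 2) := by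
  have h := hu.hasSum_hNorm_sq.mul_left (8 * 4 ^ s)
  have hpos : ∀ n : ℤ, (((n.natAbs : ℝ) + 1) ^ s) ^ 2 * sineModes u n ^ 2 ≤
      8 * 4 ^ s * (2 * Real.pi * (sobSymbol m n * ‖fourierC u n‖ ^ 2)) := fun n => by
    have h1 := pow_weight_le_sobSymbol hs n
    have h2 : sineModes u n ^ 2 ≤ 16 * Real.pi * ‖fourierC u n‖ ^ 2 := by
      rw [sineModes, mul_pow, neg_sq, mul_pow, Real.sq_sqrt Real.pi_pos.le, ← sq_abs (fourierC u n).im]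
      have := Complex.abs_im_le_norm (fourierC u n)
      have hp := Real.pi_pos
      have h3 : |(fourierC u n).im| ^ 2 ≤ ‖fourierC u n‖ ^ 2 := by gcongr
      nlinarith
    calc _ ≤ (4 ^ s * sobSymbol m n) * (16 * Real.pi * ‖fourierC u n‖ ^ 2) := by
          refine mul_le_mul h1 h2 (sq_nonneg _) ((sq_nonneg _).trans h1)
      _ = _ := by ring
  rw [← h.tsum_eq, ENNReal.ofReal_tsum_of_nonneg (fun n => le_trans (by positivity) (hpos n)) h.summable, sqNorm]
  refine ENNReal.tsum_le_tsum fun n => ?_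
  rw [enorm_weight_mul_sq]
  exact ENNReal.ofReal_le_ofReal (hpos n)

lemma memH_sineFun {m : ℕ} {x : ℤ → ℝ} (hodd : ∀ k, x (-k) = -x k) (ha : absSum x ≠ ⊤)
    (hf : sqNorm (powWeight m) x ≠ ⊤) : MemH m (sineFun x) ∧
      ENNReal.ofReal (hNorm m (sineFun x) ^ 2) ≤ (m + 1) * sqNorm (powWeight m) x := by
  have hle : ∀ n : ℤ, 2 * Real.pi * (sobSymbol m n * ‖fourierC (sineFun x) n‖ ^ 2) ≤
      (m + 1) * ((((n.natAbs : ℝ) + 1) ^ m) ^ 2 * x n ^ 2) := fun n => by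
    rw [norm_fourierC_sineFun_sq hodd ha]
    have h1 := sobSymbol_le m n
    have e : 2 * Real.pi * (sobSymbol m n * (x n ^ 2 / (16 * Real.pi))) = sobSymbol m n * (x n ^ 2 / 8) := by
      have := Real.pi_pos
      field_simp; ring
    rw [e]
    calc _ ≤ ((m + 1) * (((n.natAbs : ℝ) + 1) ^ m) ^ 2) * (x n ^ 2) := by
          refine mul_le_mul h1 (by nlinarith [sq_nonneg (x n)]) (by positivity) (by positivity)
      _ = _ := by ring
  have hnn : ∀ n : ℤ, 0 ≤ sobSymbol m n := fun n => Finset.sum_nonneg fun k _ => by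
    rw [pow_mul]; positivity
  have e : ∀ n : ℤ, ENNReal.ofReal ((m + 1) * ((((n.natAbs : ℝ) + 1) ^ m) ^ 2 * x n ^ 2)) =
      (m + 1) * ((powWeight m n.natAbs : ℝ≥0∞) * ‖x n‖ₑ) ^ 2 := fun n => by
    rw [enorm_weight_mul_sq, ENNReal.ofReal_mul (by positivity)]
    congr 1
    exact_mod_cast ENNReal.ofReal_natCast (m + 1)
  have hsum : ∑' n : ℤ, ENNReal.ofReal ((m + 1) * ((((n.natAbs : ℝ) + 1) ^ m) ^ 2 * x n ^ 2)) =
      (m + 1) * sqNorm (powWeight m) x := by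
    simp_rw [e]; rw [ENNReal.tsum_mul_left, sqNorm]
  have hS : Summable fun n : ℤ => (m + 1) * ((((n.natAbs : ℝ) + 1) ^ m) ^ 2 * x n ^ 2) := by
    have hne : ∑' n : ℤ, ENNReal.ofReal ((m + 1) * ((((n.natAbs : ℝ) + 1) ^ m) ^ 2 * x n ^ 2)) ≠ ⊤ := by
      rw [hsum]; finiteness
    have := ENNReal.summable_toReal hne
    refine this.congr fun n => ?_
    rw [ENNReal.toReal_ofReal (by positivity)]
  have hm : MemH m (sineFun x) := by
    refine memH_of_summable (sineFun_periodic x) (memL2_of_continuous (continuous_sineFun ha)) ?_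
    have h2 : Summable fun n => 2 * Real.pi * (sobSymbol m n * ‖fourierC (sineFun x) n‖ ^ 2) :=
      Summable.of_nonneg_of_le (fun n => mul_nonneg (by positivity) (mul_nonneg (hnn n) (sq_nonneg _))) hle hS
    exact (summable_mul_left_iff (by positivity)).1 h2
  refine ⟨hm, ?_⟩
  have h := hm.hasSum_hNorm_sq
  rw [← h.tsum_eq, ← hsum, ENNReal.ofReal_tsum_of_nonneg
    (fun n => mul_nonneg (by positivity) (mul_nonneg (hnn n) (sq_nonneg _))) h.summable]
  exact ENNReal.tsum_le_tsum fun n => ENNReal.ofReal_le_ofReal (hle n)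

lemma sinS_eq_zero_of_sin (x : ℤ → ℝ) {θ : ℝ} (h : Real.sin θ = 0) : sinS x θ = 0 := by
  obtain ⟨n, rfl⟩ := Real.sin_eq_zero_iff.1 h
  have e : ∀ k : ℤ, x k * Real.sin (k * (n * Real.pi)) = 0 := fun k => by
    rw [← mul_assoc, show (k : ℝ) * n = ((k * n : ℤ) : ℝ) by push_cast; rfl, Real.sin_int_mul_pi, mul_zero]
  simp [sinS, e]

lemma weighted_profile {x : ℤ → ℝ} (hx : OddModes x) (ha : absSum x ≠ ⊤) :
    weighted (profile x) = sineFun x := by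
  ext θ
  rw [weighted, (hasDerivAt_profile hx ha θ).deriv, sineFun, Pi.smul_apply, smul_eq_mul]
  rcases eq_or_ne (Real.sin θ) 0 with h | h
  · simp [h, sinS_eq_zero_of_sin x h]
  · have := Real.sqrt_pos.2 Real.pi_pos
    field_simp

lemma absSum_ne_top_of_le {m : ℕ} (hm : 2 ≤ m) {x : ℤ → ℝ} (h : sqNorm (powWeight m) x ≠ ⊤) :
    absSum x ≠ ⊤ :=
  absSum_ne_top (ne_top_of_le_ne_top h (sqNorm_mono (powWeight_mono hm) x))

lemma isState_profile {m : ℕ} (hm : 2 ≤ m) {x : ℤ → ℝ} (hx : OddModes x)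
    (h : sqNorm (powWeight m) x ≠ ⊤) : IsState m (profile x) := by
  have ha := absSum_ne_top_of_le hm h
  refine ⟨sinS_periodic _, sinS_neg _, ?_, ?_⟩
  · rw [contDiff_one_iff_deriv]
    refine ⟨fun θ => (hasDerivAt_profile hx ha θ).differentiableAt, ?_⟩
    have e : deriv (profile x) = fun θ => Real.sin θ * sinS x θ :=
      funext fun θ => (hasDerivAt_profile hx ha θ).deriv
    rw [e]
    exact Real.continuous_sin.mul (continuous_sinS ha)
  · rw [weighted_profile hx ha]
    exact (memH_sineFun hx.odd ha h).1

lemma l2Inner_odd_even {f g : ℝ → ℝ} (hf : ∀ θ, f (-θ) = -f θ) (hg : ∀ θ, g (-θ) = g θ) :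
    l2Inner f g = 0 := by
  have h : l2Inner f g = -l2Inner f g := by
    conv_lhs => rw [l2Inner, ← neg_neg Real.pi, ← intervalIntegral.integral_comp_neg, neg_neg]
    simp only [hf, hg, neg_mul, intervalIntegral.integral_neg]
    rfl
  linarith

lemma fourierC_re_of_odd {u : ℝ → ℝ} (hu : MemL2 u) (hodd : ∀ θ, u (-θ) = -u θ) (n : ℤ) :
    (fourierC u n).re = 0 := by
  have h := l2Inner_wave hu 1 n
  rw [l2Inner_odd_even hodd (fun θ => by simp [wave]), one_mul] at h
  have := Real.pi_pos
  rcases mul_eq_zero.1 h.symm with h | h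
  · linarith
  · exact h

/-- Every state is the profile of the sine coefficients of its weighted derivative. -/
lemma IsState.eq_profile {m : ℕ} (hm : 2 ≤ m) {η : ℝ → ℝ} (h : IsState m η) :
    OddModes (sineModes (weighted η)) ∧ sqNorm (powWeight m) (sineModes (weighted η)) ≠ ⊤ ∧
      η = profile (sineModes (weighted η)) := by
  set u := weighted η with hu
  set x := sineModes u with hx
  have huL : MemL2 u := h.memH.memL2
  have hfin : sqNorm (powWeight m) x ≠ ⊤ :=
    ne_top_of_le_ne_top ENNReal.ofReal_ne_top (sqNorm_sineModes_le le_rfl h.memH)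
  have ha := absSum_ne_top_of_le hm hfin
  have hodd : ∀ k, x (-k) = -x k := sineModes_neg huL
  have hdeven : ∀ θ, deriv η (-θ) = deriv η θ := fun θ => by
    have h1 : η = fun θ => -η (-θ) := funext fun θ => by rw [h.odd, neg_neg]
    conv_rhs => rw [h1]
    rw [deriv.fun_neg, deriv_comp_neg, neg_neg]
  have huodd : ∀ θ, u (-θ) = -u θ := fun θ => by
    simp only [hu, weighted, hdeven, Real.sin_neg, mul_neg, div_neg]
  have hdc : Continuous (deriv η) := h.contDiff.continuous_deriv le_rfl
  have hη : ∀ θ, HasDerivAt η (deriv η θ) θ := fun θ =>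
    (h.contDiff.differentiable (by simp) θ).hasDerivAt
  -- `u` and `sineFun x` have the same Fourier coefficients, so they agree almost everywhere.
  set w : ℝ → ℝ := u + (-1 : ℝ) • sineFun x with hw
  have hsL : MemL2 (sineFun x) := memL2_of_continuous (continuous_sineFun ha)
  have hwL : MemL2 w := huL.add (hsL.smul _)
  have hw0 : l2Norm w ^ 2 = 0 := by
    have h1 := hwL.hasSum_sq
    have h2 : ∀ n, fourierC w n = 0 := fun n => by
      rw [hw, fourierC_add huL (hsL.smul _), fourierC_smul _ hsL, fourierC_sineFun hodd ha]
      have h3 := fourierC_re_of_odd huL huodd n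
      have h4 : -(4 * Real.sqrt Real.pi)⁻¹ * x n = (fourierC u n).im := by
        have := Real.sqrt_pos.2 Real.pi_pos
        simp only [hx, sineModes]
        field_simp
      rw [h4]
      apply Complex.ext <;> simp [h3]
    simp only [h2] at h1
    simpa using h1.tsum_eq.symm
  -- Hence the continuous function `η' - sin · sinS x` vanishes.
  set d : ℝ → ℝ := fun θ => deriv η θ - Real.sin θ * sinS x θ with hd
  have hdcont : Continuous d := hdc.sub (Real.continuous_sin.mul (continuous_sinS ha))
  have hdw : ∀ θ, Real.sin θ ≠ 0 → d θ = 2 * Real.sqrt Real.pi * Real.sin θ * w θ := fun θ hθ => by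
    have := Real.sqrt_pos.2 Real.pi_pos
    simp only [hd, hw, hu, weighted, sineFun, Pi.add_apply, Pi.smul_apply, smul_eq_mul]
    field_simp
    ring
  have hcount : ∀ᵐ θ : ℝ, Real.sin θ ≠ 0 := by
    have : {θ : ℝ | Real.sin θ = 0}.Countable := by
      refine (countable_range fun n : ℤ => (n : ℝ) * Real.pi).mono fun θ hθ => ?_
      exact Real.sin_eq_zero_iff.1 hθ
    exact this.ae_notMem volume
  have hint : ∫ θ in (-Real.pi)..Real.pi, d θ ^ 2 ≤ 0 := by
    have h1 : ∫ θ in (-Real.pi)..Real.pi, d θ ^ 2 ≤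
        ∫ θ in (-Real.pi)..Real.pi, 4 * Real.pi * w θ ^ 2 := by
      have hwi : IntervalIntegrable (fun θ => 4 * Real.pi * w θ ^ 2) volume (-Real.pi) Real.pi := by
        rw [intervalIntegrable_iff_integrableOn_Ioc_of_le neg_pi_lt_pi.le]
        exact (MemLp.integrable_sq hwL).const_mul _
      refine intervalIntegral.integral_mono_ae neg_pi_lt_pi.le
        ((hdcont.pow 2).intervalIntegrable _ _) hwi ?_
      filter_upwards [hcount] with θ hθ
      rw [hdw θ hθ]
      have h2 := Real.sin_sq_le_one θ
      have h3 := Real.sq_sqrt Real.pi_pos.le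
      have e : (2 * Real.sqrt Real.pi * Real.sin θ * w θ) ^ 2 =
          4 * Real.pi * w θ ^ 2 * Real.sin θ ^ 2 := by rw [mul_pow, mul_pow, mul_pow, h3]; ring
      rw [e]
      exact mul_le_of_le_one_right (by have := Real.pi_pos; positivity) h2
    rw [intervalIntegral.integral_const_mul] at h1
    have h2 : ∫ θ in (-Real.pi)..Real.pi, w θ ^ 2 = 0 := by
      rw [← hw0, l2Norm_sq, l2Inner]; simp only [sq]
    rw [h2, mul_zero] at h1
    exact h1
  have hd0 : ∀ θ ∈ Icc (-Real.pi) Real.pi, d θ = 0 := fun θ hθ => by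
    by_contra hne
    have := intervalIntegral.integral_lt_integral_of_continuousOn_of_le_of_exists_lt
      (f := fun _ => (0 : ℝ)) (g := fun θ => d θ ^ 2) neg_pi_lt_pi continuousOn_const
      (hdcont.pow 2).continuousOn (fun _ _ => sq_nonneg _) ⟨θ, hθ, by positivity⟩
    rw [intervalIntegral.integral_zero] at this
    exact absurd hint (not_le.2 this)
  have hder : ∀ θ, deriv η θ = Real.sin θ * sinS x θ := fun θ => by
    have hp : Function.Periodic d (2 * Real.pi) := fun θ => by
      simp only [hd, Periodic_deriv h.periodic θ, Real.sin_periodic θ, sinS_periodic x θ]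
    obtain ⟨y, hy, hyθ⟩ := hp.exists_mem_Ioc Real.two_pi_pos θ (-Real.pi)
    have : d θ = 0 := by
      rw [hyθ]; exact hd0 y ⟨hy.1.le, by linarith [hy.2]⟩
    simp only [hd] at this
    linarith
  -- The first coefficient is the mean of `η' = sin · sinS x` up to a factor.
  have h1 : x 1 = 0 := by
    have e1 : ∫ θ in (-Real.pi)..Real.pi, deriv η θ = 0 := by
      rw [intervalIntegral.integral_eq_sub_of_hasDerivAt (fun θ _ => hη θ) (hdc.intervalIntegrable _ _)]
      rw [← h.periodic (-Real.pi), sub_eq_zero]; congr 1; ring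
    have e2 := l2Inner_wave (memL2_of_continuous (continuous_sinS ha)) Complex.I 1
    rw [fourierC_sinS hodd ha, l2Inner] at e2
    have e3 : ∫ θ in (-Real.pi)..Real.pi, sinS x θ * wave Complex.I 1 θ = 0 := by
      rw [← e1]
      refine intervalIntegral.integral_congr fun θ _ => ?_
      simp [hder, wave, mul_comm]
    rw [e3] at e2
    have : Complex.I * (-(Complex.I / 2) * x 1) = ((x 1 / 2 : ℝ) : ℂ) := by
      push_cast; linear_combination (-(x 1 : ℂ) / 2) * Complex.I_mul_I
    rw [this, Complex.ofReal_re] at e2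
    have := Real.pi_pos
    nlinarith
  have hom : OddModes x := ⟨hodd, h1⟩
  refine ⟨hom, hfin, ?_⟩
  refine eq_of_hasDerivAt_eq (fun θ => by simpa [hder] using hη θ) (hasDerivAt_profile hom ha) ?_
  have e0 := h.odd 0
  rw [neg_zero] at e0
  rw [profile, sinS_zero]; linarith

lemma sineModes_weighted_profile {x : ℤ → ℝ} (hx : OddModes x) (ha : absSum x ≠ ⊤) :
    sineModes (weighted (profile x)) = x := by
  rw [weighted_profile hx ha, sineModes_sineFun hx.odd ha]

lemma l2Inner_sineFun {x y : ℤ → ℝ} (hx : ∀ k, x (-k) = -x k) (hy : ∀ k, y (-k) = -y k)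
    (hxa : absSum x ≠ ⊤) (hya : absSum y ≠ ⊤) :
    l2Inner (sineFun x) (sineFun y) = (∑' n, x n * y n) / 8 := by
  have h := hasSum_l2Inner (memL2_of_continuous (continuous_sineFun hxa))
    (memL2_of_continuous (continuous_sineFun hya))
  rw [← h.tsum_eq, ← tsum_div_const]
  refine tsum_congr fun n => ?_
  rw [fourierC_sineFun hx hxa, fourierC_sineFun hy hya, map_mul, Complex.conj_I, Complex.conj_ofReal]
  have e : ∀ a b : ℝ, ((a : ℂ) * Complex.I * ((b : ℂ) * -Complex.I)) = ((a * b : ℝ) : ℂ) := fun a b => by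
    push_cast; linear_combination (-(a : ℂ) * b) * Complex.I_mul_I
  rw [e, Complex.ofReal_re]
  have h1 := Real.sq_sqrt Real.pi_pos.le
  have h2 := Real.sqrt_pos.2 Real.pi_pos
  have h3 := Real.pi_pos
  have e2 : -(4 * Real.sqrt Real.pi)⁻¹ * x n * (-(4 * Real.sqrt Real.pi)⁻¹ * y n) =
      (16 * Real.sqrt Real.pi ^ 2)⁻¹ * (x n * y n) := by
    field_simp; ring
  rw [e2, h1]
  field_simp
  ring

/-! ### Existence of solutions -/

lemma tendsto_of_enorm_sub_sq {α : Type*} {l : Filter α} {f : α → ℝ} {c : ℝ}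
    (h : Tendsto (fun a => ‖f a - c‖ₑ ^ 2) l (𝓝 0)) : Tendsto f l (𝓝 c) := by
  rw [tendsto_iff_edist_tendsto_0]
  have h2 := ((ENNReal.continuous_rpow_const (y := (1 / 2 : ℝ))).tendsto 0).comp h
  simpa [Function.comp_def, ← ENNReal.rpow_natCast_mul, edist_eq_enorm_sub] using h2

lemma hNorm_nonneg (m : ℕ) (f : ℝ → ℝ) : 0 ≤ hNorm m f := Real.sqrt_nonneg _

lemma tendsto_hNorm_sineFun {α : Type*} {l : Filter α} {m : ℕ} (hm : 2 ≤ m) {z : α → ℤ → ℝ}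
    (hz : ∀ᶠ a in l, OddModes (z a)) (h : Tendsto (fun a => sqNorm (powWeight m) (z a)) l (𝓝 0)) :
    Tendsto (fun a => hNorm m (sineFun (z a))) l (𝓝 0) := by
  refine tendsto_of_enorm_sub_sq (tendsto_zero_of_le_const_mul (A := m + 1) (by finiteness) h ?_)
  filter_upwards [hz, h.eventually (gt_mem_nhds one_pos)] with a ha hfin
  have hfin' : sqNorm (powWeight m) (z a) ≠ ⊤ := ne_top_of_lt hfin
  have := (memH_sineFun ha.odd (absSum_ne_top_of_le hm hfin') hfin').2
  rwa [sub_zero, Real.enorm_of_nonneg (hNorm_nonneg _ _), ← ENNReal.ofReal_pow (hNorm_nonneg _ _)]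

lemma ContInH.congr {s : ℕ} {T : ℝ} {f g : ℝ → ℝ → ℝ} (h : ContInH s T f)
    (hfg : ∀ t ∈ Icc 0 T, f t = g t) : ContInH s T g where
  memH t ht := hfg t ht ▸ h.memH t ht
  tendsto t ht := (h.tendsto t ht).congr' (by
    filter_upwards [self_mem_nhdsWithin] with r hr
    rw [hfg r hr, hfg t ht])

lemma HasTimeDerivInH.congr {s : ℕ} {T : ℝ} {f f₁ g : ℝ → ℝ → ℝ} (h : HasTimeDerivInH s T f f₁)
    (hfg : ∀ t ∈ Icc 0 T, f t = g t) : HasTimeDerivInH s T g f₁ := fun t ht =>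
  (h t ht).congr' (by
    filter_upwards [self_mem_nhdsWithin] with r hr
    rw [hfg r hr.1, hfg t ht])

lemma sineFun_sub {x y : ℤ → ℝ} (hx : absSum x ≠ ⊤) (hy : absSum y ≠ ⊤) :
    sineFun (x - y) = fun θ => sineFun x θ - sineFun y θ := by
  ext θ; simp only [sineFun, Pi.smul_apply, sinS_sub hx hy, smul_eq_mul]; ring

lemma ContIn.absSum {m : ℕ} {T : ℝ} {x : ℝ → ℤ → ℝ} (h : ContIn m T x) (hm : 2 ≤ m) {t : ℝ}
    (ht : t ∈ Icc 0 T) : absSum (x t) ≠ ⊤ := absSum_ne_top_of_le hm (h.finite t ht)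

lemma ContIn.contInH {m : ℕ} (hm : 2 ≤ m) {T : ℝ} {x : ℝ → ℤ → ℝ} (h : ContIn m T x) :
    ContInH m T (fun t => sineFun (x t)) where
  memH t ht := (memH_sineFun (h.modes t ht).odd (h.absSum hm ht) (h.finite t ht)).1
  tendsto t ht := by
    refine (tendsto_hNorm_sineFun hm ?_ (h.tendsto t ht)).congr' ?_
    · filter_upwards [self_mem_nhdsWithin] with r hr
      exact (h.modes r hr).sub (h.modes t ht)
    · filter_upwards [self_mem_nhdsWithin] with r hr
      rw [sineFun_sub (h.absSum hm hr) (h.absSum hm ht)]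

lemma HasSeqDeriv.hasTimeDerivInH {s : ℕ} (hs : 2 ≤ s) {T : ℝ} {x f : ℝ → ℤ → ℝ} (hx : ContIn s T x)
    (hf : ContIn s T f) (h : HasSeqDeriv s T x f) :
    HasTimeDerivInH s T (fun t => sineFun (x t)) (fun t => sineFun (f t)) := fun t ht => by
  refine (tendsto_hNorm_sineFun hs ?_ (h t ht)).congr' ?_
  · filter_upwards [self_mem_nhdsWithin] with r hr
    exact (((hx.modes r hr.1).sub (hx.modes t ht)).smul _).sub (hf.modes t ht)
  · filter_upwards [self_mem_nhdsWithin] with r hr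
    have h1 := hx.absSum hs hr.1
    have h2 := hx.absSum hs ht
    rw [sineFun_sub (absSum_smul _ (absSum_sub h1 h2)) (hf.absSum hs ht), sineFun_smul, sineFun_sub h1 h2]
    rfl

lemma sqNorm_comb_le (w : ℕ → ℝ≥0) (a b : ℝ) (x y : ℤ → ℝ) :
    sqNorm w (a • x + b • y) ≤ 2 * (‖a‖ₑ ^ 2 + ‖b‖ₑ ^ 2) * (sqNorm w x + sqNorm w y) := by
  refine (sqNorm_add_le _ _ _).trans ?_
  rw [sqNorm_smul', sqNorm_smul', mul_assoc]
  refine mul_le_mul' le_rfl ?_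
  rw [mul_add]
  gcongr
  · exact le_self_add
  · exact le_add_self

lemma ContIn.comb {m : ℕ} {T : ℝ} {x y : ℝ → ℤ → ℝ} (hx : ContIn m T x) (hy : ContIn m T y) (a b : ℝ) :
    ContIn m T (fun t => a • x t + b • y t) where
  modes t ht := ((hx.modes t ht).smul a).add ((hy.modes t ht).smul b)
  finite t ht := ne_top_of_le_ne_top (by
    have := hx.finite t ht
    have := hy.finite t ht
    finiteness) (sqNorm_comb_le _ a b (x t) (y t))
  tendsto t ht := by
    have h := (hx.tendsto t ht).add (hy.tendsto t ht)
    rw [add_zero] at h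
    refine tendsto_zero_of_le_const_mul (A := 2 * (‖a‖ₑ ^ 2 + ‖b‖ₑ ^ 2)) (by finiteness) h
      (Eventually.of_forall fun r => ?_)
    refine le_trans (le_of_eq ?_) (sqNorm_comb_le _ a b (x r - x t) (y r - y t))
    congr 1
    rw [smul_sub, smul_sub]; abel

lemma HasSeqDeriv.comb {s : ℕ} {T : ℝ} {x y f g : ℝ → ℤ → ℝ} (hx : HasSeqDeriv s T x f)
    (hy : HasSeqDeriv s T y g) (a b : ℝ) :
    HasSeqDeriv s T (fun t => a • x t + b • y t) (fun t => a • f t + b • g t) := fun t ht => by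
  have h := (hx t ht).add (hy t ht)
  rw [add_zero] at h
  refine tendsto_zero_of_le_const_mul (A := 2 * (‖a‖ₑ ^ 2 + ‖b‖ₑ ^ 2)) (by finiteness) h
    (Eventually.of_forall fun r => ?_)
  refine le_trans (le_of_eq ?_) (sqNorm_comb_le _ a b _ _)
  congr 1
  module

lemma HasSeqDeriv.of_le {s l : ℕ} {T : ℝ} {x f : ℝ → ℤ → ℝ} (h : HasSeqDeriv s T x f) (hl : l ≤ s) :
    HasSeqDeriv l T x f := fun t ht =>
  tendsto_of_tendsto_of_tendsto_of_le_of_le tendsto_const_nhds (h t ht) (fun _ => zero_le)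
    fun _ => le_sqNorm_powWeight hl _

lemma enorm_profile_sq_le {s : ℕ} (hs : 2 ≤ s) (z : ℤ → ℝ) (θ : ℝ) :
    ‖profile z θ‖ₑ ^ 2 ≤ (4 * invSq + 1) * sqNorm (powWeight s) z := by
  rcases eq_or_ne (sqNorm (powWeight s) z) ⊤ with h | h
  · rw [h, ENNReal.mul_top]
    · exact le_top
    · simp
  have ha := absSum_ne_top_of_le hs h
  have h1 : ‖profile z θ‖ₑ ≤ 2 * MHD1D.absSum z := by
    have h2 : ∀ n, ‖profCoeff z n * Real.sin (n * θ)‖ₑ ≤ ‖z (n + 1)‖ₑ + ‖z (n - 1)‖ₑ := fun n => by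
      refine le_trans ?_ (enorm_halfDiff_le z n)
      rcases eq_or_ne n 0 with rfl | hn
      · simp
      · refine enorm_le_of_abs_le ?_
        rw [← freq_profCoeff_of_ne z hn, freq, abs_mul, abs_mul, mul_comm |(n : ℝ)|]
        have h3 : (1 : ℝ) ≤ |(n : ℝ)| := by exact_mod_cast Int.one_le_abs hn
        exact mul_le_mul_of_nonneg_left ((Real.abs_sin_le_one _).trans h3) (abs_nonneg _)
    have h4 : MHD1D.absSum (fun n : ℤ => profCoeff z n * Real.sin (n * θ)) ≤ 2 * MHD1D.absSum z :=
      absSum_le_of_neighbours h2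
    refine le_trans ?_ h4
    have h5 : ‖∑' n : ℤ, profCoeff z n * Real.sin (n * θ)‖ₑ ≤ ∑' n : ℤ, ‖profCoeff z n * Real.sin (n * θ)‖ₑ :=
      enorm_tsum_le_tsum_enorm
    refine le_trans ?_ h5
    refine enorm_le_of_abs_le ?_
    rw [profile, sinS, abs_div, abs_two]
    have := abs_nonneg (∑' n : ℤ, profCoeff z n * Real.sin (n * θ))
    linarith
  calc _ ≤ (2 * MHD1D.absSum z) ^ 2 := by gcongr
    _ = 4 * MHD1D.absSum z ^ 2 := by ring
    _ ≤ 4 * (invSq * sqNorm (powWeight 2) z) := by gcongr; exact absSum_sq_le z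
    _ ≤ 4 * (invSq * sqNorm (powWeight s) z) := by gcongr; exact sqNorm_mono (powWeight_mono hs) z
    _ = 4 * invSq * sqNorm (powWeight s) z := by ring
    _ ≤ _ := by gcongr; exact le_self_add

/-- Derivatives in sequence space are pointwise time derivatives of the profiles. -/
lemma hasDerivWithinAt_profile {s : ℕ} (hs : 2 ≤ s) {T : ℝ} {x : ℝ → ℤ → ℝ} {f : ℤ → ℝ} {t : ℝ}
    (ht : t ∈ Icc 0 T) (hx : ∀ r ∈ Icc 0 T, sqNorm (powWeight s) (x r) ≠ ⊤)
    (hf : MHD1D.absSum f ≠ ⊤)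
    (h : Tendsto (fun r => sqNorm (powWeight s) ((r - t)⁻¹ • (x r - x t) - f)) (𝓝[Icc 0 T \ {t}] t) (𝓝 0))
    (θ : ℝ) : HasDerivWithinAt (fun r => profile (x r) θ) (profile f θ) (Icc 0 T) t := by
  rw [hasDerivWithinAt_iff_tendsto_slope]
  refine tendsto_of_enorm_sub_sq (tendsto_zero_of_le_const_mul (A := 4 * invSq + 1)
    (by finiteness) h ?_)
  filter_upwards [self_mem_nhdsWithin] with r hr
  refine le_trans (le_of_eq ?_) (enorm_profile_sq_le hs _ θ)
  have h1 := absSum_ne_top_of_le hs (hx r hr.1)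
  have h2 := absSum_ne_top_of_le hs (hx t ht)
  rw [profile_sub (absSum_smul _ (absSum_sub h1 h2)) hf, profile_smul, profile_sub h1 h2, slope_def_module,
    smul_eq_mul]

lemma dataSize_sq (m : ℕ) (f g : ℝ → ℝ) :
    dataSize m f g ^ 2 = hNorm m (weighted f) ^ 2 + hNorm m (weighted g) ^ 2 := by
  rw [dataSize, Real.sq_sqrt (by positivity)]

lemma IsSeqSolution.isSolution {m : ℕ} (hm : 3 < m) {T : ℝ} {p q : ℤ → ℝ} {x y : ℝ → ℤ → ℝ}
    (h : IsSeqSolution m T (p + q) (p - q) x y) :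
    IsSolution m T (profile p) (profile q) (fun t => profile ((1 / 2 : ℝ) • x t + (1 / 2 : ℝ) • y t))
      (fun t => profile ((1 / 2 : ℝ) • x t + (-(1 / 2) : ℝ) • y t)) := by
  obtain ⟨s, rfl⟩ : ∃ s, m = s + 2 := ⟨m - 2, by omega⟩
  have hs : 2 ≤ s := by omega
  obtain ⟨x₁, x₂, hx₁, hx₂, hd₁, hd₂, hx⟩ := h.exists_derivs (by omega)
  obtain ⟨y₁, y₂, hy₁, hy₂, he₁, he₂, hy⟩ := h.symm.exists_derivs (by omega)
  have hX := h.cont_left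
  have hY := h.cont_right
  have comb : ∀ b : ℝ, ContIn (s + 2) T (fun t => (1 / 2 : ℝ) • x t + b • y t) := fun b => hX.comb hY _ b
  have hw : ∀ b : ℝ, ∀ t ∈ Icc 0 T, sineFun ((1 / 2 : ℝ) • x t + b • y t) =
      weighted (profile ((1 / 2 : ℝ) • x t + b • y t)) := fun b t ht =>
    (weighted_profile ((comb b).modes t ht) ((comb b).absSum (by omega) ht)).symm
  have state : ∀ b : ℝ, ∀ t ∈ Icc 0 T, IsState (s + 2) (profile ((1 / 2 : ℝ) • x t + b • y t)) :=
    fun b t ht => isState_profile (by omega) ((comb b).modes t ht) ((comb b).finite t ht)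
  have cont : ∀ b : ℝ, ContInH (s + 2) T (fun t => weighted (profile ((1 / 2 : ℝ) • x t + b • y t))) :=
    fun b => ((comb b).contInH (by omega)).congr (hw b)
  have c2 : ∀ b : ℝ, C2InH s T (fun t => weighted (profile ((1 / 2 : ℝ) • x t + b • y t))) := fun b => by
    have k0 := (comb b).of_le (Nat.le_add_right s 2)
    have k1 := (hx₁.comb hy₁ (1 / 2) b)
    have k1' := k1.of_le (Nat.le_add_right s 1)
    have k2 := hx₂.comb hy₂ (1 / 2) b
    have d1 : HasSeqDeriv s T (fun t => (1 / 2 : ℝ) • x t + b • y t)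
        (fun t => (1 / 2 : ℝ) • x₁ t + b • y₁ t) := 
      HasSeqDeriv.of_le (hd₁.comb he₁ (1 / 2) b) (Nat.le_add_right s 1)
    have d2 := hd₂.comb he₂ (1 / 2) b
    exact ⟨_, _, (k0.contInH hs).congr (hw b), k1'.contInH hs, k2.contInH hs,
      (d1.hasTimeDerivInH hs k0 k1').congr (hw b), d2.hasTimeDerivInH hs k1' k2⟩
  have der : ∀ b : ℝ, ∀ t ∈ Icc 0 T, ∀ θ,
      HasDerivWithinAt (fun r => profile ((1 / 2 : ℝ) • x r + b • y r) θ)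
        (profile ((1 / 2 : ℝ) • x₁ t + b • y₁ t) θ) (Icc 0 T) t := fun b t ht θ =>
    hasDerivWithinAt_profile (s := s + 1) (by omega) ht
      (fun r hr => ((comb b).of_le (by omega)).finite r hr)
      ((hx₁.comb hy₁ (1 / 2) b).absSum (by omega) ht) ((hd₁.comb he₁ (1 / 2) b) t ht) θ
  have sys : ∀ t ∈ Icc 0 T, _ := fun t ht =>
    system_profile ((comb (1 / 2)).adm (by omega) ht) ((comb (-(1 / 2))).adm (by omega) ht)
  have e1 : ∀ t, ((1 / 2 : ℝ) • x t + (1 / 2 : ℝ) • y t) + ((1 / 2 : ℝ) • x t + (-(1 / 2) : ℝ) • y t) = x t :=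
    fun t => by module
  have e2 : ∀ t, ((1 / 2 : ℝ) • x t + (1 / 2 : ℝ) • y t) - ((1 / 2 : ℝ) • x t + (-(1 / 2) : ℝ) • y t) = y t :=
    fun t => by module
  refine ⟨?_, ?_, state _, state _, fun t ht θ => ?_, fun t ht θ => ?_, cont _, cont _, c2 _, c2 _⟩
  · simp only [h.init_left, h.init_right]
    congr 1; module
  · simp only [h.init_left, h.init_right]
    congr 1; module
  · refine (der (1 / 2) t ht θ).congr_deriv ?_
    rw [(sys t ht).1 θ, e1, e2, hx, hy, smul_add]
  · refine (der (-(1 / 2)) t ht θ).congr_deriv ?_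
    rw [(sys t ht).2 θ, e1, e2, hx, hy]
    congr 1; module

/-- The base norm of the data in the variables `η⁺ ± η⁻`. The constant `23` satisfies `512 ≤ 23²`, where
`512 = 4 · 8 · 4²` collects the constants of the embedding. -/
lemma sqNorm_two_add_le {m : ℕ} (hm : 2 ≤ m) {f g : ℝ → ℝ} (hf : IsState m f) (hg : IsState m g) :
    sqNorm (powWeight 2) (sineModes (weighted f) + sineModes (weighted g)) +
      sqNorm (powWeight 2) (sineModes (weighted f) - sineModes (weighted g)) ≤
        ENNReal.ofReal ((23 * dataSize m f g) ^ 2) := by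
  have h1 := sqNorm_sineModes_le hm hf.memH
  have h2 := sqNorm_sineModes_le hm hg.memH
  calc _ ≤ 2 * (sqNorm (powWeight 2) (sineModes (weighted f)) + sqNorm (powWeight 2) (sineModes (weighted g))) +
        2 * (sqNorm (powWeight 2) (sineModes (weighted f)) + sqNorm (powWeight 2) (sineModes (weighted g))) :=
        add_le_add (sqNorm_add_le _ _ _) (sqNorm_sub_le _ _ _)
    _ = 4 * (sqNorm (powWeight 2) (sineModes (weighted f)) + sqNorm (powWeight 2) (sineModes (weighted g))) := by
        ring
    _ ≤ 4 * (ENNReal.ofReal (8 * 4 ^ 2 * hNorm m (weighted f) ^ 2) +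
          ENNReal.ofReal (8 * 4 ^ 2 * hNorm m (weighted g) ^ 2)) := by gcongr
    _ = ENNReal.ofReal (512 * dataSize m f g ^ 2) := by
        rw [← ENNReal.ofReal_add (by positivity) (by positivity), dataSize_sq,
          show (4 : ℝ≥0∞) = ENNReal.ofReal 4 by simp, ← ENNReal.ofReal_mul (by norm_num)]
        congr 1; ring
    _ ≤ _ := ENNReal.ofReal_le_ofReal (by nlinarith [sq_nonneg (dataSize m f g)])

/-- The condition on the time interval in `SeqSolvable` for `a = 23 I`: with `C₂ = 23 C₁` the existence time
is the one at which it becomes an equality. -/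
lemma exp_existenceTime_le {c I : ℝ} (hc : 0 < c) (hI : 0 < I) :
    0 < existenceTime c (23 * c) I ∧
      Real.exp (c * existenceTime c (23 * c) I) * (23 * I) ≤ 23 * I + 1 / 2 := by
  have h1 : c / (2 * (23 * c) * I) = 1 / (46 * I) := by
    field_simp; norm_num
  have h2 : 0 < 1 / (46 * I) := by positivity
  unfold existenceTime
  rw [h1]
  refine ⟨mul_pos (by positivity) (Real.log_pos (by linarith)), ?_⟩
  rw [← mul_assoc c, mul_one_div_cancel hc.ne', one_mul, Real.exp_log (by linarith)]
  refine le_of_eq ?_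
  field_simp; ring

/-! ### Uniqueness of solutions -/

lemma neBot_punctured {T t : ℝ} (hT : 0 < T) (ht : t ∈ Icc 0 T) : (𝓝[Icc 0 T \ {t}] t).NeBot := by
  have h := (uniqueDiffOn_Icc hT t ht)
  have := uniqueDiffWithinAt_iff_accPt.1 h
  rw [accPt_principal_iff_nhdsWithin] at this
  exact this

lemma tendsto_entry {α : Type*} {l : Filter α} {s : ℕ} {z : α → ℤ → ℝ} {f : ℤ → ℝ}
    (h : Tendsto (fun a => sqNorm (powWeight s) (z a - f)) l (𝓝 0)) (k : ℤ) :
    Tendsto (fun a => z a k) l (𝓝 (f k)) :=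
  tendsto_of_enorm_sub_sq (tendsto_of_tendsto_of_tendsto_of_le_of_le tendsto_const_nhds h
    (fun _ => zero_le) fun a => enorm_sq_le_sqNorm s (z a - f) k)

lemma HasSeqDeriv.hasDerivWithinAt {s : ℕ} {T : ℝ} {x f : ℝ → ℤ → ℝ} (h : HasSeqDeriv s T x f) {t : ℝ}
    (ht : t ∈ Icc 0 T) (k : ℤ) : HasDerivWithinAt (fun r => x r k) (f t k) (Icc 0 T) t := by
  rw [hasDerivWithinAt_iff_tendsto_slope]
  refine (tendsto_entry (h t ht) k).congr fun r => ?_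
  rw [slope_def_module]; rfl

lemma tendsto_sqNorm_sineModes {α : Type*} {l : Filter α} {m : ℕ} {u : α → ℝ → ℝ}
    (hu : ∀ᶠ a in l, MemH m (u a)) (h : Tendsto (fun a => hNorm m (u a)) l (𝓝 0)) :
    Tendsto (fun a => sqNorm (powWeight m) (sineModes (u a))) l (𝓝 0) := by
  have h1 : Tendsto (fun a => ENNReal.ofReal (8 * 4 ^ m * hNorm m (u a) ^ 2)) l (𝓝 0) := by
    have := ENNReal.tendsto_ofReal ((h.pow 2).const_mul (8 * 4 ^ m))
    simpa using this
  refine tendsto_of_tendsto_of_tendsto_of_le_of_le' tendsto_const_nhds h1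
    (Eventually.of_forall fun _ => zero_le) ?_
  filter_upwards [hu] with a ha using sqNorm_sineModes_le le_rfl ha

lemma MemH.sub {m : ℕ} {f g : ℝ → ℝ} (hf : MemH m f) (hg : MemH m g) : MemH m (fun θ => f θ - g θ) := by
  have := hf.add (hg.smul (-1))
  convert this using 1
  ext θ; simp [sub_eq_add_neg]

lemma sineModes_sub {u v : ℝ → ℝ} (hu : MemL2 u) (hv : MemL2 v) :
    sineModes (fun θ => u θ - v θ) = sineModes u - sineModes v := by
  have e : (fun θ => u θ - v θ) = u + (-1 : ℝ) • v := by ext θ; simp [sub_eq_add_neg]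
  rw [e, sineModes_add hu (hv.smul _), sineModes_smul _ hv]
  module

/-- The sine coefficients of a curve of states, extended by zero outside `[0, T]`. -/
def stateModes (T : ℝ) (η : ℝ → ℝ → ℝ) (t : ℝ) : ℤ → ℝ :=
  (Icc 0 T).indicator (fun t => sineModes (weighted (η t))) t

lemma stateModes_of_mem {T t : ℝ} (η : ℝ → ℝ → ℝ) (ht : t ∈ Icc 0 T) :
    stateModes T η t = sineModes (weighted (η t)) := by rw [stateModes, indicator_of_mem ht]

lemma oddModes_stateModes {m : ℕ} (hm : 2 ≤ m) {T : ℝ} {η : ℝ → ℝ → ℝ}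
    (h : ∀ t ∈ Icc 0 T, IsState m (η t)) (t : ℝ) : OddModes (stateModes T η t) := by
  by_cases ht : t ∈ Icc 0 T
  · rw [stateModes_of_mem η ht]; exact ((h t ht).eq_profile hm).1
  · rw [stateModes, indicator_of_notMem ht]; exact oddModes_zero

lemma contIn_stateModes {m : ℕ} (hm : 2 ≤ m) {T : ℝ} {η : ℝ → ℝ → ℝ}
    (h : ∀ t ∈ Icc 0 T, IsState m (η t)) (hc : ContInH m T (fun t => weighted (η t))) :
    ContIn m T (stateModes T η) where
  modes t _ := oddModes_stateModes hm h t
  finite t ht := by rw [stateModes_of_mem η ht]; exact ((h t ht).eq_profile hm).2.1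
  tendsto t ht := by
    refine (tendsto_sqNorm_sineModes ?_ (hc.tendsto t ht)).congr' ?_
    · filter_upwards [self_mem_nhdsWithin] with r hr
      exact (hc.memH r hr).sub (hc.memH t ht)
    · filter_upwards [self_mem_nhdsWithin] with r hr
      rw [sineModes_sub (hc.memH r hr).memL2 (hc.memH t ht).memL2, stateModes_of_mem η hr,
        stateModes_of_mem η ht]

lemma hasSeqDeriv_stateModes {s : ℕ} {T : ℝ} {η f : ℝ → ℝ → ℝ}
    (hc : ContInH s T (fun t => weighted (η t))) (hf : ContInH s T f)
    (h : HasTimeDerivInH s T (fun t => weighted (η t)) f) :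
    HasSeqDeriv s T (stateModes T η) (fun t => sineModes (f t)) := fun t ht => by
  have hm : ∀ r ∈ Icc 0 T, MemH s ((r - t)⁻¹ • fun θ => weighted (η r) θ - weighted (η t) θ) :=
    fun r hr => ((hc.memH r hr).sub (hc.memH t ht)).smul _
  refine (tendsto_sqNorm_sineModes ?_ (h t ht)).congr' ?_
  · filter_upwards [self_mem_nhdsWithin] with r hr
    exact (hm r hr.1).sub (hf.memH t ht)
  · filter_upwards [self_mem_nhdsWithin] with r hr
    have := sineModes_sub (hm r hr.1).memL2 (hf.memH t ht).memL2
    rw [sineModes_smul _ ((hc.memH r hr.1).sub (hc.memH t ht)).memL2,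
      sineModes_sub (hc.memH r hr.1).memL2 (hc.memH t ht).memL2] at this
    rw [stateModes_of_mem η hr.1, stateModes_of_mem η ht, ← this]
    rfl

/-- The time derivative of the coefficients is given by the right-hand side of the pointwise equation: the
derivative in the norm of `H^{m-2}` exists, and its profile is the pointwise derivative. -/
lemma hasDerivWithinAt_stateModes {m : ℕ} (hm : 3 < m) {T : ℝ} (hT : 0 < T) {η : ℝ → ℝ → ℝ}
    (h : ∀ t ∈ Icc 0 T, IsState m (η t)) (hc2 : C2InH (m - 2) T (fun t => weighted (η t)))
    {t : ℝ} (ht : t ∈ Icc 0 T) {g : ℤ → ℝ} (hg : OddModes g) (hga : MHD1D.absSum g ≠ ⊤)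
    (hd : ∀ θ, HasDerivWithinAt (fun r => η r θ) (profile g θ) (Icc 0 T) t) (k : ℤ) :
    HasDerivWithinAt (fun r => stateModes T η r k) (g k) (Icc 0 T) t := by
  obtain ⟨f₁, f₂, c0, c1, -, d1, -⟩ := hc2
  have hs : 2 ≤ m - 2 := by omega
  have hseq := hasSeqDeriv_stateModes c0 c1 d1
  set f := sineModes (f₁ t) with hf
  have hffin : sqNorm (powWeight (m - 2)) f ≠ ⊤ :=
    ne_top_of_le_ne_top ENNReal.ofReal_ne_top (sqNorm_sineModes_le le_rfl (c1.memH t ht))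
  have hfa := absSum_ne_top_of_le hs hffin
  have hne := neBot_punctured hT ht
  have hfm : OddModes f := by
    refine ⟨sineModes_neg (c1.memH t ht).memL2, ?_⟩
    refine tendsto_nhds_unique (tendsto_entry (hseq t ht) 1) ?_
    refine tendsto_const_nhds.congr fun r => ?_
    have h1 := (oddModes_stateModes (by omega) h r).one
    have h2 := (oddModes_stateModes (by omega) h t).one
    simp [h1, h2]
  have hη : ∀ r ∈ Icc 0 T, η r = profile (stateModes T η r) := fun r hr => by
    rw [stateModes_of_mem η hr]; exact ((h r hr).eq_profile (by omega)).2.2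
  have hprof : profile f = profile g := by
    ext θ
    have h1 := hasDerivWithinAt_profile hs ht (fun r hr => by
      rw [stateModes_of_mem η hr]
      exact ne_top_of_le_ne_top ((h r hr).eq_profile (by omega)).2.1 (le_sqNorm_powWeight (by omega) _))
      hfa (hseq t ht) θ
    have h2 : HasDerivWithinAt (fun r => profile (stateModes T η r) θ) (profile g θ) (Icc 0 T) t :=
      (hd θ).congr (fun r hr => by rw [hη r hr]) (by rw [hη t ht])
    exact (uniqueDiffOn_Icc hT t ht).eq_deriv _ h1 h2
  have hfg : f = g := by
    rw [← sineModes_weighted_profile hfm hfa, hprof, sineModes_weighted_profile hg hga]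
  rw [← hfg]
  exact hseq.hasDerivWithinAt ht k

lemma IsSolution.isSeqSolution {m : ℕ} (hm : 3 < m) {T : ℝ} (hT : 0 < T) {f g : ℝ → ℝ}
    {ηp ηm : ℝ → ℝ → ℝ} (h : IsSolution m T f g ηp ηm) :
    IsSeqSolution m T (sineModes (weighted f) + sineModes (weighted g))
      (sineModes (weighted f) - sineModes (weighted g))
      (fun t => (1 : ℝ) • stateModes T ηp t + (1 : ℝ) • stateModes T ηm t)
      (fun t => (1 : ℝ) • stateModes T ηp t + (-1 : ℝ) • stateModes T ηm t) := by
  set P := stateModes T ηp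
  set Q := stateModes T ηm
  have hP : ContIn m T P := contIn_stateModes (by omega) h.state_plus h.cont_plus
  have hQ : ContIn m T Q := contIn_stateModes (by omega) h.state_minus h.cont_minus
  have h0 : (0 : ℝ) ∈ Icc 0 T := ⟨le_rfl, hT.le⟩
  have hPm := oddModes_stateModes (by omega) h.state_plus
  have hQm := oddModes_stateModes (by omega) h.state_minus
  have ep : ∀ t ∈ Icc 0 T, ηp t = profile (P t) := fun t ht => by
    simp only [P]; rw [stateModes_of_mem _ ht]; exact ((h.state_plus t ht).eq_profile (by omega)).2.2
  have em : ∀ t ∈ Icc 0 T, ηm t = profile (Q t) := fun t ht => by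
    simp only [Q]; rw [stateModes_of_mem _ ht]; exact ((h.state_minus t ht).eq_profile (by omega)).2.2
  have e1 : ∀ t, (1 : ℝ) • P t + (1 : ℝ) • Q t = P t + Q t := fun t => by module
  have e2 : ∀ t, (1 : ℝ) • P t + (-1 : ℝ) • Q t = P t - Q t := fun t => by module
  have der : ∀ t ∈ Icc 0 T, ∀ k : ℤ,
      HasDerivWithinAt (fun r => P r k)
        (((1 / 2 : ℝ) • (rhs (P t + Q t) (P t - Q t) + rhs (P t - Q t) (P t + Q t))) k) (Icc 0 T) t ∧
      HasDerivWithinAt (fun r => Q r k)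
        (((1 / 2 : ℝ) • (rhs (P t + Q t) (P t - Q t) - rhs (P t - Q t) (P t + Q t))) k) (Icc 0 T) t :=
    fun t ht k => by
    have hp := hP.adm (by omega) ht
    have hq := hQ.adm (by omega) ht
    have hx := hp.add hq
    have hy := hp.sub hq
    have sys := system_profile hp hq
    have o1 := oddModes_rhs hx hy
    have o2 := oddModes_rhs hy hx
    have a1 := absSum_rhs hx hy
    have a2 := absSum_rhs hy hx
    constructor
    · refine hasDerivWithinAt_stateModes hm hT h.state_plus h.c2_plus ht ((o1.add o2).smul _)
        (absSum_smul _ (absSum_add a1 a2)) (fun θ => ?_) k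
      refine (h.eq_plus t ht θ).congr_deriv ?_
      rw [ep t ht, em t ht, sys.1]
    · refine hasDerivWithinAt_stateModes hm hT h.state_minus h.c2_minus ht ((o1.sub o2).smul _)
        (absSum_smul _ (absSum_sub a1 a2)) (fun θ => ?_) k
      refine (h.eq_minus t ht θ).congr_deriv ?_
      rw [ep t ht, em t ht, sys.2]
  refine ⟨?_, ?_, hP.comb hQ 1 1, hP.comb hQ 1 (-1), fun L => ⟨fun t => ?_, fun t => ?_,
    fun t ht k _ _ => ?_, fun t ht k _ _ => ?_⟩⟩
  · simp only [e1, P, Q]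
    rw [stateModes_of_mem _ h0, stateModes_of_mem _ h0, h.init_plus, h.init_minus]
  · simp only [e2, P, Q]
    rw [stateModes_of_mem _ h0, stateModes_of_mem _ h0, h.init_plus, h.init_minus]
  · rw [e1]; exact (hPm t).add (hQm t)
  · rw [e2]; exact (hPm t).sub (hQm t)
  · simp only [e1, e2]
    refine ((der t ht k).1.fun_add (der t ht k).2).congr_deriv ?_
    simp only [Pi.smul_apply, Pi.add_apply, Pi.sub_apply, smul_eq_mul]; ring
  · simp only [e1, e2]
    refine ((der t ht k).1.fun_sub (der t ht k).2).congr_deriv ?_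
    simp only [Pi.smul_apply, Pi.add_apply, Pi.sub_apply, smul_eq_mul]; ring

lemma ContIn.exists_bound {m : ℕ} {T : ℝ} {x : ℝ → ℤ → ℝ} (h : ContIn m T x) :
    ∃ K : ℝ≥0, ∀ t ∈ Icc 0 T, sqNorm (powWeight m) (x t) ≤ K := by
  refine isCompact_Icc.induction_on (p := fun S => ∃ K : ℝ≥0, ∀ t ∈ S, sqNorm (powWeight m) (x t) ≤ K)
    ⟨0, by simp⟩ (fun S S' hS ⟨K, hK⟩ => ⟨K, fun t ht => hK t (hS ht)⟩)
    (fun S S' ⟨K, hK⟩ ⟨K', hK'⟩ => ⟨max K K', fun t ht => ?_⟩) (fun t ht => ?_)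
  · rw [ENNReal.coe_max]
    rcases ht with ht | ht
    · exact (hK t ht).trans (le_max_left _ _)
    · exact (hK' t ht).trans (le_max_right _ _)
  · have hne : 2 * (1 + sqNorm (powWeight m) (x t)) ≠ ⊤ := by
      have := h.finite t ht
      finiteness
    exact ⟨_, h.eventually_le ht, (2 * (1 + sqNorm (powWeight m) (x t))).toNNReal, fun r hr => by
      rw [ENNReal.coe_toNNReal hne]; exact hr⟩

/-- The error in `exists_diffEnergy_le` tends to zero as the truncation is removed. -/
lemma IsSeqSolution.unique {m : ℕ} (hm : 4 ≤ m) {T : ℝ} {u v : ℤ → ℝ} {x y x' y' : ℝ → ℤ → ℝ}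
    (h : IsSeqSolution m T u v x y) (h' : IsSeqSolution m T u v x' y') {t : ℝ} (ht : t ∈ Icc 0 T) :
    x t = x' t ∧ y t = y' t := by
  obtain ⟨K₁, h1⟩ := (h.cont_left.of_le hm).exists_bound
  obtain ⟨K₂, h2⟩ := (h.cont_right.of_le hm).exists_bound
  obtain ⟨K₃, h3⟩ := (h'.cont_left.of_le hm).exists_bound
  obtain ⟨K₄, h4⟩ := (h'.cont_right.of_le hm).exists_bound
  set K := K₁ + K₂ + K₃ + K₄ with hK
  obtain ⟨C, hC, hd⟩ := exists_diffEnergy_le K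
  have hb : ∀ r ∈ Icc 0 T, sqNorm (powWeight 4) (x r) ≤ K ∧ sqNorm (powWeight 4) (y r) ≤ K ∧
      sqNorm (powWeight 4) (x' r) ≤ K ∧ sqNorm (powWeight 4) (y' r) ≤ K := fun r hr =>
    ⟨(h1 r hr).trans (by norm_cast; rw [hK, add_assoc, add_assoc]; exact le_self_add),
      (h2 r hr).trans (by norm_cast; rw [hK]; exact le_trans le_add_self (le_self_add.trans le_self_add)),
      (h3 r hr).trans (by norm_cast; rw [hK]; exact le_trans le_add_self le_self_add),
      (h4 r hr).trans (by norm_cast; exact le_add_self)⟩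
  have key : ∀ L : ℕ, diffEnergy L (x t) (y t) (x' t) (y' t) ≤
      C * (1 / ((L : ℝ) + 1) ^ 2) * t * Real.exp (C * t) := fun L => by
    have := hd L T x y x' y' (h.solves L) (h'.solves L) hb t ht
    have e0 : diffEnergy L (x 0) (y 0) (x' 0) (y' 0) = 0 := by
      have : ENNReal.ofReal (diffEnergy L (x 0) (y 0) (x' 0) (y' 0)) = 0 := by
        rw [ofReal_diffEnergy, h.init_left, h.init_right, h'.init_left, h'.init_right, sub_self, sub_self]
        have e : trunc L (0 : ℤ → ℝ) = 0 := by ext k; simp [trunc]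
        rw [e, sqNorm_zero, add_zero]
      exact le_antisymm (ENNReal.ofReal_eq_zero.1 this)
        (add_nonneg (pairing_self_nonneg _ _) (pairing_self_nonneg _ _))
    rwa [e0, zero_add] at this
  have lim : Tendsto (fun L : ℕ => C * (1 / ((L : ℝ) + 1) ^ 2) * t * Real.exp (C * t)) atTop (𝓝 0) := by
    have := ((tendsto_one_div_add_atTop_nhds_zero_nat (𝕜 := ℝ)).pow 2).const_mul C
      |>.mul_const t |>.mul_const (Real.exp (C * t))
    simpa using this
  have fin : ∀ z : ℤ → ℝ, (∀ L : ℕ, sqNorm (powWeight 2) (trunc L z) ≤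
      ENNReal.ofReal (C * (1 / ((L : ℝ) + 1) ^ 2) * t * Real.exp (C * t))) → z = 0 := fun z hz => by
    ext k
    have lim' := ENNReal.tendsto_ofReal lim
    have : ‖z k‖ₑ ^ 2 ≤ ENNReal.ofReal 0 := by
      refine ge_of_tendsto lim' ?_
      filter_upwards [eventually_ge_atTop k.natAbs] with L hL
      refine le_trans (le_of_eq ?_) ((enorm_sq_le_sqNorm 2 (trunc L z) k).trans (hz L))
      simp [trunc, hL]
    simpa using this
  have h5 : ∀ L : ℕ, sqNorm (powWeight 2) (trunc L (x t - x' t)) + sqNorm (powWeight 2) (trunc L (y t - y' t))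
      ≤ ENNReal.ofReal (C * (1 / ((L : ℝ) + 1) ^ 2) * t * Real.exp (C * t)) := fun L => by
    rw [← ofReal_diffEnergy]; exact ENNReal.ofReal_le_ofReal (key L)
  exact ⟨sub_eq_zero.1 (fin _ fun L => le_self_add.trans (h5 L)),
    sub_eq_zero.1 (fin _ fun L => le_add_self.trans (h5 L))⟩

lemma IsSolution.unique {m : ℕ} (hm : 3 < m) {T : ℝ} (hT : 0 < T) {f g : ℝ → ℝ}
    {ηp ηm ξp ξm : ℝ → ℝ → ℝ} (h : IsSolution m T f g ηp ηm) (h' : IsSolution m T f g ξp ξm) {t : ℝ}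
    (ht : t ∈ Icc 0 T) : ηp t = ξp t ∧ ηm t = ξm t := by
  obtain ⟨e1, e2⟩ := (h.isSeqSolution hm hT).unique hm (h'.isSeqSolution hm hT) ht
  have ep : stateModes T ηp t = stateModes T ξp t := by
    ext k
    have h1 := congrFun e1 k
    have h2 := congrFun e2 k
    simp only [Pi.add_apply, Pi.smul_apply, smul_eq_mul] at h1 h2
    linarith
  have em : stateModes T ηm t = stateModes T ξm t := by
    ext k
    have h1 := congrFun e1 k
    have h2 := congrFun e2 k
    simp only [Pi.add_apply, Pi.smul_apply, smul_eq_mul] at h1 h2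
    linarith
  rw [stateModes_of_mem _ ht, stateModes_of_mem _ ht] at ep em
  exact ⟨by rw [((h.state_plus t ht).eq_profile (by omega)).2.2, ep,
      ← ((h'.state_plus t ht).eq_profile (by omega)).2.2],
    by rw [((h.state_minus t ht).eq_profile (by omega)).2.2, em,
      ← ((h'.state_minus t ht).eq_profile (by omega)).2.2]⟩

theorem SeqSolvable.locallyWellPosed {c C : ℝ} (hc : 0 < c) (hex : SeqSolvable c C) {m : ℕ} (hm : 3 < m) :
    LocallyWellPosed c (23 * c) m := by
  intro f g hf hg hI
  obtain ⟨hT, hexp⟩ := exp_existenceTime_le hc hI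
  refine ⟨?_, fun ηp ηm ξp ξm h h' t ht => h.unique hm hT h' ht⟩
  obtain ⟨of, ff, ef⟩ := hf.eq_profile (by omega)
  obtain ⟨og, fg, eg⟩ := hg.eq_profile (by omega)
  obtain ⟨x, y, hxy, -⟩ := hex _ _ (by positivity) hT.le hexp m _ _ hm (of.add og) (of.sub og)
    (sqNorm_two_add_le (by omega) hf hg)
    (ne_top_of_le_ne_top (by finiteness) (sqNorm_add_le _ _ _))
    (ne_top_of_le_ne_top (by finiteness) (sqNorm_sub_le _ _ _))
  have := hxy.isSolution hm
  rw [← ef, ← eg] at this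
  exact ⟨_, _, this⟩

/-! ### Growth of the second mode -/

/-- The symbol of `L⁺` acting on the coefficients: for `η⁻ = 0` the coefficients of `η⁺ + η⁻` and
`η⁺ - η⁻` agree, and the two linear terms add up. -/
def symT (n : ℤ) : ℝ := symS n + symR n

lemma band_symT (x : ℤ → ℝ) : band symT x = band symS x + band symR x := by
  ext k; simp only [band, symT, Pi.add_apply]; ring

lemma rhs_self (x : ℤ → ℝ) (k : ℤ) : rhs x x k = band symT x k + bilin x x k := by
  rw [band_symT]; rfl

lemma symT_of_pos {n : ℤ} (hn : 0 < n) :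
    symT n = ((n : ℝ) ^ 2 - 4) * (n - 2) / (4 * (n : ℝ) ^ 2) := by
  have : (n : ℝ) ≠ 0 := by exact_mod_cast hn.ne'
  unfold symT symS symR
  rw [Int.sign_eq_one_of_pos hn]
  push_cast
  field_simp
  ring

/-- The diagonal entry of the linear part at a frequency `k ≥ 3` is at most `-3 / 8`: only the second mode is
unstable. -/
lemma symT_sub_le {k : ℤ} (hk : 3 ≤ k) : symT (k - 1) - symT (k + 1) ≤ -(3 / 8) := by
  obtain ⟨j, rfl⟩ : ∃ j : ℕ, k = j + 3 := ⟨(k - 3).toNat, by omega⟩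
  rw [symT_of_pos (by omega), symT_of_pos (by omega)]
  push_cast
  have hj : (0 : ℝ) ≤ j := by positivity
  have h1 : (0 : ℝ) < 4 * ((j : ℝ) + 3 - 1) ^ 2 := by nlinarith
  have h2 : (0 : ℝ) < 4 * ((j : ℝ) + 3 + 1) ^ 2 := by nlinarith
  rw [div_sub_div _ _ h1.ne' h2.ne', div_le_iff₀ (by positivity)]
  ring_nf
  nlinarith [pow_nonneg hj 2, pow_nonneg hj 3, pow_nonneg hj 4]

lemma abs_symT_le {k : ℤ} (hk : 1 ≤ k) : |symT k| ≤ k := by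
  have h1 : (1 : ℝ) ≤ k := by exact_mod_cast hk
  rw [symT_of_pos (by omega), abs_le]
  have h2 : (0 : ℝ) < 4 * (k : ℝ) ^ 2 := by positivity
  constructor
  · rw [le_div_iff₀ h2]; nlinarith [mul_nonneg (sub_nonneg.2 h1) (sub_nonneg.2 h1)]
  · rw [div_le_iff₀ h2]; nlinarith [mul_nonneg (sub_nonneg.2 h1) (sub_nonneg.2 h1), pow_pos (lt_of_lt_of_le one_pos h1) 3]

lemma symT_values : symT 1 = 3 / 4 ∧ symT 2 = 0 ∧ symT 3 = 5 / 36 ∧ symT 5 = 63 / 100 := by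
  refine ⟨?_, ?_, ?_, ?_⟩ <;> rw [symT_of_pos (by norm_num)] <;> norm_num

lemma band_symT_two {x : ℤ → ℝ} (hx : OddModes x) :
    band symT x 2 = 11 / 18 * x 2 + 5 / 36 * x 4 := by
  obtain ⟨h1, -, h3, -⟩ := symT_values
  unfold band
  norm_num [h1, h3, hx.zero]
  ring

/-- The quadratic form of the linear part on the modes `3, …, L + 2`: the off-diagonal terms telescope and
leave contributions at both ends. -/
lemma sum_mul_band_symT {x : ℤ → ℝ} (hx : OddModes x) (L : ℕ) :
    ∑ k ∈ Finset.Ico 3 (L + 3), x k * band symT x k =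
      (∑ k ∈ Finset.Ico 3 (L + 3), (symT ((k : ℤ) - 1) - symT (k + 1)) * x k ^ 2) +
        (symT (L + 3) * x (L + 2) * x (L + 4) + symT (L + 2) * x (L + 1) * x (L + 3)) -
        5 / 36 * x 2 * x 4 := by
  obtain ⟨-, h2, h3, -⟩ := symT_values
  induction L with
  | zero =>
    have e1 : symT (((0 : ℕ) : ℤ) + 3) = 5 / 36 := by simpa using h3
    have e2 : x (((0 : ℕ) : ℤ) + 1) = 0 := by simpa using hx.one
    rw [e1, e2]
    simp
  | succ L ih =>
    rw [show L + 1 + 3 = (L + 3) + 1 by ring, Finset.sum_Ico_succ_top (show 3 ≤ L + 3 by omega),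
      Finset.sum_Ico_succ_top (show 3 ≤ L + 3 by omega), ih]
    unfold band
    push_cast
    rw [show (L : ℤ) + 3 - 1 = L + 2 by ring, show (L : ℤ) + 3 - 2 = L + 1 by ring,
      show (L : ℤ) + 3 + 1 = L + 4 by ring, show (L : ℤ) + 3 + 2 = L + 5 by ring,
      show (L : ℤ) + 1 + 3 = L + 4 by ring, show (L : ℤ) + 1 + 2 = L + 3 by ring,
      show (L : ℤ) + 1 + 4 = L + 5 by ring, show (L : ℤ) + 1 + 1 = L + 2 by ring]
    ring

lemma sum_sq_le_of_sqNorm {s : ℕ} {x : ℤ → ℝ} {b : ℝ} (hb : 0 ≤ b)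
    (h : sqNorm (powWeight s) x ≤ ENNReal.ofReal b) (S : Finset ℕ) : ∑ k ∈ S, x k ^ 2 ≤ b := by
  rw [← ENNReal.ofReal_le_ofReal_iff hb, ENNReal.ofReal_sum_of_nonneg fun _ _ => sq_nonneg _]
  refine le_trans ?_ h
  have h1 : ∑ k ∈ S, ENNReal.ofReal (x k ^ 2) ≤
      ∑ k ∈ S.map Nat.castEmbedding, ((powWeight s k.natAbs : ℝ≥0∞) * ‖x k‖ₑ) ^ 2 := by
    rw [Finset.sum_map]
    refine Finset.sum_le_sum fun k _ => ?_
    rw [← sq_abs, ENNReal.ofReal_pow (abs_nonneg _), ← Real.enorm_eq_ofReal_abs]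
    gcongr
    exact le_mul_of_one_le_left zero_le (by exact_mod_cast one_le_powWeight s _)
  exact h1.trans (ENNReal.sum_le_tsum _)

lemma abs_mul_sq_le_of_sqNorm {x : ℤ → ℝ} {r : ℝ} (hr : 0 ≤ r)
    (h : sqNorm (powWeight 2) x ≤ ENNReal.ofReal (r ^ 2)) (k : ℕ) : |x k| * ((k : ℝ) + 1) ^ 2 ≤ r := by
  have h1 := (le_sqNorm (powWeight 2) x k).trans h
  rw [enorm_weight_mul_sq, ENNReal.ofReal_le_ofReal_iff (by positivity), ← mul_pow] at h1
  have h2 := abs_le_of_sq_le_sq h1 hr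
  rw [mul_comm, ← abs_of_nonneg (show (0 : ℝ) ≤ ((k : ℝ) + 1) ^ 2 by positivity), ← abs_mul]
  simpa using h2

/-- The functional that detects the growth of the second mode, up to frequency `L + 2`. The higher modes
enter with a negative sign, so it is a lower bound for the square of the second mode. -/
def growthForm (L : ℕ) (x : ℤ → ℝ) : ℝ := x 2 ^ 2 - (∑ k ∈ Finset.Ico 3 (L + 3), x k ^ 2) / 2

/-- The terms left over at the cut-off frequency vanish as the cut-off is removed. -/
lemma abs_boundary_le {x : ℤ → ℝ} {r : ℝ} (hr : 0 ≤ r)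
    (h : sqNorm (powWeight 2) x ≤ ENNReal.ofReal (r ^ 2)) (j : ℕ) :
    |symT (j + 2) * x (j + 1) * x (j + 3)| ≤ r ^ 2 / (j + 1) := by
  have h1 := abs_mul_sq_le_of_sqNorm hr h (j + 1)
  have h2 := abs_mul_sq_le_of_sqNorm hr h (j + 3)
  have h3 := abs_symT_le (k := (j : ℤ) + 2) (by omega)
  push_cast at h1 h2 h3
  have hj : (0 : ℝ) ≤ j := by positivity
  have a1 : |x (j + 1)| * (j + 2) ≤ r := by
    refine le_trans ?_ h1
    have := abs_nonneg (x (j + 1))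
    exact mul_le_mul_of_nonneg_left (by nlinarith) this
  have a2 : |x (j + 3)| * (j + 1) ≤ r := by
    refine le_trans ?_ h2
    have := abs_nonneg (x (j + 3))
    exact mul_le_mul_of_nonneg_left (by nlinarith) this
  rw [le_div_iff₀ (by positivity), abs_mul, abs_mul]
  calc |symT (j + 2)| * |x (j + 1)| * |x (j + 3)| * (j + 1)
      ≤ (j + 2) * |x (j + 1)| * |x (j + 3)| * (j + 1) := by gcongr
    _ = (|x (j + 1)| * (j + 2)) * (|x (j + 3)| * (j + 1)) := by ring
    _ ≤ r * r := by gcongr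
    _ = _ := by ring

/-- The right-hand side is the time derivative of `growthForm L`. The linear part contributes at least
`growthForm L`, the nonlinearity an error of third order, and the cut-off an error of order `1 / L`. -/
lemma exists_growthForm_deriv_ge : ∃ A : ℝ, 0 ≤ A ∧ ∀ (L : ℕ) (x : ℤ → ℝ) (r : ℝ), 2 ≤ L → 0 ≤ r →
    OddModes x → sqNorm (powWeight 2) x ≤ ENNReal.ofReal (r ^ 2) →
    growthForm L x - (A * r ^ 3 + 2 * r ^ 2 / L) ≤
      2 * x 2 * rhs x x 2 - ∑ k ∈ Finset.Ico 3 (L + 3), x k * rhs x x k := by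
  obtain ⟨C, hC⟩ := exists_sqNorm_bilin_pow_le 1 le_rfl
  refine ⟨3 * Real.sqrt C, by positivity, fun L x r hL hr hx h => ?_⟩
  set B := bilin x x with hB
  set q : ℝ := Real.sqrt C * r ^ 2 with hq
  have hBq : sqNorm (powWeight 1) B ≤ ENNReal.ofReal (q ^ 2) := by
    refine (hC x x hx hx).trans ?_
    calc (C : ℝ≥0∞) * (sqNorm (powWeight 2) x * sqNorm (powWeight 2) x) ≤
          C * (ENNReal.ofReal (r ^ 2) * ENNReal.ofReal (r ^ 2)) := by gcongr
      _ = _ := by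
        rw [hq, mul_pow, Real.sq_sqrt (NNReal.coe_nonneg C), ENNReal.ofReal_mul (by positivity), ENNReal.ofReal_coe_nnreal,
          ← ENNReal.ofReal_mul (by positivity)]
        congr 2; ring
  have sx := fun S => sum_sq_le_of_sqNorm (sq_nonneg r) h S
  have sB := fun S => sum_sq_le_of_sqNorm (sq_nonneg q) hBq S
  have cs : ∀ S : Finset ℕ, |∑ k ∈ S, x k * B k| ≤ r * q := fun S => by
    have h1 := Finset.sum_mul_sq_le_sq_mul_sq S (fun k => x k) (fun k => B k)
    refine abs_le_of_sq_le_sq (h1.trans ?_) (by positivity)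
    rw [mul_pow]
    exact mul_le_mul (sx S) (sB S) (Finset.sum_nonneg fun _ _ => sq_nonneg _) (sq_nonneg r)
  have hsplit : ∑ k ∈ Finset.Ico 3 (L + 3), x k * rhs x x k =
      (∑ k ∈ Finset.Ico 3 (L + 3), x k * band symT x k) + ∑ k ∈ Finset.Ico 3 (L + 3), x k * B k := by
    rw [← Finset.sum_add_distrib]
    exact Finset.sum_congr rfl fun k _ => by rw [rhs_self]; ring
  have hdiag : ∑ k ∈ Finset.Ico 3 (L + 3), (symT ((k : ℤ) - 1) - symT (k + 1)) * x k ^ 2 ≤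
      -(3 / 8) * ∑ k ∈ Finset.Ico 3 (L + 3), x k ^ 2 := by
    rw [Finset.mul_sum]
    refine Finset.sum_le_sum fun k hk => ?_
    have hk3 : (3 : ℤ) ≤ k := by exact_mod_cast (Finset.mem_Ico.1 hk).1
    exact mul_le_mul_of_nonneg_right (symT_sub_le hk3) (sq_nonneg _)
  have h4 : x 4 ^ 2 ≤ ∑ k ∈ Finset.Ico 3 (L + 3), x k ^ 2 := by
    have := Finset.single_le_sum (f := fun k : ℕ => x k ^ 2) (s := Finset.Ico 3 (L + 3))
      (fun _ _ => sq_nonneg _) (Finset.mem_Ico.2 ⟨by norm_num, by omega⟩ : 4 ∈ _)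
    simpa using this
  have b1 := (le_abs_self _).trans (abs_boundary_le hr h (L + 1))
  have b2 := (le_abs_self _).trans (abs_boundary_le hr h L)
  push_cast at b1
  rw [show (L : ℤ) + 1 + 2 = L + 3 by ring, show (L : ℤ) + 1 + 1 = L + 2 by ring,
    show (L : ℤ) + 1 + 3 = L + 4 by ring] at b1
  have hL0 : (0 : ℝ) < L := by exact_mod_cast (by omega : 0 < L)
  have b3 : r ^ 2 / ((L : ℝ) + 1 + 1) ≤ r ^ 2 / L := by gcongr; linarith
  have b4 : r ^ 2 / ((L : ℝ) + 1) ≤ r ^ 2 / L := by gcongr; linarith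
  have c1 := (abs_le.1 (cs {2})).1
  have c2 := (abs_le.1 (cs (Finset.Ico 3 (L + 3)))).2
  rw [Finset.sum_singleton] at c1
  push_cast at c1
  have e1 : r * q = Real.sqrt C * r ^ 3 := by rw [hq]; ring
  rw [e1] at c1 c2
  rw [hsplit, sum_mul_band_symT hx, rhs_self, band_symT_two hx, growthForm, ← hB]
  set E := ∑ k ∈ Finset.Ico 3 (L + 3), x k ^ 2
  have e2 : 2 * r ^ 2 / (L : ℝ) = r ^ 2 / L + r ^ 2 / L := by ring
  rw [e2]
  -- The linear terms leave `2/9 x₂² + 5/12 x₂ x₄ + 7/8 x₄²`, a nonnegative quadratic form.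
  nlinarith [sq_nonneg (x 4 + 5 / 6 * x 2), sq_nonneg (x 2)]

/-- Solutions with vanishing `η⁻` that stay small have an exponentially growing second mode. -/
lemma exists_growth : ∃ A : ℝ, 0 ≤ A ∧ ∀ (L : ℕ) (T r : ℝ) (x : ℝ → ℤ → ℝ), 2 ≤ L → 0 ≤ r →
    (∀ t, OddModes (x t)) → (∀ t ∈ Icc 0 T, sqNorm (powWeight 2) (x t) ≤ ENNReal.ofReal (r ^ 2)) →
    (∀ t ∈ Icc 0 T, ∀ k : ℤ, 2 ≤ k.natAbs →
      HasDerivWithinAt (fun s => x s k) (rhs (x t) (x t) k) (Icc 0 T) t) →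
    ∀ t ∈ Icc 0 T, (growthForm L (x 0) - (A * r ^ 3 + 2 * r ^ 2 / L) * t) * Real.exp t ≤ x t 2 ^ 2 := by
  obtain ⟨A, hA, hder⟩ := exists_growthForm_deriv_ge
  refine ⟨A, hA, fun L T r x hL hr hx hb hd t ht => ?_⟩
  have h := gronwall_le (f := fun t => -growthForm L (x t)) (K := 1) (e := A * r ^ 3 + 2 * r ^ 2 / L)
    (f' := fun t => -(2 * x t 2 * rhs (x t) (x t) 2 -
      ∑ k ∈ Finset.Ico 3 (L + 3), x t k * rhs (x t) (x t) k)) zero_le_one (by positivity)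
    (fun s hs => by
      have h1 := (hd s hs 2 (by norm_num)).fun_pow 2
      have h2 : HasDerivWithinAt (fun t => ∑ k ∈ Finset.Ico 3 (L + 3), x t k ^ 2)
          (∑ k ∈ Finset.Ico 3 (L + 3), 2 * (x s k * rhs (x s) (x s) k)) (Icc 0 T) s := by
        refine HasDerivWithinAt.fun_sum fun k hk => ?_
        have := (hd s hs k (by have := (Finset.mem_Ico.1 hk).1; simp; omega)).fun_pow 2
        refine this.congr_deriv ?_
        norm_num; ring
      refine (h1.fun_sub (h2.div_const 2)).fun_neg.congr_deriv ?_
      rw [← Finset.mul_sum]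
      norm_num)
    (fun s hs => by
      have := hder L (x s) r hL hr (hx s) (hb s hs)
      linarith) t ht
  have h5 : growthForm L (x t) ≤ x t 2 ^ 2 := by
    unfold growthForm
    have : 0 ≤ ∑ k ∈ Finset.Ico 3 (L + 3), x t k ^ 2 := Finset.sum_nonneg fun _ _ => sq_nonneg _
    linarith
  rw [one_mul] at h
  nlinarith

/-! ### The linear part and the initial values -/

lemma sqNorm_ne_top_of_supported {L : ℕ} {x : ℤ → ℝ} (w : ℕ → ℝ≥0) (hx : SupportedIn L x) :
    sqNorm w x ≠ ⊤ := by rw [pairing_self _ hx]; simp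

/-- The part of the right-hand side that is odd in the state is the linear one. -/
lemma band_symT_eq (p : ℤ → ℝ) :
    band symT p = (1 / 2 : ℝ) • (rhs p p - rhs ((-1 : ℝ) • p) ((-1 : ℝ) • p)) := by
  ext k
  simp only [Pi.smul_apply, Pi.sub_apply, smul_eq_mul]
  rw [rhs_self, rhs_self, band_smul, bilin_smul_left, bilin_smul_right]
  simp only [Pi.smul_apply, smul_eq_mul]
  ring

lemma oddModes_band_symT {p : ℤ → ℝ} (hp : Adm p) : OddModes (band symT p) := by
  rw [band_symT_eq]
  exact ((oddModes_rhs hp hp).sub (oddModes_rhs (hp.smul _) (hp.smul _))).smul _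

lemma absSum_band_symT {p : ℤ → ℝ} (hp : Adm p) : absSum (band symT p) ≠ ⊤ := by
  rw [band_symT_eq]
  exact absSum_smul _ (absSum_sub (absSum_rhs hp hp) (absSum_rhs (hp.smul _) (hp.smul _)))

lemma opLplus_profile {p : ℤ → ℝ} (hp : Adm p) : opLplus (profile p) = profile (band symT p) := by
  have hn := hp.smul (-1)
  have h1 := (system_profile hp adm_zero).1
  have h2 := (system_profile hn adm_zero).1
  have e : profile ((-1 : ℝ) • p) = fun θ => -profile p θ := by
    ext θ; rw [profile_smul]; ring
  have ev : velocity (profile ((-1 : ℝ) • p)) = fun θ => -velocity (profile p) θ := by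
    rw [velocity_profile hn.absSum, velocity_profile hp.absSum]
    ext θ
    rw [profVel, velCoeff_smul, sinS_smul, profVel]; ring
  have l1 : ∀ θ, opLplus (profile ((-1 : ℝ) • p)) θ = -opLplus (profile p) θ := fun θ => by
    unfold opLplus bracket
    rw [e, ← e, ev, e]
    have : deriv (fun θ => -profile p θ / 2 + -velocity (profile p) θ) θ =
        -deriv (fun θ => profile p θ / 2 + velocity (profile p) θ) θ := by
      rw [← deriv.fun_neg]; congr 1; ext θ; ring
    rw [this]; ring
  have l2 : ∀ θ, nonlin₁ (profile ((-1 : ℝ) • p)) (profile 0) θ = nonlin₁ (profile p) (profile 0) θ :=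
    fun θ => by
      unfold nonlin₁ bracket
      rw [ev, e, deriv.fun_neg, deriv.fun_neg]; ring
  ext θ
  have h3 := h1 θ
  have h4 := h2 θ
  rw [l1, l2] at h4
  simp only [add_zero, sub_zero, profile_smul] at h3 h4
  rw [profile_add (absSum_rhs hp hp) (absSum_rhs hp hp)] at h3
  rw [profile_add (absSum_rhs hn hn) (absSum_rhs hn hn)] at h4
  rw [band_symT_eq, profile_smul, profile_sub (absSum_rhs hp hp) (absSum_rhs hn hn)]
  linarith

/-- The shape of the unstable initial values. The linear part has the diagonal entries `11 / 18` at
frequency `2` and `-221 / 450` at frequency `4`, and antisymmetric off-diagonal ones, so the squared ratio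
`275 / 221` of the amplitudes makes the state orthogonal to its image. -/
def seed (n : ℤ) : ℝ :=
  if n = 2 then 1 else if n = -2 then -1 else if n = 4 then √(275 / 221)
    else if n = -4 then -√(275 / 221) else 0

lemma seed_of_ne {n : ℤ} (h1 : n.natAbs ≠ 2) (h2 : n.natAbs ≠ 4) : seed n = 0 := by
  unfold seed
  split_ifs <;> first | rfl | omega

lemma oddModes_seed : OddModes seed where
  odd k := by
    unfold seed
    split_ifs <;> first | omega | simp
  one := seed_of_ne (by norm_num) (by norm_num)

lemma supportedIn_seed : SupportedIn 4 seed := fun k hk => seed_of_ne (by omega) (by omega)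

lemma seed_two : seed 2 = 1 := by simp [seed]

lemma seed_four_sq : seed 4 ^ 2 = 275 / 221 := by
  rw [show seed 4 = √(275 / 221) by simp [seed], Real.sq_sqrt (by norm_num)]

lemma adm_seed : Adm seed := adm_of_supported oddModes_seed supportedIn_seed

lemma tsum_band_symT_mul_seed (ε : ℝ) : ∑' n, band symT (ε • seed) n * (ε • seed) n = 0 := by
  have ho := (oddModes_band_symT (adm_seed.smul ε)).odd
  have hs := (oddModes_seed.smul ε).odd
  rw [tsum_eq_sum (s := {2, -2, 4, -4}) fun n hn => by
    simp only [Finset.mem_insert, Finset.mem_singleton, not_or] at hn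
    rw [Pi.smul_apply, seed_of_ne (by omega) (by omega)]; simp]
  obtain ⟨-, -, h3, h5⟩ := symT_values
  have h4 : band symT (ε • seed) 4 = -(63 / 100) * (ε * seed 4) + 5 / 36 * (ε * seed 4 - ε * seed 2) := by
    unfold band
    norm_num [h3, h5, seed_of_ne (n := 6)]
  rw [Finset.sum_insert (by decide), Finset.sum_insert (by decide), Finset.sum_insert (by decide),
    Finset.sum_singleton, ho, hs, ho 4, hs 4, h4, band_symT_two (oddModes_seed.smul ε)]
  simp only [Pi.smul_apply, smul_eq_mul]
  have := seed_four_sq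
  have h2 := seed_two
  linear_combination (-(221 / 225) * ε ^ 2) * this + (11 / 9 * ε ^ 2 * (seed 2 + 1)) * h2

lemma l2Inner_opLplus_seed (ε : ℝ) :
    l2Inner (weighted (opLplus (profile (ε • seed)))) (weighted (profile (ε • seed))) = 0 := by
  have hp := adm_seed.smul ε
  have ho := oddModes_band_symT hp
  rw [opLplus_profile hp, weighted_profile ho (absSum_band_symT hp),
    weighted_profile hp.toOddModes hp.absSum,
    l2Inner_sineFun ho.odd hp.odd (absSum_band_symT hp) hp.absSum, tsum_band_symT_mul_seed, zero_div]

lemma growthForm_seed (ε : ℝ) {L : ℕ} (hL : 2 ≤ L) : ε ^ 2 / 3 ≤ growthForm L (ε • seed) := by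
  unfold growthForm
  rw [Finset.sum_eq_single_of_mem 4 (Finset.mem_Ico.2 ⟨by norm_num, by omega⟩) fun k hk h4 => by
    have := (Finset.mem_Ico.1 hk).1
    rw [Pi.smul_apply, seed_of_ne (by simp; omega) (by simp; omega)]; simp]
  push_cast
  simp only [Pi.smul_apply, smul_eq_mul]
  rw [mul_pow, mul_pow, seed_four_sq, seed_two]
  nlinarith [sq_nonneg ε]

lemma sq_div_four_le_l2Norm_sq {x : ℤ → ℝ} (hx : Adm x) :
    x 2 ^ 2 / 4 ≤ l2Norm (weighted (profile x)) ^ 2 := by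
  rw [l2Norm_sq, weighted_profile hx.toOddModes hx.absSum, l2Inner_sineFun hx.odd hx.odd hx.absSum hx.absSum]
  have hs : Summable fun n => x n * x n := by
    refine summable_of_tsum_enorm_ne_top (ne_top_of_le_ne_top
      (ENNReal.mul_ne_top hx.absSum hx.absSum) ?_)
    calc ∑' n, ‖x n * x n‖ₑ ≤ ∑' n, absSum x * ‖x n‖ₑ := by
          refine ENNReal.tsum_le_tsum fun n => ?_
          rw [enorm_mul]
          gcongr
          exact ENNReal.le_tsum n
      _ = _ := by rw [ENNReal.tsum_mul_left]; rfl
  have h := hs.sum_le_tsum {2, -2} fun n _ => mul_self_nonneg _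
  rw [Finset.sum_pair (by decide), hx.odd] at h
  linarith

lemma dataSize_profile_seed {m : ℕ} (hm : 2 ≤ m) {ε : ℝ} (hε : 0 < ε) :
    0 < dataSize m (profile (ε • seed)) (profile 0) ∧
      dataSize m (profile (ε • seed)) (profile 0) ≤
        ε * √((m + 1) * (sqNorm (powWeight m) seed).toReal + 1) := by
  have hp := adm_seed.smul ε
  have hf := sqNorm_ne_top_of_supported (powWeight m) supportedIn_seed
  have hfp : sqNorm (powWeight m) (ε • seed) ≠ ⊤ := by
    rw [sqNorm_smul']; exact ENNReal.mul_ne_top (by simp) hf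
  have hnn : 0 ≤ dataSize m (profile (ε • seed)) (profile 0) := Real.sqrt_nonneg _
  constructor
  · refine lt_of_le_of_ne hnn fun h0 => ?_
    have h := sqNorm_two_add_le hm (isState_profile hm hp.toOddModes hfp)
      (isState_profile hm oddModes_zero (by rw [sqNorm_zero]; simp))
    rw [← h0, sineModes_weighted_profile hp.toOddModes hp.absSum,
      sineModes_weighted_profile oddModes_zero adm_zero.absSum, add_zero] at h
    have h2 := (enorm_sq_le_sqNorm 2 (ε • seed) 2).trans (le_self_add.trans h)
    simp [seed_two, hε.ne'] at h2
  · refine (sq_le_sq₀ hnn (by positivity)).1 ?_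
    rw [dataSize_sq, weighted_profile hp.toOddModes hp.absSum,
      weighted_profile oddModes_zero adm_zero.absSum, mul_pow, Real.sq_sqrt (by positivity)]
    have h1 := (memH_sineFun hp.odd hp.absSum hfp).2
    have h2 := (memH_sineFun (m := m) oddModes_zero.odd adm_zero.absSum (by rw [sqNorm_zero]; simp)).2
    rw [sqNorm_zero, mul_zero, nonpos_iff_eq_zero, ENNReal.ofReal_eq_zero] at h2
    rw [sqNorm_smul', ← ENNReal.ofReal_toReal hf, Real.enorm_eq_ofReal hε.le,
      ← ENNReal.ofReal_pow hε.le, ← ENNReal.ofReal_mul (by positivity),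
      show ((m : ℝ≥0∞) + 1) = ENNReal.ofReal ((m : ℝ) + 1) by
        rw [ENNReal.ofReal_add (by positivity) zero_le_one]; simp,
      ← ENNReal.ofReal_mul (by positivity), ENNReal.ofReal_le_ofReal_iff (by positivity)] at h1
    nlinarith [sq_nonneg ε]

/-! ### Norm inflation -/

lemma eventually_mul_lt (B : ℝ) {b : ℝ} (hb : 0 < b) : ∀ᶠ ε in 𝓝[>] (0 : ℝ), ε * B < b := by
  have h : Tendsto (fun ε : ℝ => ε * B) (𝓝[>] 0) (𝓝 0) :=
    ((continuous_id.mul continuous_const).tendsto' 0 0 (by simp)).mono_left nhdsWithin_le_nhds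
  exact h.eventually_lt_const hb

lemma lt_existenceTime {c I T : ℝ} (hc : 0 < c) (hI : 0 < I) (h : I * (46 * Real.exp (c * T)) < 1) :
    T < existenceTime c (23 * c) I := by
  have h1 : c / (2 * (23 * c) * I) = 1 / (46 * I) := by
    field_simp; norm_num
  unfold existenceTime
  rw [h1, one_div_mul_eq_div, lt_div_iff₀ hc, mul_comm, Real.lt_log_iff_exp_lt (by positivity)]
  have : Real.exp (c * T) < 1 / (46 * I) := by
    rw [lt_div_iff₀ (by positivity)]; linarith
  linarith

/-- For every factor `K` there are arbitrarily small initial values, orthogonal to their image under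
the linear part, whose solution exceeds `K` times their size. The observation time depends only on
`K` and `m`, whereas the existence time tends to infinity as the initial values shrink. -/
theorem SeqSolvable.norm_inflation {c C : ℝ} (hc : 0 < c) (hC : 0 < C) (hex : SeqSolvable c C)
    {m : ℕ} (hm : 3 < m) {δ K : ℝ} (hδ : 0 < δ) (hK : 0 < K) :
    ∃ f g : ℝ → ℝ, IsState m f ∧ IsState m g ∧ 0 < dataSize m f g ∧ dataSize m f g < δ ∧
      l2Inner (weighted (opLplus f)) (weighted f) = 0 ∧
      ∃ ηp ηm : ℝ → ℝ → ℝ, IsSolution m (existenceTime c (23 * c) (dataSize m f g)) f g ηp ηm ∧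
        ∃ t ∈ Ioo 0 (existenceTime c (23 * c) (dataSize m f g)),
          K * dataSize m f g < l2Norm (weighted (ηp t)) := by
  obtain ⟨A, hA, hgrow⟩ := exists_growth
  set D : ℝ := √((m + 1) * (sqNorm (powWeight m) seed).toReal + 1) with hD
  have hD0 : 0 < D := Real.sqrt_pos.2 (by positivity)
  -- The second mode gives `l2Norm² ≥ ε² e^τ / 16` at time `τ`, to be compared with `(K D ε)²`.
  set τ : ℝ := 16 * K ^ 2 * D ^ 2 + 1 with hτ
  have hτ0 : 0 < τ := by positivity
  -- The solution stays below `ε M` in the base norm; `3` bounds `√(1 + (2a + 1)²)` for `a ≤ 1 / 2`.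
  set M : ℝ := √(Real.exp (C * 3 * τ) * (2 * (sqNorm (powWeight 2) seed).toReal)) with hM
  have hM0 : 0 ≤ M := Real.sqrt_nonneg _
  -- Small size, existence beyond `τ`, and a small contribution of the nonlinearity.
  obtain ⟨ε, ⟨⟨h1, h2⟩, h3⟩, hε⟩ := (((eventually_mul_lt D hδ).and
    (eventually_mul_lt (D * (46 * Real.exp (c * τ))) one_pos)).and
    (eventually_mul_lt (A * M ^ 3 * τ) (show (0 : ℝ) < 1 / 24 by norm_num))).and
    self_mem_nhdsWithin |>.exists
  -- A small contribution of the cut-off.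
  obtain ⟨L, hL⟩ := exists_nat_ge (max 2 (48 * M ^ 2 * τ))
  have hL2 : 2 ≤ L := by exact_mod_cast (le_max_left _ _).trans hL
  have hL0 : (0 : ℝ) < L := by exact_mod_cast (by omega : 0 < L)
  have hp := adm_seed.smul ε
  have hf2 := sqNorm_ne_top_of_supported (powWeight 2) supportedIn_seed
  have hfp : sqNorm (powWeight m) (ε • seed) ≠ ⊤ := by
    rw [sqNorm_smul']
    exact ENNReal.mul_ne_top (by simp) (sqNorm_ne_top_of_supported (powWeight m) supportedIn_seed)
  have sp := isState_profile (by omega) hp.toOddModes hfp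
  have s0 : IsState m (profile 0) := isState_profile (by omega) oddModes_zero (by rw [sqNorm_zero]; simp)
  obtain ⟨hI, hID⟩ := dataSize_profile_seed (m := m) (by omega) hε
  set I := dataSize m (profile (ε • seed)) (profile 0) with hIdef
  have hsmall : I * (46 * Real.exp (c * τ)) < 1 :=
    lt_of_le_of_lt (by rw [← mul_assoc ε]; gcongr) h2
  have hI46 : 46 * I ≤ 1 := by
    have := Real.one_le_exp (show 0 ≤ c * τ by positivity)
    nlinarith
  have hT := lt_existenceTime hc hI hsmall
  obtain ⟨hT0, hexp⟩ := exp_existenceTime_le hc hI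
  set T := existenceTime c (23 * c) I with hTdef
  have hdata := sqNorm_two_add_le (m := m) (by omega) sp s0
  rw [sineModes_weighted_profile hp.toOddModes hp.absSum,
    sineModes_weighted_profile oddModes_zero adm_zero.absSum, add_zero, sub_zero] at hdata
  obtain ⟨x, y, hxy, hb⟩ := hex (23 * I) T (by positivity) hT0.le hexp m _ _ hm hp.toOddModes hp.toOddModes
    hdata hfp hfp
  -- Uniqueness preserves the symmetry of the initial values, that is, `η⁻ = 0`.
  have hyx : ∀ t ∈ Icc 0 T, y t = x t := fun t ht => (hxy.unique hm hxy.symm ht).2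
  have hmem : ∀ t ∈ Icc 0 τ, t ∈ Icc 0 T := fun t ht => ⟨ht.1, ht.2.trans hT.le⟩
  have hτm : τ ∈ Icc 0 τ := ⟨hτ0.le, le_rfl⟩
  have hbound : ∀ t ∈ Icc 0 τ, sqNorm (powWeight 2) (x t) ≤ ENNReal.ofReal ((ε * M) ^ 2) := fun t ht => by
    refine (hb t (hmem t ht)).trans ?_
    have hs : √(1 + (2 * (23 * I) + 1) ^ 2) ≤ 3 := by
      rw [Real.sqrt_le_left (by norm_num)]; nlinarith
    have he : Real.exp (C * √(1 + (2 * (23 * I) + 1) ^ 2) * t) ≤ Real.exp (C * 3 * τ) :=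
      Real.exp_le_exp.2 (mul_le_mul (by gcongr) ht.2 ht.1 (by positivity))
    calc _ ≤ ENNReal.ofReal (Real.exp (C * 3 * τ)) *
          (sqNorm (powWeight 2) (ε • seed) + sqNorm (powWeight 2) (ε • seed)) := by gcongr
      _ = _ := by
        rw [mul_pow, hM, Real.sq_sqrt (by positivity), sqNorm_smul', ← ENNReal.ofReal_toReal hf2,
          Real.enorm_eq_ofReal hε.le, ← ENNReal.ofReal_pow hε.le, ← ENNReal.ofReal_mul (by positivity),
          ← ENNReal.ofReal_add (by positivity) (by positivity), ← ENNReal.ofReal_mul (by positivity),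
          ENNReal.toReal_ofReal (by positivity)]
        congr 1; ring
  have hfinal := hgrow L τ (ε * M) x hL2 (by positivity) (hxy.solves 0).modes_left hbound
    (fun t ht k hk => by
      have := (hxy.solves k.natAbs).deriv_left t (hmem t ht) k hk le_rfl
      rw [hyx t (hmem t ht)] at this
      exact this.mono hmem) τ hτm
  rw [hxy.init_left] at hfinal
  have hform := growthForm_seed ε hL2
  have hloss : (A * (ε * M) ^ 3 + 2 * (ε * M) ^ 2 / L) * τ ≤ ε ^ 2 / 12 := by
    have b1 : 2 * M ^ 2 * τ / L ≤ 1 / 24 := by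
      rw [div_le_iff₀ hL0]
      have := (le_max_right _ _).trans hL
      linarith
    have e : (A * (ε * M) ^ 3 + 2 * (ε * M) ^ 2 / L) * τ =
        ε ^ 2 * (ε * (A * M ^ 3 * τ) + 2 * M ^ 2 * τ / L) := by ring
    rw [e]
    nlinarith [sq_nonneg ε]
  have hgrowth : ε ^ 2 / 4 * Real.exp τ ≤ x τ 2 ^ 2 :=
    le_trans (mul_le_mul_of_nonneg_right (by linarith) (Real.exp_pos _).le) hfinal
  have hsol := IsSeqSolution.isSolution hm (p := ε • seed) (q := 0) (T := T) (x := x) (y := y)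
    (by rwa [add_zero, sub_zero])
  refine ⟨_, _, sp, s0, hI, hID.trans_lt h1, l2Inner_opLplus_seed ε, _, _, hsol, τ, ⟨hτ0, hT⟩, ?_⟩
  have hadm : Adm (x τ) := hxy.cont_left.adm (by omega) (hmem τ hτm)
  have hmean : (1 / 2 : ℝ) • x τ + (1 / 2 : ℝ) • y τ = x τ := by
    rw [hyx τ (hmem τ hτm), ← add_smul]; norm_num
  simp only [hmean]
  have hl := sq_div_four_le_l2Norm_sq hadm
  have hexpτ := Real.add_one_le_exp τ
  refine lt_of_le_of_lt (mul_le_mul_of_nonneg_left hID hK.le) ?_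
  refine lt_of_pow_lt_pow_left₀ 2 (Real.sqrt_nonneg _) ?_
  have hε2 : 0 < ε ^ 2 := by positivity
  have : ε ^ 2 * (16 * K ^ 2 * D ^ 2) < ε ^ 2 * Real.exp τ :=
    mul_lt_mul_of_pos_left (by linarith) hε2
  nlinarith

end MHD1D

end

theorem mainTheorem5 :
    ∃ C₁ C₂ : ℝ, 0 < C₁ ∧ 0 < C₂ ∧
      (∀ m : ℕ, 3 < m → MHD1D.LocallyWellPosed C₁ C₂ m) ∧
      ∀ (m : ℕ) (δ : ℝ), 3 < m → 0 < δ →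
        (∀ (K : ℝ) (lam₁ : ℝ) (F : ℝ → ℝ), 0 < K → 0 < lam₁ →
          (∀ y : ℝ, 0 ≤ y → F y ≤ K * y) →
          ∃ ηp₀ ηm₀ : ℝ → ℝ,
            MHD1D.IsState m ηp₀ ∧ MHD1D.IsState m ηm₀ ∧
            0 < MHD1D.dataSize m ηp₀ ηm₀ ∧ MHD1D.dataSize m ηp₀ ηm₀ < δ ∧
            0 ≤ MHD1D.l2Inner (MHD1D.weighted (MHD1D.opLplus ηp₀)) (MHD1D.weighted ηp₀) ∧
            MHD1D.l2Inner (MHD1D.weighted (MHD1D.opLplus ηp₀)) (MHD1D.weighted ηp₀) ≤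
              Real.sqrt lam₁ * MHD1D.l2Norm (MHD1D.weighted ηp₀) ∧
            MHD1D.l2Inner (MHD1D.weighted (MHD1D.opLplus ηp₀)) (MHD1D.weighted ηp₀) ≤
              Real.sqrt lam₁ * MHD1D.l2Norm (MHD1D.weighted ηp₀) ^ 2 ∧
            ∃ ηp ηm : ℝ → ℝ → ℝ,
              MHD1D.IsSolution m
                (MHD1D.existenceTime C₁ C₂ (MHD1D.dataSize m ηp₀ ηm₀)) ηp₀ ηm₀ ηp ηm ∧
              ∃ tK ∈ Set.Ioo 0 (MHD1D.existenceTime C₁ C₂ (MHD1D.dataSize m ηp₀ ηm₀)),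
                F (MHD1D.dataSize m ηp₀ ηm₀) < MHD1D.l2Norm (MHD1D.weighted (ηp tK))) ∧
        ¬ ∃ C : ℝ, 0 < C ∧
          ∀ ηp₀ ηm₀ : ℝ → ℝ, MHD1D.IsState m ηp₀ → MHD1D.IsState m ηm₀ →
            0 < MHD1D.dataSize m ηp₀ ηm₀ → MHD1D.dataSize m ηp₀ ηm₀ < δ →
            ∀ ηp ηm : ℝ → ℝ → ℝ,
              MHD1D.IsSolution m
                (MHD1D.existenceTime C₁ C₂ (MHD1D.dataSize m ηp₀ ηm₀)) ηp₀ ηm₀ ηp ηm →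
              ∀ t ∈ Set.Icc 0 (MHD1D.existenceTime C₁ C₂ (MHD1D.dataSize m ηp₀ ηm₀)),
                MHD1D.l2Norm (MHD1D.weighted (ηp t)) ≤ C * MHD1D.hNorm m (MHD1D.weighted ηp₀) := by
  obtain ⟨c, C, hc, hC, hex⟩ := MHD1D.exists_seqSolvable
  refine ⟨c, 23 * c, hc, by positivity, fun m hm => hex.locallyWellPosed hc hm, fun m δ hm hδ => ⟨?_, ?_⟩⟩
  · intro K lam₁ F hK _ hF
    obtain ⟨f, g, hf, hg, hI, hIδ, h0, ηp, ηm, hsol, t, ht, hgt⟩ := hex.norm_inflation hc hC hm hδ hK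
    refine ⟨f, g, hf, hg, hI, hIδ, h0.ge, ?_, ?_, ηp, ηm, hsol, t, ht, (hF _ hI.le).trans_lt hgt⟩
    · rw [h0]
      exact mul_nonneg (Real.sqrt_nonneg _) (Real.sqrt_nonneg _)
    · rw [h0]
      positivity
  · rintro ⟨K, hK, hstab⟩
    obtain ⟨f, g, hf, hg, hI, hIδ, -, ηp, ηm, hsol, t, ht, hgt⟩ := hex.norm_inflation hc hC hm hδ hK
    have h1 := hstab f g hf hg hI hIδ ηp ηm hsol t ⟨ht.1.le, ht.2.le⟩
    have h2 : MHD1D.hNorm m (MHD1D.weighted f) ≤ MHD1D.dataSize m f g :=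
      Real.le_sqrt_of_sq_le (le_add_of_nonneg_right (sq_nonneg _))
    exact absurd (h1.trans (mul_le_mul_of_nonneg_left h2 hK.le)) (not_le.2 hgt)
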